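/- Let $p$ be a prime number and let $F$ be a field extension of $\mathbb{Q}_p$ with $[F:\mathbb{Q}_p]=2$. Let $\mathcal{O}_F$ be its ring of integers, $\varpi$ a uniformizer (with $\varpi=p$ if $F/\mathbb{Q}_p$ is unramified) and $k_F=\mathcal{O}_F/\varpi\mathcal{O}_F$ its residue field. Let $k$ be a field together with an embedding $k_F\hookrightarrow k$. Put $G=\mathrm{GL}_2(F)$, let $Z$ be the centre of $G$, and let $\mathcal{K}=Z\,\mathrm{GL}_2(\mathcal{O}_F)$ and $\alpha=\begin{pmatrix}\varpi&0\\0&1\end{pmatrix}$. Let $I\subset \mathrm{GL}_2(\mathcal{O}_F)$ be the subgroup of the matrices that are upper triangular modulo $\varpi$ and let $U=\begin{pmatrix}1&\mathcal{O}_F\\0&1\end{pmatrix}$. Let $A=k[[U]]$ be the completed group algebra of $U$, let $\varphi$ be the endomorphism of $A$ induced by $u\mapsto\alpha u\alpha^{-1}$, and let $A[X]_\varphi$ be the ring of twisted polynomials, in which $Xa=\varphi(a)X$ for $a\in A$. For an $A[X]_\varphi$-module $M$ the space $\mathrm{Tor}_i^A(k,M)$ is a $k[X]$-module through the isomorphism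 $\mathrm{Tor}_i^A(k,M)\cong\mathrm{Tor}_i^{A[X]_\varphi}(k[X],M)$, where $k[X]=k\otimes_A A[X]_\varphi$; in degree $0$, $X$ acts on $k\otimes_A M$ by $c\otimes m\mapsto c\otimes Xm$. Let $\sigma$ be a smooth irreducible $k$-linear representation of $\mathcal{K}$. Let $\mathrm{ind}_{\mathcal{K}}^G\sigma$ be the space of the smooth functions $\phi\colon G\to\sigma$ with compact support modulo $\mathcal{K}$ such that $\phi(g\kappa)=\sigma(\kappa)^{-1}\phi(g)$ for all $g\in G$ and $\kappa\in\mathcal{K}$, on which $G$ acts by left translation. It is an $A[X]_\varphi$-module: $A$ acts through the action of $U$, and $X$ acts by $\alpha$. For $m\ge 0$ let $R_m(\sigma)$ be the subspace of the functions with support in $I\alpha^m\mathcal{K}$, and let $I_{\ge i}(\sigma)=\bigoplus_{m\ge i}R_m(\sigma)$, which is an $A[X]_\varphi$-submodule. Let $f\colon G\to\mathrm{End}_k(\sigma)$ be a nonzero function with support in $\mathcal{K}\alpha\mathcal{K}$ such that $f(\kappa_1g\kappa_2)=\sigma(\kappa_1)f(g)\sigma(\kappa_2)$ for all $g\in G$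 and $\kappa_1,\kappa_2\in\mathcal{K}$, and let $T$ be the $G$-equivariant endomorphism of $\mathrm{ind}_{\mathcal{K}}^G\sigma$ given by $(T\phi)(g)=\sum_{h\in G/\mathcal{K}}f(g^{-1}h)\phi(h)$. Then $T(I_{\ge1}(\sigma))\subset I_{\ge0}(\sigma)$. The $k[X]$-module $\mathrm{Tor}_2^A\bigl(k,\,I_{\ge0}(\sigma)/T(I_{\ge1}(\sigma))\bigr)$ is not a torsion module. In particular, it is an infinite-dimensional $k$-vector space. -/

import Mathlib

open CategoryTheory Polynomial Matrix
open scoped TensorProduct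

universe u

noncomputable section

namespace ModPGL2

/-! ### The completed group algebra of the unipotent group -/

section Iwasawa

variable (k : Type u) [Field k] (O : Type u) [CommRing O] (ϖ : O)

/-- The ideal `ϖ ^ n O` of `O`. -/
abbrev lev (n : ℕ) : Ideal O := Ideal.span {ϖ ^ n}

variable {O} in
lemma lev_succ_le (n : ℕ) : lev O ϖ (n + 1) ≤ lev O ϖ n :=
  Ideal.span_singleton_le_span_singleton.2 (pow_dvd_pow ϖ n.le_succ)

/-- The projection `k[O] → k[O / ϖ ^ n O]` of group algebras of additive groups. -/
def proj (n : ℕ) : AddMonoidAlgebra k O →ₐ[k] AddMonoidAlgebra k (O ⧸ lev O ϖ n) :=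
  AddMonoidAlgebra.mapDomainAlgHom k k (Ideal.Quotient.mk (lev O ϖ n) : O →+ O ⧸ lev O ϖ n)

/-- The transition map `k[O / ϖ ^ (n + 1) O] → k[O / ϖ ^ n O]`. -/
def transition (n : ℕ) :
    AddMonoidAlgebra k (O ⧸ lev O ϖ (n + 1)) →ₐ[k] AddMonoidAlgebra k (O ⧸ lev O ϖ n) :=
  AddMonoidAlgebra.mapDomainAlgHom k k
    (Ideal.Quotient.factor (lev_succ_le ϖ n) : O ⧸ lev O ϖ (n + 1) →+ O ⧸ lev O ϖ n)

/-- The algebra `lim k[O / ϖ ^ n O]` of the compatible families of elements of the group algebras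
`k[O / ϖ ^ n O]`. -/
def iwasawaSub : Subalgebra k (∀ n : ℕ, AddMonoidAlgebra k (O ⧸ lev O ϖ n)) where
  carrier := {a | ∀ n, transition k O ϖ n (a (n + 1)) = a n}
  mul_mem' ha hb n := by simp [ha n, hb n]
  add_mem' ha hb n := by simp [ha n, hb n]
  algebraMap_mem' r n := (transition k O ϖ n).commutes r

/-- The completed group algebra `k[[U]] = lim k[U / U_n]` of the group `U` of unipotent upper
triangular matrices over `O`. The group `U` is identified with the additive group of `O` by
`x ↦ (1, x; 0, 1)`, and the open subgroups `U_n` correspond to `ϖ ^ n O`. -/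
def iwasawa : Type u := iwasawaSub k O ϖ

instance : CommRing (iwasawa k O ϖ) := inferInstanceAs (CommRing (iwasawaSub k O ϖ))

instance : Algebra k (iwasawa k O ϖ) := inferInstanceAs (Algebra k (iwasawaSub k O ϖ))

/-- The endomorphism of `k[O / ϖ ^ n O]` induced by multiplication by `ϖ`. -/
def phiLev (n : ℕ) :
    AddMonoidAlgebra k (O ⧸ lev O ϖ n) →ₐ[k] AddMonoidAlgebra k (O ⧸ lev O ϖ n) :=
  AddMonoidAlgebra.mapDomainAlgHom k k (AddMonoidHom.mulLeft (Ideal.Quotient.mk (lev O ϖ n) ϖ))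

lemma transition_phiLev (n : ℕ) :
    (transition k O ϖ n).comp (phiLev k O ϖ (n + 1)) = (phiLev k O ϖ n).comp (transition k O ϖ n) := by
  simp only [transition, phiLev, ← AddMonoidAlgebra.mapDomainAlgHom_comp]
  congr 1
  ext x
  simp

/-- The endomorphism `φ` of `k[[U]]` induced by the conjugation `u ↦ α u α⁻¹` of `U`,
where `α = (ϖ, 0; 0, 1)`; it maps the matrix `(1, x; 0, 1)` to `(1, ϖ x; 0, 1)`. -/
def phi : iwasawa k O ϖ →ₐ[k] iwasawa k O ϖ :=
  AlgHom.codRestrict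
    ((AlgHom.pi fun n => (phiLev k O ϖ n).comp (Pi.evalAlgHom k _ n)).comp (iwasawaSub k O ϖ).val)
    (iwasawaSub k O ϖ) fun a n => by
      have := DFunLike.congr_fun (transition_phiLev k O ϖ n) (a.1 (n + 1))
      simpa [a.2 n] using this

/-- The augmentation `k[[U]] → k`, which sends every element of `U` to `1`. -/
def aug : iwasawa k O ϖ →ₐ[k] k :=
  ((AddMonoidAlgebra.lift k k (O ⧸ lev O ϖ 0) 1).comp (Pi.evalAlgHom k _ 0)).comp
    (iwasawaSub k O ϖ).val

lemma aug_phi (a : iwasawa k O ϖ) : aug k O ϖ (phi k O ϖ a) = aug k O ϖ a := by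
  have h : (AddMonoidAlgebra.lift k k (O ⧸ lev O ϖ 0) 1).comp (phiLev k O ϖ 0) =
      AddMonoidAlgebra.lift k k (O ⧸ lev O ϖ 0) 1 := by
    ext x; simp [phiLev]
  exact DFunLike.congr_fun h (a.1 0)

/-- The residue field `k` as a `k[[U]]`-algebra. -/
instance instAlgebraResidue : Algebra (iwasawa k O ϖ) k :=
  (aug k O ϖ).toRingHom.toAlgebra

lemma residue_smul (a : iwasawa k O ϖ) (c : k) : a • c = aug k O ϖ a * c := rfl

instance : SMulCommClass (iwasawa k O ϖ) k k where
  smul_comm a c d := by simp only [residue_smul, smul_eq_mul]; ring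

/-- The action of `ℕ` on `k[[U]]` by the powers of `φ`. -/
instance instAction : MulSemiringAction (Multiplicative ℕ) (iwasawa k O ϖ) :=
  MulSemiringAction.compHom _
    (powersHom (iwasawa k O ϖ →+* iwasawa k O ϖ) (phi k O ϖ).toRingHom)

lemma ofAdd_one_smul (a : iwasawa k O ϖ) : Multiplicative.ofAdd 1 • a = phi k O ϖ a := by
  change (powersHom (iwasawa k O ϖ →+* iwasawa k O ϖ) (phi k O ϖ).toRingHom
    (Multiplicative.ofAdd 1)) a = _
  simp

/-- The ring `k[[U]][X]_φ` of twisted polynomials, in which `X * a = φ a * X`. -/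
abbrev Twisted : Type u := SkewPolynomial (iwasawa k O ϖ)

lemma X_mul_C (a : iwasawa k O ϖ) :
    (SkewPolynomial.X : Twisted k O ϖ) * SkewPolynomial.CRingHom a =
      SkewPolynomial.CRingHom (phi k O ϖ a) * SkewPolynomial.X := by
  rw [SkewPolynomial.CRingHom_eq_C, SkewPolynomial.CRingHom_eq_C, SkewPolynomial.C_mul_X_eq_monomial,
    SkewPolynomial.X, SkewPolynomial.monomial_mul_C]
  simp [SkewPolynomial.φ_def, ofAdd_one_smul]

end Iwasawa

/-! ### `Tor` with its structure of `k[X]`-module -/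

section Tor

variable (k : Type u) [Field k] (O : Type u) [CommRing O] (ϖ : O)

/-- A `k[[U]][X]_φ`-module, seen as a `k[[U]]`-module. -/
abbrev resModule (M : Type u) [AddCommGroup M] [Module (Twisted k O ϖ) M] :
    Module (iwasawa k O ϖ) M :=
  Module.compHom M (SkewPolynomial.CRingHom (R := iwasawa k O ϖ))

attribute [local instance] resModule

variable (M : Type u) [AddCommGroup M] [Module (Twisted k O ϖ) M]
variable (N : Type u) [AddCommGroup N] [Module (Twisted k O ϖ) N]

lemma res_smul (a : iwasawa k O ϖ) (m : M) :
    a • m = (SkewPolynomial.CRingHom a : Twisted k O ϖ) • m := rfl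

/-- The action of `X` on a `k[[U]][X]_φ`-module, as a `φ`-semilinear map. -/
def phiMod : M →ₛₗ[(phi k O ϖ).toRingHom] M where
  toFun m := (SkewPolynomial.X : Twisted k O ϖ) • m
  map_add' := smul_add _
  map_smul' a m := by
    simp only [res_smul, ← mul_smul, X_mul_C]
    rfl

/-- The identity of `k`, which is `φ`-semilinear. -/
def idSemi : k →ₛₗ[(phi k O ϖ).toRingHom] k where
  toFun c := c
  map_add' _ _ := rfl
  map_smul' a c := by
    simp only [residue_smul]
    exact congrArg (· * c) (aug_phi k O ϖ a).symm

/-- The `k`-linear endomorphism `c ⊗ m ↦ c ⊗ X m` of `k ⊗ M`. -/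
def tensorPhi : Module.End k (k ⊗[iwasawa k O ϖ] M) where
  toFun := TensorProduct.map (idSemi k O ϖ) (phiMod k O ϖ M)
  map_add' := map_add _
  map_smul' c x := by
    induction x with
    | zero => simp only [smul_zero, map_zero]
    | add x y hx hy => simp only [smul_add, map_add, hx, hy]
    | tmul d m => rfl

/-- The `k[X]`-linear map `k ⊗ M → k ⊗ N`, `c ⊗ m ↦ c ⊗ f m`, where `X` acts on `k ⊗ M` and on
`k ⊗ N` by `tensorPhi`. -/
def coinvMap (f : M →ₗ[Twisted k O ϖ] N) :
    Module.AEval' (tensorPhi k O ϖ M) →ₗ[k[X]] Module.AEval' (tensorPhi k O ϖ N) :=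
  LinearMap.ofAEval _
    ((Module.AEval'.of (tensorPhi k O ϖ N)).toLinearMap ∘ₗ
      TensorProduct.AlgebraTensorModule.map (LinearMap.id : k →ₗ[k] k)
        ({ toFun := f
           map_add' := map_add f
           map_smul' := fun a m => map_smul f _ _ } : M →ₗ[iwasawa k O ϖ] N))
    (fun m => by
      induction m with
      | zero => simp only [smul_zero, map_zero]
      | add x y hx hy => simp only [smul_add, map_add, hx, hy]
      | tmul c m =>
        simp only [LinearMap.comp_apply, LinearEquiv.coe_coe, Module.AEval'.X_smul_of]
        congr 1
        exact congrArg (fun y => c ⊗ₜ[iwasawa k O ϖ] y) (map_smul f _ _))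

variable {M N} in
lemma coinvMap_of_tmul (f : M →ₗ[Twisted k O ϖ] N) (c : k) (m : M) :
    coinvMap k O ϖ M N f (Module.AEval'.of _ (c ⊗ₜ m)) = Module.AEval'.of _ (c ⊗ₜ f m) := rfl

variable {M} in
lemma coinv_hom_ext {P : Type u} [AddCommGroup P] [Module k[X] P]
    {f g : Module.AEval' (tensorPhi k O ϖ M) →ₗ[k[X]] P}
    (h : ∀ c m, f (Module.AEval'.of _ (c ⊗ₜ m)) = g (Module.AEval'.of _ (c ⊗ₜ m))) : f = g := by
  ext x
  obtain ⟨x, rfl⟩ := (Module.AEval'.of _).surjective x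
  induction x with
  | zero => simp only [map_zero]
  | add x y hx hy => simp only [map_add, hx, hy]
  | tmul c m => exact h c m

/-- `M ↦ k ⊗ M`, where the tensor product is over `k[[U]]`, as a functor from
`k[[U]][X]_φ`-modules to `k[X]`-modules; `X` acts on `k ⊗ M` by `c ⊗ m ↦ c ⊗ X m`. This is
`M ↦ k[X] ⊗ M`, with the tensor product over `k[[U]][X]_φ`. -/
def coinv : ModuleCat.{u} (Twisted k O ϖ) ⥤ ModuleCat.{u} k[X] where
  obj M := ModuleCat.of k[X] (Module.AEval' (tensorPhi k O ϖ M))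
  map {M N} f := ModuleCat.ofHom (coinvMap k O ϖ M N f.hom)
  map_id _ := ModuleCat.hom_ext <| coinv_hom_ext k O ϖ fun _ _ => rfl
  map_comp _ _ := ModuleCat.hom_ext <| coinv_hom_ext k O ϖ fun _ _ => rfl

instance : (coinv k O ϖ).Additive where
  map_add {_ N f g} := ModuleCat.hom_ext <| coinv_hom_ext k O ϖ fun c m =>
    congrArg (Module.AEval'.of (tensorPhi k O ϖ N)) (TensorProduct.tmul_add c (f.hom m) (g.hom m))

/-- The `k[X]`-module `Tor_i^A(k, M)` of an `A[X]_φ`-module `M`, where `A = k[[U]]`: it is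
`Tor_i^{A[X]_φ}(k[X], M)`, that is, the `i`-th left derived functor of
`M ↦ k[X] ⊗_{A[X]_φ} M = k ⊗_A M` on `A[X]_φ`-modules. Since `A[X]_φ` is free as a left
`A`-module, a projective resolution of `M` over `A[X]_φ` is also one over `A`, and the underlying
`k`-vector space is `Tor_i^A(k, M)`. -/
def tor (i : ℕ) : ModuleCat.{u} k[X] :=
  ((coinv k O ϖ).leftDerived i).obj (ModuleCat.of (Twisted k O ϖ) M)

end Tor

/-! ### Modules over `k[[U]][X]_φ` from smooth representations -/

section Smooth

open Multiplicative

variable (k : Type u) [Field k] (O : Type u) [CommRing O] (ϖ : O)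

lemma proj_transition (n : ℕ) : (transition k O ϖ n).comp (proj k O ϖ (n + 1)) = proj k O ϖ n := by
  simp only [transition, proj, ← AddMonoidAlgebra.mapDomainAlgHom_comp]
  rfl

lemma proj_surjective (n : ℕ) : Function.Surjective (proj k O ϖ n) := by
  intro a
  induction a using AddMonoidAlgebra.induction_linear with
  | zero => exact ⟨0, map_zero _⟩
  | add a b ha hb =>
    obtain ⟨x, rfl⟩ := ha
    obtain ⟨y, rfl⟩ := hb
    exact ⟨x + y, map_add _ _ _⟩
  | single g c =>
    obtain ⟨x, rfl⟩ := Ideal.Quotient.mk_surjective g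
    exact ⟨AddMonoidAlgebra.single x c, by simp [proj]⟩

variable {k O ϖ} in
lemma proj_eq_of_le {m n : ℕ} (h : m ≤ n) {a : iwasawa k O ϖ} {b : AddMonoidAlgebra k O}
    (hb : proj k O ϖ n b = a.1 n) : proj k O ϖ m b = a.1 m := by
  induction n, h using Nat.le_induction with
  | base => exact hb
  | succ n _ ih =>
    refine ih ?_
    rw [← a.2 n, ← hb, ← proj_transition]
    rfl

/-- A smooth linear representation `rho` of the group `U ≃ O` on `V` together with an
endomorphism `t` of `V` such that `t u = (α u α⁻¹) t` for all `u` in `U`. -/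
structure OreRep (V : Type u) [AddCommGroup V] [Module k V] where
  rho : Representation k (Multiplicative O) V
  t : Module.End k V
  comm : ∀ x v, t (rho (ofAdd x) v) = rho (ofAdd (ϖ * x)) (t v)
  smooth : ∀ v, ∃ n : ℕ, ∀ x, rho (ofAdd (ϖ ^ n * x)) v = v

namespace OreRep

variable {k O ϖ} {V : Type u} [AddCommGroup V] [Module k V] (r : OreRep k O ϖ V)

/-- `v` is fixed by the subgroup of `U` that corresponds to `ϖ ^ n O`. -/
def Fixed (n : ℕ) (v : V) : Prop := ∀ x, r.rho (ofAdd (ϖ ^ n * x)) v = v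

lemma Fixed.mono {r : OreRep k O ϖ V} {m n : ℕ} (h : m ≤ n) {v : V} (hv : r.Fixed m v) :
    r.Fixed n v := fun x => by
  obtain ⟨d, rfl⟩ := Nat.exists_eq_add_of_le h
  rw [pow_add, mul_assoc]
  exact hv _

/-- The action of the group algebra `k[U]`. -/
def grp : AddMonoidAlgebra k O →ₐ[k] Module.End k V := AddMonoidAlgebra.lift k _ O r.rho

lemma grp_congr {n : ℕ} {v : V} (hv : r.Fixed n v) {b c : AddMonoidAlgebra k O}
    (h : proj k O ϖ n b = proj k O ϖ n c) : r.grp b v = r.grp c v := by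
  have key : ∃ L : AddMonoidAlgebra k (O ⧸ lev O ϖ n) →ₗ[k] V,
      ∀ b, r.grp b v = L (proj k O ϖ n b) := by
    have hw : ∀ x y : O, Ideal.Quotient.mk (lev O ϖ n) x = Ideal.Quotient.mk (lev O ϖ n) y →
        r.rho (ofAdd x) v = r.rho (ofAdd y) v := by
      intro x y hxy
      obtain ⟨z, hz⟩ := Ideal.mem_span_singleton.1 (Ideal.Quotient.eq.1 hxy)
      obtain rfl : x = y + ϖ ^ n * z := by rw [← hz]; ring
      rw [ofAdd_add, map_mul, Module.End.mul_apply, hv z]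
    refine ⟨(Finsupp.lift V k (O ⧸ lev O ϖ n) fun x => r.rho (ofAdd x.out) v) ∘ₗ
      (AddMonoidAlgebra.coeffLinearEquiv k).toLinearMap, fun b => ?_⟩
    induction b using AddMonoidAlgebra.induction_linear with
    | zero => simp
    | add a b ha hb => simp only [map_add, LinearMap.add_apply, ha, hb]
    | single g c =>
      have := hw g (Ideal.Quotient.mk (lev O ϖ n) g).out (Quotient.out_eq' _).symm
      simp [grp, proj, this]
  obtain ⟨L, hL⟩ := key
  rw [hL, hL, h]

lemma Fixed.grp {r : OreRep k O ϖ V} {n : ℕ} {v : V} (hv : r.Fixed n v)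
    (b : AddMonoidAlgebra k O) : r.Fixed n (r.grp b v) := fun x => by
  have : r.rho (ofAdd (ϖ ^ n * x)) = r.grp (AddMonoidAlgebra.single (ϖ ^ n * x) 1) := by
    simp [OreRep.grp]
  rw [this, ← Module.End.mul_apply, ← map_mul, mul_comm, map_mul, Module.End.mul_apply, ← this, hv]

/-- The action of `a` in `k[[U]]` on `v`: if `v` is fixed by `ϖ ^ n O`, then `a` acts as any
element of `k[U]` with the same image in `k[U / ϖ ^ n O]` does. -/
def act (a : iwasawa k O ϖ) (v : V) : V :=
  r.grp (proj_surjective k O ϖ (r.smooth v).choose (a.1 (r.smooth v).choose)).choose v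

lemma act_eq {a : iwasawa k O ϖ} {v : V} {n : ℕ} (hv : r.Fixed n v) {b : AddMonoidAlgebra k O}
    (hb : proj k O ϖ n b = a.1 n) : r.act a v = r.grp b v := by
  have h1 := (r.smooth v).choose_spec
  have h2 := (proj_surjective k O ϖ (r.smooth v).choose (a.1 (r.smooth v).choose)).choose_spec
  set m := (r.smooth v).choose
  obtain ⟨c, hc⟩ := proj_surjective k O ϖ (max m n) (a.1 (max m n))
  have hm := proj_eq_of_le (le_max_left m n) hc
  have hn := proj_eq_of_le (le_max_right m n) hc
  rw [r.grp_congr hv (hb.trans hn.symm)]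
  exact r.grp_congr h1 (h2.trans hm.symm)

/-- The `k`-linear endomorphism `v ↦ a v`. -/
def actEnd (a : iwasawa k O ϖ) : Module.End k V where
  toFun := r.act a
  map_add' v w := by
    obtain ⟨m, hv⟩ := r.smooth v
    obtain ⟨n, hw⟩ := r.smooth w
    have hv' : r.Fixed (max m n) v := Fixed.mono (le_max_left m n) hv
    have hw' : r.Fixed (max m n) w := Fixed.mono (le_max_right m n) hw
    obtain ⟨b, hb⟩ := proj_surjective k O ϖ (max m n) (a.1 (max m n))
    have hvw : r.Fixed (max m n) (v + w) := fun x => by rw [map_add, hv' x, hw' x]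
    rw [r.act_eq hv' hb, r.act_eq hw' hb, r.act_eq hvw hb, map_add]
  map_smul' c v := by
    obtain ⟨n, hv⟩ := r.smooth v
    obtain ⟨b, hb⟩ := proj_surjective k O ϖ n (a.1 n)
    have hcv : r.Fixed n (c • v) := fun x => by rw [map_smul, hv x]
    rw [r.act_eq hv hb, r.act_eq hcv hb, map_smul, RingHom.id_apply]

/-- The action of `k[[U]]` on a smooth representation of `U`. -/
def actHom : iwasawa k O ϖ →+* Module.End k V where
  toFun := r.actEnd
  map_zero' := LinearMap.ext fun v => by
    obtain ⟨n, hv⟩ := r.smooth v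
    change r.act 0 v = 0
    rw [r.act_eq hv (b := 0) (by rw [map_zero]; rfl), map_zero, LinearMap.zero_apply]
  map_one' := LinearMap.ext fun v => by
    obtain ⟨n, hv⟩ := r.smooth v
    change r.act 1 v = v
    rw [r.act_eq hv (b := 1) (by rw [map_one]; rfl), map_one, Module.End.one_apply]
  map_add' a a' := LinearMap.ext fun v => by
    obtain ⟨n, hv⟩ := r.smooth v
    obtain ⟨b, hb⟩ := proj_surjective k O ϖ n (a.1 n)
    obtain ⟨b', hb'⟩ := proj_surjective k O ϖ n (a'.1 n)
    change r.act (a + a') v = r.act a v + r.act a' v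
    rw [r.act_eq hv hb, r.act_eq hv hb', r.act_eq hv (b := b + b') (by rw [map_add, hb, hb']; rfl),
      map_add, LinearMap.add_apply]
  map_mul' a a' := LinearMap.ext fun v => by
    obtain ⟨n, hv⟩ := r.smooth v
    obtain ⟨b, hb⟩ := proj_surjective k O ϖ n (a.1 n)
    obtain ⟨b', hb'⟩ := proj_surjective k O ϖ n (a'.1 n)
    change r.act (a * a') v = r.act a (r.act a' v)
    rw [r.act_eq hv hb', r.act_eq (Fixed.grp hv b') hb,
      r.act_eq hv (b := b * b') (by rw [map_mul, hb, hb']; rfl), map_mul, Module.End.mul_apply]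

lemma Fixed.t {r : OreRep k O ϖ V} {n : ℕ} {v : V} (hv : r.Fixed n v) :
    r.Fixed (n + 1) (r.t v) := fun x => by
  rw [pow_succ', mul_assoc, ← r.comm, hv]

lemma t_actHom (a : iwasawa k O ϖ) : r.t * r.actHom a = r.actHom (phi k O ϖ a) * r.t :=
  LinearMap.ext fun v => by
    obtain ⟨n, hv⟩ := r.smooth v
    replace hv : r.Fixed n v := hv
    obtain ⟨b, hb⟩ := proj_surjective k O ϖ (n + 1) (a.1 (n + 1))
    change r.t (r.act a v) = r.act (phi k O ϖ a) (r.t v)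
    have hp : proj k O ϖ (n + 1)
        (AddMonoidAlgebra.mapDomainAlgHom k k (AddMonoidHom.mulLeft ϖ) b) =
          (phi k O ϖ a).1 (n + 1) := by
      change _ = phiLev k O ϖ (n + 1) (a.1 (n + 1))
      rw [← hb, proj, phiLev, ← AlgHom.comp_apply, ← AlgHom.comp_apply,
        ← AddMonoidAlgebra.mapDomainAlgHom_comp, ← AddMonoidAlgebra.mapDomainAlgHom_comp]
      congr 2
    rw [r.act_eq (Fixed.mono n.le_succ hv) hb, r.act_eq (Fixed.t hv) hp]
    clear hb hp
    induction b using AddMonoidAlgebra.induction_linear with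
    | zero => simp
    | add a b ha hb => simp only [map_add, LinearMap.add_apply, ha, hb]
    | single g c => simp [grp, r.comm]

/-- The action of `k[[U]][X]_φ`, where `X` acts by `t`. -/
def toEnd : Twisted k O ϖ →+* Module.End k V :=
  SkewMonoidAlgebra.liftNCRingHom r.actHom (powersHom _ r.t) (by
    intro a y
    obtain ⟨n, rfl⟩ := Multiplicative.ofAdd.surjective y
    change r.actHom (ofAdd n • a) * r.t ^ n = r.t ^ n * r.actHom a
    induction n generalizing a with
    | zero => simp
    | succ n ih =>
      rw [ofAdd_add, mul_smul, pow_succ, mul_assoc, r.t_actHom, ← mul_assoc, ih, mul_assoc,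
        ← mul_assoc (r.t ^ n), ← ofAdd_one_smul, mul_assoc])

lemma toEnd_single (n : Multiplicative ℕ) (a : iwasawa k O ϖ) (v : V) :
    r.toEnd (SkewMonoidAlgebra.single n a) v = r.act a ((r.t ^ toAdd n) v) := by
  have h : r.toEnd (SkewMonoidAlgebra.single n a) = r.actHom a * r.t ^ toAdd n :=
    SkewMonoidAlgebra.liftNC_single _ _ _ _
  rw [h]
  rfl

lemma grp_mem {N : Submodule k V} (hN : ∀ x, ∀ v ∈ N, r.rho x v ∈ N)
    (b : AddMonoidAlgebra k O) {v : V} (hv : v ∈ N) : r.grp b v ∈ N := by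
  induction b using AddMonoidAlgebra.induction_linear with
  | zero => simp
  | add a b ha hb => rw [map_add]; exact N.add_mem ha hb
  | single g c => simpa [grp] using N.smul_mem c (hN _ v hv)

lemma toEnd_mem {N : Submodule k V} (hN : ∀ x, ∀ v ∈ N, r.rho x v ∈ N)
    (ht : ∀ v ∈ N, r.t v ∈ N) (s : Twisted k O ϖ) {v : V} (hv : v ∈ N) : r.toEnd s v ∈ N := by
  induction s using SkewMonoidAlgebra.induction_on with
  | zero => simp
  | add a b ha hb => rw [map_add]; exact N.add_mem ha hb
  | single n a =>
    rw [toEnd_single]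
    refine r.grp_mem hN _ ?_
    induction toAdd n with
    | zero => exact hv
    | succ n ih => rw [pow_succ']; exact ht _ ih

lemma map_toEnd {f : Module.End k V} (hf : ∀ x v, f (r.rho x v) = r.rho x (f v))
    (ht : ∀ v, f (r.t v) = r.t (f v)) (s : Twisted k O ϖ) (v : V) :
    f (r.toEnd s v) = r.toEnd s (f v) := by
  induction s using SkewMonoidAlgebra.induction_on with
  | zero => simp
  | add a b ha hb => simp only [map_add, LinearMap.add_apply, ha, hb]
  | single n a =>
    rw [toEnd_single, toEnd_single]
    have htn : f ((r.t ^ toAdd n) v) = (r.t ^ toAdd n) (f v) := by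
      induction toAdd n with
      | zero => rfl
      | succ n ih => rw [pow_succ', Module.End.mul_apply, Module.End.mul_apply, ht, ih]
    rw [← htn]
    generalize (r.t ^ toAdd n) v = w
    obtain ⟨m, hw⟩ := r.smooth w
    obtain ⟨b, hb⟩ := proj_surjective k O ϖ m (a.1 m)
    rw [r.act_eq hw hb, r.act_eq (n := m) (v := f w) (fun x => by rw [← hf, hw x]) hb]
    clear hb
    induction b using AddMonoidAlgebra.induction_linear with
    | zero => simp
    | add a b ha hb => simp only [map_add, LinearMap.add_apply, ha, hb]
    | single g c => simp [grp, hf]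

end OreRep

end Smooth

/-! ### Compact induction from `Z GL_2(O)` to `GL_2(F)` -/

section Induction

open Multiplicative

variable (F : Type u) [Field F] (O : Type u) [CommRing O] [Algebra O F] (ϖ : O)

/-- The inclusion `GL_2(O) → GL_2(F)`. -/
def inc : GL (Fin 2) O →* GL (Fin 2) F := GeneralLinearGroup.map (algebraMap O F)

/-- The subgroup `Z GL_2(O)` of `GL_2(F)`, where `Z` is the centre of `GL_2(F)`. -/
def ZK : Subgroup (GL (Fin 2) F) := Subgroup.center (GL (Fin 2) F) ⊔ (inc F O).range

lemma inc_mem (g : GL (Fin 2) O) : inc F O g ∈ ZK F O :=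
  Subgroup.mem_sup_right ⟨g, rfl⟩

/-- The principal congruence subgroup of the `g` in `GL_2(O)` with `g ≡ 1` modulo `ϖ ^ n`. The
images of these subgroups are a basis of neighbourhoods of `1` in `Z GL_2(O)` and in `GL_2(F)`. -/
def congr (n : ℕ) : Subgroup (GL (Fin 2) O) :=
  (GeneralLinearGroup.map (Ideal.Quotient.mk (lev O ϖ n))).ker

/-- The upper Iwahori subgroup of `GL_2(O)`: the matrices that are upper triangular
modulo `ϖ`. -/
def iwahori : Set (GL (Fin 2) O) := {g | ϖ ∣ g 1 0}

/-- The matrix `(1, x; 0, 1)` in `GL_2(F)`, for `x` in `O`. -/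
def unip (x : O) : GL (Fin 2) F := inc F O (GeneralLinearGroup.upperRightHom x)

lemma unip_mul (x y : O) : unip F O (x + y) = unip F O x * unip F O y := by
  rw [unip, AddChar.map_add_eq_mul, map_mul]
  rfl

variable {O} in
lemma mem_congr_iff {n : ℕ} {g : GL (Fin 2) O} :
    g ∈ congr O ϖ n ↔ ∀ i j, ϖ ^ n ∣ g i j - (1 : Matrix (Fin 2) (Fin 2) O) i j := by
  rw [congr, MonoidHom.mem_ker, GeneralLinearGroup.ext_iff]
  refine forall₂_congr fun i j => ?_
  rw [← Ideal.mem_span_singleton, ← Ideal.Quotient.eq]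
  have : (Ideal.Quotient.mk (lev O ϖ n)) ((1 : Matrix (Fin 2) (Fin 2) O) i j) =
      ((1 : GL (Fin 2) (O ⧸ lev O ϖ n)) : Matrix (Fin 2) (Fin 2) _) i j := by
    rw [Units.val_one, Matrix.one_apply, Matrix.one_apply]
    split_ifs <;> simp
  rw [this]
  rfl

lemma upperRightHom_mem_congr (n : ℕ) (x : O) :
    GeneralLinearGroup.upperRightHom (ϖ ^ n * x) ∈ congr O ϖ n := by
  rw [mem_congr_iff]
  intro i j
  fin_cases i <;> fin_cases j <;> simp

variable [FaithfulSMul O F] [Fact (Irreducible ϖ)]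

/-- The matrix `α = (ϖ, 0; 0, 1)` in `GL_2(F)`. -/
def alpha : GL (Fin 2) F :=
  GeneralLinearGroup.mkOfDetNeZero !![algebraMap O F ϖ, 0; 0, 1] (by
    rw [det_fin_two_of, mul_one, mul_zero, sub_zero, map_ne_zero_iff _
      (FaithfulSMul.algebraMap_injective O F)]
    exact (Fact.out : Irreducible ϖ).ne_zero)

lemma alpha_val_pow (m : ℕ) : ((alpha F O ϖ ^ m : GL (Fin 2) F) : Matrix (Fin 2) (Fin 2) F) =
    !![algebraMap O F ϖ ^ m, 0; 0, 1] := by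
  induction m with
  | zero => simp [Matrix.one_fin_two]
  | succ m ih =>
    rw [pow_succ, Units.val_mul, ih]
    simp [pow_succ, alpha]

lemma alpha_unip (x : O) : alpha F O ϖ * unip F O x = unip F O (ϖ * x) * alpha F O ϖ := by
  ext i j
  fin_cases i <;> fin_cases j <;> simp [alpha, inc, unip, Matrix.mul_apply, Fin.sum_univ_two]

lemma congr_conj_alpha {n : ℕ} {u : GL (Fin 2) O} (hu : u ∈ congr O ϖ (n + 1)) :
    ∃ v ∈ congr O ϖ n, inc F O u * alpha F O ϖ = alpha F O ϖ * inc F O v := by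
  rw [mem_congr_iff] at hu
  obtain ⟨b, hb⟩ := hu 0 1
  have h00 := (pow_dvd_pow ϖ n.le_succ).trans (hu 0 0)
  have h10 := (pow_dvd_pow ϖ n.le_succ).trans (hu 1 0)
  have h11 := (pow_dvd_pow ϖ n.le_succ).trans (hu 1 1)
  simp only [Matrix.one_apply_ne zero_ne_one, sub_zero, Matrix.one_apply_ne one_ne_zero,
    Matrix.one_apply_eq] at hb h00 h10 h11
  have hdet : (!![u 0 0, ϖ ^ n * b; ϖ * u 1 0, u 1 1] : Matrix (Fin 2) (Fin 2) O).det =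
      (u : Matrix (Fin 2) (Fin 2) O).det := by
    rw [Matrix.det_fin_two_of, Matrix.det_fin_two, hb]; ring
  obtain ⟨v, hv⟩ := (Matrix.isUnit_iff_isUnit_det _).2
    (hdet ▸ (Matrix.isUnit_iff_isUnit_det _).1 u.isUnit)
  refine ⟨v, ?_, ?_⟩
  · rw [mem_congr_iff]
    intro i j
    fin_cases i <;> fin_cases j <;> simp [hv, h00, h11, h10.mul_left]
  · ext i j
    fin_cases i <;> fin_cases j <;>
      simp [alpha, inc, hv, Matrix.mul_apply, Fin.sum_univ_two, hb, pow_succ, mul_comm,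
        mul_left_comm]

lemma iwahori_alpha [IsLocalRing O] {g : GL (Fin 2) O} (hg : g ∈ iwahori O ϖ) (m : ℕ) :
    ∃ x : O, ∃ κ : GL (Fin 2) O,
      inc F O g * alpha F O ϖ ^ m = unip F O x * alpha F O ϖ ^ m * inc F O κ := by
  obtain ⟨c, hc⟩ := hg
  have hdet : IsUnit (g 0 0 * g 1 1 - g 0 1 * g 1 0) := by
    rw [← Matrix.det_fin_two]
    exact (Matrix.isUnit_iff_isUnit_det _).1 g.isUnit
  have hd : IsUnit (g 1 1) := by
    by_contra h
    have h1 : g 1 1 ∈ IsLocalRing.maximalIdeal O := h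
    have h2 : ϖ ∈ IsLocalRing.maximalIdeal O := (Fact.out : Irreducible ϖ).not_isUnit
    refine (IsLocalRing.mem_maximalIdeal _).1 (Ideal.sub_mem _ (Ideal.mul_mem_left _ (g 0 0) h1)
      (Ideal.mul_mem_left _ (g 0 1) ?_)) hdet
    rw [hc]
    exact Ideal.mul_mem_right _ _ h2
  obtain ⟨e, he⟩ := hd.exists_right_inv
  have hdet' : (!![g 0 0 - g 0 1 * e * g 1 0, 0; ϖ ^ (m + 1) * c, g 1 1] :
      Matrix (Fin 2) (Fin 2) O).det = g 0 0 * g 1 1 - g 0 1 * g 1 0 := by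
    rw [Matrix.det_fin_two_of]
    linear_combination (-g 0 1 * g 1 0) * he
  obtain ⟨κ, hκ⟩ := (Matrix.isUnit_iff_isUnit_det _).2 (hdet' ▸ hdet)
  refine ⟨g 0 1 * e, κ, ?_⟩
  have he' := congrArg (algebraMap O F) he
  have hc' := congrArg (algebraMap O F) hc
  simp only [map_mul, map_one] at he' hc'
  have ha := alpha_val_pow F O ϖ m
  generalize alpha F O ϖ ^ m = a at ha ⊢
  ext i j
  fin_cases i <;> fin_cases j <;>
    simp [ha, inc, unip, hκ, Matrix.mul_apply, Fin.sum_univ_two, hc']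
  · ring
  · linear_combination (-(algebraMap O F (g 0 1))) * he'
  · ring

variable {F O} {k : Type u} [Field k] {W : Type u} [AddCommGroup W] [Module k W]
variable (σ : Representation k (ZK F O) W)

/-- A representation of `Z GL_2(O)` is smooth if every vector is fixed by an open subgroup. -/
def IsSmooth : Prop :=
  ∀ w, ∃ n, ∀ g ∈ congr O ϖ n, σ ⟨inc F O g, inc_mem F O g⟩ w = w

/-- The compact induction of `σ` from `Z GL_2(O)` to `GL_2(F)`: the smooth functions
`f : GL_2(F) → W` with `f (g κ) = σ(κ)⁻¹ f(g)` for `κ` in `Z GL_2(O)` that are supported on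
finitely many cosets `g Z GL_2(O)`. The group `GL_2(F)` acts by left translation. -/
def cInd : Submodule k (GL (Fin 2) F → W) where
  carrier := {f | (∀ g (κ : ZK F O), f (g * κ) = σ κ⁻¹ (f g)) ∧
    {c : GL (Fin 2) F ⧸ ZK F O | ∃ g, QuotientGroup.mk g = c ∧ f g ≠ 0}.Finite ∧
    ∃ n, ∀ u ∈ congr O ϖ n, ∀ g, f (inc F O u * g) = f g}
  zero_mem' := ⟨by simp, by simp, 0, by simp⟩
  add_mem' := by
    rintro f g ⟨h1, h2, m, h3⟩ ⟨h1', h2', n, h3'⟩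
    refine ⟨fun x κ => by simp [h1, h1'], (h2.union h2').subset ?_, max m n, fun u hu x => ?_⟩
    · rintro c ⟨x, rfl, hx⟩
      by_cases hf : f x = 0
      · exact Or.inr ⟨x, rfl, fun hg => hx (by simp [hf, hg])⟩
      · exact Or.inl ⟨x, rfl, hf⟩
    · rw [mem_congr_iff] at hu
      simp only [Pi.add_apply]
      rw [h3 u ((mem_congr_iff ϖ).2 fun i j => (pow_dvd_pow _ (le_max_left m n)).trans (hu i j)),
        h3' u ((mem_congr_iff ϖ).2 fun i j => (pow_dvd_pow _ (le_max_right m n)).trans (hu i j))]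
  smul_mem' := by
    rintro c f ⟨h1, h2, m, h3⟩
    refine ⟨fun x κ => by simp [h1], h2.subset ?_, m, fun u hu x => by simp [h3 u hu]⟩
    rintro _ ⟨x, rfl, hx⟩
    exact ⟨x, rfl, fun hf => hx (by simp [hf])⟩

variable (k W) in
/-- Left translation of functions: `(x f)(g) = f (x⁻¹ g)`. -/
def translate : Representation k (GL (Fin 2) F) (GL (Fin 2) F → W) where
  toFun x := LinearMap.funLeft k W (x⁻¹ * ·)
  map_one' := by ext; simp [LinearMap.funLeft]
  map_mul' x y := by ext; simp [LinearMap.funLeft, mul_assoc]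

lemma translate_apply (x g : GL (Fin 2) F) (f : GL (Fin 2) F → W) :
    translate k W x f g = f (x⁻¹ * g) := rfl

variable {ϖ σ} in
lemma translate_mem {x : GL (Fin 2) F} (d : ℕ)
    (hx : ∀ n, ∀ u ∈ congr O ϖ (n + d), ∃ v ∈ congr O ϖ n, inc F O u * x = x * inc F O v)
    {f : GL (Fin 2) F → W} (hf : f ∈ cInd ϖ σ) : translate k W x f ∈ cInd ϖ σ := by
  obtain ⟨h1, h2, n, h3⟩ := hf
  refine ⟨fun g κ => ?_, (h2.image (fun c => x • c)).subset ?_, n + d, fun u hu g => ?_⟩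
  · rw [translate_apply, ← mul_assoc, h1]; rfl
  · rintro _ ⟨g, rfl, hg⟩
    refine ⟨_, ⟨x⁻¹ * g, rfl, hg⟩, ?_⟩
    change (QuotientGroup.mk (x * (x⁻¹ * g)) : GL (Fin 2) F ⧸ ZK F O) = _
    rw [mul_inv_cancel_left]
  · obtain ⟨v, hv, h⟩ := hx n u hu
    rw [translate_apply, translate_apply, ← h3 v hv (x⁻¹ * g), ← mul_assoc, ← mul_assoc]
    congr 2
    rw [inv_mul_eq_iff_eq_mul, ← mul_assoc, ← h, mul_inv_cancel_right]

variable {ϖ σ} in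
lemma translate_unip_mem (x : O) {f : GL (Fin 2) F → W} (hf : f ∈ cInd ϖ σ) :
    translate k W (unip F O x) f ∈ cInd ϖ σ := by
  refine translate_mem 0 (fun n u hu => ?_) hf
  rw [unip]
  generalize (GeneralLinearGroup.upperRightHom x : GL (Fin 2) O) = y
  refine ⟨y⁻¹ * u * y⁻¹⁻¹, (MonoidHom.normal_ker _ : (congr O ϖ n).Normal).conj_mem u hu _, ?_⟩
  rw [← map_mul, ← map_mul]
  congr 1
  group

variable {ϖ σ} in
lemma translate_alpha_mem {f : GL (Fin 2) F → W} (hf : f ∈ cInd ϖ σ) :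
    translate k W (alpha F O ϖ) f ∈ cInd ϖ σ :=
  translate_mem 1 (fun _ _ hu => congr_conj_alpha F O ϖ hu) hf

/-- The compact induction, as a type. -/
def CInd : Type u := cInd ϖ σ

instance : AddCommGroup (CInd ϖ σ) := inferInstanceAs (AddCommGroup (cInd ϖ σ))

instance : Module k (CInd ϖ σ) := inferInstanceAs (Module k (cInd ϖ σ))

/-- The `k`-linear endomorphism of the compact induction induced by an endomorphism of the space
of all functions that preserves it. -/
def CInd.restr (e : Module.End k (GL (Fin 2) F → W))
    (he : ∀ f ∈ cInd ϖ σ, e f ∈ cInd ϖ σ) : Module.End k (CInd ϖ σ) :=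
  show Module.End k (cInd ϖ σ) from e.restrict he

/-- The action of `U` and of `α` on the compact induction. -/
def cIndOre : OreRep k O ϖ (CInd ϖ σ) where
  rho :=
    { toFun x := CInd.restr ϖ σ (translate k W (unip F O (toAdd x))) fun _ => translate_unip_mem _
      map_one' := LinearMap.ext fun f => Subtype.ext <| by
        change translate k W (unip F O 0) f.1 = f.1
        rw [unip, AddChar.map_zero_eq_one, map_one, map_one, Module.End.one_apply]
      map_mul' x y := LinearMap.ext fun f => Subtype.ext <| by
        change translate k W (unip F O (toAdd x + toAdd y)) f.1 =
          translate k W (unip F O (toAdd x)) (translate k W (unip F O (toAdd y)) f.1)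
        rw [unip_mul, map_mul, Module.End.mul_apply] }
  t := CInd.restr ϖ σ (translate k W (alpha F O ϖ)) fun _ => translate_alpha_mem
  comm x f := Subtype.ext <| by
    change translate k W (alpha F O ϖ) (translate k W (unip F O x) f.1) =
      translate k W (unip F O (ϖ * x)) (translate k W (alpha F O ϖ) f.1)
    rw [← Module.End.mul_apply, ← Module.End.mul_apply, ← map_mul, ← map_mul, alpha_unip]
  smooth f := by
    obtain ⟨n, hn⟩ := f.2.2.2
    refine ⟨n, fun x => Subtype.ext <| funext fun g => ?_⟩
    change f.1 ((unip F O (ϖ ^ n * x))⁻¹ * g) = f.1 g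
    rw [unip, ← map_inv]
    exact hn _ (inv_mem (upperRightHom_mem_congr O ϖ n x)) g

/-- The compact induction as a module over `k[[U]][X]_φ`, where `X` acts by `α`. -/
instance instTwistedModule : Module (Twisted k O ϖ) (CInd ϖ σ) :=
  Module.compHom _ (cIndOre ϖ σ).toEnd

/-- The subspace `R_m(σ)` of the functions with support in `I α ^ m Z GL_2(O)`, where `I` is the
Iwahori subgroup. -/
def layer (m : ℕ) : Submodule k (CInd ϖ σ) where
  carrier := {f | ∀ g, f.1 g ≠ 0 →
    ∃ i ∈ iwahori O ϖ, ∃ κ ∈ ZK F O, g = inc F O i * alpha F O ϖ ^ m * κ}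
  zero_mem' g hg := absurd rfl hg
  add_mem' {f f'} hf hf' g hg := by
    by_cases h : f.1 g = 0
    · exact hf' g fun h' => hg ((congrArg₂ (· + ·) h h').trans (add_zero 0))
    · exact hf g h
  smul_mem' c f hf g hg := hf g fun h => hg ((congrArg (c • ·) h).trans (smul_zero c))

variable {ϖ σ} in
lemma layer_rho {m : ℕ} {f : CInd ϖ σ} (hf : f ∈ layer ϖ σ m) (x : Multiplicative O) :
    (cIndOre ϖ σ).rho x f ∈ layer ϖ σ m := by
  intro g hg
  obtain ⟨i, hi, κ, hκ, h⟩ := hf _ hg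
  refine ⟨GeneralLinearGroup.upperRightHom (toAdd x) * i, ?_, κ, hκ, ?_⟩
  · simpa [iwahori, Matrix.mul_apply, Fin.sum_univ_two] using hi
  · rw [inv_mul_eq_iff_eq_mul] at h
    rw [h, map_mul, unip]
    simp only [mul_assoc]

variable [IsLocalRing O]

variable {ϖ σ} in
lemma layer_t {m : ℕ} {f : CInd ϖ σ} (hf : f ∈ layer ϖ σ m) :
    (cIndOre ϖ σ).t f ∈ layer ϖ σ (m + 1) := by
  intro g hg
  obtain ⟨i, hi, κ, hκ, h⟩ := hf _ hg
  obtain ⟨x, κ', h'⟩ := iwahori_alpha F O ϖ hi m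
  refine ⟨GeneralLinearGroup.upperRightHom (ϖ * x), by simp [iwahori],
    inc F O κ' * κ, mul_mem (inc_mem F O κ') hκ, ?_⟩
  rw [inv_mul_eq_iff_eq_mul] at h
  rw [h, h']
  change _ = unip F O (ϖ * x) * _ * _
  rw [pow_succ', ← mul_assoc (unip F O (ϖ * x)), ← alpha_unip]
  simp only [mul_assoc]

/-- The `k[[U]][X]_φ`-submodule `I_{≥ i}(σ) = ⨁_{m ≥ i} R_m(σ)` of the compact induction. -/
def geLayer (i : ℕ) : Submodule (Twisted k O ϖ) (CInd ϖ σ) where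
  carrier := ((⨆ m, ⨆ _ : i ≤ m, layer ϖ σ m : Submodule k (CInd ϖ σ)) : Set (CInd ϖ σ))
  zero_mem' := Submodule.zero_mem _
  add_mem' := Submodule.add_mem _
  smul_mem' s f hf := by
    refine (cIndOre ϖ σ).toEnd_mem (N := ⨆ m, ⨆ _ : i ≤ m, layer ϖ σ m) ?_ ?_ s hf
    · intro x v hv
      refine (iSup₂_le fun m hm f hf => ?_ : (⨆ m, ⨆ _ : i ≤ m, layer ϖ σ m) ≤
        Submodule.comap ((cIndOre ϖ σ).rho x) (⨆ m, ⨆ _ : i ≤ m, layer ϖ σ m)) hv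
      exact Submodule.mem_iSup_of_mem m (Submodule.mem_iSup_of_mem hm (layer_rho hf x))
    · intro v hv
      refine (iSup₂_le fun m hm f hf => ?_ : (⨆ m, ⨆ _ : i ≤ m, layer ϖ σ m) ≤
        Submodule.comap (cIndOre ϖ σ).t (⨆ m, ⨆ _ : i ≤ m, layer ϖ σ m)) hv
      exact Submodule.mem_iSup_of_mem (m + 1)
        (Submodule.mem_iSup_of_mem (hm.trans m.le_succ) (layer_t hf))

end Induction

/-! ### Hecke operators -/

section Hecke

variable {F : Type u} [Field F] {O : Type u} [CommRing O] [Algebra O F] (ϖ : O)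
  {k : Type u} [Field k] {W : Type u} [AddCommGroup W] [Module k W]
  (σ : Representation k (ZK F O) W)

/-- The functions `f : GL_2(F) → End(W)` with `f (κ₁ g κ₂) = σ(κ₁) f(g) σ(κ₂)` for `κ₁`, `κ₂` in
`Z GL_2(O)` whose support is compact modulo `Z GL_2(O)`, that is, a finite union of cosets
`Z GL_2(O) g`. -/
structure HeckeFun where
  toFun : GL (Fin 2) F → Module.End k W
  equivariant : ∀ (κ₁ κ₂ : ZK F O) g, toFun (κ₁ * g * κ₂) = σ κ₁ * toFun g * σ κ₂
  finite : {c : GL (Fin 2) F ⧸ ZK F O | ∃ g, QuotientGroup.mk g⁻¹ = c ∧ toFun g ≠ 0}.Finite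

variable {ϖ σ}
namespace HeckeFun

variable (f : HeckeFun σ)

/-- The function `g ↦ ∑ f(g⁻¹ h) φ(h)`, where `h` runs over `GL_2(F) / Z GL_2(O)`. -/
def conv (φ : GL (Fin 2) F → W) (g : GL (Fin 2) F) : W :=
  ∑ᶠ c : GL (Fin 2) F ⧸ ZK F O, f.toFun (g⁻¹ * c.out) (φ c.out)

lemma mul_apply_mul {φ : GL (Fin 2) F → W} (hφ : ∀ g (κ : ZK F O), φ (g * κ) = σ κ⁻¹ (φ g))
    (x h : GL (Fin 2) F) (κ : ZK F O) :
    f.toFun (x * (h * κ)) (φ (h * κ)) = f.toFun (x * h) (φ h) := by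
  have := f.equivariant 1 κ (x * h)
  rw [OneMemClass.coe_one, one_mul, map_one, one_mul, mul_assoc] at this
  rw [hφ, this, Module.End.mul_apply, ← Module.End.mul_apply (σ κ), ← map_mul, mul_inv_cancel,
    map_one, Module.End.one_apply]

/-- The summands of `conv` do not depend on the choice of representatives. -/
lemma out_term {φ : GL (Fin 2) F → W} (hφ : ∀ g (κ : ZK F O), φ (g * κ) = σ κ⁻¹ (φ g))
    (x h : GL (Fin 2) F) :
    f.toFun (x * (QuotientGroup.mk h : GL (Fin 2) F ⧸ ZK F O).out)
      (φ (QuotientGroup.mk h : GL (Fin 2) F ⧸ ZK F O).out) = f.toFun (x * h) (φ h) := by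
  obtain ⟨κ, hκ⟩ := QuotientGroup.mk_out_eq_mul (ZK F O) h
  rw [hκ, f.mul_apply_mul hφ]

lemma conv_translate {φ : GL (Fin 2) F → W} (hφ : ∀ g (κ : ZK F O), φ (g * κ) = σ κ⁻¹ (φ g))
    (x : GL (Fin 2) F) : f.conv (translate k W x φ) = translate k W x (f.conv φ) := by
  funext g
  rw [translate_apply, conv, conv]
  have h1 : ∀ g (κ : ZK F O), translate k W x φ (g * κ) = σ κ⁻¹ (translate k W x φ g) := by
    intro g κ
    rw [translate_apply, ← mul_assoc, hφ]
    rfl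
  rw [← finsum_comp_equiv (MulAction.toPerm x : Equiv.Perm (GL (Fin 2) F ⧸ ZK F O))]
  refine finsum_congr fun c => ?_
  obtain ⟨h, rfl⟩ := QuotientGroup.mk_surjective c
  rw [f.out_term hφ]
  change f.toFun (g⁻¹ * (QuotientGroup.mk (x * h) : GL (Fin 2) F ⧸ ZK F O).out)
    (translate k W x φ (QuotientGroup.mk (x * h) : GL (Fin 2) F ⧸ ZK F O).out) = _
  rw [f.out_term h1, translate_apply, inv_mul_cancel_left, _root_.mul_inv_rev, inv_inv, mul_assoc]

lemma finite_term {φ : GL (Fin 2) F → W} (hφ : φ ∈ cInd ϖ σ) (g : GL (Fin 2) F) :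
    (Function.support fun c : GL (Fin 2) F ⧸ ZK F O =>
      f.toFun (g⁻¹ * c.out) (φ c.out)).Finite := by
  refine hφ.2.1.subset fun c hc => ⟨c.out, Quotient.out_eq' c, fun h => hc ?_⟩
  simp only [h, map_zero]

lemma conv_mem {φ : GL (Fin 2) F → W} (hφ : φ ∈ cInd ϖ σ) : f.conv φ ∈ cInd ϖ σ := by
  refine ⟨fun g κ => ?_, ?_, ?_⟩
  · rw [conv, conv, map_finsum _ (f.finite_term hφ g)]
    refine finsum_congr fun c => ?_
    have := f.equivariant κ⁻¹ 1 (g⁻¹ * c.out)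
    rw [OneMemClass.coe_one, mul_one, map_one, mul_one, InvMemClass.coe_inv] at this
    rw [_root_.mul_inv_rev, mul_assoc, this, Module.End.mul_apply]
  · refine ((hφ.2.1.prod f.finite).image
      fun q => (q.1.out • q.2 : GL (Fin 2) F ⧸ ZK F O)).subset ?_
    rintro _ ⟨g, rfl, hg⟩
    obtain ⟨c, hc⟩ : ∃ c : GL (Fin 2) F ⧸ ZK F O, f.toFun (g⁻¹ * c.out) (φ c.out) ≠ 0 := by
      by_contra! h
      exact hg ((finsum_congr h).trans finsum_zero)
    have h1 : φ c.out ≠ 0 := fun h => hc (by rw [h, map_zero])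
    have h2 : f.toFun (g⁻¹ * c.out) ≠ 0 := fun h => hc (by rw [h, LinearMap.zero_apply])
    refine ⟨(c, QuotientGroup.mk (g⁻¹ * c.out)⁻¹),
      ⟨⟨c.out, Quotient.out_eq' c, h1⟩, ⟨_, rfl, h2⟩⟩, ?_⟩
    change (QuotientGroup.mk (c.out * (g⁻¹ * c.out)⁻¹) : GL (Fin 2) F ⧸ ZK F O) = _
    rw [_root_.mul_inv_rev, mul_inv_cancel_left, inv_inv]
  · obtain ⟨n, hn⟩ := hφ.2.2
    refine ⟨n, fun u hu g => ?_⟩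
    have h : translate k W (inc F O u)⁻¹ φ = φ := funext fun g => by
      rw [translate_apply, inv_inv, hn u hu]
    have := congrFun (f.conv_translate hφ.1 (inc F O u)⁻¹) g
    rw [h, translate_apply, inv_inv] at this
    exact this.symm

/-- The `GL_2(F)`-equivariant endomorphism `T` of the compact induction attached to `f`, given by
`(T φ)(g) = ∑ f(g⁻¹ h) φ(h)`, where `h` runs over `GL_2(F) / Z GL_2(O)`. -/
def opLin : Module.End k (CInd ϖ σ) where
  toFun φ := ⟨f.conv φ.1, f.conv_mem φ.2⟩
  map_add' φ ψ := Subtype.ext <| funext fun g => by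
    change f.conv (φ.1 + ψ.1) g = f.conv φ.1 g + f.conv ψ.1 g
    rw [conv, conv, conv, ← finsum_add_distrib (f.finite_term φ.2 g) (f.finite_term ψ.2 g)]
    simp only [Pi.add_apply, map_add]
  map_smul' c φ := Subtype.ext <| funext fun g => by
    change f.conv (c • φ.1) g = c • f.conv φ.1 g
    rw [conv, conv, smul_finsum]
    simp only [Pi.smul_apply, map_smul]

variable [FaithfulSMul O F] [Fact (Irreducible ϖ)]

/-- The operator `T` attached to `f`, as an endomorphism of `k[[U]][X]_φ`-modules. -/
def op : CInd ϖ σ →ₗ[Twisted k O ϖ] CInd ϖ σ where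
  toFun := f.opLin
  map_add' := map_add f.opLin
  map_smul' s φ := (cIndOre ϖ σ).map_toEnd
    (fun _ φ => Subtype.ext (f.conv_translate φ.2.1 _))
    (fun φ => Subtype.ext (f.conv_translate φ.2.1 _)) s φ

end HeckeFun

/-- The `k[[U]][X]_φ`-module `I_{≥ 0}(σ) / T(I_{≥ 1}(σ))`, where `T` is the operator attached
to `f`. If `f` is supported in `Z GL_2(O) α GL_2(O)`, then `T` maps `R_m(σ)` to
`R_{m - 1}(σ) ⊕ R_{m + 1}(σ)` for `m ≥ 1`, so that `T(I_{≥ 1}(σ))` is contained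
in `I_{≥ 0}(σ)`. -/
abbrev cokerT [FaithfulSMul O F] [Fact (Irreducible ϖ)] [IsLocalRing O]
    (f : HeckeFun σ) : Type u :=
  geLayer ϖ σ 0 ⧸ ((geLayer ϖ σ 1).map f.op).submoduleOf (geLayer ϖ σ 0)

end Hecke

/-! ### The ring of integers of a finite extension of `ℚ_p` -/

section Integers

variable (p : ℕ) [Fact p.Prime] (F : Type u) [Field F] [Algebra ℚ_[p] F] [Algebra ℤ_[p] F]
  [IsScalarTower ℤ_[p] ℚ_[p] F]

/-- The ring of integers of `F`: the integral closure of `ℤ_p` in `F`. -/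
abbrev ringInt : Subalgebra ℤ_[p] F := integralClosure ℤ_[p] F

variable [Algebra.IsAlgebraic ℚ_[p] F]

lemma mem_ringInt_iff (x : F) : x ∈ ringInt p F ↔ spectralNorm ℚ_[p] F x ≤ 1 := by
  have hx : IsIntegral ℚ_[p] x := (Algebra.IsAlgebraic.isAlgebraic x).isIntegral
  rw [spectralNorm, spectralValue_le_one_iff (minpoly.monic hx), mem_integralClosure_iff]
  constructor
  · intro h n
    rw [minpoly.isIntegrallyClosed_eq_field_fractions' ℚ_[p] h, coeff_map]
    exact PadicInt.norm_le_one _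
  · intro h
    have hl : minpoly ℚ_[p] x ∈ lifts (algebraMap ℤ_[p] ℚ_[p]) := by
      rw [lifts_iff_coeff_lifts]
      exact fun n => ⟨⟨_, h n⟩, rfl⟩
    obtain ⟨q, hq, -, hm⟩ := lifts_and_degree_eq_and_monic hl (minpoly.monic hx)
    refine ⟨q, hm, ?_⟩
    have := minpoly.aeval ℚ_[p] x
    rw [← hq, aeval_map_algebraMap] at this
    exact this

lemma isUnit_ringInt_iff (x : ringInt p F) : IsUnit x ↔ spectralNorm ℚ_[p] F (x : F) = 1 := by
  have hmul := spectralAlgNorm_mul (K := ℚ_[p]) (L := F)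
  simp only [spectralAlgNorm_def] at hmul
  constructor
  · rintro ⟨u, rfl⟩
    have h1 := (mem_ringInt_iff p F _).1 u.1.2
    have h2 := (mem_ringInt_iff p F _).1 (u⁻¹).1.2
    have h3 := hmul (u : ringInt p F) ((u⁻¹ : (ringInt p F)ˣ) : ringInt p F)
    rw [← Subalgebra.coe_mul, Units.mul_inv, Subalgebra.coe_one, spectralNorm_one] at h3
    nlinarith [spectralNorm_nonneg (K := ℚ_[p]) (((u : ringInt p F)) : F),
      spectralNorm_nonneg (K := ℚ_[p]) ((((u⁻¹ : (ringInt p F)ˣ) : ringInt p F)) : F)]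
  · intro h
    have hx0 : (x : F) ≠ 0 := by
      intro h0
      rw [h0, spectralNorm_zero] at h
      exact zero_ne_one h
    have h3 := hmul (x : F) (x : F)⁻¹
    rw [mul_inv_cancel₀ hx0, spectralNorm_one, h, one_mul] at h3
    exact .of_mul_eq_one (⟨(x : F)⁻¹, (mem_ringInt_iff p F _).2 h3.ge⟩ : ringInt p F)
      (Subtype.ext (mul_inv_cancel₀ hx0))

instance : IsLocalRing (ringInt p F) :=
  .of_nonunits_add fun x y hx hy => by
    rw [mem_nonunits_iff, isUnit_ringInt_iff] at hx hy ⊢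
    have h := isNonarchimedean_spectralNorm (K := ℚ_[p]) (L := F) (x : F) (y : F)
    have hx' := lt_of_le_of_ne ((mem_ringInt_iff p F _).1 x.2) hx
    have hy' := lt_of_le_of_ne ((mem_ringInt_iff p F _).1 y.2) hy
    exact (h.trans_lt (max_lt hx' hy')).ne

end Integers

end ModPGL2

end

/-!
Write `A = k[[U]]` and `S = A[X]_φ`. The proof reduces the assertion to an explicit free resolution.

*The ring.* Since `O` is free of rank two over `ℤ_p`, the ring `A` is a ring of power series in two
variables (`seriesMap_bijective`), hence a regular local ring of dimension two, and it is free over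
the image of `φ`, with the maps `psi` as coordinates.

*The representation.* The image of the central element `ϖ` generates a finite extension `k'` of `k`
(`exists_coefficient_field`), over which `σ` is an irreducible representation of `GL_2` of the
residue field (`exists_isLinearWeight`). Its vectors fixed by `U` form a line `k' v`, and the image
of `v` under the Weyl element generates `σ` over `A` (`exists_line_of_irreducible`). From here on,
`A` and `S` have coefficients in `k'`. Let `J` be the annihilator of this generator in `A`. The
socle of `A / J ≅ σ` is one-dimensional (`exists_socle_generator`), so that `J` is a Gorenstein ideal
of codimension two and is generated by a regular sequence `(a, b)` (`exists_koszulExact_of_socle`).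

*The cokernel.* Let `e` be the function with support in `Z GL_2(O)` whose value at `1` is the
generator of `σ`. The functions `u α ^ m e` for `u` in `U` modulo
`φ ^ m (U)` have disjoint supports, so that
`I_{≥ 0}(σ) = S e ≅ S / S J` (`exists_toEnd_eq_of_mem_geLayer`, `toEnd_single_eq_zero_iff`), and
`I_{≥ 1}(σ) = S X e`. The support of `f` gives a relation `T(X e) = γ e + φ(s) X² e` with `γ ≠ 0`
(`exists_opExt_t_gen`, `IsLinearWeight.exists_toFun_alpha_eq`). After dividing `s` by `γ`, the
cokernel is `M = S / (S a + S b + S τ)` with `τ = 1 + φ(s) X²` (`toCokerT_eq_zero_iff`). Moreover, an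
element `x` of `A` lies in `J` if and only if `s x` lies in `φ(J) A` (`mem_annIdeal_iff_mul_mem`).

*The resolution.* By the last fact, right multiplication by `τ` maps `φ(a)` and `φ(b)` into the left
ideal `S a + S b`, and `P τ` lies in `S a + S b` only if `P` lies in `S φ(a) + S φ(b)`
(`TwistData.exists_of_mul_τ`). It follows that `M` has a free resolution
`0 → S → S³ → S³ → S → M → 0`, in which the three basis vectors in degree two correspond to the
Koszul relation of `(a, b)` and to the relations that express `φ(a) τ` and `φ(b) τ` by `a` and `b`.

*The class.* Write `φ(a) = n₁ a + n₂ b` and `s a = c₁ φ(a) + c₂ φ(b)`. The regular sequence can be chosen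
such that all four coefficients lie in the augmentation ideal (`hasGoodGenerators`): the matrices
over `k'` that express `(φ(a), φ(b))` by `(a, b)` and `(s a, s b)` by `(φ(a), φ(b))` have a common vector
in their left kernels, because the first one is nilpotent and the product of the two is a scalar.
The second basis vector in degree two is then a cycle after passing to the coinvariants of `U`, whereas
its coordinate vanishes on all boundaries. So its class in `Tor_2` is not killed by any nonzero
polynomial (`tor_two_of_twistData`), and the multiples of this class form an infinite-dimensional
subspace. As `S` over `k'` is a free module over `S` over `k`, this is also a projective resolution
over the latter ring.
-/

noncomputable section

namespace ModPGL2

/-! ### Left derived functors in degree two -/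

section Derived

open Limits

variable {R : Type u} [Ring R] {R' : Type u} [Ring R']
  {P₀ P₁ P₂ P₃ : ModuleCat.{u} R} (d₁ : P₁ ⟶ P₀) (d₂ : P₂ ⟶ P₁) (d₃ : P₃ ⟶ P₂)

variable (P₀ P₁ P₂ P₃) in
/-- The terms of a complex `0 → P₃ → P₂ → P₁ → P₀`, indexed by `ℕ`. -/
def resObj : ℕ → ModuleCat.{u} R
  | 0 => P₀
  | 1 => P₁
  | 2 => P₂
  | 3 => P₃
  | _ => ModuleCat.of R PUnit

/-- The differentials of a complex `0 → P₃ → P₂ → P₁ → P₀`, indexed by `ℕ`. -/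
def resDiff : ∀ n, resObj P₀ P₁ P₂ P₃ (n + 1) ⟶ resObj P₀ P₁ P₂ P₃ n
  | 0 => d₁
  | 1 => d₂
  | 2 => d₃
  | _ + 3 => 0

variable {d₁ d₂ d₃}

lemma resDiff_comp (h₁ : d₂ ≫ d₁ = 0) (h₂ : d₃ ≫ d₂ = 0) :
    ∀ n, resDiff d₁ d₂ d₃ (n + 1) ≫ resDiff d₁ d₂ d₃ n = 0
  | 0 => h₁
  | 1 => h₂
  | _ + 2 => zero_comp

lemma of_resDiff_comp {M : ModuleCat.{u} R} {ε : P₀ ⟶ M} (e₀ : Function.Exact d₁ ε)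
    (sq : ∀ n, resDiff d₁ d₂ d₃ (n + 1) ≫ resDiff d₁ d₂ d₃ n = 0) :
    (ChainComplex.of (resObj P₀ P₁ P₂ P₃) (resDiff d₁ d₂ d₃) sq).d 1 0 ≫ ε = 0 :=
  (congrArg (· ≫ ε) (ChainComplex.of_d (resObj P₀ P₁ P₂ P₃) (resDiff d₁ d₂ d₃) 0)).trans
    (ModuleCat.hom_ext (LinearMap.ext e₀.apply_apply_eq_zero))

/-- An exact sequence `0 → P₃ → P₂ → P₁ → P₀ → M → 0` with projective `Pᵢ`, as a projective
resolution of `M`. -/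
def resolution {M : ModuleCat.{u} R} (ε : P₀ ⟶ M)
    (hP₀ : Projective P₀) (hP₁ : Projective P₁) (hP₂ : Projective P₂) (hP₃ : Projective P₃)
    (hε : Function.Surjective ε) (e₀ : Function.Exact d₁ ε) (e₁ : Function.Exact d₂ d₁)
    (e₂ : Function.Exact d₃ d₂) (e₃ : Function.Injective d₃) : ProjectiveResolution M where
  complex := ChainComplex.of (resObj P₀ P₁ P₂ P₃) (resDiff d₁ d₂ d₃)
    (resDiff_comp (ModuleCat.hom_ext (LinearMap.ext e₁.apply_apply_eq_zero))
      (ModuleCat.hom_ext (LinearMap.ext e₂.apply_apply_eq_zero)))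
  projective n := by
    match n with
    | 0 => exact hP₀
    | 1 => exact hP₁
    | 2 => exact hP₂
    | 3 => exact hP₃
    | n + 4 =>
      exact (ModuleCat.isZero_of_subsingleton (ModuleCat.of R PUnit)).projective
  π := (ChainComplex.toSingle₀Equiv _ _).symm ⟨ε, of_resDiff_comp e₀ _⟩
  quasiIso := ⟨fun n => by
    cases n with
    | zero =>
      rw [ChainComplex.quasiIsoAt₀_iff, ShortComplex.quasiIso_iff_of_zeros']
      · refine (ShortComplex.exact_and_epi_g_iff_of_iso (S₂ := ShortComplex.mk d₁ ε
          (ModuleCat.hom_ext (LinearMap.ext e₀.apply_apply_eq_zero))) ?_).2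
          ⟨(ShortComplex.ShortExact.moduleCat_exact_iff_function_exact _).2 e₀,
            (ModuleCat.epi_iff_surjective _).2 hε⟩
        exact ShortComplex.isoMk (Iso.refl _) (Iso.refl _) (Iso.refl _)
          (ChainComplex.of_d (resObj P₀ P₁ P₂ P₃) (resDiff d₁ d₂ d₃) 0).symm
          (ChainComplex.toSingle₀Equiv_symm_apply_f_zero (C := ChainComplex.of (resObj P₀ P₁ P₂ P₃)
            (resDiff d₁ d₂ d₃) _) ε (of_resDiff_comp e₀ _)).symm
      all_goals rfl
    | succ n =>
      rw [quasiIsoAt_iff_exactAt']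
      · rw [HomologicalComplex.exactAt_iff' _ (n + 1 + 1) (n + 1) n (by simp) (by simp),
          ShortComplex.ShortExact.moduleCat_exact_iff_function_exact]
        change Function.Exact
          (ChainComplex.of.d (resObj P₀ P₁ P₂ P₃) (resDiff d₁ d₂ d₃) (n + 1 + 1) (n + 1)).hom
          (ChainComplex.of.d (resObj P₀ P₁ P₂ P₃) (resDiff d₁ d₂ d₃) (n + 1) n).hom
        rw [ChainComplex.of_d, ChainComplex.of_d]
        match n with
        | 0 => exact e₁
        | 1 => exact e₂
        | 2 =>
          intro y
          refine ⟨fun h => ⟨0, ?_⟩, ?_⟩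
          · rw [map_zero]
            exact (e₃ (h.trans (map_zero _).symm)).symm
          · rintro ⟨x, rfl⟩
            change d₃ 0 = 0
            exact map_zero _
        | n + 3 => exact fun y => ⟨fun _ => ⟨0, rfl⟩, fun _ => rfl⟩
      · apply ChainComplex.exactAt_succ_single_obj⟩

/-- A cycle `z` in degree two of the image of a resolution under `F`, and a linear form on that
degree which vanishes on the boundaries, give an element of the second left derived functor and
a linear form on it. -/
lemma exists_leftDerived_two (F : ModuleCat.{u} R ⥤ ModuleCat.{u} R') [F.Additive]
    {M : ModuleCat.{u} R} (ε : P₀ ⟶ M)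
    (hP₀ : Projective P₀) (hP₁ : Projective P₁) (hP₂ : Projective P₂) (hP₃ : Projective P₃)
    (hε : Function.Surjective ε) (e₀ : Function.Exact d₁ ε) (e₁ : Function.Exact d₂ d₁)
    (e₂ : Function.Exact d₃ d₂) (e₃ : Function.Injective d₃)
    {Q : ModuleCat.{u} R'} (l : F.obj P₂ ⟶ Q) (hl : F.map d₃ ≫ l = 0)
    (z : F.obj P₂) (hz : F.map d₂ z = 0) :
    ∃ (h : (F.leftDerived 2).obj M) (l' : (F.leftDerived 2).obj M →ₗ[R'] Q), l' h = l z := by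
  let P := resolution ε hP₀ hP₁ hP₂ hP₃ hε e₀ e₁ e₂ e₃
  let K := (F.mapHomologicalComplex (ComplexShape.down ℕ)).obj P.complex
  have hd (j) : P.complex.d (j + 1) j = resDiff d₁ d₂ d₃ j := ChainComplex.of_d _ _ _
  let S := ShortComplex.mk (F.map d₃) (F.map d₂) (by
    rw [← F.map_comp, ← F.map_zero]
    exact congrArg F.map (ModuleCat.hom_ext (LinearMap.ext e₂.apply_apply_eq_zero)))
  let j : K.sc' 3 2 1 ≅ S := ShortComplex.isoMk (Iso.refl _) (Iso.refl _) (Iso.refl _)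
    (congrArg F.map (hd 2)).symm (congrArg F.map (hd 1)).symm
  let i : (F.leftDerived 2).obj M ≅ S.homology :=
    (P.isoLeftDerivedObj F 2) ≪≫ (K.homologyIsoSc' 3 2 1 (by simp) (by simp)) ≪≫
      ShortComplex.homologyMapIso j
  let L : S.homology ⟶ Q := S.descHomology (S.iCycles ≫ l) (by
    rw [← Category.assoc, S.toCycles_i]; exact hl)
  let z' : S.cycles := S.moduleCatCyclesIso.inv ⟨z, hz⟩
  refine ⟨i.inv (S.homologyπ z'), (i.hom ≫ L).hom, ?_⟩
  have h1 : S.iCycles z' = z := by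
    have := S.moduleCatCyclesIso_inv_iCycles
    exact ConcreteCategory.congr_hom this _
  have h2 : i.inv ≫ i.hom ≫ L = L := by simp
  calc (i.hom ≫ L) (i.inv (S.homologyπ z')) = L (S.homologyπ z') :=
        ConcreteCategory.congr_hom h2 (S.homologyπ z')
    _ = (S.homologyπ ≫ L) z' := rfl
    _ = (S.iCycles ≫ l) z' := by rw [S.π_descHomology]
    _ = l (S.iCycles z') := rfl
    _ = l z := by rw [h1]

end Derived

/-! ### Koszul relations over twisted polynomial rings -/

section Skew

variable {R : Type u} [CommRing R]

/-- The Koszul complex `0 → R → R² → R` of the pair `(a, b)` is exact. -/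
structure KoszulExact (a b : R) : Prop where
  rel : ∀ c d, c * a + d * b = 0 → ∃ e, c = e * b ∧ d = -(e * a)
  inj : ∀ e, e * a = 0 → e * b = 0 → e = 0

local notation "cst" => SkewPolynomial.C
local notation "mon" => SkewPolynomial.monomial
local notation "cf" => SkewPolynomial.coeff

lemma coeff_sum_skew {ι : Type*} (s : Finset ι) (f : ι → SkewPolynomial R) (n : ℕ) :
    cf (∑ i ∈ s, f i) n = ∑ i ∈ s, cf (f i) n :=
  map_sum (⟨⟨fun P : SkewPolynomial R => cf P n, rfl⟩,
    fun P Q => SkewPolynomial.coeff_add P Q n⟩ : SkewPolynomial R →+ R) f s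

lemma coeff_neg_skew (P : SkewPolynomial R) (n : ℕ) : cf (-P) n = -cf P n :=
  map_neg (⟨⟨fun P : SkewPolynomial R => cf P n, rfl⟩,
    fun P Q => SkewPolynomial.coeff_add P Q n⟩ : SkewPolynomial R →+ R) P

lemma coeff_sub_skew (P Q : SkewPolynomial R) (n : ℕ) :
    cf (P - Q) n = cf P n - cf Q n := by
  rw [sub_eq_add_neg, SkewPolynomial.coeff_add, coeff_neg_skew, sub_eq_add_neg]

lemma skew_induction {motive : SkewPolynomial R → Prop} (P : SkewPolynomial R)
    (h0 : motive 0) (hadd : ∀ P Q, motive P → motive Q → motive (P + Q))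
    (hm : ∀ n r, motive (mon n r)) : motive P :=
  SkewPolynomial.induction P h0 fun n r _ _ _ hQ => hadd _ _ (hm n r) hQ

lemma coeff_sum_range_monomial (N : ℕ) (e : ℕ → R) (n : ℕ) :
    cf (∑ i ∈ Finset.range N, mon i (e i)) n = if n < N then e n else 0 := by
  rw [coeff_sum_skew]
  simp only [SkewPolynomial.coeff_monomial]
  rw [Finset.sum_ite_eq' (Finset.range N) n e]
  simp only [Finset.mem_range]

lemma exists_coeff_eq_zero (P : SkewPolynomial R) : ∃ N, ∀ n, N ≤ n → cf P n = 0 := by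
  refine ⟨P.support.sup id + 1, fun n hn => ?_⟩
  by_contra h
  have := Finset.le_sup (f := id) (SkewPolynomial.mem_support_iff.2 h)
  simp only [id] at this
  omega

variable [MulSemiringAction (Multiplicative ℕ) R]

local notation "φ" => SkewPolynomial.φ (R := R)

/-- Right multiplication by a constant twists it: `X ^ n a = φ ^ n (a) X ^ n`. -/
lemma coeff_mul_C (P : SkewPolynomial R) (a : R) (n : ℕ) :
    cf (P * cst a) n = cf P n * φ^[n] a := by
  induction P using skew_induction with
  | h0 => rw [zero_mul, SkewPolynomial.coeff_zero, zero_mul]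
  | hadd P Q hP hQ =>
    rw [add_mul, SkewPolynomial.coeff_add, SkewPolynomial.coeff_add, hP, hQ, add_mul]
  | hm m r =>
    rw [SkewPolynomial.monomial_mul_C, SkewPolynomial.coeff_monomial, SkewPolynomial.coeff_monomial]
    split_ifs with h
    · rw [h]
    · rw [zero_mul]

lemma coeff_mul_monomial_two (P : SkewPolynomial R) (a : R) (n : ℕ) :
    cf (P * mon 2 a) (n + 2) = cf P n * φ^[n] a := by
  induction P using skew_induction with
  | h0 => rw [zero_mul, SkewPolynomial.coeff_zero, SkewPolynomial.coeff_zero, zero_mul]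
  | hadd P Q hP hQ =>
    rw [add_mul, SkewPolynomial.coeff_add, SkewPolynomial.coeff_add, hP, hQ, add_mul]
  | hm m r =>
    rw [SkewPolynomial.monomial_mul_monomial, SkewPolynomial.coeff_monomial,
      SkewPolynomial.coeff_monomial]
    simp only [add_left_inj]
    split_ifs with h
    · rw [h]
    · rw [zero_mul]

lemma skew_koszul_rel {a b : R} (h : ∀ n, KoszulExact (φ^[n] a) (φ^[n] b))
    {P Q : SkewPolynomial R} (hPQ : P * cst a + Q * cst b = 0) :
    ∃ E, P = E * cst b ∧ Q = -(E * cst a) := by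
  obtain ⟨N, hN⟩ := exists_coeff_eq_zero P
  obtain ⟨N', hN'⟩ := exists_coeff_eq_zero Q
  have key : ∀ n, ∃ e, cf P n = e * φ^[n] b ∧ cf Q n = -(e * φ^[n] a) := fun n => by
    refine (h n).rel _ _ ?_
    rw [← coeff_mul_C, ← coeff_mul_C, ← SkewPolynomial.coeff_add, hPQ, SkewPolynomial.coeff_zero]
  choose e he he' using key
  refine ⟨∑ i ∈ Finset.range (max N N'), mon i (e i), ?_, ?_⟩
  · ext n
    rw [coeff_mul_C, coeff_sum_range_monomial]
    split_ifs with hn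
    · exact he n
    · rw [hN n ((le_max_left _ _).trans (not_lt.1 hn)), zero_mul]
  · ext n
    rw [coeff_neg_skew, coeff_mul_C, coeff_sum_range_monomial]
    split_ifs with hn
    · exact he' n
    · rw [hN' n ((le_max_right _ _).trans (not_lt.1 hn)), zero_mul, neg_zero]

lemma skew_koszul_inj {a b : R} (h : ∀ n, KoszulExact (φ^[n] a) (φ^[n] b))
    {E : SkewPolynomial R} (ha : E * cst a = 0) (hb : E * cst b = 0) : E = 0 := by
  ext n
  refine (h n).inj _ ?_ ?_
  · rw [← coeff_mul_C, ha, SkewPolynomial.coeff_zero]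
  · rw [← coeff_mul_C, hb, SkewPolynomial.coeff_zero]

end Skew

/-! ### A free resolution of a cyclic module -/

section Cyclic

variable {R : Type u} [CommRing R] [MulSemiringAction (Multiplicative ℕ) R]

local notation "cst" => SkewPolynomial.C
local notation "mon" => SkewPolynomial.monomial
local notation "cf" => SkewPolynomial.coeff

local notation "φ" => SkewPolynomial.φ (R := R)

variable (R) in
/-- A pair `(a, b)` of generators of an ideal `J` of `R` and an element `s` of `R` such that
`φ(J)` is contained in `J` and `s J` is contained in the ideal `J'` generated by `φ(J)`. The
coefficients `n` and `c` express this, and further conditions say that the Koszul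
complexes of the twists of `(a, b)` are exact and that multiplication by `s` is injective
from `R / J` to `R / J'`, also after twisting. -/
structure TwistData where
  a : R
  b : R
  s : R
  n₁ : R × R
  n₂ : R × R
  c₁ : R × R
  c₂ : R × R
  map_a : φ a = n₁.1 * a + n₁.2 * b
  map_b : φ b = n₂.1 * a + n₂.2 * b
  s_mul_a : s * a = c₁.1 * φ a + c₁.2 * φ b
  s_mul_b : s * b = c₂.1 * φ a + c₂.2 * φ b
  koszul : ∀ n, KoszulExact (φ^[n] a) (φ^[n] b)
  inj : ∀ n x, (∃ u v, x * φ^[n] s = u * φ^[n + 1] a + v * φ^[n + 1] b) →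
    ∃ u v, x = u * φ^[n] a + v * φ^[n] b

namespace TwistData

variable (D : TwistData R)

/-- The skew polynomial `1 + φ(s) X²`. -/
def τ : SkewPolynomial R := 1 + mon 2 (φ D.s)

/-- The coefficients of a relation between `φ(a) (1 + φ(s) X²)` and `(a, b)`. -/
def row (n c : R × R) : SkewPolynomial R × SkewPolynomial R :=
  (cst n.1 + mon 2 (φ c.1), cst n.2 + mon 2 (φ c.2))

lemma map_mul_τ {g : R} {n c : R × R} (hn : φ g = n.1 * D.a + n.2 * D.b)
    (hc : D.s * g = c.1 * φ D.a + c.2 * φ D.b) :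
    cst (φ g) * D.τ = (row n c).1 * cst D.a + (row n c).2 * cst D.b := by
  have h : φ g * φ D.s = φ c.1 * φ^[2] D.a + φ c.2 * φ^[2] D.b := by
    rw [← map_mul, mul_comm, hc, map_add, map_mul, map_mul]
    rfl
  rw [τ, row, mul_add, mul_one, SkewPolynomial.C_mul_monomial, h, add_mul, add_mul,
    SkewPolynomial.monomial_mul_C, SkewPolynomial.monomial_mul_C, hn, map_add, map_add,
    SkewPolynomial.C_mul, SkewPolynomial.C_mul]
  abel

lemma coeff_mul_τ (P : SkewPolynomial R) (n : ℕ) :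
    cf (P * D.τ) (n + 2) = cf P (n + 2) + cf P n * φ^[n + 1] D.s := by
  rw [τ, mul_add, mul_one, SkewPolynomial.coeff_add, coeff_mul_monomial_two]
  rfl

/-- The left ideal of the `P` such that `P (1 + φ(s) X²)` lies in the left ideal generated by `a`
and `b` is generated by `φ(a)` and `φ(b)`. The proof is by induction on the degree; the
leading coefficient is controlled by the injectivity of multiplication by `s`. -/
lemma exists_of_mul_τ {P U V : SkewPolynomial R} (h : P * D.τ = U * cst D.a + V * cst D.b) :
    ∃ U' V', P = U' * cst (φ D.a) + V' * cst (φ D.b) := by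
  obtain ⟨N, hN⟩ := exists_coeff_eq_zero P
  induction N generalizing P U V with
  | zero =>
    refine ⟨0, 0, ?_⟩
    ext n
    simp [hN n n.zero_le]
  | succ N ih =>
    have h1 : cf P N * φ^[N + 1] D.s =
        cf U (N + 2) * φ^[N + 2] D.a + cf V (N + 2) * φ^[N + 2] D.b := by
      rw [← coeff_mul_C, ← coeff_mul_C, ← SkewPolynomial.coeff_add, ← h, coeff_mul_τ,
        hN (N + 2) (by omega), zero_add]
    obtain ⟨u, v, huv⟩ := D.inj _ _ ⟨_, _, h1⟩
    have h2 : mon N (cf P N) =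
        mon N u * cst (φ D.a) + mon N v * cst (φ D.b) := by
      rw [huv, SkewPolynomial.monomial_mul_C, SkewPolynomial.monomial_mul_C, map_add]
      rfl
    have h3 : (P - mon N (cf P N)) * D.τ =
        (U - mon N u * (row D.n₁ D.c₁).1 - mon N v * (row D.n₂ D.c₂).1) * cst D.a +
        (V - mon N u * (row D.n₁ D.c₁).2 - mon N v * (row D.n₂ D.c₂).2) * cst D.b := by
      rw [sub_mul, h, h2, add_mul, mul_assoc, mul_assoc, D.map_mul_τ D.map_a D.s_mul_a,
        D.map_mul_τ D.map_b D.s_mul_b]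
      noncomm_ring
    obtain ⟨U', V', hUV⟩ := ih h3 fun n hn => by
      rw [coeff_sub_skew, SkewPolynomial.coeff_monomial]
      split_ifs with h
      · rw [h, sub_self]
      · rw [hN n (by omega), sub_zero]
    refine ⟨U' + mon N u, V' + mon N v, ?_⟩
    rw [add_mul, add_mul, ← sub_add_cancel P (mon N (cf P N)), hUV, h2]
    abel

local notation "S" => SkewPolynomial R

/-- The differential `S³ → S`, with image the left ideal generated by `a`, `b` and
`1 + φ(s) X²`. -/
def d₁ : (S × S × S) →ₗ[S] S :=
  (LinearMap.toSpanSingleton S S (cst D.a)).coprod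
    ((LinearMap.toSpanSingleton S S (cst D.b)).coprod (LinearMap.toSpanSingleton S S D.τ))

lemma d₁_apply (z : S × S × S) : D.d₁ z = z.1 * cst D.a + (z.2.1 * cst D.b + z.2.2 * D.τ) := rfl

/-- The differential `S³ → S³`: the first basis vector is sent to the Koszul relation between
`a` and `b`, and the other two to the relations which express that multiplication
by `1 + φ(s) X²` on the right maps `φ(a)` and `φ(b)` into the left ideal generated by `a`
and `b`. -/
def d₂ : (S × S × S) →ₗ[S] (S × S × S) :=
  (LinearMap.toSpanSingleton S (S × S × S) (cst D.b, -cst D.a, 0)).coprod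
    ((LinearMap.toSpanSingleton S (S × S × S)
      ((row D.n₁ D.c₁).1, (row D.n₁ D.c₁).2, -cst (φ D.a))).coprod
      (LinearMap.toSpanSingleton S (S × S × S)
        ((row D.n₂ D.c₂).1, (row D.n₂ D.c₂).2, -cst (φ D.b))))

lemma d₂_apply (z : S × S × S) : D.d₂ z =
    (z.1 * cst D.b + (z.2.1 * (row D.n₁ D.c₁).1 + z.2.2 * (row D.n₂ D.c₂).1),
      z.1 * -cst D.a + (z.2.1 * (row D.n₁ D.c₁).2 + z.2.2 * (row D.n₂ D.c₂).2),
      z.1 * 0 + (z.2.1 * -cst (φ D.a) + z.2.2 * -cst (φ D.b))) := rfl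

lemma koszul_map (n : ℕ) : KoszulExact (φ^[n] (φ D.a)) (φ^[n] (φ D.b)) := D.koszul (n + 1)

lemma exists_κ : ∃ κ : S,
    cst (φ D.b) * (row D.n₁ D.c₁).1 - cst (φ D.a) * (row D.n₂ D.c₂).1 = κ * cst D.b ∧
    cst (φ D.b) * (row D.n₁ D.c₁).2 - cst (φ D.a) * (row D.n₂ D.c₂).2 = -(κ * cst D.a) := by
  refine skew_koszul_rel D.koszul ?_
  have h : cst (φ D.b) * (cst (φ D.a) * D.τ) - cst (φ D.a) * (cst (φ D.b) * D.τ) = 0 := by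
    rw [← mul_assoc, ← mul_assoc, ← SkewPolynomial.C_mul, ← SkewPolynomial.C_mul, mul_comm,
      sub_self]
  rw [D.map_mul_τ D.map_a D.s_mul_a, D.map_mul_τ D.map_b D.s_mul_b] at h
  rw [← h]
  noncomm_ring

/-- The differential `S → S³`. The relation between the three images under `d₂` comes from the Koszul
relation between `φ(a)` and `φ(b)`. -/
def d₃ : S →ₗ[S] (S × S × S) :=
  LinearMap.toSpanSingleton S (S × S × S) (-D.exists_κ.choose, cst (φ D.b), -cst (φ D.a))

lemma d₃_apply (z : S) : D.d₃ z =
    (z * -D.exists_κ.choose, z * cst (φ D.b), z * -cst (φ D.a)) := rfl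

lemma d₁_d₂ (z : S × S × S) : D.d₁ (D.d₂ z) = 0 := by
  have h1 := D.map_mul_τ D.map_a D.s_mul_a
  have h2 := D.map_mul_τ D.map_b D.s_mul_b
  have h3 : cst D.b * cst D.a = cst D.a * cst D.b := by
    rw [← SkewPolynomial.C_mul, ← SkewPolynomial.C_mul, mul_comm]
  rw [d₂_apply, d₁_apply]
  have e : ∀ x y z : S, x * y * z = x * (y * z) := mul_assoc
  simp only [mul_zero, zero_add, add_mul, neg_mul, mul_neg, e, h1, h2, h3, mul_add, neg_add]
  abel

lemma d₂_d₃ (z : S) : D.d₂ (D.d₃ z) = 0 := by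
  obtain ⟨h1, h2⟩ := D.exists_κ.choose_spec
  have h3 : cst (φ D.b) * cst (φ D.a) = cst (φ D.a) * cst (φ D.b) := by
    rw [← SkewPolynomial.C_mul, ← SkewPolynomial.C_mul, mul_comm]
  have e : ∀ x y z : S, x * y * z = x * (y * z) := mul_assoc
  rw [d₃_apply, d₂_apply]
  refine Prod.ext ?_ (Prod.ext ?_ ?_)
  · simp only [mul_neg, neg_mul, e, ← h1, mul_sub, Prod.fst_zero]
    abel
  · simp only [mul_neg, neg_mul, neg_neg, e, Prod.snd_zero, Prod.fst_zero]
    rw [← neg_eq_iff_eq_neg] at h2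
    rw [← h2, ← mul_neg, ← mul_add, ← mul_add, mul_eq_zero_of_right]
    abel
  · simp only [mul_neg, neg_mul, neg_neg, e, h3, mul_zero, Prod.snd_zero]
    abel

lemma exact_d₂_d₁ : Function.Exact D.d₂ D.d₁ := by
  intro z
  refine ⟨fun hz => ?_, ?_⟩
  · rw [d₁_apply] at hz
    have hτ : z.2.2 * D.τ = (-z.1) * cst D.a + (-z.2.1) * cst D.b := by
      rw [eq_neg_of_add_eq_zero_left (a := z.2.2 * D.τ) (b := z.1 * cst D.a + z.2.1 * cst D.b)
        (by rw [← hz]; abel)]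
      noncomm_ring
    obtain ⟨u, v, huv⟩ := D.exists_of_mul_τ hτ
    obtain ⟨E, hE1, hE2⟩ := skew_koszul_rel D.koszul
      (P := z.1 + u * (row D.n₁ D.c₁).1 + v * (row D.n₂ D.c₂).1)
      (Q := z.2.1 + u * (row D.n₁ D.c₁).2 + v * (row D.n₂ D.c₂).2) (by
        rw [← hz, huv, add_mul _ _ D.τ, mul_assoc u, mul_assoc v, D.map_mul_τ D.map_a D.s_mul_a,
          D.map_mul_τ D.map_b D.s_mul_b]
        noncomm_ring)
    refine ⟨(E, -u, -v), ?_⟩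
    rw [d₂_apply]
    refine Prod.ext ?_ (Prod.ext ?_ ?_)
    · simp only [← hE1]
      noncomm_ring
    · simp only [mul_neg, ← hE2]
      noncomm_ring
    · simp only [huv]
      noncomm_ring
  · rintro ⟨y, rfl⟩
    exact D.d₁_d₂ y

lemma exact_d₃_d₂ : Function.Exact D.d₃ D.d₂ := by
  intro z
  refine ⟨fun hz => ?_, ?_⟩
  · have h3 := congrArg (fun w => w.2.2) hz
    simp only [d₂_apply, mul_zero, zero_add, mul_neg, Prod.snd_zero] at h3
    obtain ⟨e, he1, he2⟩ := skew_koszul_rel D.koszul_map (P := z.2.1) (Q := z.2.2) (by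
      rw [← neg_eq_zero, ← h3]
      abel)
    have hz' : D.d₂ (z - D.d₃ e) = 0 := by rw [map_sub, hz, D.d₂_d₃, sub_zero]
    have h21 : (z - D.d₃ e).2.1 = 0 := by
      change z.2.1 - e * cst (φ D.b) = 0
      rw [he1, sub_self]
    have h22 : (z - D.d₃ e).2.2 = 0 := by
      change z.2.2 - e * -cst (φ D.a) = 0
      rw [he2, mul_neg, sub_self]
    rw [d₂_apply, h21, h22] at hz'
    have h1 := congrArg (fun w => w.1) hz'
    have h2 := congrArg (fun w => w.2.1) hz'
    simp only [zero_mul, add_zero, mul_neg, Prod.fst_zero, Prod.snd_zero, neg_eq_zero] at h1 h2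
    have h0 := skew_koszul_inj D.koszul h2 h1
    refine ⟨e, (sub_eq_zero.1 (Prod.ext h0 (Prod.ext h21 h22))).symm⟩
  · rintro ⟨y, rfl⟩
    exact D.d₂_d₃ y

lemma injective_d₃ : Function.Injective D.d₃ := by
  rw [injective_iff_map_eq_zero]
  intro e he
  rw [d₃_apply] at he
  have h1 := congrArg (fun w => w.2.1) he
  have h2 := congrArg (fun w => w.2.2) he
  simp only [mul_neg, Prod.fst_zero, Prod.snd_zero, neg_eq_zero] at h1 h2
  exact skew_koszul_inj D.koszul_map h2 h1

end TwistData

end Cyclic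

/-! ### Extension of the field of coefficients -/

section BaseChange

variable {k : Type u} [Field k] {k' : Type u} [Field k'] (O : Type u) [CommRing O] (ϖ : O)

@[ext] lemma iwasawa.ext {a b : iwasawa k O ϖ} (h : ∀ n, a.1 n = b.1 n) : a = b :=
  Subtype.ext (funext h)

lemma transition_map (g : k →+ k') (n : ℕ) (x : AddMonoidAlgebra k (O ⧸ lev O ϖ (n + 1))) :
    transition k' O ϖ n (x.map g) = (transition k O ϖ n x).map g := by
  induction x using AddMonoidAlgebra.induction_linear with
  | zero => simp
  | add a b ha hb => simp only [AddMonoidAlgebra.map_add, map_add, ha, hb]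
  | single z c => simp [transition]

lemma phiLev_map (g : k →+ k') (n : ℕ) (x : AddMonoidAlgebra k (O ⧸ lev O ϖ n)) :
    phiLev k' O ϖ n (x.map g) = (phiLev k O ϖ n x).map g := by
  induction x using AddMonoidAlgebra.induction_linear with
  | zero => simp
  | add a b ha hb => simp only [AddMonoidAlgebra.map_add, map_add, ha, hb]
  | single z c => simp [phiLev]

/-- The additive map `k[[U]] → k'[[U]]` induced by an additive map `k → k'` of coefficients. -/
def coefMap (g : k →+ k') : iwasawa k O ϖ →+ iwasawa k' O ϖ where
  toFun a := ⟨fun n => (a.1 n).map g, fun n => by rw [transition_map, a.2 n]⟩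
  map_zero' := iwasawa.ext O ϖ fun _ => AddMonoidAlgebra.map_zero g
  map_add' a b := iwasawa.ext O ϖ fun n => AddMonoidAlgebra.map_add g (a.1 n) (b.1 n)

lemma phi_coefMap (g : k →+ k') (a : iwasawa k O ϖ) :
    phi k' O ϖ (coefMap O ϖ g a) = coefMap O ϖ g (phi k O ϖ a) :=
  iwasawa.ext O ϖ fun n => phiLev_map O ϖ g n (a.1 n)

/-- The ring homomorphism `k[[U]] → k'[[U]]` induced by a homomorphism `k → k'`. -/
def baseChange (g : k →+* k') : iwasawa k O ϖ →+* iwasawa k' O ϖ where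
  __ := coefMap O ϖ (g : k →+ k')
  map_one' := iwasawa.ext O ϖ fun _ => AddMonoidAlgebra.map_one g
  map_mul' a b := iwasawa.ext O ϖ fun n => AddMonoidAlgebra.map_mul g (a.1 n) (b.1 n)

lemma phi_baseChange (g : k →+* k') (a : iwasawa k O ϖ) :
    phi k' O ϖ (baseChange O ϖ g a) = baseChange O ϖ g (phi k O ϖ a) :=
  phi_coefMap O ϖ _ a

lemma aug_baseChange (g : k →+* k') (a : iwasawa k O ϖ) :
    aug k' O ϖ (baseChange O ϖ g a) = g (aug k O ϖ a) := by
  change AddMonoidAlgebra.lift k' k' (O ⧸ lev O ϖ 0) 1 ((a.1 0).map (g : k →+ k')) =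
    g (AddMonoidAlgebra.lift k k (O ⧸ lev O ϖ 0) 1 (a.1 0))
  induction a.1 0 using AddMonoidAlgebra.induction_linear with
  | zero => simp
  | add a b ha hb => simp only [AddMonoidAlgebra.map_add, map_add, ha, hb]
  | single z c => simp

lemma smul_iwasawa_eq (n : ℕ) (a : iwasawa k O ϖ) :
    Multiplicative.ofAdd n • a = (phi k O ϖ)^[n] a := by
  induction n with
  | zero => exact one_smul _ a
  | succ n ih => rw [add_comm n 1, ofAdd_add, mul_smul, ih, ofAdd_one_smul, add_comm 1 n,
      Function.iterate_succ_apply']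

lemma φ_eq_phi (a : iwasawa k O ϖ) : SkewPolynomial.φ a = phi k O ϖ a := by
  rw [SkewPolynomial.φ_def]; exact ofAdd_one_smul k O ϖ a

lemma aug_φ_iterate (n : ℕ) (a : iwasawa k O ϖ) :
    aug k O ϖ (SkewPolynomial.φ^[n] a) = aug k O ϖ a := by
  induction n with
  | zero => rfl
  | succ n ih => rw [Function.iterate_succ_apply', φ_eq_phi, aug_phi, ih]

/-- The additive map between the rings of twisted polynomials induced by an additive map
between the fields of coefficients. -/
def skewCoefMap (g : k →+ k') : Twisted k O ϖ →+ Twisted k' O ϖ :=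
  SkewMonoidAlgebra.liftNC ((SkewPolynomial.C).comp (coefMap O ϖ g))
    fun n => SkewPolynomial.X ^ n.toAdd

lemma skewCoefMap_monomial (g : k →+ k') (n : ℕ) (a : iwasawa k O ϖ) :
    skewCoefMap O ϖ g (SkewPolynomial.monomial n a) =
      SkewPolynomial.monomial n (coefMap O ϖ g a) := by
  exact (SkewMonoidAlgebra.liftNC_single _ _ _ _).trans
    (SkewPolynomial.C_mul_X_pow_eq_monomial (n := n))

/-- The ring homomorphism between the rings of twisted polynomials induced by a homomorphism
`k → k'`. -/
def skewBaseChange (g : k →+* k') : Twisted k O ϖ →+* Twisted k' O ϖ :=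
  SkewMonoidAlgebra.liftNCRingHom (SkewPolynomial.CRingHom.comp (baseChange O ϖ g))
    (powersHom _ SkewPolynomial.X) (by
      intro a y
      obtain ⟨n, rfl⟩ := Multiplicative.ofAdd.surjective y
      change SkewPolynomial.C (baseChange O ϖ g (Multiplicative.ofAdd n • a)) *
        SkewPolynomial.X ^ n = SkewPolynomial.X ^ n * SkewPolynomial.C (baseChange O ϖ g a)
      rw [← SkewPolynomial.monomial_one_right_eq_X_pow, SkewPolynomial.monomial_mul_C, one_mul,
        SkewPolynomial.C_mul_monomial, mul_one, SkewPolynomial.φ_iterate_apply]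
      congr 1
      rw [smul_iwasawa_eq, smul_iwasawa_eq]
      induction n with
      | zero => rfl
      | succ n ih => rw [Function.iterate_succ_apply', Function.iterate_succ_apply', ← ih,
          phi_baseChange])

lemma skewBaseChange_monomial (g : k →+* k') (n : ℕ) (a : iwasawa k O ϖ) :
    skewBaseChange O ϖ g (SkewPolynomial.monomial n a) =
      SkewPolynomial.monomial n (baseChange O ϖ g a) := by
  exact (SkewMonoidAlgebra.liftNC_single _ _ _ _).trans
    (SkewPolynomial.C_mul_X_pow_eq_monomial (n := n))

lemma skewBaseChange_C (g : k →+* k') (a : iwasawa k O ϖ) :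
    skewBaseChange O ϖ g (SkewPolynomial.C a) = SkewPolynomial.C (baseChange O ϖ g a) :=
  skewBaseChange_monomial O ϖ g 0 a

/-- The augmentation `k[[U]][X]_φ → k[X]`. -/
def skewAug (k : Type u) [Field k] : Twisted k O ϖ →+* k[X] :=
  SkewMonoidAlgebra.liftNCRingHom ((Polynomial.C).comp (aug k O ϖ).toRingHom)
    (powersHom _ Polynomial.X) (by
      intro a y
      obtain ⟨n, rfl⟩ := Multiplicative.ofAdd.surjective y
      change Polynomial.C (aug k O ϖ (Multiplicative.ofAdd n • a)) * Polynomial.X ^ n =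
        Polynomial.X ^ n * Polynomial.C (aug k O ϖ a)
      rw [mul_comm, ← SkewPolynomial.φ_iterate_apply, aug_φ_iterate])

lemma skewAug_monomial (n : ℕ) (a : iwasawa k O ϖ) :
    skewAug O ϖ k (SkewPolynomial.monomial n a) = Polynomial.C (aug k O ϖ a) * Polynomial.X ^ n :=
  SkewMonoidAlgebra.liftNC_single _ _ _ _

lemma skewAug_C (a : iwasawa k O ϖ) :
    skewAug O ϖ k (SkewPolynomial.C a) = Polynomial.C (aug k O ϖ a) :=
  (skewAug_monomial O ϖ 0 a).trans (by rw [pow_zero, mul_one])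

lemma skewAug_skewBaseChange (g : k →+* k') (P : Twisted k O ϖ) :
    skewAug O ϖ k' (skewBaseChange O ϖ g P) = (skewAug O ϖ k P).map g := by
  induction P using skew_induction with
  | h0 => simp
  | hadd P Q hP hQ => simp only [map_add, hP, hQ, Polynomial.map_add]
  | hm n a =>
    rw [skewBaseChange_monomial, skewAug_monomial, skewAug_monomial, aug_baseChange]
    simp

variable [Algebra k k']

lemma coefMap_baseChange_mul (l : k' →ₗ[k] k) (a : iwasawa k O ϖ) (x : iwasawa k' O ϖ) :
    coefMap O ϖ (l : k' →+ k) (baseChange O ϖ (algebraMap k k') a * x) =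
      a * coefMap O ϖ (l : k' →+ k) x := by
  refine iwasawa.ext O ϖ fun n => ?_
  change ((a.1 n).map (algebraMap k k' : k →+ k') * x.1 n).map (l : k' →+ k) =
    a.1 n * (x.1 n).map (l : k' →+ k)
  induction a.1 n using AddMonoidAlgebra.induction_linear with
  | zero => simp
  | add a b ha hb => simp only [AddMonoidAlgebra.map_add, add_mul, ha, hb]
  | single z c =>
    induction x.1 n using AddMonoidAlgebra.induction_linear with
    | zero => simp
    | add a b ha hb => simp only [AddMonoidAlgebra.map_add, mul_add, ha, hb]
    | single z' c' =>
      simp [AddMonoidAlgebra.single_mul_single, ← Algebra.smul_def]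

lemma sum_baseChange_coefMap {ι : Type*} [Fintype ι] (b : Module.Basis ι k k')
    (x : iwasawa k' O ϖ) :
    ∑ i, baseChange O ϖ (algebraMap k k') (coefMap O ϖ (b.coord i : k' →+ k) x) *
      algebraMap k' _ (b i) = x := by
  refine iwasawa.ext O ϖ fun n => ?_
  have h1 : ∀ (s : Finset ι) (f : ι → iwasawa k' O ϖ), (∑ i ∈ s, f i).1 n = ∑ i ∈ s, (f i).1 n := by
    intro s f
    exact map_sum ((Pi.evalRingHom _ n).comp (iwasawaSub k' O ϖ).val.toRingHom) f s
  rw [h1]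
  change ∑ i, ((x.1 n).map (b.coord i : k' →+ k)).map (algebraMap k k' : k →+ k') *
    algebraMap k' _ (b i) = x.1 n
  induction x.1 n using AddMonoidAlgebra.induction_linear with
  | zero => simp
  | add a b ha hb =>
    simp only [AddMonoidAlgebra.map_add, add_mul, Finset.sum_add_distrib, ha, hb]
  | single z c =>
    simp only [AddMonoidAlgebra.map_single, AddMonoidAlgebra.coe_algebraMap, Function.comp,
      AddMonoidAlgebra.single_mul_single, add_zero, Algebra.algebraMap_self, RingHom.id_apply]
    conv_rhs => rw [← b.sum_repr c]
    refine Eq.trans ?_ (map_sum (AddMonoidAlgebra.singleAddHom z) _ _).symm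
    exact Finset.sum_congr rfl fun i _ => congrArg _ (Algebra.smul_def _ _).symm

lemma skewCoefMap_skewBaseChange_mul (l : k' →ₗ[k] k) (P : Twisted k O ϖ) (Q : Twisted k' O ϖ) :
    skewCoefMap O ϖ (l : k' →+ k) (skewBaseChange O ϖ (algebraMap k k') P * Q) =
      P * skewCoefMap O ϖ (l : k' →+ k) Q := by
  induction P using skew_induction with
  | h0 => simp
  | hadd P Q hP hQ => simp only [map_add, add_mul, hP, hQ]
  | hm n a =>
    induction Q using skew_induction with
    | h0 => simp
    | hadd P Q hP hQ => simp only [map_add, mul_add, hP, hQ]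
    | hm m x =>
      rw [skewBaseChange_monomial, SkewPolynomial.monomial_mul_monomial, skewCoefMap_monomial,
        skewCoefMap_monomial, SkewPolynomial.monomial_mul_monomial, coefMap_baseChange_mul]
      congr 2
      induction n with
      | zero => rfl
      | succ n ih => rw [Function.iterate_succ_apply', Function.iterate_succ_apply', ← ih,
          φ_eq_phi, φ_eq_phi, phi_coefMap]

lemma sum_skewBaseChange_skewCoefMap {ι : Type*} [Fintype ι] (b : Module.Basis ι k k')
    (P : Twisted k' O ϖ) :
    ∑ i, skewBaseChange O ϖ (algebraMap k k') (skewCoefMap O ϖ (b.coord i : k' →+ k) P) *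
      SkewPolynomial.C (algebraMap k' _ (b i)) = P := by
  induction P using skew_induction with
  | h0 => simp
  | hadd P Q hP hQ => simp only [map_add, add_mul, Finset.sum_add_distrib, hP, hQ]
  | hm n a =>
    conv_rhs => rw [← sum_baseChange_coefMap O ϖ b a, map_sum]
    refine Finset.sum_congr rfl fun i _ => ?_
    rw [skewCoefMap_monomial, skewBaseChange_monomial, SkewPolynomial.monomial_mul_C]
    congr 2
    induction n with
    | zero => rfl
    | succ n ih => rw [Function.iterate_succ_apply', ih, φ_eq_phi, AlgHom.commutes]

/-- A `k'[[U]][X]_φ`-module, seen as a `k[[U]][X]_φ`-module. -/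
abbrev skewRes (k k' : Type u) [Field k] [Field k'] [Algebra k k'] :
    Module (Twisted k O ϖ) (Twisted k' O ϖ) :=
  Module.compHom _ (skewBaseChange O ϖ (algebraMap k k'))

attribute [local instance] skewRes

lemma skewRes_smul (P : Twisted k O ϖ) (Q : Twisted k' O ϖ) :
    P • Q = skewBaseChange O ϖ (algebraMap k k') P * Q := rfl

lemma projective_skewRes [FiniteDimensional k k'] :
    Module.Projective (Twisted k O ϖ) (Twisted k' O ϖ) := by
  let b := Module.finBasis k k'
  let i : Twisted k' O ϖ →ₗ[Twisted k O ϖ] (Fin (Module.finrank k k') → Twisted k O ϖ) :=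
    { toFun := fun Q j => skewCoefMap O ϖ (b.coord j : k' →+ k) Q
      map_add' := fun Q Q' => funext fun j => map_add _ Q Q'
      map_smul' := fun P Q => funext fun j => skewCoefMap_skewBaseChange_mul O ϖ _ P Q }
  let s : (Fin (Module.finrank k k') → Twisted k O ϖ) →ₗ[Twisted k O ϖ] Twisted k' O ϖ :=
    { toFun := fun v => ∑ j, skewBaseChange O ϖ (algebraMap k k') (v j) *
        SkewPolynomial.C (algebraMap k' _ (b j))
      map_add' := fun v w => by
        simp only [Pi.add_apply, map_add, add_mul, Finset.sum_add_distrib]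
      map_smul' := fun P v => by
        simp only [Pi.smul_apply, smul_eq_mul, map_mul, skewRes_smul, Finset.mul_sum, mul_assoc,
          RingHom.id_apply] }
  exact Module.Projective.of_split i s
    (LinearMap.ext fun Q => sum_skewBaseChange_skewCoefMap O ϖ b Q)

end BaseChange

/-! ### Torsion-free classes in `Tor` -/

section TorClass

variable {k : Type u} [Field k] {k' : Type u} [Field k'] [Algebra k k']
  {O : Type u} [CommRing O] {ϖ : O}

attribute [local instance] resModule skewRes

/-- A semilinear map along the augmentation `k[[U]][X]_φ → k[X]` factors through the
coinvariants. -/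
lemma exists_coinv_lift {N : Type u} [AddCommGroup N] [Module (Twisted k O ϖ) N]
    {Q : Type u} [AddCommGroup Q] [Module k[X] Q] (g : N →+ Q)
    (hg : ∀ (P : Twisted k O ϖ) n, g (P • n) = skewAug O ϖ k P • g n) :
    ∃ l : Module.AEval' (tensorPhi k O ϖ N) →ₗ[k[X]] Q,
      ∀ c n, l (Module.AEval'.of _ (c ⊗ₜ n)) = (Polynomial.C c : k[X]) • g n := by
  let : Module k Q := Module.compHom Q (Polynomial.C : k →+* k[X])
  have hsm (c : k) (q : Q) : c • q = (Polynomial.C c : k[X]) • q := rfl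
  have : IsScalarTower k k[X] Q := ⟨fun c P q => by
    rw [hsm, Polynomial.smul_eq_C_mul, mul_smul]⟩
  let l₀ : k ⊗[iwasawa k O ϖ] N →+ Q := TensorProduct.liftAddHom
    { toFun := fun c =>
        { toFun := fun n => (Polynomial.C c : k[X]) • g n
          map_zero' := by simp
          map_add' := fun x y => by simp }
      map_zero' := by ext; simp
      map_add' := fun c d => by ext; simp [add_smul] }
    (fun a c n => by
      change (Polynomial.C (aug k O ϖ a * c) : k[X]) • g n =
        (Polynomial.C c : k[X]) • g (SkewPolynomial.CRingHom a • n)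
      rw [hg, SkewPolynomial.CRingHom_eq_C, skewAug_C, ← mul_smul, ← Polynomial.C_mul, mul_comm])
  have hl₀ (c n) : l₀ (c ⊗ₜ n) = (Polynomial.C c : k[X]) • g n := rfl
  let l₁ : k ⊗[iwasawa k O ϖ] N →ₗ[k] Q :=
    { toFun := l₀
      map_add' := map_add l₀
      map_smul' := fun c x => by
        induction x with
        | zero => simp only [smul_zero, map_zero]
        | add x y hx hy => simp only [smul_add, map_add, hx, hy]
        | tmul d n =>
          rw [TensorProduct.smul_tmul', hl₀, hl₀, hsm, RingHom.id_apply, ← mul_smul,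
            ← Polynomial.C_mul, smul_eq_mul] }
  refine ⟨LinearMap.ofAEval _ l₁ fun x => ?_, fun c n => hl₀ c n⟩
  induction x with
  | zero => simp only [smul_zero, map_zero]
  | add x y hx hy => simp only [smul_add, map_add, hx, hy]
  | tmul c n =>
    change (Polynomial.C c : k[X]) • g ((SkewPolynomial.X : Twisted k O ϖ) • n) =
      (Polynomial.X : k[X]) • (Polynomial.C c : k[X]) • g n
    rw [hg, SkewPolynomial.X, skewAug_monomial, ← mul_smul, ← mul_smul]
    rw [map_one, Polynomial.C_1, one_mul, pow_one, mul_comm]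

lemma one_tmul_C_smul_eq_zero {N : Type u} [AddCommGroup N] [Module (Twisted k O ϖ) N]
    {a : iwasawa k O ϖ} (ha : aug k O ϖ a = 0) (n : N) :
    (1 : k) ⊗ₜ[iwasawa k O ϖ] ((SkewPolynomial.C a : Twisted k O ϖ) • n) = 0 := by
  have : (SkewPolynomial.C a : Twisted k O ϖ) • n = a • n := rfl
  rw [this, ← TensorProduct.smul_tmul, residue_smul, ha, zero_mul, TensorProduct.zero_tmul]

/-- If the augmentation ideal of `k'[[U]]` is generated by that of `k[[U]]`, then it kills
`k ⊗ N` for every `k'[[U]][X]_φ`-module `N`. -/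
lemma one_tmul_eq_zero_of_aug_eq_zero
    {N : Type u} [AddCommGroup N] [Module (Twisted k' O ϖ) N] [Module (Twisted k O ϖ) N]
    [IsScalarTower (Twisted k O ϖ) (Twisted k' O ϖ) N]
    (hm : ∀ a : iwasawa k' O ϖ, aug k' O ϖ a = 0 → ∃ (x y : iwasawa k O ϖ) (u v : iwasawa k' O ϖ),
      aug k O ϖ x = 0 ∧ aug k O ϖ y = 0 ∧
        a = baseChange O ϖ (algebraMap k k') x * u + baseChange O ϖ (algebraMap k k') y * v)
    {a : iwasawa k' O ϖ} (ha : aug k' O ϖ a = 0) (n : N) :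
    (1 : k) ⊗ₜ[iwasawa k O ϖ] ((SkewPolynomial.C a : Twisted k' O ϖ) • n) = 0 := by
  obtain ⟨x, y, u, v, hx, hy, rfl⟩ := hm a ha
  have key (x u) : (SkewPolynomial.C (baseChange O ϖ (algebraMap k k') x * u) :
      Twisted k' O ϖ) • n = (SkewPolynomial.C x : Twisted k O ϖ) •
        ((SkewPolynomial.C u : Twisted k' O ϖ) • n) := by
    rw [← smul_assoc, skewRes_smul, skewBaseChange_C, ← SkewPolynomial.C_mul]
  rw [map_add, add_smul, TensorProduct.tmul_add, key, key, one_tmul_C_smul_eq_zero hx,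
    one_tmul_C_smul_eq_zero hy, add_zero]

/-- If `M` is the quotient of `k'[[U]][X]_φ` by the left ideal generated by `a`, `b`, `τ`, where the
coefficients that express `φ(a)` and `s a` vanish under the augmentation, then the second basis
vector in degree two of the resolution of `M` gives a torsion-free class in `Tor`. -/
theorem tor_two_of_twistData [FiniteDimensional k k'] (D : TwistData (iwasawa k' O ϖ))
    (hm : ∀ a : iwasawa k' O ϖ, aug k' O ϖ a = 0 → ∃ (x y : iwasawa k O ϖ) (u v : iwasawa k' O ϖ),
      aug k O ϖ x = 0 ∧ aug k O ϖ y = 0 ∧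
        a = baseChange O ϖ (algebraMap k k') x * u + baseChange O ϖ (algebraMap k k') y * v)
    (ha : aug k' O ϖ D.a = 0) (hb : aug k' O ϖ D.b = 0)
    (hn₁ : aug k' O ϖ D.n₁.1 = 0) (hn₂ : aug k' O ϖ D.n₁.2 = 0)
    (hc₁ : aug k' O ϖ D.c₁.1 = 0) (hc₂ : aug k' O ϖ D.c₁.2 = 0)
    {M : Type u} [AddCommGroup M] [Module (Twisted k O ϖ) M] (ε : Twisted k' O ϖ →+ M)
    (hε : ∀ P Q, ε (skewBaseChange O ϖ (algebraMap k k') P * Q) = P • ε Q)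
    (hsurj : Function.Surjective ε)
    (hker : ∀ Q, ε Q = 0 ↔ ∃ u v w, Q = u * SkewPolynomial.C D.a + v * SkewPolynomial.C D.b +
      w * D.τ) :
    ¬ Module.IsTorsion k[X] (tor k O ϖ M 2) ∧
      ¬ Module.Finite k ((ModuleCat.restrictScalars (Polynomial.C : k →+* k[X])).obj
        (tor k O ϖ M 2)) := by
  let S := Twisted k O ϖ
  let S' := Twisted k' O ϖ
  have : IsScalarTower S S' S' := ⟨fun P Q R => by
    rw [skewRes_smul, smul_eq_mul, smul_eq_mul, skewRes_smul, mul_assoc]⟩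
  have : Module.Projective S S' := projective_skewRes O ϖ
  let ε' : S' →ₗ[S] M := { ε with map_smul' := hε }
  let d₁ : ModuleCat.of S (S' × S' × S') ⟶ ModuleCat.of S S' :=
    ModuleCat.ofHom (D.d₁.restrictScalars S)
  let d₂ : ModuleCat.of S (S' × S' × S') ⟶ ModuleCat.of S (S' × S' × S') :=
    ModuleCat.ofHom (D.d₂.restrictScalars S)
  let d₃ : ModuleCat.of S S' ⟶ ModuleCat.of S (S' × S' × S') :=
    ModuleCat.ofHom (D.d₃.restrictScalars S)
  let : Module k[X] k'[X] := Module.compHom k'[X] (Polynomial.mapRingHom (algebraMap k k'))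
  let g : (S' × S' × S') →+ k'[X] :=
    { toFun := fun z => skewAug O ϖ k' z.2.1
      map_zero' := map_zero _
      map_add' := fun z w => map_add _ _ _ }
  obtain ⟨l, hl⟩ := exists_coinv_lift (k := k) (O := O) (ϖ := ϖ) g (fun P z => by
    change skewAug O ϖ k' (skewBaseChange O ϖ (algebraMap k k') P * z.2.1) =
      (skewAug O ϖ k P).map (algebraMap k k') * skewAug O ϖ k' z.2.1
    rw [map_mul, skewAug_skewBaseChange])
  have hφ (x : iwasawa k' O ϖ) : aug k' O ϖ (SkewPolynomial.φ x) = aug k' O ϖ x :=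
    aug_φ_iterate O ϖ 1 x
  have key (a) (ha : aug k' O ϖ a = 0) (w : S' × S' × S') := one_tmul_eq_zero_of_aug_eq_zero hm ha w
  obtain ⟨h, l', hl'⟩ := exists_leftDerived_two (d₁ := d₁) (d₂ := d₂) (d₃ := d₃)
    (coinv k O ϖ)
    (ModuleCat.ofHom ε') ((IsProjective.iff_projective _).1 ‹_›)
    ((IsProjective.iff_projective _).1 inferInstance)
    ((IsProjective.iff_projective _).1 inferInstance)
    ((IsProjective.iff_projective _).1 ‹_›)
    hsurj
    (fun Q => (hker Q).trans ⟨fun ⟨u, v, w, h⟩ => ⟨(u, v, w), by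
        rw [h, add_assoc]; rfl⟩, fun ⟨z, h⟩ => ⟨z.1, z.2.1, z.2.2, by
        rw [← h, add_assoc]; rfl⟩⟩)
    D.exact_d₂_d₁ D.exact_d₃_d₂ D.injective_d₃ (Q := ModuleCat.of k[X] k'[X])
    (ModuleCat.ofHom l)
    (ModuleCat.hom_ext <| coinv_hom_ext k O ϖ fun c z => by
      refine (hl c (D.d₃ z)).trans ?_
      have : g (D.d₃ z) = 0 := by
        change skewAug O ϖ k' (D.d₃ z).2.1 = 0
        rw [D.d₃_apply, map_mul, skewAug_C, hφ, hb, Polynomial.C_0, mul_zero]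
      rw [this, smul_zero]
      rfl)
    (Module.AEval'.of (tensorPhi k O ϖ (S' × S' × S'))
      ((1 : k) ⊗ₜ[iwasawa k O ϖ] ((0, 1, 0) : S' × S' × S')))
    (by
      change Module.AEval'.of (tensorPhi k O ϖ (S' × S' × S'))
        ((1 : k) ⊗ₜ[iwasawa k O ϖ] D.d₂ (0, 1, 0)) = 0
      have h0 : D.d₂ (0, 1, 0) =
          (SkewPolynomial.C D.n₁.1 : S') • ((1, 0, 0) : S' × S' × S') +
          ((SkewPolynomial.C (SkewPolynomial.φ D.c₁.1) : S') •
            ((SkewPolynomial.monomial 2 1, 0, 0) : S' × S' × S') +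
          ((SkewPolynomial.C D.n₁.2 : S') • ((0, 1, 0) : S' × S' × S') +
          ((SkewPolynomial.C (SkewPolynomial.φ D.c₁.2) : S') •
            ((0, SkewPolynomial.monomial 2 1, 0) : S' × S' × S') +
          (SkewPolynomial.C (SkewPolynomial.φ D.a) : S') • ((0, 0, -1) : S' × S' × S')))) := by
        rw [D.d₂_apply]
        simp [TwistData.row, SkewPolynomial.C_mul_monomial]
      have h1 : (1 : k) ⊗ₜ[iwasawa k O ϖ] D.d₂ (0, 1, 0) = 0 := by
        rw [h0]
        simp only [TensorProduct.tmul_add]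
        rw [key _ hn₁, key _ (by rw [hφ, hc₁]), key _ hn₂, key _ (by rw [hφ, hc₂]),
          key _ (by rw [hφ, ha])]
        simp only [add_zero]
      rw [h1]
      exact LinearEquiv.map_zero _)
  have hl1 : l' h = (1 : k'[X]) := by
    rw [hl']
    refine (hl 1 _).trans ?_
    rw [Polynomial.C_1, one_smul]
    exact map_one (skewAug O ϖ k')
  -- the linear form `l'` maps the class `h` to `1`, hence `q h` to `q`
  have hinj : ∀ q : k[X], q • h = 0 → q = 0 := by
    intro q hq
    have h1 := congrArg l' hq
    rw [map_smul, hl1, map_zero] at h1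
    have h2 : q.map (algebraMap k k') * 1 = 0 := h1
    rw [mul_one] at h2
    exact (Polynomial.map_eq_zero _).1 h2
  refine ⟨fun ht => ?_, fun hfin => ?_⟩
  · obtain ⟨q, hq⟩ := ht (x := h)
    exact nonZeroDivisors.ne_zero q.2 (hinj q hq)
  · let N := (ModuleCat.restrictScalars (Polynomial.C : k →+* k[X])).obj (tor k O ϖ M 2)
    let j : k[X] →ₗ[k] N :=
      { toFun := fun q => (q • h : tor k O ϖ M 2)
        map_add' := fun q r => add_smul q r h
        map_smul' := fun c q => by
          rw [Polynomial.smul_eq_C_mul, mul_smul]; rfl }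
    have hj : Function.Injective j := (injective_iff_map_eq_zero j).2 hinj
    have : Module.Finite k N := hfin
    have : Module.Finite k k[X] := Module.Finite.of_injective j hj
    exact Polynomial.not_finite this

end TorClass

/-! ### Evaluation of power series at nilpotent elements -/

section EvalNil

open PowerSeries

variable {R S T : Type*} [CommRing R] [CommRing S] [CommRing T]

lemma eval₂_trunc_coe (f : R →+* S) {x : S} {N : ℕ} (h : x ^ N = 0) (P : R[X]) :
    (trunc N (P : R⟦X⟧)).eval₂ f x = P.eval₂ f x := by
  have h1 : (Polynomial.X ^ N : R[X]) ∣ P - trunc N (P : R⟦X⟧) := by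
    rw [Polynomial.X_pow_dvd_iff]
    intro d hd
    rw [Polynomial.coeff_sub, coeff_trunc, if_pos hd, Polynomial.coeff_coe, sub_self]
  obtain ⟨Q, hQ⟩ := h1
  have h2 := congrArg (Polynomial.eval₂ f x) hQ
  rw [Polynomial.eval₂_sub, Polynomial.eval₂_mul, Polynomial.eval₂_X_pow, h, zero_mul,
    sub_eq_zero] at h2
  exact h2.symm

/-- The evaluation of power series at an element `x` with `x ^ N = 0`. -/
def evalNil (f : R →+* S) (x : S) (N : ℕ) (h : x ^ N = 0) : R⟦X⟧ →+* S where
  toFun P := (trunc N P).eval₂ f x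
  map_zero' := by simp
  map_one' := by rw [← Polynomial.coe_one, eval₂_trunc_coe f h, Polynomial.eval₂_one]
  map_add' P Q := by rw [map_add, Polynomial.eval₂_add]
  map_mul' P Q := by
    rw [← trunc_trunc_mul_trunc, ← Polynomial.coe_mul, eval₂_trunc_coe f h, Polynomial.eval₂_mul]

lemma evalNil_coe (f : R →+* S) {x : S} {N : ℕ} (h : x ^ N = 0) (P : R[X]) :
    evalNil f x N h P = P.eval₂ f x :=
  eval₂_trunc_coe f h P

lemma evalNil_C (f : R →+* S) {x : S} {N : ℕ} (h : x ^ N = 0) (r : R) :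
    evalNil f x N h (PowerSeries.C r) = f r := by
  rw [← Polynomial.coe_C, evalNil_coe, Polynomial.eval₂_C]

lemma evalNil_X (f : R →+* S) {x : S} {N : ℕ} (h : x ^ N = 0) :
    evalNil f x N h PowerSeries.X = x := by
  rw [← Polynomial.coe_X, evalNil_coe, Polynomial.eval₂_X]

lemma evalNil_eq_sum (f : R →+* S) {x : S} {N : ℕ} (h : x ^ N = 0) (P : R⟦X⟧) :
    evalNil f x N h P = ∑ i ∈ Finset.range N, f (coeff i P) * x ^ i :=
  eval₂_trunc_eq_sum_range ..

lemma evalNil_sum_of_le (f : R →+* S) {x : S} {N M : ℕ} (h : x ^ N = 0) (hM : N ≤ M) (P : R⟦X⟧) :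
    evalNil f x N h P = ∑ i ∈ Finset.range M, f (coeff i P) * x ^ i := by
  rw [evalNil_eq_sum]
  refine Finset.sum_subset (Finset.range_mono hM) fun i _ hi => ?_
  rw [pow_eq_zero_of_le (by simpa using hi) h, mul_zero]

lemma map_evalNil (f : R →+* S) (g : R →+* T) (t : S →+* T) (hfg : ∀ r, t (f r) = g r)
    {x : S} {y : T} {N M : ℕ} (h : x ^ N = 0) (h' : y ^ M = 0) (hM : M ≤ N) (hxy : t x = y)
    (P : R⟦X⟧) : t (evalNil f x N h P) = evalNil g y M h' P := by
  rw [evalNil_eq_sum, evalNil_sum_of_le g h' hM, map_sum]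
  exact Finset.sum_congr rfl fun i _ => by rw [map_mul, map_pow, hfg, hxy]

end EvalNil

/-! ### The completed group algebra as a ring of power series -/

section PowerSeriesIso

/-- The elements `e₁` and `e₂` behave as a `ℤ_p`-basis of `O`, and `p` and `ϖ ^ e` generate the
same ideal. The ring `O` need not be a `ℤ_p`-algebra: the quotients by the powers of `p` are
generated by `e₁` and `e₂` as abelian groups, and have the order of a free `ℤ / p ^ r`-module of
rank two. -/
structure IsPadicBasis (p : ℕ) {O : Type u} [CommRing O] (ϖ : O) (e : ℕ) (e₁ e₂ : O) : Prop where
  pos : 0 < e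
  lev_eq : ∀ r, lev O ϖ (e * r) = Ideal.span {(p : O) ^ r}
  span : ∀ r z, ∃ i j : ℕ, (p : O) ^ r ∣ z - (i * e₁ + j * e₂)
  card : ∀ r, Nat.card (O ⧸ Ideal.span {(p : O) ^ r}) = (p ^ r) ^ 2

variable {p : ℕ} [Fact p.Prime] (k : Type u) [Field k] [CharP k p] {O : Type u} [CommRing O]
  (ϖ : O)

/-- The element of `k[[U]]` that corresponds to the unipotent matrix with entry `z`. -/
def dirac (z : O) : iwasawa k O ϖ :=
  ⟨fun n => AddMonoidAlgebra.single (Ideal.Quotient.mk (lev O ϖ n) z) 1, fun n => by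
    simp [transition]⟩

lemma dirac_val (z : O) (n : ℕ) :
    (dirac k ϖ z).1 n = AddMonoidAlgebra.single (Ideal.Quotient.mk (lev O ϖ n) z) 1 := rfl

lemma iwasawa_mul_val (a b : iwasawa k O ϖ) (n : ℕ) : (a * b).1 n = a.1 n * b.1 n := rfl
lemma iwasawa_sub_val (a b : iwasawa k O ϖ) (n : ℕ) : (a - b).1 n = a.1 n - b.1 n := rfl
lemma iwasawa_one_val (n : ℕ) : (1 : iwasawa k O ϖ).1 n = 1 := rfl
lemma iwasawa_pow_val (a : iwasawa k O ϖ) (m n : ℕ) : (a ^ m).1 n = a.1 n ^ m := rfl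
lemma iwasawa_algebraMap_val (c : k) (n : ℕ) :
    (algebraMap k (iwasawa k O ϖ) c).1 n = algebraMap k _ c := rfl

/-- The projection of `k[[U]]` to the group algebra of level `n`. -/
def evalLev (n : ℕ) : iwasawa k O ϖ →+* AddMonoidAlgebra k (O ⧸ lev O ϖ n) :=
  (Pi.evalRingHom _ n).comp (iwasawaSub k O ϖ).val.toRingHom

lemma dirac_add (z w : O) : dirac k ϖ (z + w) = dirac k ϖ z * dirac k ϖ w :=
  iwasawa.ext O ϖ fun n => by
    rw [iwasawa_mul_val, dirac_val, dirac_val, dirac_val, AddMonoidAlgebra.single_mul_single,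
      map_add, mul_one]

lemma dirac_zero : dirac k ϖ (0 : O) = 1 :=
  iwasawa.ext O ϖ fun n => by rw [dirac_val, map_zero]; rfl

lemma dirac_natCast_mul (n : ℕ) (z : O) : dirac k ϖ (n * z) = dirac k ϖ z ^ n := by
  induction n with
  | zero => rw [Nat.cast_zero, zero_mul, dirac_zero, pow_zero]
  | succ n ih => rw [Nat.cast_succ, add_mul, one_mul, dirac_add, ih, pow_succ]

lemma aug_dirac (z : O) : aug k O ϖ (dirac k ϖ z) = 1 := by
  change AddMonoidAlgebra.lift k k (O ⧸ lev O ϖ 0) 1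
    (AddMonoidAlgebra.single (Ideal.Quotient.mk (lev O ϖ 0) z) 1) = 1
  simp

lemma phi_dirac (z : O) : phi k O ϖ (dirac k ϖ z) = dirac k ϖ (ϖ * z) :=
  iwasawa.ext O ϖ fun n => by
    change phiLev k O ϖ n (AddMonoidAlgebra.single (Ideal.Quotient.mk (lev O ϖ n) z) 1) = _
    simp [phiLev, dirac_val]

instance charP_iwasawa : CharP (iwasawa k O ϖ) p :=
  charP_of_injective_ringHom (f := algebraMap k (iwasawa k O ϖ)) (fun c d h => by
    have := congrArg (aug k O ϖ) h
    simpa using this) p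

lemma dirac_sub_one_pow (z : O) (r : ℕ) :
    (dirac k ϖ z - 1) ^ p ^ r = dirac k ϖ ((p : O) ^ r * z) - 1 := by
  have := charP_iwasawa (p := p) k ϖ
  rw [sub_pow_char_pow, one_pow, ← Nat.cast_pow, dirac_natCast_mul]

variable {k ϖ}
variable {e : ℕ} {e₁ e₂ : O} (hb : IsPadicBasis p ϖ e e₁ e₂)
include hb

omit [Fact p.Prime] in
lemma IsPadicBasis.pow_mem_lev (n : ℕ) (z : O) : (p : O) ^ n * z ∈ lev O ϖ n := by
  have h1 : lev O ϖ (e * n) ≤ lev O ϖ n := Ideal.span_singleton_le_span_singleton.2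
    (pow_dvd_pow _ (Nat.le_mul_of_pos_left n hb.pos))
  refine Ideal.mul_mem_right _ _ (h1 ?_)
  rw [hb.lev_eq]
  exact Ideal.mem_span_singleton_self _

variable (k) in
lemma IsPadicBasis.dirac_sub_one_val_pow (z : O) (n : ℕ) :
    (dirac k ϖ z - 1).1 n ^ p ^ n = 0 := by
  rw [← iwasawa_pow_val, dirac_sub_one_pow, iwasawa_sub_val, dirac_val,
    Ideal.Quotient.eq_zero_iff_mem.2 (hb.pow_mem_lev n z), iwasawa_one_val,
    ← AddMonoidAlgebra.one_def, sub_self]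

variable (k) in
/-- The map `k⟦X⟧⟦Y⟧ → k[U / U_n]` with `X ↦ [e₁] - 1` and `Y ↦ [e₂] - 1`. -/
def seriesLev (n : ℕ) :
    PowerSeries (PowerSeries k) →+* AddMonoidAlgebra k (O ⧸ lev O ϖ n) :=
  evalNil (evalNil (algebraMap k _) ((dirac k ϖ e₁ - 1).1 n) (p ^ n)
    (hb.dirac_sub_one_val_pow k e₁ n)) ((dirac k ϖ e₂ - 1).1 n) (p ^ n)
    (hb.dirac_sub_one_val_pow k e₂ n)

lemma transition_seriesLev (n : ℕ) (f : PowerSeries (PowerSeries k)) :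
    transition k O ϖ n (seriesLev k hb (n + 1) f) = seriesLev k hb n f := by
  have hp : p ^ n ≤ p ^ (n + 1) := Nat.pow_le_pow_right (Fact.out : p.Prime).pos n.le_succ
  refine map_evalNil (t := (transition k O ϖ n).toRingHom) (hfg := fun r => ?_) (hM := hp)
    (hxy := (dirac k ϖ e₂ - 1).2 n) ..
  exact map_evalNil (t := (transition k O ϖ n).toRingHom)
    (hfg := fun c => (transition k O ϖ n).commutes c) (hM := hp)
    (hxy := (dirac k ϖ e₁ - 1).2 n) ..

variable (k) in
/-- The map `k⟦X⟧⟦Y⟧ → k[[U]]` with `X ↦ [e₁] - 1` and `Y ↦ [e₂] - 1`. -/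
def seriesMap : PowerSeries (PowerSeries k) →+* iwasawa k O ϖ where
  toFun f := ⟨fun n => seriesLev k hb n f, fun n => transition_seriesLev hb n f⟩
  map_zero' := iwasawa.ext O ϖ fun n => map_zero (seriesLev k hb n)
  map_one' := iwasawa.ext O ϖ fun n => map_one (seriesLev k hb n)
  map_add' f g := iwasawa.ext O ϖ fun n => map_add (seriesLev k hb n) f g
  map_mul' f g := iwasawa.ext O ϖ fun n => map_mul (seriesLev k hb n) f g

lemma seriesMap_val (f : PowerSeries (PowerSeries k)) (n : ℕ) :
    (seriesMap k hb f).1 n = seriesLev k hb n f := rfl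

lemma seriesMap_X : seriesMap k hb (PowerSeries.C PowerSeries.X) = dirac k ϖ e₁ - 1 :=
  iwasawa.ext O ϖ fun n => by rw [seriesMap_val, seriesLev, evalNil_C, evalNil_X]

lemma seriesMap_Y : seriesMap k hb PowerSeries.X = dirac k ϖ e₂ - 1 :=
  iwasawa.ext O ϖ fun n => by rw [seriesMap_val, seriesLev, evalNil_X]

lemma seriesMap_C (c : k) :
    seriesMap k hb (PowerSeries.C (PowerSeries.C c)) = algebraMap k _ c :=
  iwasawa.ext O ϖ fun n => by
    rw [seriesMap_val, seriesLev, evalNil_C, evalNil_C]; rfl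

lemma pow_val_eq_zero (z : O) (r : ℕ) : (dirac k ϖ z - 1).1 (e * r) ^ p ^ r = 0 := by
  rw [← iwasawa_pow_val, dirac_sub_one_pow, iwasawa_sub_val, dirac_val,
    Ideal.Quotient.eq_zero_iff_mem.2 (by
      rw [hb.lev_eq]; exact Ideal.mul_mem_right _ _ (Ideal.mem_span_singleton_self _)),
    iwasawa_one_val, ← AddMonoidAlgebra.one_def, sub_self]

lemma seriesLev_eq_sum (r : ℕ) (f : PowerSeries (PowerSeries k)) :
    seriesLev k hb (e * r) f = ∑ q : Fin (p ^ r) × Fin (p ^ r),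
      PowerSeries.coeff q.1 (PowerSeries.coeff q.2 f) •
        ((dirac k ϖ e₁ - 1).1 (e * r) ^ (q.1 : ℕ) * (dirac k ϖ e₂ - 1).1 (e * r) ^ (q.2 : ℕ)) := by
  have hp : p ^ r ≤ p ^ (e * r) := Nat.pow_le_pow_right (Fact.out : p.Prime).pos
    (Nat.le_mul_of_pos_left r hb.pos)
  let L := AddMonoidAlgebra k (O ⧸ lev O ϖ (e * r))
  have h1 := fun c => map_evalNil (algebraMap k L) (algebraMap k L) (RingHom.id L) (fun r => rfl)
    (hb.dirac_sub_one_val_pow k e₁ (e * r)) (pow_val_eq_zero hb e₁ r) hp rfl c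
  have h2 := map_evalNil _ (evalNil (algebraMap k L) _ _ (pow_val_eq_zero hb e₁ r)) (RingHom.id L)
    h1 (hb.dirac_sub_one_val_pow k e₂ (e * r)) (pow_val_eq_zero hb e₂ r) hp rfl f
  refine h2.trans ?_
  rw [evalNil_eq_sum, Fintype.sum_prod_type_right, Finset.sum_range]
  refine Finset.sum_congr rfl fun j _ => ?_
  rw [evalNil_eq_sum, Finset.sum_mul, Finset.sum_range]
  exact Finset.sum_congr rfl fun i _ => by rw [Algebra.smul_def, mul_assoc]

lemma seriesLev_surjective (r : ℕ) : Function.Surjective (seriesLev k hb (e * r)) := by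
  intro a
  have hx : dirac k ϖ e₁ ∈ (seriesMap k hb).range :=
    ⟨PowerSeries.C PowerSeries.X + 1, by rw [map_add, seriesMap_X, map_one, sub_add_cancel]⟩
  have hy : dirac k ϖ e₂ ∈ (seriesMap k hb).range :=
    ⟨PowerSeries.X + 1, by rw [map_add, seriesMap_Y, map_one, sub_add_cancel]⟩
  suffices h : a ∈ (seriesLev k hb (e * r)).range from h
  induction a using AddMonoidAlgebra.induction_linear with
  | zero => exact zero_mem _
  | add a b ha hb => exact add_mem ha hb
  | single z c =>
    obtain ⟨z, rfl⟩ := Ideal.Quotient.mk_surjective z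
    obtain ⟨i, j, hij⟩ := hb.span r z
    obtain ⟨f, hf⟩ : algebraMap k _ c * dirac k ϖ (i * e₁ + j * e₂) ∈ (seriesMap k hb).range := by
      rw [dirac_add, dirac_natCast_mul, dirac_natCast_mul]
      exact mul_mem ⟨_, seriesMap_C hb c⟩ (mul_mem (pow_mem hx i) (pow_mem hy j))
    refine ⟨f, ?_⟩
    rw [← seriesMap_val, hf, iwasawa_mul_val, iwasawa_algebraMap_val, dirac_val]
    rw [← Ideal.mem_span_singleton, ← hb.lev_eq, ← Ideal.Quotient.eq] at hij
    rw [hij, ← Algebra.smul_def, AddMonoidAlgebra.smul_single, smul_eq_mul, mul_one]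

lemma IsPadicBasis.finite_quotient (n : ℕ) : Finite (O ⧸ lev O ϖ n) := by
  have h1 : lev O ϖ (e * n) ≤ lev O ϖ n := Ideal.span_singleton_le_span_singleton.2
    (pow_dvd_pow _ (Nat.le_mul_of_pos_left n hb.pos))
  have h2 : Finite (O ⧸ lev O ϖ (e * n)) := by
    rw [hb.lev_eq]
    refine Nat.finite_of_card_ne_zero ?_
    rw [hb.card]
    exact pow_ne_zero _ (pow_ne_zero _ (Fact.out : p.Prime).ne_zero)
  exact Finite.of_surjective _ (Ideal.Quotient.factor_surjective h1)

/-- The monomials of degree less than `p ^ r` in each variable, which are as many as the elements of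
`O / p ^ r`, generate the group algebra of this group, so that they are linearly independent. -/
lemma coeff_eq_zero_of_seriesLev {r : ℕ} {f : PowerSeries (PowerSeries k)}
    (hf : seriesLev k hb (e * r) f = 0) {i j : ℕ} (hi : i < p ^ r) (hj : j < p ^ r) :
    PowerSeries.coeff i (PowerSeries.coeff j f) = 0 := by
  have := hb.finite_quotient (e * r)
  let L : (Fin (p ^ r) × Fin (p ^ r) → k) →ₗ[k] AddMonoidAlgebra k (O ⧸ lev O ϖ (e * r)) :=
    Fintype.linearCombination k fun q =>
      ((dirac k ϖ e₁ - 1).1 (e * r) ^ (q.1 : ℕ) * (dirac k ϖ e₂ - 1).1 (e * r) ^ (q.2 : ℕ))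
  have hL (f : PowerSeries (PowerSeries k)) :
      L (fun q => PowerSeries.coeff q.1 (PowerSeries.coeff q.2 f)) = seriesLev k hb (e * r) f :=
    (seriesLev_eq_sum hb r f).symm
  have hs : Function.Surjective L := fun a => by
    obtain ⟨f, rfl⟩ := seriesLev_surjective hb r a
    exact ⟨_, hL f⟩
  have hd : Module.finrank k (Fin (p ^ r) × Fin (p ^ r) → k) =
      Module.finrank k (AddMonoidAlgebra k (O ⧸ lev O ϖ (e * r))) := by
    rw [LinearEquiv.finrank_eq (AddMonoidAlgebra.coeffLinearEquiv k :
      AddMonoidAlgebra k (O ⧸ lev O ϖ (e * r)) ≃ₗ[k] (O ⧸ lev O ϖ (e * r)) →₀ k)]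
    have := Fintype.ofFinite (O ⧸ lev O ϖ (e * r))
    rw [Module.finrank_finsupp_self, Module.finrank_fintype_fun_eq_card, ← Nat.card_eq_fintype_card,
      ← Nat.card_eq_fintype_card, hb.lev_eq, hb.card, Nat.card_prod, Nat.card_fin, sq]
  have : Module.Finite k (AddMonoidAlgebra k (O ⧸ lev O ϖ (e * r))) :=
    Module.Finite.of_surjective L hs
  have hi' := (LinearMap.injective_iff_surjective_of_finrank_eq_finrank hd).2 hs
  have h0 := hi' ((hL f).trans (hf.trans (map_zero L).symm))
  exact congrFun h0 (⟨i, hi⟩, ⟨j, hj⟩)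

lemma seriesLev_congr {r : ℕ} {f g : PowerSeries (PowerSeries k)}
    (h : ∀ i j, i < p ^ r → j < p ^ r →
      PowerSeries.coeff i (PowerSeries.coeff j f) = PowerSeries.coeff i (PowerSeries.coeff j g)) :
    seriesLev k hb (e * r) f = seriesLev k hb (e * r) g := by
  rw [seriesLev_eq_sum, seriesLev_eq_sum]
  exact Finset.sum_congr rfl fun q _ => by rw [h _ _ q.1.2 q.2.2]

omit [Fact p.Prime] [CharP k p] in
lemma eq_of_val_mul_eq {a b : iwasawa k O ϖ} (h : ∀ r, a.1 (e * r) = b.1 (e * r)) : a = b := by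
  refine iwasawa.ext O ϖ fun n => ?_
  obtain ⟨c, hc⟩ := proj_surjective k O ϖ (e * n) (a.1 (e * n))
  have hn := Nat.le_mul_of_pos_left n hb.pos
  rw [← proj_eq_of_le hn hc, ← proj_eq_of_le hn (hc.trans (h n))]

/-- The completed group algebra of a free `ℤ_p`-module of rank two is a ring of power series in two
variables. -/
theorem seriesMap_bijective : Function.Bijective (seriesMap k hb) := by
  have hlt (n : ℕ) : n < p ^ n := Nat.lt_pow_self (Fact.out : p.Prime).one_lt
  refine ⟨(injective_iff_map_eq_zero _).2 fun f hf => ?_, fun a => ?_⟩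
  · ext j i
    refine coeff_eq_zero_of_seriesLev hb (r := i + j) ?_ ?_ ?_
    · rw [← seriesMap_val, hf]; rfl
    · exact (Nat.le_add_right i j).trans_lt (hlt _)
    · exact (Nat.le_add_left j i).trans_lt (hlt _)
  · choose f hf using fun r => seriesLev_surjective hb r (a.1 (e * r))
    have hstep (r d : ℕ) : ∀ i j, i < p ^ r → j < p ^ r →
        PowerSeries.coeff i (PowerSeries.coeff j (f (r + d))) =
          PowerSeries.coeff i (PowerSeries.coeff j (f r)) := by
      intro i j hi hj
      rw [← sub_eq_zero, ← map_sub, ← map_sub]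
      refine coeff_eq_zero_of_seriesLev hb (r := r) ?_ hi hj
      have h1 : (seriesMap k hb (f (r + d))).1 (e * r) = a.1 (e * r) := by
        obtain ⟨c, hc⟩ := proj_surjective k O ϖ (e * (r + d)) (a.1 (e * (r + d)))
        have hn : e * r ≤ e * (r + d) := Nat.mul_le_mul_left e (Nat.le_add_right r d)
        rw [← proj_eq_of_le hn hc, ← proj_eq_of_le hn (hc.trans (hf (r + d)).symm)]
      rw [map_sub, hf r, ← seriesMap_val, h1, sub_self]
    let g : PowerSeries (PowerSeries k) := PowerSeries.mk fun j => PowerSeries.mk fun i =>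
      PowerSeries.coeff i (PowerSeries.coeff j (f (i + j)))
    refine ⟨g, eq_of_val_mul_eq hb fun r => ?_⟩
    rw [seriesMap_val, ← hf r]
    refine seriesLev_congr hb fun i j hi hj => ?_
    simp only [g, PowerSeries.coeff_mk]
    rw [← hstep (i + j) r i j ((Nat.le_add_right i j).trans_lt (hlt _))
      ((Nat.le_add_left j i).trans_lt (hlt _)), add_comm (i + j) r, hstep r (i + j) i j hi hj]

variable (k) in
/-- The isomorphism `k⟦X⟧⟦Y⟧ ≃ k[[U]]` with `X ↦ [e₁] - 1` and `Y ↦ [e₂] - 1`. -/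
def seriesEquiv : PowerSeries (PowerSeries k) ≃+* iwasawa k O ϖ :=
  RingEquiv.ofBijective (seriesMap k hb) (seriesMap_bijective hb)

end PowerSeriesIso

/-! ### Ring-theoretic properties of the completed group algebra -/

section IwasawaStructure

variable {p : ℕ} [Fact p.Prime] {k : Type u} [Field k] [CharP k p] {O : Type u} [CommRing O]
  {ϖ : O} {e : ℕ} {e₁ e₂ : O} (hb : IsPadicBasis p ϖ e e₁ e₂)
include hb

lemma IsPadicBasis.exists_series (a : iwasawa k O ϖ) :
    ∃ (f : PowerSeries (PowerSeries k)) (u v : iwasawa k O ϖ), seriesMap k hb f = a ∧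
      PowerSeries.constantCoeff (PowerSeries.constantCoeff f) = aug k O ϖ a ∧
      a = algebraMap k _ (aug k O ϖ a) + (u * (dirac k ϖ e₁ - 1) + v * (dirac k ϖ e₂ - 1)) := by
  obtain ⟨f, rfl⟩ := (seriesMap_bijective hb).2 a
  obtain ⟨g, hg⟩ : PowerSeries.X ∣ f - PowerSeries.C (PowerSeries.constantCoeff f) := by
    rw [PowerSeries.X_dvd_iff]; simp
  set c := PowerSeries.constantCoeff f with hc
  obtain ⟨h, hh⟩ : PowerSeries.X ∣ c - PowerSeries.C (PowerSeries.constantCoeff c) := by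
    rw [PowerSeries.X_dvd_iff]; simp
  have hf : f = PowerSeries.C (PowerSeries.C (PowerSeries.constantCoeff c)) +
      (PowerSeries.C h * PowerSeries.C PowerSeries.X + g * PowerSeries.X) := by
    rw [← map_mul, mul_comm h, ← hh, map_sub, mul_comm g, ← hg]
    ring
  have h1 := congrArg (seriesMap k hb) hf
  rw [map_add, map_add, map_mul, map_mul, seriesMap_X, seriesMap_Y, seriesMap_C] at h1
  have h2 : aug k O ϖ (seriesMap k hb f) = PowerSeries.constantCoeff c := by
    rw [h1]
    simp [aug_dirac]
  refine ⟨f, seriesMap k hb (PowerSeries.C h), seriesMap k hb g, rfl, h2.symm, ?_⟩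
  rw [h2]
  exact h1

lemma IsPadicBasis.isDomain : IsDomain (iwasawa k O ϖ) :=
  MulEquiv.isDomain (A := iwasawa k O ϖ) (PowerSeries (PowerSeries k))
    (seriesEquiv k hb).symm.toMulEquiv

lemma IsPadicBasis.isNoetherianRing : IsNoetherianRing (iwasawa k O ϖ) :=
  isNoetherianRing_of_ringEquiv _ (seriesEquiv k hb)

lemma IsPadicBasis.isUnit_of_aug_ne_zero {a : iwasawa k O ϖ} (ha : aug k O ϖ a ≠ 0) :
    IsUnit a := by
  obtain ⟨f, -, -, rfl, hf, -⟩ := hb.exists_series a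
  rw [← hf] at ha
  exact ((PowerSeries.isUnit_iff_constantCoeff.2
    (PowerSeries.isUnit_iff_constantCoeff.2 ha.isUnit))).map (seriesMap k hb)

lemma IsPadicBasis.isUnit_iff {a : iwasawa k O ϖ} : IsUnit a ↔ aug k O ϖ a ≠ 0 :=
  ⟨fun h => (h.map (aug k O ϖ)).ne_zero, hb.isUnit_of_aug_ne_zero⟩

lemma IsPadicBasis.isLocalRing : IsLocalRing (iwasawa k O ϖ) := by
  have : Nontrivial (iwasawa k O ϖ) := hb.isDomain.toNontrivial
  refine .of_nonunits_add fun a b ha hb' => ?_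
  rw [mem_nonunits_iff, hb.isUnit_iff, not_not] at *
  rw [map_add, ha, hb', add_zero]

lemma IsPadicBasis.exists_eq_of_aug_eq_zero {a : iwasawa k O ϖ} (ha : aug k O ϖ a = 0) :
    ∃ u v, a = u * (dirac k ϖ e₁ - 1) + v * (dirac k ϖ e₂ - 1) := by
  obtain ⟨-, u, v, -, -, h⟩ := hb.exists_series a
  exact ⟨u, v, by rw [ha, map_zero, zero_add] at h; exact h⟩

lemma IsPadicBasis.koszulExact : KoszulExact (dirac k ϖ e₁ - 1) (dirac k ϖ e₂ - 1) := by
  have hdom : IsDomain (iwasawa k O ϖ) := hb.isDomain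
  have key : ∀ f : PowerSeries (PowerSeries k), f * PowerSeries.C PowerSeries.X = 0 → f = 0 := by
    intro f hf
    refine (mul_eq_zero.1 hf).resolve_right fun h => ?_
    have h1 := congrArg PowerSeries.constantCoeff h
    rw [PowerSeries.constantCoeff_C, map_zero] at h1
    exact PowerSeries.X_ne_zero h1
  constructor
  · intro c d h
    obtain ⟨c, rfl⟩ := (seriesMap_bijective hb).2 c
    obtain ⟨d, rfl⟩ := (seriesMap_bijective hb).2 d
    rw [← seriesMap_X hb, ← seriesMap_Y hb, ← map_mul, ← map_mul, ← map_add,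
      (seriesMap_bijective hb).1.eq_iff' (map_zero _)] at h
    obtain ⟨c', rfl⟩ : PowerSeries.X ∣ c := by
      rw [PowerSeries.X_dvd_iff]
      have h1 := congrArg PowerSeries.constantCoeff h
      simp only [map_add, map_mul, PowerSeries.constantCoeff_C, PowerSeries.constantCoeff_X,
        mul_zero, add_zero, map_zero] at h1
      exact (mul_eq_zero.1 h1).resolve_right PowerSeries.X_ne_zero
    refine ⟨seriesMap k hb c', ?_, ?_⟩
    · rw [← seriesMap_Y hb, ← map_mul, mul_comm]
    · rw [← seriesMap_X hb, ← map_mul, ← map_neg]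
      congr 1
      have h2 : PowerSeries.X * (c' * PowerSeries.C PowerSeries.X + d) = 0 := by
        rw [← h]; ring
      linear_combination (mul_eq_zero.1 h2).resolve_left PowerSeries.X_ne_zero
  · intro a ha _
    obtain ⟨f, rfl⟩ := (seriesMap_bijective hb).2 a
    rw [← seriesMap_X hb, ← map_mul, (seriesMap_bijective hb).1.eq_iff' (map_zero _)] at ha
    rw [key f ha, map_zero]

end IwasawaStructure

/-! ### The completed group algebra as a free module over the image of `φ` -/

section Psi

variable {k : Type u} [Field k] {O : Type u} [CommRing O] {ϖ : O} (hϖ : ϖ ≠ 0)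

open Classical in
/-- The linear map `k[O / ϖ ^ (n + 1)] → k[O / ϖ ^ n]` that sends the class of `r + ϖ z` to the
class of `z`, and the classes that are not of this form to `0`. -/
def psiLev (k : Type u) [Field k] (ϖ r : O) (n : ℕ) :
    AddMonoidAlgebra k (O ⧸ lev O ϖ (n + 1)) →ₗ[k] AddMonoidAlgebra k (O ⧸ lev O ϖ n) :=
  (Finsupp.lift (AddMonoidAlgebra k (O ⧸ lev O ϖ n)) k (O ⧸ lev O ϖ (n + 1)) fun g =>
    if h : ∃ z, Ideal.Quotient.mk (lev O ϖ (n + 1)) (r + ϖ * z) = g then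
      AddMonoidAlgebra.single (Ideal.Quotient.mk (lev O ϖ n) h.choose) 1 else 0) ∘ₗ
  (AddMonoidAlgebra.coeffLinearEquiv k).toLinearMap

include hϖ in
lemma psiLev_single [IsDomain O] (r z : O) (n : ℕ) (c : k) :
    psiLev k ϖ r n (AddMonoidAlgebra.single (Ideal.Quotient.mk _ (r + ϖ * z)) c) =
      AddMonoidAlgebra.single (Ideal.Quotient.mk _ z) c := by
  have h : ∃ z', Ideal.Quotient.mk (lev O ϖ (n + 1)) (r + ϖ * z') =
    Ideal.Quotient.mk (lev O ϖ (n + 1)) (r + ϖ * z) := ⟨z, rfl⟩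
  have h1 : Ideal.Quotient.mk (lev O ϖ n) h.choose = Ideal.Quotient.mk (lev O ϖ n) z := by
    have h2 := h.choose_spec
    rw [Ideal.Quotient.eq, Ideal.mem_span_singleton, add_sub_add_left_eq_sub, ← mul_sub,
      pow_succ', mul_dvd_mul_iff_left hϖ] at h2
    rwa [Ideal.Quotient.eq, Ideal.mem_span_singleton]
  simp [psiLev, ← h1]

lemma psiLev_single_of_not_dvd {r w : O} (h : ¬ ϖ ∣ w - r) (n : ℕ) (c : k) :
    psiLev k ϖ r n (AddMonoidAlgebra.single (Ideal.Quotient.mk _ w) c) = 0 := by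
  have h1 : ¬ ∃ z', Ideal.Quotient.mk (lev O ϖ (n + 1)) (r + ϖ * z') =
      Ideal.Quotient.mk (lev O ϖ (n + 1)) w := by
    rintro ⟨z, hz⟩
    rw [Ideal.Quotient.eq, Ideal.mem_span_singleton] at hz
    refine h ?_
    have h2 : w - r = ϖ * z - (r + ϖ * z - w) := by ring
    rw [h2]
    exact dvd_sub (dvd_mul_right _ _) ((dvd_pow_self ϖ n.succ_ne_zero).trans hz)
  rw [psiLev, LinearMap.comp_apply]
  simp [-map_add, -map_mul, h1]

/-- Induction on the elements of a group algebra `k[O / ϖ ^ n]`. -/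
lemma lev_induction {n : ℕ} {motive : AddMonoidAlgebra k (O ⧸ lev O ϖ n) → Prop}
    (a : AddMonoidAlgebra k (O ⧸ lev O ϖ n)) (zero : motive 0)
    (add : ∀ a b, motive a → motive b → motive (a + b))
    (single : ∀ z c, motive (AddMonoidAlgebra.single (Ideal.Quotient.mk _ z) c)) : motive a := by
  induction a using AddMonoidAlgebra.induction_linear with
  | zero => exact zero
  | add a b ha hb => exact add a b ha hb
  | single g c =>
    obtain ⟨z, rfl⟩ := Ideal.Quotient.mk_surjective g
    exact single z c

lemma transition_single (n : ℕ) (z : O) (c : k) :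
    transition k O ϖ n (AddMonoidAlgebra.single (Ideal.Quotient.mk _ z) c) =
      AddMonoidAlgebra.single (Ideal.Quotient.mk _ z) c := by
  simp [transition]

lemma phiLev_single (n : ℕ) (z : O) (c : k) :
    phiLev k O ϖ n (AddMonoidAlgebra.single (Ideal.Quotient.mk _ z) c) =
      AddMonoidAlgebra.single (Ideal.Quotient.mk _ (ϖ * z)) c := by
  simp [phiLev]

variable [IsDomain O]

/-- The additive map `ψ_r` of `k[[U]]` that sends `r + ϖ z` to `z` and kills the elements of `O`
that are not congruent to `r`. -/
def psi (hϖ : ϖ ≠ 0) (r : O) : iwasawa k O ϖ →+ iwasawa k O ϖ where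
  toFun a := ⟨fun n => psiLev k ϖ r n (a.1 (n + 1)), fun n => by
    change transition k O ϖ n (psiLev k ϖ r (n + 1) (a.1 (n + 1 + 1))) =
      psiLev k ϖ r n (a.1 (n + 1))
    rw [← a.2 (n + 1)]
    induction a.1 (n + 1 + 1) using lev_induction with
    | zero => simp only [map_zero]
    | add a b ha hb => simp only [map_add, ha, hb]
    | single w c =>
      rw [transition_single]
      by_cases h : ϖ ∣ w - r
      · obtain ⟨z, hz⟩ := h
        obtain rfl : w = r + ϖ * z := by rw [← hz]; ring
        rw [psiLev_single hϖ, psiLev_single hϖ, transition_single]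
      · rw [psiLev_single_of_not_dvd h, psiLev_single_of_not_dvd h, map_zero]⟩
  map_zero' := iwasawa.ext O ϖ fun n => map_zero (psiLev k ϖ r n)
  map_add' a b := iwasawa.ext O ϖ fun n => map_add (psiLev k ϖ r n) _ _

lemma psi_val (r : O) (a : iwasawa k O ϖ) (n : ℕ) :
    (psi hϖ r a).1 n = psiLev k ϖ r n (a.1 (n + 1)) := rfl

/-- `ψ_r` is linear over the image of `φ`. -/
lemma psi_mul_phi (r : O) (a b : iwasawa k O ϖ) :
    psi hϖ r (a * phi k O ϖ b) = psi hϖ r a * b := by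
  refine iwasawa.ext O ϖ fun n => ?_
  rw [iwasawa_mul_val, psi_val, psi_val, iwasawa_mul_val, ← b.2 n]
  change psiLev k ϖ r n (a.1 (n + 1) * phiLev k O ϖ (n + 1) (b.1 (n + 1))) = _
  induction b.1 (n + 1) using lev_induction with
  | zero => simp only [map_zero, mul_zero]
  | add a b ha hb => simp only [map_add, mul_add, ha, hb]
  | single z d =>
    induction a.1 (n + 1) using lev_induction with
    | zero => simp only [map_zero, zero_mul]
    | add a b ha hb => simp only [map_add, add_mul, ha, hb]
    | single w c =>
      rw [phiLev_single, transition_single, AddMonoidAlgebra.single_mul_single, ← map_add]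
      by_cases h : ϖ ∣ w - r
      · obtain ⟨z', hz⟩ := h
        obtain rfl : w = r + ϖ * z' := by rw [← hz]; ring
        rw [add_assoc, ← mul_add, psiLev_single hϖ, psiLev_single hϖ,
          AddMonoidAlgebra.single_mul_single, map_add]
      · rw [psiLev_single_of_not_dvd h, zero_mul, psiLev_single_of_not_dvd]
        rwa [add_sub_right_comm, dvd_add_left (dvd_mul_right _ _)]

/-- The ring `k[[U]]` is generated over the image of `φ` by representatives of `U / φ(U)`, with the
maps `ψ_r` as coordinates. -/
lemma sum_dirac_mul_phi_psi [Fintype (O ⧸ Ideal.span {ϖ})] (a : iwasawa k O ϖ) :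
    a = ∑ r : O ⧸ Ideal.span {ϖ}, dirac k ϖ r.out * phi k O ϖ (psi hϖ r.out a) := by
  refine iwasawa.ext O ϖ fun n => ?_
  have h1 : ∀ f : O ⧸ Ideal.span {ϖ} → iwasawa k O ϖ, (∑ r, f r).1 n = ∑ r, (f r).1 n :=
    fun f => map_sum (evalLev k ϖ n) f _
  rw [h1, ← a.2 n]
  have h2 (r : O) : (dirac k ϖ r * phi k O ϖ (psi hϖ r a)).1 n =
    AddMonoidAlgebra.single (Ideal.Quotient.mk _ r) 1 *
      phiLev k O ϖ n (psiLev k ϖ r n (a.1 (n + 1))) := rfl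
  simp only [h2]
  induction a.1 (n + 1) using lev_induction with
  | zero => simp only [map_zero, mul_zero, Finset.sum_const_zero]
  | add a b ha hb => simp only [map_add, mul_add, Finset.sum_add_distrib, ha, hb]
  | single w c =>
    have h3 (r : O ⧸ Ideal.span {ϖ}) : ϖ ∣ w - r.out ↔ r = Ideal.Quotient.mk _ w := by
      rw [← Ideal.mem_span_singleton, ← Ideal.Quotient.eq, eq_comm]
      exact (congrArg (· = _) (Quotient.out_eq' r)).to_iff
    rw [Finset.sum_eq_single (Ideal.Quotient.mk _ w)]
    · obtain ⟨z, hz⟩ := (h3 _).2 rfl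
      generalize Quotient.out (Ideal.Quotient.mk (Ideal.span {ϖ}) w) = r at hz ⊢
      obtain rfl : w = r + ϖ * z := by rw [← hz]; ring
      rw [psiLev_single hϖ, phiLev_single, AddMonoidAlgebra.single_mul_single, one_mul,
        transition_single, map_add]
    · intro r _ hr
      rw [psiLev_single_of_not_dvd fun h => hr ((h3 r).1 h), map_zero, mul_zero]
    · exact fun h => absurd (Finset.mem_univ _) h

/-- Membership in an ideal generated by the image of `φ` can be tested after applying all `ψ_r`. -/
lemma exists_eq_of_psi [Finite (O ⧸ Ideal.span {ϖ})] {a b x : iwasawa k O ϖ}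
    (h : ∀ r, ∃ u v, psi hϖ r x = u * a + v * b) :
    ∃ u v, x = u * phi k O ϖ a + v * phi k O ϖ b := by
  have := Fintype.ofFinite (O ⧸ Ideal.span {ϖ})
  choose u v huv using fun r : O ⧸ Ideal.span {ϖ} => h r.out
  refine ⟨∑ r : O ⧸ Ideal.span {ϖ}, dirac k ϖ r.out * phi k O ϖ (u r),
    ∑ r : O ⧸ Ideal.span {ϖ}, dirac k ϖ r.out * phi k O ϖ (v r), ?_⟩
  conv_lhs => rw [sum_dirac_mul_phi_psi hϖ x]
  rw [Finset.sum_mul, Finset.sum_mul, ← Finset.sum_add_distrib]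
  refine Finset.sum_congr rfl fun r _ => ?_
  rw [huv, map_add, map_mul, map_mul]
  ring

lemma KoszulExact.phi [Finite (O ⧸ Ideal.span {ϖ})] {a b : iwasawa k O ϖ} (hϖ : ϖ ≠ 0)
    (h : KoszulExact a b) : KoszulExact (phi k O ϖ a) (phi k O ϖ b) := by
  have := Fintype.ofFinite (O ⧸ Ideal.span {ϖ})
  constructor
  · intro c d hcd
    have h1 (r) : psi hϖ r c * a + psi hϖ r d * b = 0 := by
      rw [← psi_mul_phi, ← psi_mul_phi, ← map_add, hcd, map_zero]
    choose f hc hd using fun r : O ⧸ Ideal.span {ϖ} => h.rel _ _ (h1 r.out)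
    refine ⟨∑ r : O ⧸ Ideal.span {ϖ}, dirac k ϖ r.out * ModPGL2.phi k O ϖ (f r), ?_, ?_⟩
    · conv_lhs => rw [sum_dirac_mul_phi_psi hϖ c]
      rw [Finset.sum_mul]
      exact Finset.sum_congr rfl fun r _ => by rw [hc, map_mul, mul_assoc]
    · conv_lhs => rw [sum_dirac_mul_phi_psi hϖ d]
      rw [Finset.sum_mul, ← Finset.sum_neg_distrib]
      exact Finset.sum_congr rfl fun r _ => by rw [hd, map_neg, map_mul]; ring
  · intro x hxa hxb
    have h1 (r) : psi hϖ r x = 0 :=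
      h.inj _ (by rw [← psi_mul_phi, hxa, map_zero]) (by rw [← psi_mul_phi, hxb, map_zero])
    rw [sum_dirac_mul_phi_psi hϖ x]
    exact Finset.sum_eq_zero fun r _ => by rw [h1, map_zero, mul_zero]

/-- The conditions on `φ ^ n` in `TwistData` follow from those for `n = 0`, since `k[[U]]` is free
over the image of `φ`. -/
lemma koszul_iterate [Finite (O ⧸ Ideal.span {ϖ})] (hϖ : ϖ ≠ 0) {a b : iwasawa k O ϖ}
    (h : KoszulExact a b) (n : ℕ) :
    KoszulExact (SkewPolynomial.φ^[n] a) (SkewPolynomial.φ^[n] b) := by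
  induction n with
  | zero => exact h
  | succ n ih =>
    rw [Function.iterate_succ_apply', Function.iterate_succ_apply', φ_eq_phi, φ_eq_phi]
    exact ih.phi hϖ

lemma inj_iterate [Finite (O ⧸ Ideal.span {ϖ})] (hϖ : ϖ ≠ 0) {a b s : iwasawa k O ϖ}
    (h : ∀ x, (∃ u v, x * s = u * phi k O ϖ a + v * phi k O ϖ b) → ∃ u v, x = u * a + v * b)
    (n : ℕ) (x : iwasawa k O ϖ)
    (hx : ∃ u v, x * SkewPolynomial.φ^[n] s =
      u * SkewPolynomial.φ^[n + 1] a + v * SkewPolynomial.φ^[n + 1] b) :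
    ∃ u v, x = u * SkewPolynomial.φ^[n] a + v * SkewPolynomial.φ^[n] b := by
  induction n generalizing x with
  | zero =>
    have hx' : ∃ u v, x * s = u * SkewPolynomial.φ a + v * SkewPolynomial.φ b := hx
    exact h x (by simpa only [φ_eq_phi] using hx')
  | succ n ih =>
    rw [Function.iterate_succ_apply', Function.iterate_succ_apply', φ_eq_phi, φ_eq_phi]
    refine exists_eq_of_psi hϖ fun r => ih _ ?_
    obtain ⟨u, v, huv⟩ := hx
    refine ⟨psi hϖ r u, psi hϖ r v, ?_⟩
    rw [Function.iterate_succ_apply', Function.iterate_succ_apply' (n := n + 1),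
      Function.iterate_succ_apply' (n := n + 1), φ_eq_phi, φ_eq_phi, φ_eq_phi] at huv
    rw [← psi_mul_phi, huv, map_add, psi_mul_phi, psi_mul_phi]

end Psi

/-! ### Gorenstein ideals of codimension two -/

section Gorenstein

variable {A : Type u} [CommRing A]

lemma KoszulExact.symm {a b : A} (h : KoszulExact a b) : KoszulExact b a where
  rel c d hcd := by
    obtain ⟨e, h1, h2⟩ := h.rel d c (by rw [add_comm, hcd])
    exact ⟨-e, by rw [h2, neg_mul], by rw [h1, neg_mul, neg_neg]⟩
  inj e hb ha := h.inj e ha hb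

lemma KoszulExact.pow_left [IsDomain A] {a b : A} (h : KoszulExact a b) (hb : b ≠ 0) (n : ℕ) :
    KoszulExact (a ^ n) b where
  rel := by
    induction n with
    | zero =>
      intro c d hcd
      rw [pow_zero, mul_one] at hcd
      exact ⟨-d, by linear_combination hcd, by ring⟩
    | succ n ih =>
      intro c d hcd
      obtain ⟨e, h1, h2⟩ := ih (c * a) d (by rw [← hcd]; ring)
      obtain ⟨f, h3, h4⟩ := h.rel c (-e) (by rw [h1]; ring)
      exact ⟨f, h3, by rw [h2]; linear_combination a ^ n * h4⟩
  inj e _ hb' := (mul_eq_zero.1 hb').resolve_right hb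

variable [IsLocalRing A] {x y : A}
  (hm : IsLocalRing.maximalIdeal A = Ideal.span {x, y})
include hm

lemma mem_maximalIdeal_left : x ∈ IsLocalRing.maximalIdeal A :=
  hm ▸ Ideal.subset_span (Set.mem_insert _ _)

lemma mem_maximalIdeal_right : y ∈ IsLocalRing.maximalIdeal A :=
  hm ▸ Ideal.subset_span (Set.mem_insert_of_mem _ rfl)

lemma ne_zero_right (h : KoszulExact x y) : y ≠ 0 := by
  rintro rfl
  obtain ⟨e, -, h2⟩ := h.rel 0 1 (by ring)
  refine (IsLocalRing.mem_maximalIdeal _).1 (mem_maximalIdeal_left hm) ?_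
  exact IsUnit.of_mul_eq_one (-e) (by rw [h2]; ring)

lemma koszulExact_pow [IsDomain A] (h : KoszulExact x y) (n : ℕ) : KoszulExact (x ^ n) (y ^ n) :=
  have hy := ne_zero_right hm h
  have hx := ne_zero_right (by rw [hm, Set.pair_comm]) h.symm
  ((h.symm.pow_left hx n).symm.pow_left (pow_ne_zero n hy) n)

lemma isUnit_of_dvd_pow [IsDomain A] (h : KoszulExact x y) {n : ℕ} {c : A} (hx : c ∣ x ^ n)
    (hy : c ∣ y ^ n) :
    IsUnit c := by
  obtain ⟨u, hu⟩ := hx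
  obtain ⟨v, hv⟩ := hy
  obtain ⟨e, h1, -⟩ := (koszulExact_pow hm h n).rel v (-u) (by rw [hu, hv]; ring)
  refine IsUnit.of_mul_eq_one e ?_
  refine mul_right_cancel₀ (pow_ne_zero n (ne_zero_right hm h)) ?_
  rw [one_mul, mul_assoc, ← h1, ← hv]

omit hm in
/-- The relations between minimal generators of an ideal have coefficients in the maximal ideal. -/
lemma exists_minimal_generators [IsNoetherianRing A] (J : Ideal A) :
    ∃ (n : ℕ) (g : Fin n → A), Ideal.span (Set.range g) = J ∧
      ∀ c : Fin n → A, ∑ i, c i * g i = 0 → ∀ i, c i ∈ IsLocalRing.maximalIdeal A := by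
  classical
  have h : ∃ (n : ℕ) (g : Fin n → A), Ideal.span (Set.range g) = J := by
    obtain ⟨n, g, hg⟩ := Submodule.fg_iff_exists_fin_generating_family.1
      (IsNoetherian.noetherian J)
    exact ⟨n, g, hg⟩
  obtain ⟨g, hg⟩ := Nat.find_spec h
  refine ⟨Nat.find h, g, hg, fun c hc i => ?_⟩
  by_contra hi
  have hu : IsUnit (c i) := by
    by_contra h'
    exact hi ((IsLocalRing.mem_maximalIdeal _).2 h')
  generalize hn : Nat.find h = n at g hg c hc i
  obtain _ | n := n
  · exact i.elim0
  refine Nat.find_min h (m := n) (by omega) ⟨fun j => g (i.succAbove j), ?_⟩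
  rw [← hg]
  refine le_antisymm (Ideal.span_mono (Set.range_comp_subset_range i.succAbove g)) ?_
  rw [Ideal.span_le]
  rintro _ ⟨j, rfl⟩
  have hj (j) : g (i.succAbove j) ∈ Ideal.span (Set.range fun j => g (i.succAbove j)) :=
    Ideal.subset_span ⟨j, rfl⟩
  rcases Fin.eq_self_or_eq_succAbove i j with rfl | ⟨j, rfl⟩
  · rw [Fin.sum_univ_succAbove _ j, add_comm, ← eq_neg_iff_add_eq_zero] at hc
    have := neg_mem (sum_mem (S := Ideal.span (Set.range fun i => g (j.succAbove i))) (t := Finset.univ)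
      fun i _ => Ideal.mul_mem_left _ (c (j.succAbove i)) (hj i))
    rw [hc, neg_neg] at this
    exact (Ideal.unit_mul_mem_iff_mem _ hu).1 this
  · exact hj j

lemma exists_eq_of_mem_maximalIdeal {a : A} (ha : a ∈ IsLocalRing.maximalIdeal A) :
    ∃ u v, a = x * u + y * v := by
  rw [hm, Ideal.mem_span_pair] at ha
  obtain ⟨u, v, h⟩ := ha
  exact ⟨u, v, by rw [← h]; ring⟩

/-- In a two-dimensional regular local ring with parameters `x` and `y`, the relations between
minimal generators of an `(x, y)`-primary ideal `J` form a cyclic module if the socle of `A / J` is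
one-dimensional. -/
lemma exists_relation_generator [IsNoetherianRing A] (h : KoszulExact x y) {n : ℕ} {g : Fin n → A}
    (hg : ∀ c : Fin n → A, ∑ i, c i * g i = 0 → ∀ i, c i ∈ IsLocalRing.maximalIdeal A)
    {w : A} (hxw : x * w ∈ Ideal.span (Set.range g)) (hyw : y * w ∈ Ideal.span (Set.range g))
    (hw : ∀ u, x * u ∈ Ideal.span (Set.range g) → y * u ∈ Ideal.span (Set.range g) →
      ∃ c, u - c * w ∈ Ideal.span (Set.range g)) :
    ∃ κ : Fin n → A, ∀ c : Fin n → A, ∑ i, c i * g i = 0 → ∃ t, ∀ i, c i = t * κ i := by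
  let K : Submodule A (Fin n → A) := LinearMap.ker (Fintype.linearCombination A g)
  have hK (c : Fin n → A) : c ∈ K ↔ ∑ i, c i * g i = 0 := Iff.rfl
  have hspan (a : A) : a ∈ Ideal.span (Set.range g) ↔ ∃ c : Fin n → A, ∑ i, c i * g i = a :=
    Ideal.mem_span_range_iff_exists_fun
  obtain ⟨p, hp⟩ := (hspan _).1 hxw
  obtain ⟨q, hq⟩ := (hspan _).1 hyw
  -- the generator comes from the two ways of writing `x y w` in terms of the generators of `J`
  let κ : Fin n → A := x • q - y • p
  have hle : K ≤ Submodule.span A {κ} ⊔ IsLocalRing.maximalIdeal A • K := by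
    intro c hc
    choose d e hde using fun i => exists_eq_of_mem_maximalIdeal hm (hg c ((hK c).1 hc) i)
    have h0 : (∑ i, d i * g i) * x + (∑ i, e i * g i) * y = 0 := by
      rw [← (hK c).1 hc, Finset.sum_mul, Finset.sum_mul, ← Finset.sum_add_distrib]
      exact Finset.sum_congr rfl fun i _ => by rw [hde i]; ring
    obtain ⟨u, hu1, hu2⟩ := h.rel _ _ h0
    obtain ⟨α, hα⟩ := hw u
      (by rw [← neg_neg (x * u), mul_comm x u, ← hu2]; exact neg_mem ((hspan _).2 ⟨e, rfl⟩))
      (by rw [mul_comm, ← hu1]; exact (hspan _).2 ⟨d, rfl⟩)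
    obtain ⟨r, hr⟩ := (hspan _).1 hα
    have hsum (c d : Fin n → A) : ∑ i, (c + d) i * g i = ∑ i, c i * g i + ∑ i, d i * g i := by
      rw [← Finset.sum_add_distrib]
      exact Finset.sum_congr rfl fun i _ => by rw [Pi.add_apply]; ring
    have hsmul (t : A) (c : Fin n → A) : ∑ i, (t • c) i * g i = t * ∑ i, c i * g i := by
      rw [Finset.mul_sum]
      exact Finset.sum_congr rfl fun i _ => by rw [Pi.smul_apply, smul_eq_mul, mul_assoc]
    have h1 : d + ((-α) • q + (-y) • r) ∈ K := by
      rw [hK, hsum, hsum, hsmul, hsmul, hu1, hr, hq]; ring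
    have h2 : e + (α • p + x • r) ∈ K := by
      rw [hK, hsum, hsum, hsmul, hsmul, hu2, hr, hp]; ring
    have hc' : c = α • κ + (x • (d + ((-α) • q + (-y) • r)) + y • (e + (α • p + x • r))) := by
      funext i
      simp only [κ, Pi.add_apply, Pi.smul_apply, Pi.sub_apply, smul_eq_mul, hde i]
      ring
    rw [hc']
    exact Submodule.add_mem_sup (Submodule.smul_mem _ _ (Submodule.mem_span_singleton_self κ))
      (add_mem (Submodule.smul_mem_smul (mem_maximalIdeal_left hm) h1)
        (Submodule.smul_mem_smul (mem_maximalIdeal_right hm) h2))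
  have hle' : K ≤ Submodule.span A {κ} :=
    Submodule.le_of_le_smul_of_le_jacobson_bot (IsNoetherian.noetherian K)
      (IsLocalRing.jacobson_eq_maximalIdeal ⊥ bot_ne_top).ge hle
  refine ⟨κ, fun c hc => ?_⟩
  obtain ⟨t, rfl⟩ := Submodule.mem_span_singleton.1 (hle' ((hK c).2 hc))
  exact ⟨t, fun i => rfl⟩

/-- In a two-dimensional regular local ring with parameters `x` and `y`, an `(x, y)`-primary
ideal `J` such that the socle of `A / J` is one-dimensional is generated by a regular sequence. -/
theorem exists_koszulExact_of_socle [IsDomain A] [IsNoetherianRing A] (h : KoszulExact x y)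
    {J : Ideal A} (hJ : J ≠ ⊤) {N : ℕ} (hx : x ^ N ∈ J) (hy : y ^ N ∈ J)
    {w : A} (hxw : x * w ∈ J) (hyw : y * w ∈ J)
    (hw : ∀ u, x * u ∈ J → y * u ∈ J → ∃ c, u - c * w ∈ J) :
    ∃ a b, J = Ideal.span {a, b} ∧ KoszulExact a b := by
  obtain ⟨n, g, rfl, hg⟩ := exists_minimal_generators J
  obtain ⟨κ, hκ⟩ := exists_relation_generator hm h hg hxw hyw hw
  have hprinc (c : A) (hc : Ideal.span (Set.range g) ≤ Ideal.span {c}) : IsUnit c :=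
    isUnit_of_dvd_pow hm h (Ideal.mem_span_singleton.1 (hc hx))
      (Ideal.mem_span_singleton.1 (hc hy))
  obtain ⟨f, hf⟩ := Ideal.mem_span_range_iff_exists_fun.1 hx
  have hx0 : x ^ N ≠ 0 := pow_ne_zero N (ne_zero_right (by rw [hm, Set.pair_comm]) h.symm)
  -- `x ^ N` times the identity matrix is a sum of two matrices of rank one
  have hrank (l : Fin n) : ∃ t, ∀ i, (if i = l then x ^ N else 0) = g l * f i + t * κ i := by
    obtain ⟨t, ht⟩ := hκ (fun i => (if i = l then x ^ N else 0) - g l * f i) (by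
      simp only [sub_mul, Finset.sum_sub_distrib, ite_mul, zero_mul, Finset.sum_ite_eq',
        Finset.mem_univ, if_true, mul_assoc, ← Finset.mul_sum, hf]
      ring)
    exact ⟨t, fun i => by rw [← ht]; ring⟩
  choose t ht using hrank
  match n, g, f, κ, t, hg, hκ, hf, ht, hJ, hprinc with
  | 0, g, _, _, _, _, _, hf, _, _, _ =>
    simp only [Finset.univ_eq_empty, Finset.sum_empty] at hf
    exact absurd hf.symm hx0
  | 1, g, _, _, _, _, _, hf, _, hJ, hprinc =>
    have h1 : Ideal.span (Set.range g) = Ideal.span {g 0} := by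
      rw [Set.range_unique]; rfl
    have := hprinc (g 0) h1.le
    exact absurd (h1.trans (Ideal.span_singleton_eq_top.2 this)) hJ
  | 2, g, _, κ, _, _, hκ, _, _, _, hprinc =>
    have hspan : Ideal.span (Set.range g) = Ideal.span {g 0, g 1} := by
      congr 1
      ext a
      simp [Fin.exists_fin_two, eq_comm]
    obtain ⟨c, hc⟩ := hκ ![g 1, -g 0] (by
      simp only [Fin.sum_univ_two, Matrix.cons_val_zero, Matrix.cons_val_one]; ring)
    have hc0 : g 1 = c * κ 0 := hc 0
    have hc1 : -g 0 = c * κ 1 := hc 1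
    -- `(g₁, -g₀)` is a relation, and it is a unit multiple of the generator of the relations
    obtain ⟨u, rfl⟩ : IsUnit c := by
      refine hprinc c ?_
      rw [hspan, Ideal.span_le]
      rintro _ (rfl | rfl)
      · rw [SetLike.mem_coe, ← neg_mem_iff, hc1]
        exact Ideal.mul_mem_right _ _ (Ideal.mem_span_singleton_self c)
      · rw [SetLike.mem_coe, hc0]
        exact Ideal.mul_mem_right _ _ (Ideal.mem_span_singleton_self _)
    have hne : ¬ (g 0 = 0 ∧ g 1 = 0) := by
      rintro ⟨h0, h1⟩
      rw [hspan, h0, h1, Set.pair_eq_singleton, Ideal.span_singleton_eq_bot.2 rfl] at hx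
      exact hx0 hx
    refine ⟨g 0, g 1, hspan, ⟨fun c d hcd => ?_, fun e he0 he1 => ?_⟩⟩
    · obtain ⟨t, ht⟩ := hκ ![c, d] (by
        simpa only [Fin.sum_univ_two, Matrix.cons_val_zero, Matrix.cons_val_one] using hcd)
      have ht0 : c = t * κ 0 := ht 0
      have ht1 : d = t * κ 1 := ht 1
      refine ⟨t * ↑u⁻¹, ?_, ?_⟩
      · rw [hc0, ht0, mul_assoc, Units.inv_mul_cancel_left]
      · rw [← mul_neg, hc1, ht1, mul_assoc, Units.inv_mul_cancel_left]
    · by_contra he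
      exact hne ⟨(mul_eq_zero.1 he0).resolve_left he, (mul_eq_zero.1 he1).resolve_left he⟩
  | n + 3, g, f, κ, t, _, _, _, ht, _, _ =>
    exfalso
    -- a matrix of rank at most two has no nonzero minor of size three, whereas a principal minor of
    -- `x ^ N` times the identity is `(x ^ N) ^ 3`
    let i₀ : Fin (n + 3) := ⟨0, by omega⟩
    let i₁ : Fin (n + 3) := ⟨1, by omega⟩
    let i₂ : Fin (n + 3) := ⟨2, by omega⟩
    have e01 : i₁ ≠ i₀ := by simp [i₁, i₀]
    have e02 : i₂ ≠ i₀ := by simp [i₂, i₀]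
    have e12 : i₂ ≠ i₁ := by simp [i₂, i₁]
    have h00 := ht i₀ i₀
    have h01 := ht i₁ i₀
    have h02 := ht i₂ i₀
    have h10 := ht i₀ i₁
    have h11 := ht i₁ i₁
    have h12 := ht i₂ i₁
    have h20 := ht i₀ i₂
    have h21 := ht i₁ i₂
    have h22 := ht i₂ i₂
    simp only [if_true, if_neg e01, if_neg e02, if_neg e12, if_neg e01.symm, if_neg e02.symm,
      if_neg e12.symm] at h00 h01 h02 h10 h11 h12 h20 h21 h22
    have hdet : (!![x ^ N, 0, 0; 0, x ^ N, 0; 0, 0, x ^ N] : Matrix (Fin 3) (Fin 3) A).det = 0 := by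
      have : (!![x ^ N, 0, 0; 0, x ^ N, 0; 0, 0, x ^ N] : Matrix (Fin 3) (Fin 3) A) =
          !![g i₀ * f i₀ + t i₀ * κ i₀, g i₁ * f i₀ + t i₁ * κ i₀, g i₂ * f i₀ + t i₂ * κ i₀;
             g i₀ * f i₁ + t i₀ * κ i₁, g i₁ * f i₁ + t i₁ * κ i₁, g i₂ * f i₁ + t i₂ * κ i₁;
             g i₀ * f i₂ + t i₀ * κ i₂, g i₁ * f i₂ + t i₁ * κ i₂, g i₂ * f i₂ + t i₂ * κ i₂] := by
        rw [← h00, ← h01, ← h02, ← h10, ← h11, ← h12, ← h20, ← h21, ← h22]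
      rw [this, Matrix.det_fin_three]
      simp only [Matrix.of_apply, Matrix.cons_val', Matrix.cons_val_zero, Matrix.cons_val_one,
        Matrix.cons_val]
      ring
    rw [Matrix.det_fin_three] at hdet
    simp only [Matrix.of_apply, Matrix.cons_val', Matrix.cons_val_zero, Matrix.cons_val_one,
      Matrix.cons_val, mul_zero, sub_zero, add_zero, zero_mul] at hdet
    exact mul_ne_zero (mul_ne_zero hx0 hx0) hx0 hdet

end Gorenstein

/-! ### The choice of the generators -/

section Generators

/-- A nilpotent `2 × 2`-matrix over a field has square zero. -/
lemma sq_eq_zero_of_isNilpotent {k : Type*} [Field k] {N : Matrix (Fin 2) (Fin 2) k}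
    (h : IsNilpotent N) : N * N = 0 ∧ N.det = 0 := by
  have ht : N.trace = 0 := (Matrix.isNilpotent_trace_of_isNilpotent h).eq_zero
  have hd : N.det = 0 := by
    obtain ⟨n, hn⟩ := h
    have h1 := congrArg Matrix.det hn
    rw [Matrix.det_pow, Matrix.det_zero] at h1
    exact eq_zero_of_pow_eq_zero h1
  refine ⟨?_, hd⟩
  rw [Matrix.trace_fin_two] at ht
  rw [Matrix.det_fin_two] at hd
  ext i j
  fin_cases i <;> fin_cases j <;> simp [Matrix.mul_apply, Fin.sum_univ_two]
  · linear_combination N 0 0 * ht - hd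
  · linear_combination N 0 1 * ht
  · linear_combination N 1 0 * ht
  · linear_combination N 1 1 * ht - hd

/-- If `N` is nilpotent and `N C = s` is a scalar matrix, then `N` and `C` have a common vector in
their left kernels, provided that `C` is singular in case `N` and `s` vanish. A nonzero row of `N`
is such a vector. -/
lemma exists_common_left_kernel {k : Type*} [Field k] {N C : Matrix (Fin 2) (Fin 2) k} {s : k}
    (hN : IsNilpotent N) (h : N * C = s • 1) (hdet : N = 0 → s = 0 → C.det = 0) :
    ∃ v : Fin 2 → k, v ≠ 0 ∧ v ᵥ* N = 0 ∧ v ᵥ* C = 0 := by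
  obtain ⟨hN2, hNd⟩ := sq_eq_zero_of_isNilpotent hN
  have hs : s = 0 := by
    have h1 := congrArg Matrix.det h
    rw [Matrix.det_mul, hNd, zero_mul, Matrix.det_smul, Matrix.det_one, mul_one] at h1
    exact pow_eq_zero_iff (by simp) |>.1 h1.symm
  rw [hs, zero_smul] at h
  by_cases h0 : N = 0
  · obtain ⟨v, hv, hv'⟩ := Matrix.exists_vecMul_eq_zero_iff.2 (hdet h0 hs)
    exact ⟨v, hv, by rw [h0, Matrix.vecMul_zero], hv'⟩
  · obtain ⟨i, hi⟩ : ∃ i, N i ≠ 0 := by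
      by_contra! h'
      exact h0 (funext h')
    refine ⟨N i, hi, ?_, ?_⟩
    · exact congrFun hN2 i
    · exact congrFun h i

variable {k : Type u} [Field k] {A : Type u} [CommRing A] [Algebra k A]
  {aug : A →ₐ[k] k} {φ : A →ₐ[k] A}

/-- There is a regular sequence `a'`, `b'` that generates the same ideal as `a`, `b` and is such that the coefficients of `φ(a')` and of `s a'` vanish under `aug`. -/
def HasGoodGenerators (aug : A →ₐ[k] k) (φ : A →ₐ[k] A) (s a b : A) : Prop :=
  ∃ a' b', Ideal.span {a', b'} = Ideal.span {a, b} ∧ KoszulExact a' b' ∧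
    (∃ n₁ n₂, φ a' = n₁ * a' + n₂ * b' ∧ aug n₁ = 0 ∧ aug n₂ = 0) ∧
    (∃ c₁ c₂, s * a' = c₁ * φ a' + c₂ * φ b' ∧ aug c₁ = 0 ∧ aug c₂ = 0)

/-- If `(1, t)` lies in the left kernel of the matrices of coefficients modulo the augmentation ideal,
then `a + t b` and `b` are suitable generators. -/
lemma hasGoodGenerators_of_row {a b s n₁₁ n₁₂ n₂₁ n₂₂ c₁₁ c₁₂ c₂₁ c₂₂ : A}
    (hab : KoszulExact a b) (ha : φ a = n₁₁ * a + n₁₂ * b) (hb : φ b = n₂₁ * a + n₂₂ * b)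
    (hsa : s * a = c₁₁ * φ a + c₁₂ * φ b) (hsb : s * b = c₂₁ * φ a + c₂₂ * φ b) (t : k)
    (h₁ : aug n₁₁ + t * aug n₂₁ = 0) (h₂ : aug n₁₂ + t * aug n₂₂ = 0)
    (h₃ : aug c₁₁ + t * aug c₂₁ = 0) (h₄ : aug c₁₂ + t * aug c₂₂ = 0) :
    HasGoodGenerators aug φ s a b := by
  set T := algebraMap k A t with hT
  have hφT : φ T = T := φ.commutes t
  have haT : aug T = t := aug.commutes t
  refine ⟨a + T * b, b, ?_, ⟨fun c d hcd => ?_, fun e h h' => ?_⟩, ?_, ?_⟩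
  · exact Ideal.span_pair_add_mul_right a b T
  · obtain ⟨e, he, he'⟩ := hab.rel c (c * T + d) (by rw [← hcd]; ring)
    exact ⟨e, he, by linear_combination he' - T * he⟩
  · exact hab.inj e (by linear_combination h - T * h') h'
  · refine ⟨n₁₁ + T * n₂₁, n₁₂ + T * n₂₂ - T * (n₁₁ + T * n₂₁), ?_, ?_, ?_⟩
    · rw [map_add, map_mul, hφT, ha, hb]; ring
    · rw [map_add, map_mul, haT, h₁]
    · rw [map_sub, map_add, map_mul, map_mul aug T, map_add, map_mul, haT, h₁, h₂,
        mul_zero, sub_zero]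
  · refine ⟨c₁₁ + T * c₂₁, c₁₂ + T * c₂₂ - T * (c₁₁ + T * c₂₁), ?_, ?_, ?_⟩
    · rw [map_add, map_mul, hφT, mul_add, hsa, mul_left_comm, hsb]; ring
    · rw [map_add, map_mul, haT, h₃]
    · rw [map_sub, map_add, map_mul, map_mul aug T, map_add, map_mul, haT, h₃, h₄,
        mul_zero, sub_zero]

/-- The matrices that express `φ(a), φ(b)` in terms of `a, b`, and `s a, s b` in terms of
`φ(a), φ(b)`, have, modulo the augmentation ideal, a common vector in their left kernels, so
that a change of generators makes the coefficients of `φ(a)` and of `s a` vanish there. -/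
theorem hasGoodGenerators (haug : ∀ u, aug (φ u) = aug u) (hunit : ∀ u, aug u ≠ 0 → IsUnit u)
    {a b s : A} (hab : KoszulExact a b) (hφab : KoszulExact (φ a) (φ b))
    (ha0 : aug a = 0) (hb0 : aug b = 0)
    (ha : φ a ∈ Ideal.span {a, b}) (hb : φ b ∈ Ideal.span {a, b})
    (hsa : s * a ∈ Ideal.span {φ a, φ b}) (hsb : s * b ∈ Ideal.span {φ a, φ b})
    (hnil : ∃ n : ℕ, ∀ u ∈ ({a, b} : Set A), ∃ α β, φ^[n] u = α * a + β * b ∧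
      aug α = 0 ∧ aug β = 0) :
    HasGoodGenerators aug φ s a b := by
  simp only [Ideal.mem_span_pair] at ha hb hsa hsb
  obtain ⟨n₁₁, n₁₂, ha⟩ := ha
  obtain ⟨n₂₁, n₂₂, hb⟩ := hb
  obtain ⟨c₁₁, c₁₂, hsa⟩ := hsa
  obtain ⟨c₂₁, c₂₂, hsb⟩ := hsb
  have hone : aug (1 : A) ≠ 0 := by rw [map_one]; exact one_ne_zero
  -- the coefficients of the elements of `(a, b)` are unique modulo the augmentation ideal
  have huniq {u v : A} (huv : KoszulExact u v) (hu : aug u = 0) (hv : aug v = 0) {α β α' β' : A}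
      (h : α * u + β * v = α' * u + β' * v) : aug α = aug α' ∧ aug β = aug β' := by
    obtain ⟨e, h1, h2⟩ := huv.rel (α - α') (β - β') (by linear_combination h)
    rw [← sub_eq_zero, ← sub_eq_zero (a := aug β), ← map_sub, ← map_sub, h1, h2]
    simp [hu, hv]
  let N : Matrix (Fin 2) (Fin 2) k := !![aug n₁₁, aug n₁₂; aug n₂₁, aug n₂₂]
  let C : Matrix (Fin 2) (Fin 2) k := !![aug c₁₁, aug c₁₂; aug c₂₁, aug c₂₂]
  have hφs : ∀ α β, φ (α * a + β * b) =
      (φ α * n₁₁ + φ β * n₂₁) * a + (φ α * n₁₂ + φ β * n₂₂) * b := fun α β => by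
    rw [map_add, map_mul, map_mul, ← ha, ← hb]; ring
  have hNC : N * C = aug s • 1 := by
    have e1 : (n₁₁ * c₁₁ + n₁₂ * c₂₁) * φ a + (n₁₁ * c₁₂ + n₁₂ * c₂₂) * φ b =
        s * φ a + 0 * φ b := by
      linear_combination n₁₁ * hsa + n₁₂ * hsb + s * ha
    have e2 : (n₂₁ * c₁₁ + n₂₂ * c₂₁) * φ a + (n₂₁ * c₁₂ + n₂₂ * c₂₂) * φ b =
        0 * φ a + s * φ b := by
      linear_combination n₂₁ * hsa + n₂₂ * hsb + s * hb
    obtain ⟨h11, h12⟩ := huniq hφab (by rw [haug, ha0]) (by rw [haug, hb0]) e1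
    obtain ⟨h21, h22⟩ := huniq hφab (by rw [haug, ha0]) (by rw [haug, hb0]) e2
    simp only [map_add, map_mul, map_zero] at h11 h12 h21 h22
    ext i j
    fin_cases i <;> fin_cases j <;>
      simp [N, C, Matrix.mul_apply, Fin.sum_univ_two, h11, h12, h21, h22]
  have hpow (n : ℕ) : ∀ i : Fin 2, ∃ α β, φ^[n] (![a, b] i) = α * a + β * b ∧
      aug α = (N ^ n) i 0 ∧ aug β = (N ^ n) i 1 := by
    induction n with
    | zero =>
      intro i
      fin_cases i
      · exact ⟨1, 0, by simp, by simp, by simp⟩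
      · exact ⟨0, 1, by simp, by simp, by simp⟩
    | succ n ih =>
      intro i
      obtain ⟨α, β, h, hα, hβ⟩ := ih i
      refine ⟨_, _, by rw [Function.iterate_succ_apply', h, hφs], ?_, ?_⟩ <;>
        simp [pow_succ, Matrix.mul_apply, Fin.sum_univ_two, haug, hα, hβ, N]
  have hnilN : IsNilpotent N := by
    obtain ⟨n, hn⟩ := hnil
    refine ⟨n, ?_⟩
    ext i j
    obtain ⟨α, β, h, hα, hβ⟩ := hpow n i
    obtain ⟨α', β', h', hα', hβ'⟩ := hn (![a, b] i) (by fin_cases i <;> simp)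
    obtain ⟨h1, h2⟩ := huniq hab ha0 hb0 (h.symm.trans h')
    fin_cases j
    · exact hα.symm.trans (h1.trans hα')
    · exact hβ.symm.trans (h2.trans hβ')
  -- if `C` were invertible, `φ(a)` and `φ(b)` would both be multiples of the nonunit `s`
  have hdet : N = 0 → aug s = 0 → C.det = 0 := by
    intro _ hs
    by_contra hC
    have hdu : IsUnit (c₁₁ * c₂₂ - c₁₂ * c₂₁) := hunit _ (by
      simpa [C, Matrix.det_fin_two] using hC)
    obtain ⟨d, hd⟩ := hdu.exists_left_inv
    have e1 : φ a = s * (d * (c₂₂ * a - c₁₂ * b)) := by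
      linear_combination (-φ a) * hd + d * c₂₂ * hsa - d * c₁₂ * hsb
    have e2 : φ b = s * (d * (c₁₁ * b - c₂₁ * a)) := by
      linear_combination (-φ b) * hd + d * c₁₁ * hsb - d * c₂₁ * hsa
    set a' := d * (c₂₂ * a - c₁₂ * b)
    set b' := d * (c₁₁ * b - c₂₁ * a)
    obtain ⟨e, h1, h2⟩ := hφab.rel b' (-a') (by rw [e1, e2]; ring)
    obtain ⟨f, hf⟩ := (hunit (1 - e * s) (by
      rw [map_sub, map_one, map_mul, hs, mul_zero, sub_zero]; exact one_ne_zero)).exists_left_inv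
    have hb' : b' = 0 := by
      linear_combination (-b') * hf + f * h1 + f * e * e2
    have ha' : a' = 0 := by
      linear_combination (-a') * hf - f * h2 + f * e * e1
    refine hone ?_
    rw [hφab.inj 1 (by rw [e1, ha']; ring) (by rw [e2, hb']; ring), map_zero]
  obtain ⟨v, hv, hvN, hvC⟩ := exists_common_left_kernel hnilN hNC hdet
  have hN0 := congrFun hvN 0
  have hN1 := congrFun hvN 1
  have hC0 := congrFun hvC 0
  have hC1 := congrFun hvC 1
  simp [N, C, Matrix.vecMul, dotProduct, Fin.sum_univ_two] at hN0 hN1 hC0 hC1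
  by_cases h0 : v 0 = 0
  · have h1 : v 1 ≠ 0 := fun h1 => hv (by
      funext i
      fin_cases i
      · exact h0
      · exact h1)
    rw [h0, zero_mul, zero_add, mul_eq_zero, or_iff_right h1] at hN0 hN1 hC0 hC1
    have := hasGoodGenerators_of_row (aug := aug) (φ := φ) (n₁₁ := n₂₂) (n₁₂ := n₂₁)
      (n₂₁ := n₁₂) (n₂₂ := n₁₁) (c₁₁ := c₂₂) (c₁₂ := c₂₁)
      (c₂₁ := c₁₂) (c₂₂ := c₁₁) hab.symm (by rw [← hb]; ring) (by rw [← ha]; ring)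
      (by rw [← hsb]; ring) (by rw [← hsa]; ring) 0
      (by rw [hN1, zero_mul, zero_add]) (by rw [hN0, zero_mul, zero_add])
      (by rw [hC1, zero_mul, zero_add]) (by rw [hC0, zero_mul, zero_add])
    obtain ⟨a', b', h1, h2⟩ := this
    exact ⟨a', b', by rw [h1, Set.pair_comm], h2⟩
  · refine hasGoodGenerators_of_row hab ha.symm hb.symm hsa.symm hsb.symm (v 1 / v 0) ?_ ?_ ?_ ?_ <;>
      field_simp
    · linear_combination hN0
    · linear_combination hN1
    · linear_combination hC0
    · linear_combination hC1

end Generators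

/-! ### The torsion-free class attached to an ideal of the completed group algebra -/

section IdealClass

variable {k : Type u} [Field k] {O : Type u} [CommRing O] {ϖ : O}

lemma phi_val_one (a : iwasawa k O ϖ) :
    (phi k O ϖ a).1 1 = algebraMap k _ (aug k O ϖ a) := by
  change phiLev k O ϖ 1 (a.1 1) = algebraMap k _
    (AddMonoidAlgebra.lift k k (O ⧸ lev O ϖ 0) 1 (a.1 0))
  rw [← a.2 0]
  induction a.1 (0 + 1) using lev_induction with
  | zero => simp only [map_zero]
  | add a b ha hb => simp only [map_add, ha, hb]
  | single z c =>
    have h : Ideal.Quotient.mk (lev O ϖ (0 + 1)) (ϖ * z) = 0 := by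
      rw [Ideal.Quotient.eq_zero_iff_mem, Ideal.mem_span_singleton, zero_add, pow_one]
      exact dvd_mul_right _ _
    rw [phiLev_single, transition_single, h]
    simp [AddMonoidAlgebra.coe_algebraMap]

lemma phi_iterate_dirac (n : ℕ) (z : O) :
    (phi k O ϖ)^[n] (dirac k ϖ z) = dirac k ϖ (ϖ ^ n * z) := by
  induction n with
  | zero => simp
  | succ n ih => rw [Function.iterate_succ_apply', ih, phi_dirac, pow_succ', mul_assoc]

lemma phi_iterate_eq_pow (n : ℕ) (a : iwasawa k O ϖ) :
    (phi k O ϖ)^[n] a = (phi k O ϖ ^ n) a := by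
  rw [AlgHom.coe_pow]

variable {p : ℕ} [Fact p.Prime] [CharP k p] {e : ℕ} {e₁ e₂ : O} (hb : IsPadicBasis p ϖ e e₁ e₂)
include hb

/-- The kernel of the projection of `k[[U]]` to level one contains the `p`-th powers of the elements
`[z] - 1`. -/
lemma dirac_sub_one_pow_prime_val (z : O) : ((dirac k ϖ z - 1) ^ p).1 1 = 0 := by
  have := hb.dirac_sub_one_val_pow k z 1
  rwa [pow_one, ← iwasawa_pow_val] at this

/-- Some power of `φ` maps the augmentation ideal `m` to `m (a, b)`, since a suitable power of `ϖ` is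
divisible by `p ^ 2`. -/
lemma exists_phi_iterate_eq {a b : iwasawa k O ϖ}
    (hker : ∀ u : iwasawa k O ϖ, u.1 1 = 0 → u ∈ Ideal.span {a, b}) :
    ∃ n : ℕ, ∀ u, aug k O ϖ u = 0 → ∃ α β, (phi k O ϖ)^[n] u = α * a + β * b ∧
      aug k O ϖ α = 0 ∧ aug k O ϖ β = 0 := by
  have hp : p ≠ 0 := (Fact.out : p.Prime).ne_zero
  obtain ⟨z₀, hz₀⟩ : (p : O) ^ 2 ∣ ϖ ^ (e * 2) := by
    rw [← Ideal.mem_span_singleton, ← hb.lev_eq]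
    exact Ideal.mem_span_singleton_self _
  have hd (z : O) : ∃ α β, (phi k O ϖ)^[e * 2] (dirac k ϖ z - 1) = α * a + β * b ∧
      aug k O ϖ α = 0 ∧ aug k O ϖ β = 0 := by
    have h1 : (phi k O ϖ)^[e * 2] (dirac k ϖ z - 1) = ((dirac k ϖ (z₀ * z) - 1) ^ p) ^ p := by
      rw [phi_iterate_eq_pow, map_sub, map_one, ← phi_iterate_eq_pow, phi_iterate_dirac, hz₀,
        mul_assoc, ← dirac_sub_one_pow, ← pow_mul, sq]
    obtain ⟨α, β, h2⟩ := Ideal.mem_span_pair.1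
      (hker _ (dirac_sub_one_pow_prime_val (k := k) hb (z₀ * z)))
    set h := dirac k ϖ (z₀ * z) - 1 with hh
    have haug : aug k O ϖ ((h ^ p) ^ (p - 1) * α) = 0 ∧ aug k O ϖ ((h ^ p) ^ (p - 1) * β) = 0 := by
      have : aug k O ϖ h = 0 := by rw [hh, map_sub, aug_dirac, map_one, sub_self]
      have h3 : p * (p - 1) ≠ 0 :=
        mul_ne_zero hp (Nat.sub_ne_zero_of_lt (Fact.out : p.Prime).one_lt)
      rw [← pow_mul, map_mul, map_mul, map_pow, this, zero_pow h3, zero_mul, zero_mul]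
      exact ⟨rfl, rfl⟩
    refine ⟨(h ^ p) ^ (p - 1) * α, (h ^ p) ^ (p - 1) * β, ?_, haug⟩
    rw [h1, mul_assoc, mul_assoc, ← mul_add, h2, ← pow_succ,
      Nat.sub_add_cancel (Nat.one_le_iff_ne_zero.2 hp)]
  refine ⟨e * 2, fun u hu => ?_⟩
  obtain ⟨f, g, rfl⟩ := hb.exists_eq_of_aug_eq_zero hu
  obtain ⟨α, β, h, hα, hβ⟩ := hd e₁
  obtain ⟨α', β', h', hα', hβ'⟩ := hd e₂
  rw [phi_iterate_eq_pow] at h h' ⊢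
  refine ⟨(phi k O ϖ ^ (e * 2)) f * α + (phi k O ϖ ^ (e * 2)) g * α',
    (phi k O ϖ ^ (e * 2)) f * β + (phi k O ϖ ^ (e * 2)) g * β', ?_, ?_, ?_⟩
  · rw [map_add, map_mul, map_mul, h, h']; ring
  · rw [map_add, map_mul, map_mul, hα, hα', mul_zero, mul_zero, add_zero]
  · rw [map_add, map_mul, map_mul, hβ, hβ', mul_zero, mul_zero, add_zero]

lemma IsPadicBasis.finite_residue : Finite (O ⧸ Ideal.span {ϖ}) := by
  have : Finite (O ⧸ Ideal.span {ϖ ^ 1}) := hb.finite_quotient 1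
  rwa [pow_one] at this

variable [IsDomain O] (hϖ : ϖ ≠ 0)
include hϖ

/-- The ideal `J` is to be thought of as the annihilator of a generator of a representation of `U`
on which the multiples of `ϖ` act trivially (`hker`) and whose invariants form a line
(`hw`, `hsoc`). Then `J` is generated by a regular sequence, which can be chosen such that the
coefficients of `φ(a)` and of `s a` vanish under the augmentation. -/
theorem exists_twistData {J : Ideal (iwasawa k O ϖ)} (hJ : J ≠ ⊤)
    (hker : ∀ u : iwasawa k O ϖ, u.1 1 = 0 → u ∈ J) {w s : iwasawa k O ϖ}
    (hw : ∀ a, aug k O ϖ a = 0 → a * w ∈ J)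
    (hsoc : ∀ u, (∀ a, aug k O ϖ a = 0 → a * u ∈ J) → ∃ c, u - c * w ∈ J)
    (hs : ∀ a, a ∈ J ↔ s * a ∈ J.map (phi k O ϖ)) :
    ∃ D : TwistData (iwasawa k O ϖ), Ideal.span {D.a, D.b} = J ∧ D.s = s ∧
      aug k O ϖ D.a = 0 ∧ aug k O ϖ D.b = 0 ∧ aug k O ϖ D.n₁.1 = 0 ∧ aug k O ϖ D.n₁.2 = 0 ∧
      aug k O ϖ D.c₁.1 = 0 ∧ aug k O ϖ D.c₁.2 = 0 := by
  have : IsDomain (iwasawa k O ϖ) := hb.isDomain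
  have : IsNoetherianRing (iwasawa k O ϖ) := hb.isNoetherianRing
  have : IsLocalRing (iwasawa k O ϖ) := hb.isLocalRing
  have := hb.finite_residue
  have hmem (u : iwasawa k O ϖ) : u ∈ IsLocalRing.maximalIdeal _ ↔ aug k O ϖ u = 0 := by
    rw [IsLocalRing.mem_maximalIdeal, mem_nonunits_iff, hb.isUnit_iff, not_not]
  have hx0 : aug k O ϖ (dirac k ϖ e₁ - 1) = 0 := by rw [map_sub, aug_dirac, map_one, sub_self]
  have hy0 : aug k O ϖ (dirac k ϖ e₂ - 1) = 0 := by rw [map_sub, aug_dirac, map_one, sub_self]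
  have hm : IsLocalRing.maximalIdeal (iwasawa k O ϖ) =
      Ideal.span {dirac k ϖ e₁ - 1, dirac k ϖ e₂ - 1} := by
    refine le_antisymm (fun u hu => ?_) (Ideal.span_le.2 ?_)
    · obtain ⟨f, g, h⟩ := hb.exists_eq_of_aug_eq_zero ((hmem u).1 hu)
      exact Ideal.mem_span_pair.2 ⟨f, g, h.symm⟩
    · rintro _ (rfl | rfl)
      · exact (hmem _).2 hx0
      · exact (hmem _).2 hy0
  obtain ⟨a, b, rfl, hab⟩ := exists_koszulExact_of_socle hm hb.koszulExact hJ (N := p)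
    (hker _ (dirac_sub_one_pow_prime_val hb e₁)) (hker _ (dirac_sub_one_pow_prime_val hb e₂))
    (hw _ hx0) (hw _ hy0) (fun u hu hu' => hsoc u fun a ha => by
      obtain ⟨f, g, rfl⟩ := hb.exists_eq_of_aug_eq_zero ha
      rw [add_mul, mul_assoc, mul_assoc]
      exact add_mem (Ideal.mul_mem_left _ _ hu) (Ideal.mul_mem_left _ _ hu'))
  have hJm {u} (hu : u ∈ Ideal.span {a, b}) : aug k O ϖ u = 0 :=
    (hmem u).1 (IsLocalRing.le_maximalIdeal hJ hu)
  have hφJ {u} (hu : u ∈ Ideal.span {a, b}) : phi k O ϖ u ∈ Ideal.span {a, b} :=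
    hker _ (by rw [phi_val_one, hJm hu, map_zero])
  have hmap (c d : iwasawa k O ϖ) : (Ideal.span {c, d}).map (phi k O ϖ) =
      Ideal.span {phi k O ϖ c, phi k O ϖ d} := by
    rw [Ideal.map_span, Set.image_pair]
  have ha : a ∈ Ideal.span {a, b} := Ideal.subset_span (Set.mem_insert _ _)
  have hb' : b ∈ Ideal.span {a, b} := Ideal.subset_span (Set.mem_insert_of_mem _ rfl)
  obtain ⟨n, hn⟩ := exists_phi_iterate_eq hb hker
  obtain ⟨a', b', hspan, hab', ⟨n₁, n₂, hna, hn₁, hn₂⟩, ⟨c₁, c₂, hca, hc₁, hc₂⟩⟩ :=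
    hasGoodGenerators (aug := aug k O ϖ) (φ := phi k O ϖ) (s := s) (aug_phi k O ϖ)
      (fun u hu => hb.isUnit_of_aug_ne_zero hu) hab (hab.phi hϖ) (hJm ha) (hJm hb') (hφJ ha)
      (hφJ hb') (by rw [← hmap]; exact (hs a).1 ha) (by rw [← hmap]; exact (hs b).1 hb')
      ⟨n, fun u hu => hn u (hJm (Ideal.subset_span hu))⟩
  rw [← hspan] at hJm hφJ hs
  have ha' : a' ∈ Ideal.span {a', b'} := Ideal.subset_span (Set.mem_insert _ _)
  have hb'' : b' ∈ Ideal.span {a', b'} := Ideal.subset_span (Set.mem_insert_of_mem _ rfl)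
  obtain ⟨m₁, m₂, hmb⟩ := Ideal.mem_span_pair.1 (hφJ hb'')
  have hsb := (hs b').1 hb''
  rw [hmap] at hsb
  obtain ⟨d₁, d₂, hdb⟩ := Ideal.mem_span_pair.1 hsb
  refine ⟨⟨a', b', s, (n₁, n₂), (m₁, m₂), (c₁, c₂), (d₁, d₂), ?_, ?_, ?_, ?_,
    fun n => koszul_iterate hϖ hab' n, fun n x hx => inj_iterate hϖ (fun x hx => ?_) n x hx⟩,
    hspan, rfl, hJm ha', hJm hb'', hn₁, hn₂, hc₁, hc₂⟩
  · rw [φ_eq_phi]; exact hna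
  · rw [φ_eq_phi]; exact hmb.symm
  · rw [φ_eq_phi, φ_eq_phi]; exact hca
  · rw [φ_eq_phi, φ_eq_phi]; exact hdb.symm
  · obtain ⟨f, g, h⟩ := hx
    have := (hs x).2 (by rw [hmap, mul_comm, h]; exact Ideal.mem_span_pair.2 ⟨f, g, rfl⟩)
    obtain ⟨f, g, h⟩ := Ideal.mem_span_pair.1 this
    exact ⟨f, g, h.symm⟩

/-- A module over `k[[U]][X]_φ` whose extension of scalars is presented by an ideal `J` as
in `exists_twistData` and the element `1 + φ(s) X²` has a torsion-free class in its second `Tor`. -/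
theorem tor_two_of_ideal {k' : Type u} [Field k'] [Algebra k k'] [FiniteDimensional k k']
    {J : Ideal (iwasawa k' O ϖ)} (hJ : J ≠ ⊤)
    (hker : ∀ u : iwasawa k' O ϖ, u.1 1 = 0 → u ∈ J) {w s : iwasawa k' O ϖ}
    (hw : ∀ a, aug k' O ϖ a = 0 → a * w ∈ J)
    (hsoc : ∀ u, (∀ a, aug k' O ϖ a = 0 → a * u ∈ J) → ∃ c, u - c * w ∈ J)
    (hs : ∀ a, a ∈ J ↔ s * a ∈ J.map (phi k' O ϖ))
    {M : Type u} [AddCommGroup M] [Module (Twisted k O ϖ) M] (ε : Twisted k' O ϖ →+ M)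
    (hε : ∀ P Q, ε (skewBaseChange O ϖ (algebraMap k k') P * Q) = P • ε Q)
    (hsurj : Function.Surjective ε)
    (hεker : ∀ Q, ε Q = 0 ↔ ∃ R : Twisted k' O ϖ,
      Q - R * (1 + SkewPolynomial.monomial 2 (phi k' O ϖ s)) ∈
        Submodule.span (Twisted k' O ϖ) (SkewPolynomial.C '' (J : Set (iwasawa k' O ϖ)))) :
    ¬ Module.IsTorsion k[X] (tor k O ϖ M 2) ∧
      ¬ Module.Finite k ((ModuleCat.restrictScalars (Polynomial.C : k →+* k[X])).obj
        (tor k O ϖ M 2)) := by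
  have hchar : CharP k' p := charP_of_injective_algebraMap (algebraMap k k').injective p
  obtain ⟨D, rfl, rfl, ha, hb', hn₁, hn₂, hc₁, hc₂⟩ := exists_twistData hb hϖ hJ hker hw hsoc hs
  have hspan (P : Twisted k' O ϖ) : P ∈ Submodule.span (Twisted k' O ϖ)
      (SkewPolynomial.C '' (Ideal.span {D.a, D.b} : Set (iwasawa k' O ϖ))) ↔
      ∃ u v, P = u * SkewPolynomial.C D.a + v * SkewPolynomial.C D.b := by
    constructor
    · intro hP
      induction hP using Submodule.span_induction with
      | mem P hP =>
        obtain ⟨c, hc, rfl⟩ := hP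
        obtain ⟨u, v, rfl⟩ := Ideal.mem_span_pair.1 hc
        exact ⟨SkewPolynomial.C u, SkewPolynomial.C v, by
          rw [← SkewPolynomial.C_mul, ← SkewPolynomial.C_mul, ← map_add]⟩
      | zero => exact ⟨0, 0, by simp⟩
      | add P Q _ _ hP hQ =>
        obtain ⟨u, v, rfl⟩ := hP
        obtain ⟨u', v', rfl⟩ := hQ
        exact ⟨u + u', v + v', by rw [add_mul, add_mul]; abel⟩
      | smul R P _ hP =>
        obtain ⟨u, v, rfl⟩ := hP
        exact ⟨R * u, R * v, by rw [smul_eq_mul, mul_add, mul_assoc, mul_assoc]⟩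
    · rintro ⟨u, v, rfl⟩
      exact add_mem
        (Submodule.smul_mem _ u (Submodule.subset_span
          ⟨_, Ideal.subset_span (Set.mem_insert _ _), rfl⟩))
        (Submodule.smul_mem _ v (Submodule.subset_span
          ⟨_, Ideal.subset_span (Set.mem_insert_of_mem _ rfl), rfl⟩))
  refine tor_two_of_twistData D (fun a ha => ?_) ha hb' hn₁ hn₂ hc₁ hc₂ ε hε hsurj fun Q => ?_
  · obtain ⟨u, v, h⟩ := hb.exists_eq_of_aug_eq_zero ha
    have hbc (z : O) : baseChange O ϖ (algebraMap k k') (dirac k ϖ z - 1) = dirac k' ϖ z - 1 := by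
      rw [map_sub, map_one]
      congr 1
      exact iwasawa.ext O ϖ fun n => by
        change AddMonoidAlgebra.map _ (AddMonoidAlgebra.single _ 1) = _
        simp [dirac_val]
    refine ⟨dirac k ϖ e₁ - 1, dirac k ϖ e₂ - 1, u, v, ?_, ?_, ?_⟩
    · rw [map_sub, aug_dirac, map_one, sub_self]
    · rw [map_sub, aug_dirac, map_one, sub_self]
    · rw [hbc, hbc, h]; ring
  · rw [hεker]
    simp only [hspan]
    have hτ : D.τ = 1 + SkewPolynomial.monomial 2 (phi k' O ϖ D.s) := by
      rw [TwistData.τ, φ_eq_phi]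
    rw [hτ]
    constructor
    · rintro ⟨R, u, v, h⟩
      exact ⟨u, v, R, by rw [← h, sub_add_cancel]⟩
    · rintro ⟨u, v, R, h⟩
      exact ⟨R, u, v, by rw [h, add_sub_cancel_right]⟩

end IdealClass

/-! ### Fixed vectors and the Bruhat decomposition -/

section FixedVectors

variable {p : ℕ} [Fact p.Prime] {k : Type*} [Field k] [CharP k p] {W : Type*} [AddCommGroup W]
  [Module k W]

/-- A finite `p`-group that acts linearly on a nonzero space in characteristic `p` has a nonzero
fixed vector. -/
lemma exists_fixed_vector {H : Type*} [Group H] [Finite H] (hH : IsPGroup p H)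
    (ρ : Representation k H W) {N : Submodule k W} (hN : ∀ h, ∀ v ∈ N, ρ h v ∈ N) (hne : N ≠ ⊥) :
    ∃ v ∈ N, v ≠ 0 ∧ ∀ h, ρ h v = v := by
  obtain ⟨v, hv, hv0⟩ := N.ne_bot_iff.1 hne
  let : Module (ZMod p) W := Module.compHom W (ZMod.castHom dvd_rfl k)
  let Y : Submodule (ZMod p) W := Submodule.span (ZMod p) (Set.range fun h => ρ h v)
  have hY : ∀ h, ∀ y ∈ Y, ρ h y ∈ Y := by
    intro h y hy
    induction hy using Submodule.span_induction with
    | mem y hy =>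
      obtain ⟨h', rfl⟩ := hy
      refine Submodule.subset_span ⟨h * h', ?_⟩
      simp
    | zero => rw [map_zero]; exact Y.zero_mem
    | add x y _ _ hx hy => rw [map_add]; exact Y.add_mem hx hy
    | smul c x _ hx =>
      have : ρ h (c • x) = c • ρ h x := map_smul (ρ h) (ZMod.castHom dvd_rfl k c) x
      rw [this]
      exact Y.smul_mem c hx
  have hYN : ∀ y ∈ Y, y ∈ N := by
    intro y hy
    induction hy using Submodule.span_induction with
    | mem y hy =>
      obtain ⟨h', rfl⟩ := hy
      exact hN h' v hv
    | zero => exact N.zero_mem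
    | add x y _ _ hx hy => exact N.add_mem hx hy
    | smul c x _ hx => exact N.smul_mem (ZMod.castHom dvd_rfl k c) hx
  have : Module.Finite (ZMod p) Y := Module.Finite.span_of_finite _ (Set.finite_range _)
  have : Finite Y := Module.finite_of_finite (ZMod p)
  have hvY : v ∈ Y := Submodule.subset_span ⟨1, by simp⟩
  have : Nontrivial Y := ⟨⟨⟨v, hvY⟩, 0, fun h => hv0 (congrArg Subtype.val h)⟩⟩
  let : MulAction H Y :=
    { smul := fun h y => ⟨ρ h y, hY h y y.2⟩
      one_smul := fun y => Subtype.ext (by change ρ 1 y.1 = y.1; simp)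
      mul_smul := fun g h y => Subtype.ext (by
        change ρ (g * h) y.1 = ρ g (ρ h y.1); simp) }
  have hcard : p ∣ Nat.card Y := by
    have := Module.natCard_eq_pow_finrank (K := ZMod p) (V := Y)
    rw [this, Nat.card_zmod]
    exact dvd_pow_self p Module.finrank_pos.ne'
  obtain ⟨y, hy, hy0⟩ := hH.exists_fixed_point_of_prime_dvd_card_of_fixed_point Y hcard
    (a := 0) (fun h => Subtype.ext (map_zero (ρ h)))
  exact ⟨y, hYN y y.2, fun h => hy0 (Subtype.ext h.symm), fun h => congrArg Subtype.val (hy h)⟩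

end FixedVectors

section Matrices

variable {R : Type*} [CommRing R]

/-- The matrix `(0, 1; -1, 0)`. -/
def weyl : GL (Fin 2) R where
  val := !![0, 1; -1, 0]
  inv := !![0, -1; 1, 0]
  val_inv := by ext i j; fin_cases i <;> fin_cases j <;> simp
  inv_val := by ext i j; fin_cases i <;> fin_cases j <;> simp

/-- The diagonal matrix with entries `a` and `d`. -/
def dia (a d : Rˣ) : GL (Fin 2) R where
  val := !![(a : R), 0; 0, (d : R)]
  inv := !![((a⁻¹ : Rˣ) : R), 0; 0, ((d⁻¹ : Rˣ) : R)]
  val_inv := by ext i j; fin_cases i <;> fin_cases j <;> simp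
  inv_val := by ext i j; fin_cases i <;> fin_cases j <;> simp

/-- The unipotent matrix `(1, x; 0, 1)`. -/
def upp (x : R) : GL (Fin 2) R := GeneralLinearGroup.upperRightHom x

lemma upp_val (x : R) : ((upp x : GL (Fin 2) R) : Matrix (Fin 2) (Fin 2) R) = !![1, x; 0, 1] := by
  ext i j; fin_cases i <;> fin_cases j <;> simp [upp]

lemma weyl_val : ((weyl : GL (Fin 2) R) : Matrix (Fin 2) (Fin 2) R) = !![0, 1; -1, 0] := rfl

lemma dia_val (a d : Rˣ) :
    ((dia a d : GL (Fin 2) R) : Matrix (Fin 2) (Fin 2) R) = !![(a : R), 0; 0, (d : R)] := rfl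

lemma upp_add (x y : R) : upp (x + y) = upp x * upp y := by
  apply Units.ext
  simp only [Units.val_mul, upp_val]
  ext i j; fin_cases i <;> fin_cases j <;> simp [add_comm]

lemma upp_zero : upp (0 : R) = 1 := by
  apply Units.ext
  rw [upp_val, Units.val_one, Matrix.one_fin_two]

lemma upp_neg_mul (x : R) : upp (-x) * upp x = 1 := by
  rw [← upp_add, neg_add_cancel, upp_zero]

lemma dia_mul (a d a' d' : Rˣ) : dia a d * dia a' d' = dia (a * a') (d * d') := by
  apply Units.ext
  simp only [Units.val_mul, dia_val]
  ext i j; fin_cases i <;> fin_cases j <;> simp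

lemma dia_one : dia (1 : Rˣ) 1 = 1 := by
  apply Units.ext
  rw [dia_val, Units.val_one, Units.val_one, Matrix.one_fin_two]

lemma dia_mul_upp (a d : Rˣ) (x : R) : dia a d * upp x = upp (a * ↑d⁻¹ * x) * dia a d := by
  apply Units.ext
  simp only [Units.val_mul, dia_val, upp_val]
  ext i j; fin_cases i <;> fin_cases j <;> simp
  linear_combination (-(a : R) * x) * d.inv_mul

lemma dia_mul_weyl (a d : Rˣ) : dia a d * weyl = weyl * dia d a := by
  apply Units.ext
  simp only [Units.val_mul, dia_val, weyl_val]
  ext i j; fin_cases i <;> fin_cases j <;> simp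

lemma weyl_mul_weyl : (weyl : GL (Fin 2) R) * weyl = dia (-1) (-1) := by
  apply Units.ext
  simp only [Units.val_mul, dia_val, weyl_val]
  ext i j; fin_cases i <;> fin_cases j <;> simp

lemma weyl_mul_upp_mul_weyl (a : Rˣ) : weyl * upp (a : R) * weyl =
    upp (-↑a⁻¹ : R) * dia (-a⁻¹) (-a) * weyl *
      upp (-↑a⁻¹ : R) := by
  apply Units.ext
  simp only [Units.val_mul, dia_val, weyl_val, upp_val]
  ext i j; fin_cases i <;> fin_cases j <;> simp

/-- The Bruhat decomposition of `GL_2` over a field. -/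
lemma bruhat {κ : Type*} [Field κ] (g : GL (Fin 2) κ) :
    (∃ a d x, g = dia a d * upp x) ∨ ∃ y a d x, g = upp y * dia a d * weyl * upp x := by
  have hdet : g 0 0 * g 1 1 - g 0 1 * g 1 0 ≠ 0 := by
    rw [← Matrix.det_fin_two]
    exact ((Matrix.isUnit_iff_isUnit_det _).1 g.isUnit).ne_zero
  by_cases h : g 1 0 = 0
  · rw [h, mul_zero, sub_zero] at hdet
    have h0 := left_ne_zero_of_mul hdet
    refine Or.inl ⟨Units.mk0 _ h0, Units.mk0 _ (right_ne_zero_of_mul hdet), g 0 1 / g 0 0, ?_⟩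
    apply Units.ext
    simp only [Units.val_mul, dia_val, upp_val]
    ext i j; fin_cases i <;> fin_cases j <;> simp [h, mul_div_cancel₀ _ h0]
  · refine Or.inr ⟨g 0 0 / g 1 0, Units.mk0 (-(g 0 0 * g 1 1 - g 0 1 * g 1 0) / g 1 0)
      (div_ne_zero (neg_ne_zero.2 hdet) h), Units.mk0 (-g 1 0) (neg_ne_zero.2 h), g 1 1 / g 1 0, ?_⟩
    apply Units.ext
    simp only [Units.val_mul, dia_val, weyl_val, upp_val]
    ext i j; fin_cases i <;> fin_cases j <;> simp <;> field_simp
    ring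

end Matrices

section Eigenvectors

variable {κ : Type*} [Field κ] [Finite κ] {k : Type*} [Field k]
  {W : Type*} [AddCommGroup W] [Module k W]

/-- An endomorphism of a nonzero space whose order divides `q - 1`, where the base field contains a
field with `q` elements, has an eigenvector. -/
lemma exists_eigenvector (τ : κ →+* k) (T : Module.End k W) {N : Submodule k W}
    (hN : ∀ v ∈ N, T v ∈ N)
    (hne : N ≠ ⊥) (hT : ∀ v ∈ N, (T ^ Nat.card κ) v = T v) :
    ∃ v ∈ N, v ≠ 0 ∧ ∃ c : k, T v = c • v := by
  have := Fintype.ofFinite κ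
  by_contra! hcon
  have key (s : Finset κ) : ∀ v ∈ N, v ≠ 0 →
      aeval T (∏ a ∈ s, (X - Polynomial.C (τ a))) v ∈ N ∧
        aeval T (∏ a ∈ s, (X - Polynomial.C (τ a))) v ≠ 0 := by
    classical
    induction s using Finset.induction_on with
    | empty => intro v hv hv0; simpa using ⟨hv, hv0⟩
    | insert a s ha ih =>
      intro v hv hv0
      obtain ⟨h1, h2⟩ := ih v hv hv0
      rw [Finset.prod_insert ha, map_mul, Module.End.mul_apply]
      generalize aeval T (∏ a ∈ s, (X - Polynomial.C (τ a))) v = z at h1 h2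
      have h3 : aeval T (X - Polynomial.C (τ a)) z = T z - τ a • z := by simp
      rw [h3]
      exact ⟨sub_mem (hN z h1) (N.smul_mem _ h1), sub_ne_zero.2 (hcon z h1 h2 _)⟩
  obtain ⟨v, hv, hv0⟩ := N.ne_bot_iff.1 hne
  refine (key Finset.univ v hv hv0).2 ?_
  have h1 : ∏ a : κ, (X - Polynomial.C (τ a)) = (X ^ Nat.card κ - X : k[X]) := by
    rw [Nat.card_eq_fintype_card]
    have h2 : ∏ a : κ, (X - Polynomial.C a) = (X ^ Fintype.card κ - X : κ[X]) := by
      have hr := FiniteField.roots_X_pow_card_sub_X κ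
      have h3 := Polynomial.prod_multiset_X_sub_C_of_monic_of_roots_card_eq
        (p := (X ^ Fintype.card κ - X : κ[X]))
        (monic_X_pow_sub (by rw [degree_X]; exact_mod_cast Fintype.one_lt_card))
        (by rw [hr, FiniteField.X_pow_card_sub_X_natDegree_eq κ Fintype.one_lt_card]; rfl)
      rwa [hr] at h3
    have := congrArg (Polynomial.map τ) h2
    simpa [Polynomial.map_prod] using this
  rw [h1]
  simpa [sub_eq_zero] using hT v hv

end Eigenvectors

/-! ### Irreducible representations of `GL_2` over a finite field -/

section FiniteGL

variable {κ : Type*} [Field κ]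
  {k : Type*} [Field k] {W : Type*} [AddCommGroup W] [Module k W]
  (ρ : Representation k (GL (Fin 2) κ) W)

/-- `v` is a nonzero vector that is fixed by the unipotent upper triangular matrices and is an
eigenvector of the diagonal matrices. -/
structure IsHighest (v : W) : Prop where
  ne_zero : v ≠ 0
  fixed (x : κ) : ρ (upp x) v = v
  torus (a d : κˣ) : ∃ c : k, ρ (dia a d) v = c • v

lemma upp_mul_dia {R : Type*} [CommRing R] (a d : Rˣ) (x : R) :
    upp x * dia a d = dia a d * upp (↑a⁻¹ * d * x) := by
  rw [dia_mul_upp]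
  congr 2
  linear_combination (-(d : R) * ↑d⁻¹ * x) * a.mul_inv - x * d.mul_inv

lemma dia_pow {R : Type*} [CommRing R] (a d : Rˣ) (n : ℕ) : dia a d ^ n = dia (a ^ n) (d ^ n) := by
  induction n with
  | zero => simp [dia_one]
  | succ n ih => rw [pow_succ, ih, dia_mul, pow_succ, pow_succ]

/-- The subspace of the vectors that are fixed by the unipotent upper triangular matrices. -/
def uppFixed : Submodule k W where
  carrier := {v | ∀ x, ρ (upp x) v = v}
  zero_mem' x := map_zero _
  add_mem' hv hw x := by rw [map_add, hv x, hw x]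
  smul_mem' c v hv x := by rw [map_smul, hv x]

lemma uppFixed_ne_bot {p : ℕ} [Fact p.Prime] [CharP κ p] [Finite κ] [CharP k p]
    [Nontrivial W] : uppFixed ρ ≠ ⊥ := by
  have hp : IsPGroup p (Multiplicative κ) := fun x => ⟨1, by
    rw [pow_one]
    change Multiplicative.ofAdd (p • Multiplicative.toAdd x) = 1
    rw [nsmul_eq_mul, CharP.cast_eq_zero, zero_mul]
    rfl⟩
  let η : Representation k (Multiplicative κ) W := ρ.comp
    { toFun := fun x => upp (Multiplicative.toAdd x)
      map_one' := upp_zero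
      map_mul' := fun x y => upp_add (R := κ) (Multiplicative.toAdd x) (Multiplicative.toAdd y) }
  obtain ⟨v, -, hv0, hv⟩ := exists_fixed_vector hp η (N := ⊤) (by simp) top_ne_bot
  exact (Submodule.ne_bot_iff _).2 ⟨v, fun x => hv (Multiplicative.ofAdd x), hv0⟩

lemma dia_mem_uppFixed (a d : κˣ) {v : W} (hv : v ∈ uppFixed ρ) : ρ (dia a d) v ∈ uppFixed ρ := by
  intro x
  rw [← Module.End.mul_apply, ← map_mul, upp_mul_dia, map_mul, Module.End.mul_apply, hv]

/-- The nonzero space of vectors fixed by the unipotent matrices contains an eigenvector of the diagonal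
matrices, since these form an abelian group whose exponent divides `q - 1`. -/
lemma exists_isHighest {p : ℕ} [Fact p.Prime] [CharP κ p] [Finite κ] [CharP k p] (τ : κ →+* k)
    [Nontrivial W] : ∃ v, IsHighest ρ v := by
  obtain ⟨ζ, hζ⟩ := IsCyclic.exists_monoid_generator (α := κˣ)
  have hcard : ζ ^ Nat.card κ = ζ := by
    have := Fintype.ofFinite κ
    apply Units.ext
    rw [Units.val_pow_eq_pow_val, Nat.card_eq_fintype_card, FiniteField.pow_card]
  obtain ⟨v₁, hv₁, hv₁0, c₁, hc₁⟩ := exists_eigenvector τ (ρ (dia ζ 1)) (N := uppFixed ρ)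
    (fun v hv => dia_mem_uppFixed ρ _ _ hv) (uppFixed_ne_bot (p := p) ρ) (fun v _ => by
      rw [← map_pow, dia_pow, hcard, one_pow])
  let N : Submodule k W := uppFixed ρ ⊓ Module.End.eigenspace (ρ (dia ζ 1)) c₁
  obtain ⟨v₂, hv₂, hv₂0, c₂, hc₂⟩ := exists_eigenvector τ (ρ (dia 1 ζ)) (N := N)
    (fun v hv => ⟨dia_mem_uppFixed ρ _ _ hv.1, by
      refine Module.End.mem_eigenspace_iff.2 ?_
      have hcomm : dia ζ 1 * dia 1 ζ = dia 1 ζ * dia ζ 1 := by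
        rw [dia_mul, dia_mul, mul_comm ζ, mul_comm 1 ζ]
      rw [← Module.End.mul_apply, ← map_mul, hcomm, map_mul, Module.End.mul_apply,
        Module.End.mem_eigenspace_iff.1 hv.2, map_smul]⟩)
    ((Submodule.ne_bot_iff _).2 ⟨v₁, ⟨hv₁, Module.End.mem_eigenspace_iff.2 hc₁⟩, hv₁0⟩)
    (fun v _ => by rw [← map_pow, dia_pow, hcard, one_pow])
  refine ⟨v₂, hv₂0, hv₂.1, fun a d => ?_⟩
  obtain ⟨n, rfl⟩ := hζ a
  obtain ⟨m, rfl⟩ := hζ d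
  have h1 : dia (ζ ^ n) (ζ ^ m) = dia ζ 1 ^ n * dia 1 ζ ^ m := by
    rw [dia_pow, dia_pow, dia_mul, one_pow, one_pow, one_mul, mul_one]
  have h2 (T : Module.End k W) (c : k) (hT : T v₂ = c • v₂) (n : ℕ) : (T ^ n) v₂ = c ^ n • v₂ := by
    induction n with
    | zero => simp
    | succ n ih => rw [pow_succ, Module.End.mul_apply, hT, map_smul, ih, smul_smul, pow_succ,
        mul_comm]
  refine ⟨c₂ ^ m * c₁ ^ n, ?_⟩
  rw [h1, map_mul, map_pow, map_pow, Module.End.mul_apply, h2 _ _ hc₂, map_smul,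
    h2 _ _ (Module.End.mem_eigenspace_iff.1 hv₂.2), smul_smul]

namespace IsHighest

variable {ρ} {v : W}

lemma dia_weyl (hv : IsHighest ρ v) (a d : κˣ) :
    ∃ c : k, ρ (dia a d) (ρ weyl v) = c • ρ weyl v := by
  obtain ⟨c, hc⟩ := hv.torus d a
  refine ⟨c, ?_⟩
  rw [← Module.End.mul_apply, ← map_mul, dia_mul_weyl, map_mul, Module.End.mul_apply, hc, map_smul]

lemma weyl_weyl (hv : IsHighest ρ v) : ∃ c : k, c ≠ 0 ∧ ρ weyl (ρ weyl v) = c • v := by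
  obtain ⟨c, hc⟩ := hv.torus (-1) (-1)
  rw [← weyl_mul_weyl, map_mul, Module.End.mul_apply] at hc
  refine ⟨c, ?_, hc⟩
  rintro rfl
  rw [zero_smul] at hc
  have := congrArg (ρ (weyl⁻¹) ∘ ρ (weyl⁻¹)) hc
  simp at this
  exact hv.ne_zero this

lemma weyl_upp_weyl (hv : IsHighest ρ v) (a : κˣ) :
    ∃ c : k, ρ weyl (ρ (upp (a : κ)) (ρ weyl v)) = c • ρ (upp (-↑a⁻¹ : κ)) (ρ weyl v) := by
  obtain ⟨c, hc⟩ := hv.dia_weyl (-a⁻¹) (-a)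
  refine ⟨c, ?_⟩
  rw [← Module.End.mul_apply, ← Module.End.mul_apply, ← map_mul, ← map_mul,
    weyl_mul_upp_mul_weyl, map_mul, map_mul, map_mul, Module.End.mul_apply, Module.End.mul_apply,
    Module.End.mul_apply, hv.fixed, hc, map_smul]

variable (ρ v) in
/-- The span of the translates of `weyl v` under the unipotent upper triangular matrices. -/
def big : Submodule k W := Submodule.span k (Set.range fun x => ρ (upp x) (ρ weyl v))

lemma mem_big (x : κ) : ρ (upp x) (ρ weyl v) ∈ big ρ v := Submodule.subset_span ⟨x, rfl⟩

lemma map_mem_big {g : GL (Fin 2) κ} (h : ∀ x, ρ g (ρ (upp x) (ρ weyl v)) ∈ big ρ v) {y : W}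
    (hy : y ∈ big ρ v) : ρ g y ∈ big ρ v := by
  have : big ρ v ≤ (big ρ v).comap (ρ g) := Submodule.span_le.2 (by rintro _ ⟨x, rfl⟩; exact h x)
  exact this hy

lemma upp_mem_big (x : κ) {y : W} (hy : y ∈ big ρ v) : ρ (upp x) y ∈ big ρ v :=
  map_mem_big (fun z => by
    rw [← Module.End.mul_apply (ρ _), ← map_mul, ← upp_add]
    exact mem_big _) hy

lemma weyl_upp_weyl_mem (hv : IsHighest ρ v) (a : κˣ) :
    ρ weyl (ρ (upp (a : κ)) (ρ weyl v)) ∈ big ρ v := by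
  obtain ⟨c, hc⟩ := hv.weyl_upp_weyl a
  rw [hc]
  exact Submodule.smul_mem _ _ (mem_big _)

/-- If the span of the translates of `weyl v` contains `v`, then it is a subrepresentation, by the
Bruhat decomposition. -/
lemma big_eq_top (hv : IsHighest ρ v)
    (hirr : ∀ N : Submodule k W, (∀ g, ∀ v ∈ N, ρ g v ∈ N) → N = ⊥ ∨ N = ⊤)
    (h : v ∈ big ρ v) : big ρ v = ⊤ := by
  have hw : ∀ y ∈ big ρ v, ρ weyl y ∈ big ρ v := fun y => map_mem_big fun x => by
    rcases eq_or_ne x 0 with rfl | hx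
    · rw [upp_zero, map_one, Module.End.one_apply]
      obtain ⟨c, -, hc⟩ := hv.weyl_weyl
      rw [hc]
      exact Submodule.smul_mem _ _ h
    · exact hv.weyl_upp_weyl_mem (Units.mk0 x hx)
  have hd (a d : κˣ) : ∀ y ∈ big ρ v, ρ (dia a d) y ∈ big ρ v := fun y => map_mem_big fun x => by
    obtain ⟨c, hc⟩ := hv.dia_weyl a d
    rw [← Module.End.mul_apply (ρ _), ← map_mul, dia_mul_upp, map_mul, Module.End.mul_apply, hc,
      map_smul]
    exact Submodule.smul_mem _ _ (mem_big _)
  refine (hirr (big ρ v) fun g y hy => ?_).resolve_left fun h0 => ?_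
  · obtain ⟨a, d, x, rfl⟩ | ⟨z, a, d, x, rfl⟩ := bruhat g
    · rw [map_mul]
      exact hd _ _ _ (upp_mem_big _ hy)
    · rw [map_mul, map_mul, map_mul]
      exact upp_mem_big _ (hd _ _ _ (hw _ (upp_mem_big _ hy)))
  · rw [h0, Submodule.mem_bot] at h
    exact hv.ne_zero h

end IsHighest

section Sum

variable [Fintype κ]

/-- The sum of the translates of `v` under the unipotent upper triangular matrices. -/
def uppSum (v : W) : W := ∑ x : κ, ρ (upp x) v

lemma upp_uppSum (x : κ) (v : W) : ρ (upp x) (uppSum ρ v) = uppSum ρ v := by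
  rw [uppSum, map_sum]
  refine Fintype.sum_equiv (Equiv.addLeft x) _ _ fun y => ?_
  rw [← Module.End.mul_apply, ← map_mul, ← upp_add]
  rfl

lemma uppSum_upp (x : κ) (v : W) : uppSum ρ (ρ (upp x) v) = uppSum ρ v := by
  rw [uppSum]
  refine Fintype.sum_equiv (Equiv.addRight x) _ _ fun y => ?_
  rw [← Module.End.mul_apply, ← map_mul, ← upp_add]
  rfl

namespace IsHighest

variable {ρ} {v : W}

/-- Apply the Weyl element to `∑ x, upp x (weyl v) = 0`: the term for `x = 0` is a multiple of `v`, and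
the others lie in the span of the translates of `weyl v`. -/
lemma mem_big_of_uppSum_eq_zero (hv : IsHighest ρ v) (h : uppSum ρ (ρ weyl v) = 0) :
    v ∈ big ρ v := by
  classical
  obtain ⟨c, hc0, hc⟩ := hv.weyl_weyl
  have h1 := congrArg (ρ weyl) h
  rw [uppSum, map_sum, map_zero, ← Finset.add_sum_erase _ _ (Finset.mem_univ 0), upp_zero, map_one,
    Module.End.one_apply, hc] at h1
  have h2 : ∑ x ∈ Finset.univ.erase (0 : κ), ρ weyl (ρ (upp x) (ρ weyl v)) ∈ big ρ v :=
    sum_mem fun x hx => hv.weyl_upp_weyl_mem (Units.mk0 x (Finset.ne_of_mem_erase hx))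
  have h3 : c • v ∈ big ρ v := by
    rw [eq_neg_of_add_eq_zero_left h1]
    exact neg_mem h2
  exact (Submodule.smul_mem_iff _ hc0).1 h3

lemma uppSum_weyl (hv : IsHighest ρ v) (h0 : uppSum ρ (ρ weyl v) ≠ 0) :
    IsHighest ρ (uppSum ρ (ρ weyl v)) where
  ne_zero := h0
  fixed x := upp_uppSum ρ x _
  torus a d := by
    obtain ⟨c, hc⟩ := hv.dia_weyl a d
    refine ⟨c, ?_⟩
    rw [uppSum, map_sum, Finset.smul_sum]
    refine Fintype.sum_equiv ((a * d⁻¹).mulLeft) _ _ fun x => ?_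
    rw [← Module.End.mul_apply, ← map_mul, dia_mul_upp, map_mul, Module.End.mul_apply, hc, map_smul]
    rfl

/-- Passing from `v` to `∑ x, upp x (weyl v)` a second time gives a multiple of the vector found the
first time. Hence one of the two vectors lies in the span of the translates of its image under the
Weyl element. -/
lemma uppSum_weyl_uppSum_weyl (hv : IsHighest ρ v) {p : ℕ} [CharP κ p] [CharP k p] :
    ∃ c : k, uppSum ρ (ρ weyl (uppSum ρ (ρ weyl v))) = c • uppSum ρ (ρ weyl v) := by
  classical
  obtain ⟨c, -, hc⟩ := hv.weyl_weyl
  choose d hd using hv.weyl_upp_weyl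
  have hlin : ∀ y z, uppSum ρ (y + z) = uppSum ρ y + uppSum ρ z := fun y z => by
    simp only [uppSum, map_add, Finset.sum_add_distrib]
  have hsmul : ∀ (c : k) y, uppSum ρ (c • y) = c • uppSum ρ y := fun c y => by
    simp only [uppSum, map_smul, Finset.smul_sum]
  have hzero : uppSum ρ v = 0 := by
    have : ((Fintype.card κ : ℕ) : k) = 0 := by
      rw [CharP.cast_eq_zero_iff k p]
      exact (CharP.cast_eq_zero_iff κ p _).1 (Nat.cast_card_eq_zero κ)
    simp only [uppSum, hv.fixed, Finset.sum_const, Finset.card_univ]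
    rw [← Nat.cast_smul_eq_nsmul k, this, zero_smul]
  let S : Module.End k W := ⟨⟨uppSum ρ, hlin⟩, hsmul⟩
  have h1 : ρ weyl (uppSum ρ (ρ weyl v)) =
      c • v + ∑ a : κˣ, d a • ρ (upp (-↑a⁻¹ : κ)) (ρ weyl v) := by
    rw [uppSum, map_sum, ← Finset.add_sum_erase _ _ (Finset.mem_univ 0), upp_zero, map_one,
      Module.End.one_apply, hc]
    congr 1
    symm
    refine Finset.sum_bij (fun a _ => (a : κ)) (fun a _ => ?_) (fun a _ b _ h => Units.ext h)
      (fun x hx => ⟨Units.mk0 x (Finset.ne_of_mem_erase hx), Finset.mem_univ _, rfl⟩)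
      (fun a _ => (hd a).symm)
    exact Finset.mem_erase.2 ⟨a.ne_zero, Finset.mem_univ _⟩
  refine ⟨∑ a : κˣ, d a, ?_⟩
  change S (ρ weyl (uppSum ρ (ρ weyl v))) = _
  rw [h1, map_add, map_smul, map_sum, Finset.sum_smul]
  change c • uppSum ρ v + _ = _
  rw [hzero, smul_zero, zero_add]
  refine Finset.sum_congr rfl fun a _ => ?_
  rw [map_smul]
  exact congrArg (d a • ·) (uppSum_upp ρ _ _)

end IsHighest

end Sum

/-- An irreducible representation of `GL_2` of a finite field in the defining characteristic is
generated, as a representation of the unipotent upper triangular matrices, by the image under the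
Weyl element of a vector that is fixed by them. -/
theorem exists_fixed_span_weyl_eq_top {p : ℕ} [Fact p.Prime] [CharP κ p] [Finite κ]
    [CharP k p] (τ : κ →+* k) [Nontrivial W]
    (hirr : ∀ N : Submodule k W, (∀ g, ∀ v ∈ N, ρ g v ∈ N) → N = ⊥ ∨ N = ⊤) :
    ∃ v ≠ 0, (∀ x, ρ (upp x) v = v) ∧
      Submodule.span k (Set.range fun x => ρ (upp x) (ρ weyl v)) = ⊤ := by
  have := Fintype.ofFinite κ
  obtain ⟨v, hv⟩ := exists_isHighest (p := p) ρ τ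
  by_cases h0 : uppSum ρ (ρ weyl v) = 0
  · exact ⟨v, hv.ne_zero, hv.fixed, hv.big_eq_top hirr (hv.mem_big_of_uppSum_eq_zero h0)⟩
  · have hv' := hv.uppSum_weyl h0
    obtain ⟨c, hc⟩ := hv.uppSum_weyl_uppSum_weyl (p := p)
    refine ⟨_, hv'.ne_zero, hv'.fixed, hv'.big_eq_top hirr ?_⟩
    by_cases hc0 : c = 0
    · exact hv'.mem_big_of_uppSum_eq_zero (by rw [hc, hc0, zero_smul])
    · refine (Submodule.smul_mem_iff _ hc0).1 ?_
      rw [← hc]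
      exact sum_mem fun x _ => IsHighest.mem_big x

/-- The vectors that are fixed by the unipotent upper triangular matrices form a line in an
irreducible representation. This follows from the existence of a generator of the dual. -/
theorem eq_smul_of_upp_fixed {p : ℕ} [Fact p.Prime] [CharP κ p] [Finite κ]
    [CharP k p] (τ : κ →+* k) [FiniteDimensional k W] [Nontrivial W]
    (hirr : ∀ N : Submodule k W, (∀ g, ∀ v ∈ N, ρ g v ∈ N) → N = ⊥ ∨ N = ⊤) {v z : W}
    (hv0 : v ≠ 0) (hv : ∀ x, ρ (upp x) v = v) (hz : ∀ x, ρ (upp x) z = z) : ∃ c : k, z = c • v := by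
  have hirr' : ∀ N : Submodule k (Module.Dual k W), (∀ g, ∀ ξ ∈ N, ρ.dual g ξ ∈ N) →
      N = ⊥ ∨ N = ⊤ := by
    intro N hN
    have h := hirr N.dualCoannihilator fun g w hw => by
      rw [Submodule.mem_dualCoannihilator] at hw ⊢
      intro ξ hξ
      have := hw _ (hN g⁻¹ ξ hξ)
      rwa [Representation.dual_apply, inv_inv] at this
    rw [← Subspace.dualCoannihilator_dualAnnihilator_eq (W := N)]
    rcases h with h | h
    · exact Or.inr (by rw [h, Submodule.dualAnnihilator_bot])
    · exact Or.inl (by rw [h, Submodule.dualAnnihilator_top])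
  obtain ⟨ξ, -, -, hξ⟩ := exists_fixed_span_weyl_eq_top (p := p) ρ.dual τ hirr'
  have key : ∀ z, (∀ x, ρ (upp x) z = z) → ρ.dual weyl ξ z = 0 → z = 0 := by
    intro z hz h0
    rw [← Module.forall_dual_apply_eq_zero_iff k]
    intro η
    have hη : η ∈ Submodule.span k (Set.range fun x => ρ.dual (upp x) (ρ.dual weyl ξ)) := by
      rw [hξ]; trivial
    induction hη using Submodule.span_induction with
    | mem η h =>
      obtain ⟨x, rfl⟩ := h
      have h1 : (upp x : GL (Fin 2) κ)⁻¹ = upp (-x) := inv_eq_of_mul_eq_one_left (upp_neg_mul x)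
      change ρ.dual (upp x) (ρ.dual weyl ξ) z = 0
      rw [Representation.dual_apply, h1]
      change ρ.dual weyl ξ (ρ (upp (-x)) z) = 0
      rw [hz, h0]
    | zero => rfl
    | add a b _ _ ha hb => rw [LinearMap.add_apply, ha, hb, add_zero]
    | smul c a _ ha => rw [LinearMap.smul_apply, ha, smul_zero]
  have hξv : ρ.dual weyl ξ v ≠ 0 := fun h => hv0 (key v hv h)
  refine ⟨ρ.dual weyl ξ z / ρ.dual weyl ξ v, sub_eq_zero.1 (key _ (fun x => ?_) ?_)⟩
  · rw [map_sub, map_smul, hv, hz]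
  · rw [map_sub, map_smul, smul_eq_mul, div_mul_cancel₀ _ hξv, sub_self]

end FiniteGL

/-! ### Irreducible representations of `GL_2(O)` -/

section Descent

variable {O : Type*} [CommRing O] {ϖ : O}

lemma finite_range_of_factors {α β γ : Type*} [Finite β] (q : α → β) (f : α → γ)
    (h : ∀ a b, q a = q b → f a = f b) : Finite (Set.range f) :=
  Finite.of_injective (fun y : Set.range f => q y.2.choose) fun y z hyz => Subtype.ext <| by
    rw [← y.2.choose_spec, ← z.2.choose_spec]
    exact h _ _ hyz

end Descent

section Congr

variable {O : Type u} [CommRing O] {ϖ : O}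

lemma mem_congr_iff_exists {n : ℕ} {g : GL (Fin 2) O} : g ∈ congr O ϖ n ↔
    ∃ M : Matrix (Fin 2) (Fin 2) O, (g : Matrix (Fin 2) (Fin 2) O) = 1 + ϖ ^ n • M := by
  rw [mem_congr_iff]
  constructor
  · intro h
    choose M hM using h
    refine ⟨Matrix.of M, ?_⟩
    ext i j
    rw [Matrix.add_apply, Matrix.smul_apply, smul_eq_mul, Matrix.of_apply, ← hM, add_sub_cancel]
  · rintro ⟨M, hM⟩ i j
    rw [hM, Matrix.add_apply, add_sub_cancel_left, Matrix.smul_apply]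
    exact dvd_mul_right _ _

lemma congr_anti {m n : ℕ} (h : m ≤ n) : congr O ϖ n ≤ congr O ϖ m := fun g hg => by
  rw [mem_congr_iff] at hg ⊢
  exact fun i j => (pow_dvd_pow ϖ h).trans (hg i j)

lemma pow_mem_congr {p : ℕ} (hp : ϖ ∣ (p : O)) {n : ℕ} (hn : 1 ≤ n) {g : GL (Fin 2) O}
    (hg : g ∈ congr O ϖ n) : g ^ p ∈ congr O ϖ (n + 1) := by
  obtain ⟨M, hM⟩ := mem_congr_iff_exists.1 hg
  obtain ⟨n, rfl⟩ := Nat.exists_eq_add_of_le' hn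
  obtain ⟨c, hc⟩ := hp
  have key (j : ℕ) : ∃ R : Matrix (Fin 2) (Fin 2) O,
      (g : Matrix (Fin 2) (Fin 2) O) ^ j = 1 + ϖ ^ (n + 1) • ((j : O) • M + ϖ • R) := by
    induction j with
    | zero => exact ⟨0, by simp⟩
    | succ j ih =>
      obtain ⟨R, hR⟩ := ih
      refine ⟨R + ϖ ^ n • (((j : O) • M + ϖ • R) * M), ?_⟩
      rw [pow_succ, hR, hM, add_mul, mul_add, mul_add, Matrix.one_mul, Matrix.mul_one,
        Matrix.smul_mul, Matrix.mul_smul]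
      simp only [Matrix.add_mul, Matrix.smul_mul, Matrix.mul_smul, Nat.cast_add, Nat.cast_one,
        Matrix.one_mul]
      module
  obtain ⟨R, hR⟩ := key p
  refine mem_congr_iff_exists.2 ⟨c • M + R, ?_⟩
  rw [Units.val_pow_eq_pow_val, hR, hc]
  simp only [smul_add, smul_smul]
  ring_nf

lemma exists_pow_mem_congr {p : ℕ} (hp : ϖ ∣ (p : O)) {g : GL (Fin 2) O} (hg : g ∈ congr O ϖ 1)
    (n : ℕ) : ∃ j, g ^ p ^ j ∈ congr O ϖ n := by
  suffices h : g ^ p ^ n ∈ congr O ϖ (n + 1) from ⟨n, congr_anti n.le_succ h⟩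
  induction n with
  | zero => simpa using hg
  | succ n ih =>
    rw [pow_succ, pow_mul]
    exact pow_mem_congr hp (by omega) ih

variable {p : ℕ} [Fact p.Prime] {k : Type*} [Field k] [CharP k p] {W : Type*} [AddCommGroup W]
  [Module k W]

/-- Normality of a congruence subgroup makes its fixed vectors a subrepresentation. -/
lemma forall_congr_fixed (ρ : Representation k (GL (Fin 2) O) W)
    (hirr : ∀ N : Submodule k W, (∀ g, ∀ v ∈ N, ρ g v ∈ N) → N = ⊥ ∨ N = ⊤) (m : ℕ) {v : W}
    (hv0 : v ≠ 0) (hv : ∀ g ∈ congr O ϖ m, ρ g v = v) : ∀ g ∈ congr O ϖ m, ρ g = 1 := by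
  let N : Submodule k W :=
    { carrier := {w | ∀ g ∈ congr O ϖ m, ρ g w = w}
      zero_mem' := fun g _ => map_zero _
      add_mem' := fun hv hw g hg => by rw [map_add, hv g hg, hw g hg]
      smul_mem' := fun c v hv g hg => by rw [map_smul, hv g hg] }
  have hN : N = ⊤ := by
    refine (hirr N fun g w hw h hh => ?_).resolve_left fun h => hv0 ?_
    · have h1 : g⁻¹ * h * g⁻¹⁻¹ ∈ congr O ϖ m :=
        (MonoidHom.normal_ker _ : (congr O ϖ m).Normal).conj_mem h hh _
      have h2 : h * g = g * (g⁻¹ * h * g⁻¹⁻¹) := by group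
      rw [← Module.End.mul_apply, ← map_mul, h2, map_mul, Module.End.mul_apply, hw _ h1]
    · have : v ∈ N := hv
      rwa [h, Submodule.mem_bot] at this
  intro g hg
  ext w
  have : w ∈ N := by rw [hN]; trivial
  exact this g hg

/-- If a congruence subgroup acts trivially on an irreducible representation of `GL_2(O)` in the
residue characteristic, then so does the first one, which acts through a finite `p`-group. -/
theorem congr_one_trivial (hp : ϖ ∣ (p : O)) {n : ℕ} [Finite (O ⧸ lev O ϖ n)]
    (ρ : Representation k (GL (Fin 2) O) W) [Nontrivial W]
    (hirr : ∀ N : Submodule k W, (∀ g, ∀ v ∈ N, ρ g v ∈ N) → N = ⊥ ∨ N = ⊤)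
    (hn : ∀ g ∈ congr O ϖ n, ρ g = 1) : ∀ g ∈ congr O ϖ 1, ρ g = 1 := by
  let η : congr O ϖ 1 →* (Module.End k W)ˣ :=
    (MonoidHom.toHomUnits ρ).comp (congr O ϖ 1).subtype
  have hη (g : congr O ϖ 1) : ((η g : (Module.End k W)ˣ) : Module.End k W) = ρ g := rfl
  have hfin : Finite η.range := by
    refine finite_range_of_factors
      (fun g => GeneralLinearGroup.map (Ideal.Quotient.mk (lev O ϖ n)) g.1) η fun a b hab => ?_
    have h1 : (a⁻¹ * b).1 ∈ congr O ϖ n := by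
      rw [congr, MonoidHom.mem_ker]
      simp only [Subgroup.coe_mul, map_mul, InvMemClass.coe_inv, map_inv]
      exact inv_mul_eq_one.2 hab
    have h2 : η (a⁻¹ * b) = 1 := Units.ext (hn _ h1)
    rw [map_mul, map_inv] at h2
    exact inv_mul_eq_one.1 h2
  have hP : IsPGroup p η.range := by
    rintro ⟨_, g, rfl⟩
    obtain ⟨j, hj⟩ := exists_pow_mem_congr hp g.2 n
    refine ⟨j, Subtype.ext (Units.ext ?_)⟩
    have := hn _ hj
    rw [map_pow] at this
    simpa [hη] using this
  obtain ⟨v, -, hv0, hv⟩ := exists_fixed_vector hP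
    ((Units.coeHom (Module.End k W)).comp η.range.subtype : Representation k η.range W)
    (N := ⊤) (by simp) top_ne_bot
  exact forall_congr_fixed ρ hirr 1 hv0 fun g hg => hv ⟨η ⟨g, hg⟩, ⟨g, hg⟩, rfl⟩

lemma map_surjective_of_isUnit_or_dvd (hu : ∀ c : O, IsUnit c ∨ ϖ ∣ c) :
    Function.Surjective
      (GeneralLinearGroup.map (n := Fin 2) (Ideal.Quotient.mk (Ideal.span {ϖ}))) := by
  intro g
  choose M hM using fun i j => Ideal.Quotient.mk_surjective (g i j)
  have hdet : Ideal.Quotient.mk (Ideal.span {ϖ}) (Matrix.of M).det =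
      (g : Matrix (Fin 2) (Fin 2) _).det := by
    rw [Matrix.det_fin_two, Matrix.det_fin_two, map_sub, map_mul, map_mul]
    simp only [Matrix.of_apply, hM]
  rcases subsingleton_or_nontrivial (O ⧸ Ideal.span {ϖ}) with h | h
  · exact ⟨1, GeneralLinearGroup.ext fun i j => Subsingleton.elim _ _⟩
  obtain ⟨m, hm⟩ := (Matrix.isUnit_iff_isUnit_det _).2 ((hu (Matrix.of M).det).resolve_right
    fun hd => ((Matrix.isUnit_iff_isUnit_det _).1 g.isUnit).ne_zero (by
      rw [← hdet]
      exact Ideal.Quotient.eq_zero_iff_dvd _ _ |>.2 hd))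
  refine ⟨m, GeneralLinearGroup.ext fun i j => ?_⟩
  rw [GeneralLinearGroup.map_apply, hm]
  exact hM i j

/-- The structure of an irreducible representation of `GL_2(O)` on which a congruence subgroup
acts trivially: the vectors fixed by the unipotent upper triangular matrices form a line, and their
images under the Weyl element generate the representation under these matrices. -/
theorem exists_line_of_irreducible (hu : ∀ c : O, IsUnit c ∨ ϖ ∣ c) (hϖ : ¬ IsUnit ϖ)
    (hp : ϖ ∣ (p : O)) [Finite (O ⧸ Ideal.span {ϖ})] (τ : O ⧸ Ideal.span {ϖ} →+* k)
    (ρ : Representation k (GL (Fin 2) O) W) [Nontrivial W] [FiniteDimensional k W]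
    (hirr : ∀ N : Submodule k W, (∀ g, ∀ v ∈ N, ρ g v ∈ N) → N = ⊥ ∨ N = ⊤)
    (hn : ∀ g ∈ congr O ϖ 1, ρ g = 1) :
    ∃ v ≠ 0, (∀ x, ρ (upp x) v = v) ∧
      Submodule.span k (Set.range fun x => ρ (upp x) (ρ weyl v)) = ⊤ ∧
      ∀ z, (∀ x, ρ (upp x) z = z) → ∃ c : k, z = c • v := by
  have hmax : (Ideal.span {ϖ}).IsMaximal := by
    refine Ideal.isMaximal_iff.2 ⟨fun h => hϖ ?_, fun I x hI hx hxI => ?_⟩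
    · exact isUnit_of_dvd_one (Ideal.mem_span_singleton.1 h)
    · rcases hu x with h | h
      · exact (Ideal.eq_top_of_isUnit_mem I hxI h).symm ▸ Submodule.mem_top
      · exact absurd (Ideal.mem_span_singleton.2 h) hx
  let _ : Field (O ⧸ Ideal.span {ϖ}) := Ideal.Quotient.field _
  have hchar : CharP (O ⧸ Ideal.span {ϖ}) p :=
    (CharP.charP_iff_prime_eq_zero Fact.out).2 (by
      rw [← map_natCast (Ideal.Quotient.mk _)]
      exact Ideal.Quotient.eq_zero_iff_dvd _ _ |>.2 hp)
  let π := GeneralLinearGroup.map (n := Fin 2) (Ideal.Quotient.mk (Ideal.span {ϖ}))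
  have hπ : Function.Surjective π := map_surjective_of_isUnit_or_dvd hu
  have hker : ∀ g h, π g = π h → ρ g = ρ h := by
    intro g h hgh
    have h1 : π (g⁻¹ * h) = 1 := by rw [map_mul, map_inv, hgh, inv_mul_cancel]
    have h2 : g⁻¹ * h ∈ congr O ϖ 1 := by
      rw [mem_congr_iff]
      intro i j
      rw [pow_one, ← Ideal.mem_span_singleton, ← Ideal.Quotient.eq]
      have h3 := congrArg (fun m : GL (Fin 2) (O ⧸ Ideal.span {ϖ}) => m i j) h1
      simp only [π, GeneralLinearGroup.map_apply] at h3
      rw [h3, Units.val_one, Matrix.one_apply, Matrix.one_apply]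
      split_ifs <;> simp
    have h3 := hn _ h2
    have h4 : h = g * (g⁻¹ * h) := by group
    rw [h4, map_mul, h3, mul_one]
  let ρ' : Representation k (GL (Fin 2) (O ⧸ Ideal.span {ϖ})) W :=
    { toFun := fun g => ρ (Function.surjInv hπ g)
      map_one' := by
        rw [← map_one ρ]
        exact hker _ _ (by rw [Function.surjInv_eq hπ, map_one])
      map_mul' := fun g h => by
        rw [← map_mul]
        exact hker _ _ (by rw [map_mul, Function.surjInv_eq hπ, Function.surjInv_eq hπ,
          Function.surjInv_eq hπ]) }
  have hρ' (g : GL (Fin 2) O) : ρ' (π g) = ρ g := hker _ _ (Function.surjInv_eq hπ _)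
  have hupp (x : O) : ρ' (upp (Ideal.Quotient.mk _ x)) = ρ (upp x) := by
    rw [← hρ']
    congr 1
    ext i j
    fin_cases i <;> fin_cases j <;> simp [π, upp_val]
  have hweyl : ρ' weyl = ρ weyl := by
    rw [← hρ']
    congr 1
    ext i j
    fin_cases i <;> fin_cases j <;> simp [π, weyl_val]
  have hirr' : ∀ N : Submodule k W, (∀ g, ∀ v ∈ N, ρ' g v ∈ N) → N = ⊥ ∨ N = ⊤ :=
    fun N hN => hirr N fun g v hv => hρ' g ▸ hN (π g) v hv
  obtain ⟨v, hv0, hv, hspan⟩ := exists_fixed_span_weyl_eq_top (p := p) ρ' τ hirr'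
  refine ⟨v, hv0, fun x => by rw [← hupp, hv], ?_, fun z hz => ?_⟩
  · rw [← top_le_iff, ← hspan]
    refine Submodule.span_mono ?_
    rintro _ ⟨x, rfl⟩
    obtain ⟨x, rfl⟩ := Ideal.Quotient.mk_surjective x
    exact ⟨x, by simp only [hupp, hweyl]⟩
  · refine eq_smul_of_upp_fixed (p := p) ρ' τ hirr' hv0 hv fun x => ?_
    obtain ⟨x, rfl⟩ := Ideal.Quotient.mk_surjective x
    rw [hupp, hz]

end Congr

/-! ### The field generated by the central character -/

section Schur

variable {k : Type u} [Field k] {W : Type u} [AddCommGroup W] [Module k W] {G : Type*} [Group G]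
  (σ : Representation k G W) [σ.IsIrreducible]

lemma eq_bot_or_eq_top_of_irreducible (N : Submodule k W) (hN : ∀ g, ∀ v ∈ N, σ g v ∈ N) :
    N = ⊥ ∨ N = ⊤ := by
  rcases eq_bot_or_eq_top (⟨N, fun g v hv => hN g v hv⟩ : Subrepresentation σ) with h | h
  · exact Or.inl (congrArg Subrepresentation.toSubmodule h)
  · exact Or.inr (congrArg Subrepresentation.toSubmodule h)

lemma nontrivial_of_irreducible (σ : Representation k G W) [σ.IsIrreducible] : Nontrivial W := by
  by_contra h
  rw [not_nontrivial_iff_subsingleton] at h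
  obtain ⟨a, b, hab⟩ := exists_pair_ne (Subrepresentation σ)
  exact hab (Subrepresentation.toSubmodule_injective (Subsingleton.elim _ _))

open scoped IsMulCommutative in
/-- An irreducible representation `σ` that is finitely generated over the algebra generated by a
central element `z` and its inverse is finite-dimensional over a finite extension `k'` of `k` by
the image of `z`. The algebra is a field by Schur's lemma and Nakayama's lemma, and it is finite
over `k` by Zariski's lemma. -/
theorem exists_coefficient_field (z : G) (hz : ∀ g, g * z = z * g) {s : Set W} (hs : s.Finite)
    {w : W} (hw : w ∈ s) (hw0 : w ≠ 0)
    (hsmul : ∀ g, ∀ y ∈ s, ∃ n : ℤ, ∃ y' ∈ s, σ g y = σ (z ^ n) y') :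
    ∃ (k' : Type u) (_ : Field k') (_ : Algebra k k') (_ : Module k' W),
      FiniteDimensional k k' ∧ IsScalarTower k k' W ∧ FiniteDimensional k' W ∧
      (∃ c : k', ∀ w, σ z w = c • w) ∧
      ∀ T : Module.End k W, Commute T (σ z) → ∀ (c : k') (w : W), T (c • w) = c • T w := by
  have hW := nontrivial_of_irreducible σ
  let S : Set (Module.End k W) := {σ z, σ z⁻¹}
  have hS : ∀ a ∈ S, ∀ b ∈ S, a * b = b * a := by
    rintro _ (rfl | rfl) _ (rfl | rfl) <;> simp [← map_mul]
  let A := Algebra.adjoin k S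
  have _ : IsMulCommutative A := Algebra.isMulCommutative_adjoin k hS
  have hcomm (T : Module.End k W) (hT : Commute T (σ z)) (c : A) : T * c.1 = c.1 * T := by
    have h1 : T * σ z⁻¹ = σ z⁻¹ * T := by
      have h2 : σ z⁻¹ * σ z = 1 := by rw [← map_mul, inv_mul_cancel, map_one]
      have h3 : σ z * σ z⁻¹ = 1 := by rw [← map_mul, mul_inv_cancel, map_one]
      calc T * σ z⁻¹ = σ z⁻¹ * (σ z * T) * σ z⁻¹ := by rw [← mul_assoc, h2, one_mul]
        _ = σ z⁻¹ * T := by rw [← hT.eq, mul_assoc, mul_assoc, h3, mul_one]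
    have h2 : A ≤ Subalgebra.centralizer k {T} := by
      refine Algebra.adjoin_le ?_
      rintro _ (rfl | rfl) <;> rw [SetLike.mem_coe, Subalgebra.mem_centralizer_iff] <;>
        rintro _ rfl
      exacts [hT.eq, h1]
    exact (Subalgebra.mem_centralizer_iff k).1 (h2 c.2) T rfl
  have hσ (g : G) (c : A) (w : W) : σ g (c.1 w) = c.1 (σ g w) :=
    LinearMap.congr_fun (hcomm (σ g) (by rw [Commute, SemiconjBy, ← map_mul, ← map_mul, hz]) c) w
  have hzA (n : ℤ) : σ (z ^ n) ∈ A := by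
    obtain ⟨n, rfl | rfl⟩ := n.eq_nat_or_neg
    · rw [zpow_natCast, map_pow]
      exact A.pow_mem (Algebra.subset_adjoin (Or.inl rfl)) n
    · rw [_root_.zpow_neg, zpow_natCast, ← inv_pow, map_pow]
      exact A.pow_mem (Algebra.subset_adjoin (Or.inr rfl)) n
  have hfg : Module.Finite A W := by
    refine ⟨⟨hs.toFinset, ?_⟩⟩
    rw [hs.coe_toFinset]
    have h1 : ∀ g, ∀ v ∈ Submodule.span A s, σ g v ∈ Submodule.span A s := by
      intro g v hv
      induction hv using Submodule.span_induction with
      | mem y hy =>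
        obtain ⟨n, y', hy', h⟩ := hsmul g y hy
        rw [h]
        exact Submodule.smul_mem _ (⟨_, hzA n⟩ : A) (Submodule.subset_span hy')
      | zero => rw [map_zero]; exact Submodule.zero_mem _
      | add x y _ _ hx hy => rw [map_add]; exact Submodule.add_mem _ hx hy
      | smul c x _ hx =>
        have : σ g (c • x) = c • σ g x := hσ g c x
        rw [this]
        exact Submodule.smul_mem _ c hx
    have h2 := eq_bot_or_eq_top_of_irreducible σ ((Submodule.span A s).restrictScalars k) h1
    rw [Submodule.restrictScalars_eq_bot_iff, Submodule.restrictScalars_eq_top_iff] at h2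
    refine h2.resolve_left fun h => hw0 ?_
    have : w ∈ Submodule.span A s := Submodule.subset_span hw
    rwa [h, Submodule.mem_bot] at this
  have hfield : IsField A := by
    refine ⟨⟨0, 1, fun h => zero_ne_one (congrArg Subtype.val h)⟩, mul_comm, fun {a} ha => ?_⟩
    have hrange : LinearMap.range a.1 = ⊤ := by
      refine (eq_bot_or_eq_top_of_irreducible σ (LinearMap.range a.1) ?_).resolve_left fun h => ?_
      · rintro g _ ⟨v, rfl⟩
        exact ⟨σ g v, (hσ g a v).symm⟩
      · exact ha (Subtype.ext (LinearMap.range_eq_bot.1 h))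
    obtain ⟨r, hr, hr0⟩ := Submodule.exists_sub_one_mem_and_smul_eq_zero_of_fg_of_le_smul
      (Ideal.span {a}) (⊤ : Submodule A W) hfg.1 (fun v _ => by
        obtain ⟨y, rfl⟩ := LinearMap.range_eq_top.1 hrange v
        exact Submodule.smul_mem_smul (Ideal.mem_span_singleton_self a) (Submodule.mem_top (x := y)))
    have h0 : r = 0 := Subtype.ext (LinearMap.ext fun v => hr0 v trivial)
    rw [h0, zero_sub] at hr
    obtain ⟨b, hb⟩ := Ideal.mem_span_singleton.1 ((neg_mem_iff).1 hr)
    exact ⟨b, hb.symm⟩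
  let _ : Field A := hfield.toField
  have hft : Algebra.FiniteType k A :=
    A.fg_iff_finiteType.1 (Subalgebra.fg_def.2 ⟨S, Set.toFinite S, rfl⟩)
  exact ⟨A, inferInstance, inferInstance, inferInstance,
    finite_of_finite_type_of_isJacobsonRing k A, inferInstance, hfg,
    ⟨⟨σ z, Algebra.subset_adjoin (Or.inl rfl)⟩, fun _ => rfl⟩,
    fun T hT c w => LinearMap.congr_fun (hcomm T hT c) w⟩

end Schur

/-! ### Irreducible representations of `Z GL_2(O)` -/

section Centre

variable {F : Type u} [Field F] {O : Type u} [CommRing O] [Algebra O F] {ϖ : O}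

lemma inc_upp_val (x : O) : ((inc F O (upp x) : GL (Fin 2) F) : Matrix (Fin 2) (Fin 2) F) =
    !![1, algebraMap O F x; 0, 1] := by
  ext i j; fin_cases i <;> fin_cases j <;> simp [inc, upp_val]

lemma dia_same_mem_center {R : Type*} [CommRing R] (a : Rˣ) :
    dia a a ∈ Subgroup.center (GL (Fin 2) R) := by
  rw [GeneralLinearGroup.mem_center_iff_val_mem_range_scalar]
  refine ⟨a, ?_⟩
  rw [dia_val]
  ext i j; fin_cases i <;> fin_cases j <;> simp

lemma dia_comm {R : Type*} [CommRing R] (a : Rˣ) (g : GL (Fin 2) R) :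
    g * dia a a = dia a a * g :=
  Subgroup.mem_center_iff.1 (dia_same_mem_center a) g

lemma dia_zpow {R : Type*} [CommRing R] (a d : Rˣ) (n : ℤ) : dia a d ^ n = dia (a ^ n) (d ^ n) := by
  let φ : Rˣ × Rˣ →* GL (Fin 2) R :=
    { toFun := fun q => dia q.1 q.2
      map_one' := dia_one
      map_mul' := fun q r => (dia_mul q.1 q.2 r.1 r.2).symm }
  exact (map_zpow φ (a, d) n).symm

/-- `F` is the fraction field of a ring `O` in which every nonzero element is a unit times a power
of `ϖ`. -/
def IsUniformizing (F : Type u) [Field F] {O : Type u} [CommRing O] [Algebra O F] (ϖ : O) : Prop :=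
  ∀ x : F, x ≠ 0 → ∃ (n : ℤ) (a : Oˣ), x = algebraMap O F ϖ ^ n * algebraMap O F a

lemma dia_mem_ZK (a : Fˣ) : dia a a ∈ ZK F O := Subgroup.mem_sup_left (dia_same_mem_center a)

variable [FaithfulSMul O F] [Fact (Irreducible ϖ)]

variable (F ϖ) in
/-- The uniformizer `ϖ` as a unit of `F`. -/
def unifUnit : Fˣ := Units.mk0 (algebraMap O F ϖ) <|
  (map_ne_zero_iff _ (FaithfulSMul.algebraMap_injective O F)).2
    (Fact.out : Irreducible ϖ).ne_zero

lemma IsUniformizing.isUnit_or_dvd (hu : IsUniformizing F ϖ) (c : O) : IsUnit c ∨ ϖ ∣ c := by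
  have hinj := FaithfulSMul.algebraMap_injective O F
  have hϖ : Irreducible ϖ := Fact.out
  by_cases hc : c = 0
  · exact Or.inr (hc ▸ dvd_zero ϖ)
  obtain ⟨n, a, h⟩ := hu (algebraMap O F c) ((map_ne_zero_iff _ hinj).2 hc)
  obtain ⟨n, rfl | rfl⟩ := n.eq_nat_or_neg
  · rw [zpow_natCast, ← map_pow, ← map_mul] at h
    rw [hinj h]
    rcases n with - | n
    · simp
    · exact Or.inr ((dvd_pow_self ϖ n.succ_ne_zero).mul_right _)
  · rw [_root_.zpow_neg, zpow_natCast, eq_inv_mul_iff_mul_eq₀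
      (pow_ne_zero _ ((map_ne_zero_iff _ hinj).2 hϖ.ne_zero)), ← map_pow, ← map_mul] at h
    exact Or.inl (isUnit_of_mul_isUnit_right (hinj h ▸ a.isUnit))

lemma IsUniformizing.exists_eq_of_mem_ZK (hu : IsUniformizing F ϖ) {g : GL (Fin 2) F}
    (hg : g ∈ ZK F O) : ∃ (n : ℤ) (h : GL (Fin 2) O),
      g = dia (unifUnit F ϖ) (unifUnit F ϖ) ^ n * inc F O h := by
  rw [ZK] at hg
  obtain ⟨c, hc, _, ⟨h, rfl⟩, rfl⟩ := Subgroup.mem_sup_of_normal_left.1 hg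
  rw [GeneralLinearGroup.center_eq_range_scalar] at hc
  obtain ⟨a, rfl⟩ := hc
  obtain ⟨n, b, hb⟩ := hu a a.ne_zero
  refine ⟨n, dia b b * h, ?_⟩
  rw [map_mul, ← mul_assoc]
  congr 1
  apply Units.ext
  rw [dia_zpow, Units.val_mul, dia_val]
  ext i j
  fin_cases i <;> fin_cases j <;>
    simp [inc, dia_val, Matrix.mul_apply, Fin.sum_univ_two, hb, unifUnit]

variable {k : Type u} [Field k] {W : Type u} [AddCommGroup W] [Module k W]

variable (F ϖ) in
/-- The central element `ϖ` of `Z GL_2(O)`. -/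
def zUnif : ZK F O := ⟨dia (unifUnit F ϖ) (unifUnit F ϖ), dia_mem_ZK _⟩

lemma IsUniformizing.exists_eq_zUnif_mul (hu : IsUniformizing F ϖ) (g : ZK F O) :
    ∃ (n : ℤ) (h : GL (Fin 2) O), g = zUnif F ϖ ^ n * ⟨inc F O h, inc_mem F O h⟩ := by
  obtain ⟨n, h, hg⟩ := hu.exists_eq_of_mem_ZK g.2
  exact ⟨n, h, Subtype.ext hg⟩

lemma mul_zUnif (g : ZK F O) : g * zUnif F ϖ = zUnif F ϖ * g := Subtype.ext (dia_comm _ _)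

/-- The restriction to `GL_2(O)` of a representation that is linear over `k'`. -/
def resRep {k : Type u} [Field k] [Module k W] (σ : Representation k (ZK F O) W)
    (k') [Field k'] [Module k' W]
    (hlin : ∀ g (c : k') w, σ g (c • w) = c • σ g w) : Representation k' (GL (Fin 2) O) W where
  toFun h :=
    { toFun := σ ⟨inc F O h, inc_mem F O h⟩
      map_add' := map_add _
      map_smul' := hlin _ }
  map_one' := LinearMap.ext fun w => by
    change σ ⟨inc F O 1, inc_mem F O 1⟩ w = w
    have : (⟨inc F O 1, inc_mem F O 1⟩ : ZK F O) = 1 := Subtype.ext (map_one _)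
    rw [this, map_one, Module.End.one_apply]
  map_mul' g h := LinearMap.ext fun w => by
    change σ ⟨inc F O (g * h), _⟩ w = σ ⟨inc F O g, _⟩ (σ ⟨inc F O h, _⟩ w)
    rw [← Module.End.mul_apply, ← map_mul]
    congr 2
    exact Subtype.ext (map_mul _ _ _)

/-- The data on `σ` used in the study of its compact induction: `σ` is linear over a finite
extension `k'` of `k`, the first congruence subgroup acts trivially, and there is a vector `v`
that spans the line of vectors fixed by the unipotent upper triangular matrices, such that
`weyl v` generates `σ` under these matrices. The field `comm` makes the values of functions in the
Hecke algebra `k'`-linear too. -/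
structure IsLinearWeight {k : Type u} [Field k] [Module k W] (σ : Representation k (ZK F O) W)
    (ϖ : O) [Fact (Irreducible ϖ)] (k') [Field k'] [Module k' W]
    (hlin : ∀ g (c : k') w, σ g (c • w) = c • σ g w) (v : W) : Prop where
  comm (T : Module.End k W) (hT : Commute T (σ (zUnif F ϖ))) (c : k') (w : W) :
    T (c • w) = c • T w
  congr_one : ∀ g ∈ congr O ϖ 1, resRep σ k' hlin g = 1
  ne_zero : v ≠ 0
  fixed (x : O) : resRep σ k' hlin (upp x) v = v
  span : Submodule.span k'
    (Set.range fun x => resRep σ k' hlin (upp x) (resRep σ k' hlin weyl v)) = ⊤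
  line (z : W) : (∀ x, resRep σ k' hlin (upp x) z = z) → ∃ c : k', z = c • v

/-- A smooth irreducible representation of `Z GL_2(O)` is linear over the finite extension `k'` of
`k` generated by the image of the central element `ϖ`. Over `k'` the centre contributes scalars only,
so that the restriction to `GL_2(O)` is still irreducible and comes from the finite group `GL_2` of the
residue field. -/
theorem exists_isLinearWeight {p : ℕ} [Fact p.Prime] [CharP k p] (hu : IsUniformizing F ϖ)
    (hp : ϖ ∣ (p : O)) (hfin : ∀ n, Finite (O ⧸ lev O ϖ n)) (τ : O ⧸ Ideal.span {ϖ} →+* k)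
    (σ : Representation k (ZK F O) W) [σ.IsIrreducible] (hσ : IsSmooth ϖ σ) :
    ∃ (k' : Type u) (_ : Field k') (_ : Algebra k k') (_ : Module k' W),
      FiniteDimensional k k' ∧ IsScalarTower k k' W ∧
      ∃ (hlin : ∀ g (c : k') w, σ g (c • w) = c • σ g w) (v : W),
        IsLinearWeight σ ϖ k' hlin v := by
  have hW := nontrivial_of_irreducible σ
  obtain ⟨w, hw0⟩ := exists_ne (0 : W)
  obtain ⟨n, hn⟩ := hσ w
  have hinc (g h : GL (Fin 2) O) (y : W) : σ ⟨inc F O (g * h), inc_mem F O _⟩ y =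
      σ ⟨inc F O g, inc_mem F O g⟩ (σ ⟨inc F O h, inc_mem F O h⟩ y) := by
    rw [← Module.End.mul_apply, ← map_mul]
    congr 2
    exact Subtype.ext (map_mul _ _ _)
  have hfinite : (Set.range fun h => σ ⟨inc F O h, inc_mem F O h⟩ w).Finite := by
    have := hfin n
    refine finite_range_of_factors (GeneralLinearGroup.map (Ideal.Quotient.mk (lev O ϖ n))) _
      fun a b hab => ?_
    have h1 : a⁻¹ * b ∈ congr O ϖ n := by
      rw [congr, MonoidHom.mem_ker, map_mul, map_inv, hab, inv_mul_cancel]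
    have h2 : b = a * (a⁻¹ * b) := by group
    have h3 := hinc a (a⁻¹ * b) w
    have h4 : (⟨inc F O (a * (a⁻¹ * b)), inc_mem F O _⟩ : ZK F O) = ⟨inc F O b, inc_mem F O b⟩ :=
      Subtype.ext (congrArg (inc F O) h2.symm)
    rw [hn _ h1, h4] at h3
    exact h3.symm
  obtain ⟨k', _, _, _, hfd, htower, hfd', hz, hT⟩ := exists_coefficient_field σ (zUnif F ϖ)
    mul_zUnif hfinite (w := w) ⟨1, by
      have : (⟨inc F O 1, inc_mem F O 1⟩ : ZK F O) = 1 := Subtype.ext (map_one _)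
      change σ ⟨inc F O 1, inc_mem F O 1⟩ w = w
      rw [this, map_one, Module.End.one_apply]⟩ hw0 (by
    rintro g _ ⟨h, rfl⟩
    obtain ⟨m, h', rfl⟩ := hu.exists_eq_zUnif_mul g
    refine ⟨m, _, ⟨h' * h, rfl⟩, ?_⟩
    simp only
    rw [map_mul, Module.End.mul_apply, hinc])
  have hlin : ∀ g (c : k') w, σ g (c • w) = c • σ g w := fun g c w =>
    hT (σ g) (by rw [Commute, SemiconjBy, ← map_mul, ← map_mul, mul_zUnif]) c w
  obtain ⟨c, hc⟩ := hz
  have hcs : ∀ m : ℤ, ∃ d : k', ∀ w, σ (zUnif F ϖ ^ m) w = d • w := by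
    have hc0 : c ≠ 0 := by
      rintro rfl
      refine hw0 ?_
      have := congrArg (σ (zUnif F ϖ)⁻¹) (hc w)
      rwa [zero_smul, map_zero, ← Module.End.mul_apply, ← map_mul, inv_mul_cancel, map_one] at this
    have hinv : ∀ w, σ (zUnif F ϖ)⁻¹ w = c⁻¹ • w := fun w => by
      have := congrArg (σ (zUnif F ϖ)⁻¹) (hc (c⁻¹ • w))
      rw [smul_inv_smul₀ hc0, ← Module.End.mul_apply, ← map_mul, inv_mul_cancel, map_one,
        Module.End.one_apply] at this
      exact this.symm
    have hpow (g : ZK F O) (d : k') (h : ∀ w, σ g w = d • w) (m : ℕ) (w : W) :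
        σ (g ^ m) w = d ^ m • w := by
      induction m generalizing w with
      | zero => simp
      | succ m ih => rw [pow_succ, map_mul, Module.End.mul_apply, h, ih, smul_smul, pow_succ]
    intro m
    obtain ⟨m, rfl | rfl⟩ := m.eq_nat_or_neg
    · exact ⟨c ^ m, fun w => by rw [zpow_natCast]; exact hpow _ _ hc m w⟩
    · exact ⟨c⁻¹ ^ m, fun w => by
        rw [_root_.zpow_neg, zpow_natCast, ← inv_pow]; exact hpow _ _ hinv m w⟩
  have hirr : ∀ N : Submodule k' W, (∀ g, ∀ v ∈ N, resRep σ k' hlin g v ∈ N) → N = ⊥ ∨ N = ⊤ := by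
    intro N hN
    have := eq_bot_or_eq_top_of_irreducible σ (N.restrictScalars k) fun g v hv => by
      obtain ⟨m, h', rfl⟩ := hu.exists_eq_zUnif_mul g
      obtain ⟨d, hd⟩ := hcs m
      rw [map_mul, Module.End.mul_apply, hd]
      exact N.smul_mem d (hN h' v hv)
    rwa [Submodule.restrictScalars_eq_bot_iff, Submodule.restrictScalars_eq_top_iff] at this
  have hchar : CharP k' p := charP_of_injective_algebraMap (algebraMap k k').injective p
  have := hfin n
  have hone : ∀ g ∈ congr O ϖ 1, resRep σ k' hlin g = 1 :=
    congr_one_trivial hp _ hirr (n := n) (forall_congr_fixed _ hirr n hw0 hn)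
  have : Finite (O ⧸ Ideal.span {ϖ}) := pow_one ϖ ▸ hfin 1
  obtain ⟨v, hv0, hv, hspan, hline⟩ := exists_line_of_irreducible hu.isUnit_or_dvd
    (Fact.out : Irreducible ϖ).not_isUnit hp ((algebraMap k k').comp τ) (resRep σ k' hlin) hirr hone
  exact ⟨k', _, _, _, hfd, htower, hlin, v, hT, hone, hv0, hv, hspan, hline⟩

end Centre

/-! ### The compact induction over an extension of the coefficient field -/

open Multiplicative

namespace OreRep

variable {k : Type u} [Field k] {O : Type u} [CommRing O] {ϖ : O} {V V' : Type u} [AddCommGroup V]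
  [Module k V] [AddCommGroup V'] [Module k V'] (r : OreRep k O ϖ V) (r' : OreRep k O ϖ V')

lemma map_act (L : V →ₗ[k] V') (hL : ∀ x v, L (r.rho x v) = r'.rho x (L v)) (a : iwasawa k O ϖ)
    (v : V) : L (r.act a v) = r'.act a (L v) := by
  obtain ⟨m, hv⟩ := r.smooth v
  obtain ⟨b, hb⟩ := proj_surjective k O ϖ m (a.1 m)
  rw [r.act_eq hv hb, r'.act_eq (n := m) (v := L v) (fun x => by rw [← hL, hv x]) hb]
  clear hb
  induction b using AddMonoidAlgebra.induction_linear with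
  | zero => simp
  | add a b ha hb => simp only [map_add, LinearMap.add_apply, ha, hb]
  | single g c => simp [grp, hL]

lemma act_add (a b : iwasawa k O ϖ) (v : V) : r.act (a + b) v = r.act a v + r.act b v :=
  LinearMap.congr_fun (map_add r.actHom a b) v

lemma act_sub (a b : iwasawa k O ϖ) (v : V) : r.act (a - b) v = r.act a v - r.act b v :=
  LinearMap.congr_fun (map_sub r.actHom a b) v

lemma act_mul (a b : iwasawa k O ϖ) (v : V) : r.act (a * b) v = r.act a (r.act b v) :=
  LinearMap.congr_fun (map_mul r.actHom a b) v

lemma act_zero (a : iwasawa k O ϖ) : r.act a 0 = 0 := map_zero (r.actEnd a)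

lemma zero_act (v : V) : r.act 0 v = 0 := LinearMap.congr_fun (map_zero r.actHom) v

lemma one_act (v : V) : r.act 1 v = v := LinearMap.congr_fun (map_one r.actHom) v

lemma act_add_right (a : iwasawa k O ϖ) (v w : V) : r.act a (v + w) = r.act a v + r.act a w :=
  map_add (r.actEnd a) v w

lemma act_smul (a : iwasawa k O ϖ) (c : k) (v : V) : r.act a (c • v) = c • r.act a v :=
  map_smul (r.actEnd a) c v

lemma act_sum {ι : Type*} (s : Finset ι) (a : ι → iwasawa k O ϖ) (v : V) :
    r.act (∑ i ∈ s, a i) v = ∑ i ∈ s, r.act (a i) v := by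
  classical
  induction s using Finset.induction_on with
  | empty => simp [zero_act]
  | insert i s hi ih => rw [Finset.sum_insert hi, Finset.sum_insert hi, act_add, ih]

lemma t_act (a : iwasawa k O ϖ) (v : V) : r.t (r.act a v) = r.act (phi k O ϖ a) (r.t v) :=
  LinearMap.congr_fun (r.t_actHom a) v

lemma act_dirac (x : O) (v : V) : r.act (dirac k ϖ x) v = r.rho (ofAdd x) v := by
  obtain ⟨m, hv⟩ := r.smooth v
  rw [r.act_eq hv (b := AddMonoidAlgebra.single x 1) (by simp [dirac_val, proj])]
  simp [grp]

lemma act_algebraMap (c : k) (v : V) : r.act (algebraMap k _ c) v = c • v := by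
  obtain ⟨m, hv⟩ := r.smooth v
  rw [r.act_eq hv (b := algebraMap k _ c) (by rw [AlgHom.commutes]; rfl), AlgHom.commutes]
  rfl

/-- A vector fixed by `U` is acted on through the augmentation. -/
lemma act_of_fixed {v : V} (hv : r.Fixed 0 v) (a : iwasawa k O ϖ) :
    r.act a v = aug k O ϖ a • v := by
  obtain ⟨b, hb⟩ := proj_surjective k O ϖ 0 (a.1 0)
  rw [r.act_eq hv hb]
  have : aug k O ϖ a = AddMonoidAlgebra.lift k k (O ⧸ lev O ϖ 0) 1 (a.1 0) := rfl
  rw [this, ← hb]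
  clear hb this
  induction b using AddMonoidAlgebra.induction_linear with
  | zero => simp
  | add a b ha hb => simp only [map_add, LinearMap.add_apply, ha, hb, add_smul]
  | single g c =>
    have := hv g
    rw [pow_zero, one_mul] at this
    simp [grp, proj, this]

lemma act_mem {N : Submodule k V} (hN : ∀ x, ∀ v ∈ N, r.rho x v ∈ N) (a : iwasawa k O ϖ) {v : V}
    (hv : v ∈ N) : r.act a v ∈ N := r.grp_mem hN _ hv

lemma toEnd_monomial (n : ℕ) (a : iwasawa k O ϖ) (v : V) :
    r.toEnd (SkewPolynomial.monomial n a) v = r.act a ((r.t ^ n) v) :=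
  r.toEnd_single (ofAdd n) a v

end OreRep

/-- A representation over `k` on a `k'`-vector space is linear over `k'`. -/
class IsLinearOver {k : Type*} [Field k] {G : Type*} [Group G] {W : Type*} [AddCommGroup W]
    [Module k W] (σ : Representation k G W) (k' : Type*) [Field k'] [Module k' W] : Prop where
  map_smul : ∀ g (c : k') w, σ g (c • w) = c • σ g w

section Extension

variable {F : Type u} [Field F] {O : Type u} [CommRing O] [Algebra O F] {ϖ : O}
  {k : Type u} [Field k] {W : Type u} [AddCommGroup W] [Module k W]
  {σ : Representation k (ZK F O) W}

namespace CInd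

/-- The value of an element of the compact induction at `g`. -/
def ev (f : CInd ϖ σ) (g : GL (Fin 2) F) : W := Subtype.val (p := (· ∈ cInd ϖ σ)) f g

@[ext]
lemma ext {f f' : CInd ϖ σ} (h : ∀ g, f.ev g = f'.ev g) : f = f' := Subtype.ext (funext h)

@[simp]
lemma add_ev (f f' : CInd ϖ σ) (g : GL (Fin 2) F) : (f + f').ev g = f.ev g + f'.ev g := rfl

@[simp]
lemma sub_ev (f f' : CInd ϖ σ) (g : GL (Fin 2) F) : (f - f').ev g = f.ev g - f'.ev g := rfl

@[simp]
lemma zero_ev (g : GL (Fin 2) F) : (0 : CInd ϖ σ).ev g = 0 := rfl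

@[simp]
lemma sum_ev {ι : Type*} (s : Finset ι) (f : ι → CInd ϖ σ) (g : GL (Fin 2) F) :
    (∑ i ∈ s, f i).ev g = ∑ i ∈ s, (f i).ev g :=
  map_sum (⟨⟨fun f => f.ev g, rfl⟩, fun _ _ => rfl⟩ : CInd ϖ σ →+ W) f s

lemma ev_mul (f : CInd ϖ σ) (g : GL (Fin 2) F) {κ : GL (Fin 2) F} (hκ : κ ∈ ZK F O) :
    f.ev (g * κ) = σ ⟨κ, hκ⟩⁻¹ (f.ev g) := f.2.1 g ⟨κ, hκ⟩

end CInd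

section

variable {k' : Type u} [Field k'] [Module k' W] [IsLinearOver σ k']

instance : SMul k' (CInd ϖ σ) where
  smul c f := ⟨fun g => c • f.ev g, fun x κ => by
    change c • f.ev (x * κ) = σ κ⁻¹ (c • f.ev x)
    rw [f.ev_mul x κ.2, IsLinearOver.map_smul],
    f.2.2.1.subset (by
      rintro _ ⟨x, rfl, hx⟩
      exact ⟨x, rfl, fun hf => hx (by
        change c • f.ev x = 0
        have hf' : f.ev x = 0 := hf
        rw [hf', smul_zero])⟩), by
    obtain ⟨n, hn⟩ := f.2.2.2
    exact ⟨n, fun u hu x => congrArg (c • ·) (hn u hu x)⟩⟩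

@[simp]
lemma CInd.smul_ev (c : k') (f : CInd ϖ σ) (g : GL (Fin 2) F) : (c • f).ev g = c • f.ev g := rfl

/-- The pointwise structure of `k'`-vector space on the compact induction of a representation that
is linear over `k'`. -/
instance : Module k' (CInd ϖ σ) where
  one_smul f := CInd.ext fun g => one_smul k' (f.ev g)
  mul_smul a b f := CInd.ext fun g => mul_smul a b (f.ev g)
  smul_zero a := CInd.ext fun _ => smul_zero a
  smul_add a f h := CInd.ext fun g => smul_add a (f.ev g) (h.ev g)
  add_smul a b f := CInd.ext fun g => add_smul a b (f.ev g)
  zero_smul f := CInd.ext fun g => zero_smul k' (f.ev g)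

variable [FaithfulSMul O F] [Fact (Irreducible ϖ)]

variable (ϖ σ k') in
/-- The action of `U` and of `α` on the compact induction, over `k'`. -/
def extOre : OreRep k' O ϖ (CInd ϖ σ) where
  rho :=
    { toFun x :=
        { toFun := (cIndOre ϖ σ).rho x
          map_add' := map_add _
          map_smul' := fun _ _ => rfl }
      map_one' := LinearMap.ext fun f => by
        change (cIndOre ϖ σ).rho 1 f = f
        rw [map_one, Module.End.one_apply]
      map_mul' x y := LinearMap.ext fun f => by
        change (cIndOre ϖ σ).rho (x * y) f = (cIndOre ϖ σ).rho x ((cIndOre ϖ σ).rho y f)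
        rw [map_mul, Module.End.mul_apply] }
  t :=
    { toFun := (cIndOre ϖ σ).t
      map_add' := map_add _
      map_smul' := fun _ _ => rfl }
  comm := (cIndOre ϖ σ).comm
  smooth := (cIndOre ϖ σ).smooth

/-- The matrix `(ϖ ^ n, x; 0, 1)`. -/
def pt (F : Type u) [Field F] {O : Type u} [CommRing O] [Algebra O F] (ϖ : O) [FaithfulSMul O F]
    [Fact (Irreducible ϖ)] (x : O) (n : ℕ) : GL (Fin 2) F := unip F O x * alpha F O ϖ ^ n

variable (k') in
lemma rho_t_pow_ev (f : CInd ϖ σ) (x : O) (n : ℕ) (g : GL (Fin 2) F) :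
    ((extOre ϖ σ k').rho (ofAdd x) (((extOre ϖ σ k').t ^ n) f)).ev g =
      f.ev ((pt F ϖ x n)⁻¹ * g) := by
  induction n generalizing x g with
  | zero =>
    rw [pt, pow_zero, pow_zero, mul_one]
    rfl
  | succ n ih =>
    have h1 : ((extOre ϖ σ k').rho (ofAdd x) (((extOre ϖ σ k').t ^ (n + 1)) f)).ev g =
        ((extOre ϖ σ k').rho (ofAdd 0) (((extOre ϖ σ k').t ^ n) f)).ev
          ((alpha F O ϖ)⁻¹ * ((unip F O x)⁻¹ * g)) := by
      rw [pow_succ', ofAdd_zero, map_one]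
      rfl
    rw [h1, ih]
    congr 1
    rw [pt, pt, pow_succ', unip, AddChar.map_zero_eq_one, map_one, one_mul]
    group

end

variable [FaithfulSMul O F] [Fact (Irreducible ϖ)]

lemma inc_val {F : Type u} [Field F] {O : Type u} [CommRing O] [Algebra O F] (g : GL (Fin 2) O) :
    ((inc F O g : GL (Fin 2) F) : Matrix (Fin 2) (Fin 2) F) =
      !![algebraMap O F (g 0 0), algebraMap O F (g 0 1);
        algebraMap O F (g 1 0), algebraMap O F (g 1 1)] := by
  ext i j; fin_cases i <;> fin_cases j <;> rfl

lemma pt_val (x : O) (n : ℕ) : ((pt F ϖ x n : GL (Fin 2) F) : Matrix (Fin 2) (Fin 2) F) =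
    !![algebraMap O F ϖ ^ n, algebraMap O F x; 0, 1] := by
  rw [pt, Units.val_mul, alpha_val_pow]
  ext i j; fin_cases i <;> fin_cases j <;>
    simp [unip, inc, Matrix.mul_apply, Fin.sum_univ_two]

lemma pt_add_mul (x c : O) (n : ℕ) : pt F ϖ (x + ϖ ^ n * c) n = pt F ϖ x n * unip F O c := by
  apply Units.ext
  rw [Units.val_mul, pt_val, pt_val]
  ext i j; fin_cases i <;> fin_cases j <;>
    simp [unip, inc, Matrix.mul_apply, Fin.sum_univ_two, add_comm]

lemma pt_mul_pt (x y : O) (m n : ℕ) : pt F ϖ x m * pt F ϖ y n = pt F ϖ (x + ϖ ^ m * y) (m + n) := by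
  apply Units.ext
  rw [Units.val_mul, pt_val, pt_val, pt_val]
  ext i j; fin_cases i <;> fin_cases j <;>
    simp [Matrix.mul_apply, Fin.sum_univ_two, add_comm, pow_add]

/-- The cosets of the matrices `(ϖ ^ n, x; 0, 1)` modulo `Z GL_2(O)` are distinct for distinct `n`
and distinct `x` modulo `ϖ ^ n`. -/
lemma IsUniformizing.eq_and_dvd_of_pt_eq (hu : IsUniformizing F ϖ) [IsDomain O] {x y : O} {m n : ℕ}
    {κ : GL (Fin 2) F} (hκ : κ ∈ ZK F O) (h : pt F ϖ x m = pt F ϖ y n * κ) :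
    m = n ∧ ϖ ^ n ∣ x - y := by
  have hinj := FaithfulSMul.algebraMap_injective O F
  have hϖ : Irreducible ϖ := Fact.out
  have hϖ0 : algebraMap O F ϖ ≠ 0 := (map_ne_zero_iff _ hinj).2 hϖ.ne_zero
  obtain ⟨j, g, rfl⟩ := hu.exists_eq_of_mem_ZK hκ
  have hdet := (Matrix.isUnit_iff_isUnit_det _).1 g.isUnit
  rw [Matrix.det_fin_two] at hdet
  have hM := congrArg (fun M : GL (Fin 2) F => (M : Matrix (Fin 2) (Fin 2) F)) h
  simp only [Units.val_mul, pt_val, dia_zpow, dia_val, inc_val, Matrix.mul_fin_two, zero_mul,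
    add_zero, zero_add, one_mul, Units.val_zpow_eq_zpow_val] at hM
  have e00 : algebraMap O F ϖ ^ m = algebraMap O F ϖ ^ n * (algebraMap O F ϖ ^ j *
      algebraMap O F (g 0 0)) + algebraMap O F y * (algebraMap O F ϖ ^ j * algebraMap O F (g 1 0)) :=
    congrFun (congrFun hM 0) 0
  have e01 : algebraMap O F x = algebraMap O F ϖ ^ n * (algebraMap O F ϖ ^ j *
      algebraMap O F (g 0 1)) + algebraMap O F y * (algebraMap O F ϖ ^ j * algebraMap O F (g 1 1)) :=
    congrFun (congrFun hM 0) 1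
  have e10 : 0 = algebraMap O F ϖ ^ j * algebraMap O F (g 1 0) := congrFun (congrFun hM 1) 0
  have e11 : 1 = algebraMap O F ϖ ^ j * algebraMap O F (g 1 1) := congrFun (congrFun hM 1) 1
  replace e10 : g 1 0 = 0 := by
    rcases mul_eq_zero.1 e10.symm with h | h
    · exact absurd h (zpow_ne_zero _ hϖ0)
    · exact hinj (h.trans (map_zero _).symm)
  rw [e10, mul_zero, sub_zero] at hdet
  have hj : j = 0 := by
    obtain ⟨i, rfl | rfl⟩ := j.eq_nat_or_neg
    · rw [zpow_natCast, ← map_pow, ← map_mul, ← map_one (algebraMap O F)] at e11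
      rcases i with - | i
      · rfl
      · refine absurd (isUnit_of_dvd_one ?_) hϖ.not_isUnit
        rw [hinj e11, pow_succ', mul_assoc]
        exact dvd_mul_right _ _
    · rw [_root_.zpow_neg, zpow_natCast, eq_inv_mul_iff_mul_eq₀ (pow_ne_zero _ hϖ0), mul_one,
        ← map_pow] at e11
      rcases i with - | i
      · rfl
      · refine absurd (isUnit_of_dvd_unit ?_ (isUnit_of_mul_isUnit_right hdet)) hϖ.not_isUnit
        rw [← hinj e11]
        exact dvd_pow_self _ i.succ_ne_zero
  subst hj
  simp only [zpow_zero, one_mul] at e00 e01 e11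
  have e11' := hinj (e11.symm.trans (map_one _).symm)
  rw [e10, map_zero, mul_zero, add_zero, ← map_pow, ← map_pow, ← map_mul] at e00
  have e00' := hinj e00
  rw [e11', map_one, mul_one, ← map_pow, ← map_mul, ← map_add] at e01
  have e01' := hinj e01
  rw [e11', mul_one] at hdet
  refine ⟨le_antisymm ?_ ?_, ?_⟩
  · rw [← pow_dvd_pow_iff hϖ.ne_zero hϖ.not_isUnit, e00']
    exact hdet.mul_right_dvd.2 dvd_rfl
  · rw [← pow_dvd_pow_iff hϖ.ne_zero hϖ.not_isUnit, e00']
    exact dvd_mul_right _ _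
  · rw [e01', add_sub_cancel_right]
    exact dvd_mul_right _ _

end Extension

/-! ### The support of functions in the compact induction -/

section Support

open Multiplicative

variable {F : Type u} [Field F] {O : Type u} [CommRing O] [Algebra O F] {ϖ : O}
  {k : Type u} [Field k] {W : Type u} [AddCommGroup W] [Module k W]
  {σ : Representation k (ZK F O) W} {k' : Type u} [Field k'] [Module k' W] [IsLinearOver σ k']

variable (σ k') in
/-- The restriction of `σ` to `GL_2(O)`, over `k'`. -/
abbrev resK : Representation k' (GL (Fin 2) O) W := resRep σ k' IsLinearOver.map_smul

lemma resK_apply (g : GL (Fin 2) O) (w : W) :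
    resK σ k' g w = σ ⟨inc F O g, inc_mem F O g⟩ w := rfl

lemma unip_mem (x : O) : unip F O x ∈ ZK F O := inc_mem F O _

lemma resK_upp (x : O) (w : W) : resK σ k' (upp x) w = σ ⟨unip F O x, unip_mem x⟩ w := rfl

variable (hone : ∀ g ∈ congr O ϖ 1, resK σ k' g = 1)

include hone in
lemma resK_upp_mul (x : O) : resK σ k' (upp (ϖ * x)) = 1 := by
  apply hone
  have := upperRightHom_mem_congr O ϖ 1 x
  rwa [pow_one] at this

/-- The group homomorphism `x ↦ (1, x; 0, 1)`. -/
def uppHom (R : Type*) [CommRing R] : Multiplicative R →* GL (Fin 2) R where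
  toFun x := upp (toAdd x)
  map_one' := upp_zero
  map_mul' x y := upp_add (toAdd x) (toAdd y)

variable (σ k') in
/-- The representation of `U` on the space of `σ`. -/
def weightRho : Representation k' (Multiplicative O) W := (resK σ k').comp (uppHom O)

lemma weightRho_ofAdd (x : O) : weightRho σ k' (ofAdd x) = resK σ k' (upp x) := rfl

/-- The representation of `U` on the space of `σ`, on which `X` acts by zero. -/
def weightOre : OreRep k' O ϖ W where
  rho := weightRho σ k'
  t := 0
  comm x v := by rw [LinearMap.zero_apply, LinearMap.zero_apply, map_zero]
  smooth v := ⟨1, fun x => by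
    rw [weightRho_ofAdd, pow_one, resK_upp_mul hone, Module.End.one_apply]⟩

lemma weightOre_rho (x : O) (w : W) : (weightOre hone).rho (ofAdd x) w = resK σ k' (upp x) w := rfl

lemma weightOre_fixed_one (w : W) : (weightOre hone).Fixed 1 w := fun x => by
  rw [weightOre_rho, pow_one, resK_upp_mul hone, Module.End.one_apply]

open Classical in
/-- The function in the compact induction with support in `Z GL_2(O)` and value `w` at `1`. -/
def singleFun (w : W) : CInd ϖ σ :=
  ⟨fun g => if h : g ∈ ZK F O then σ ⟨g, h⟩⁻¹ w else 0, by
    refine ⟨fun g κ => ?_, (Set.finite_singleton (QuotientGroup.mk 1)).subset ?_, 1,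
      fun u hu g => ?_⟩
    · by_cases hg : g ∈ ZK F O
      · have hg' : g * κ ∈ ZK F O := mul_mem hg κ.2
        have h : (⟨g * κ, hg'⟩ : ZK F O)⁻¹ = κ⁻¹ * ⟨g, hg⟩⁻¹ := by
          rw [← _root_.mul_inv_rev]; rfl
        simp only [hg, hg', dite_true, h, map_mul, Module.End.mul_apply]
      · have hg' : g * κ ∉ ZK F O := fun h => hg ((Subgroup.mul_mem_cancel_right _ κ.2).1 h)
        simp only [hg, hg', dite_false, map_zero]
    · rintro _ ⟨g, rfl, hg⟩
      have hg' : g ∈ ZK F O := by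
        by_contra h
        exact hg (by simp only [h, dite_false])
      rw [Set.mem_singleton_iff, QuotientGroup.eq, mul_one]
      exact inv_mem hg'
    · by_cases hg : g ∈ ZK F O
      · have hg' : inc F O u * g ∈ ZK F O := mul_mem (inc_mem F O u) hg
        have h : (⟨inc F O u * g, hg'⟩ : ZK F O)⁻¹ = ⟨g, hg⟩⁻¹ * ⟨inc F O u⁻¹, inc_mem F O _⟩ :=
          Subtype.ext (by
            change (inc F O u * g)⁻¹ = g⁻¹ * inc F O u⁻¹
            rw [_root_.mul_inv_rev, map_inv])
        have h1 : σ ⟨inc F O u⁻¹, inc_mem F O _⟩ w = w :=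
          LinearMap.congr_fun (hone u⁻¹ (inv_mem hu)) w
        simp only [hg, hg', dite_true, h, map_mul, Module.End.mul_apply, h1]
      · have hg' : inc F O u * g ∉ ZK F O := fun h =>
          hg ((Subgroup.mul_mem_cancel_left _ (inc_mem F O u)).1 h)
        simp only [hg, hg', dite_false]⟩

lemma singleFun_ev {g : GL (Fin 2) F} (hg : g ∈ ZK F O) (w : W) :
    (singleFun hone w).ev g = σ ⟨g, hg⟩⁻¹ w := dif_pos hg

lemma singleFun_ev_of_notMem {g : GL (Fin 2) F} (hg : g ∉ ZK F O) (w : W) :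
    (singleFun hone w).ev g = 0 := dif_neg hg

/-- The function `singleFun w` as a linear function of `w`. -/
def single : W →ₗ[k'] CInd ϖ σ where
  toFun := singleFun hone
  map_add' w w' := CInd.ext fun g => by
    by_cases h : g ∈ ZK F O
    · rw [CInd.add_ev]
      simp only [singleFun_ev hone h, map_add]
    · rw [CInd.add_ev]
      simp only [singleFun_ev_of_notMem hone h, add_zero]
  map_smul' c w := CInd.ext fun g => by
    by_cases h : g ∈ ZK F O
    · rw [RingHom.id_apply, CInd.smul_ev]
      simp only [singleFun_ev hone h, IsLinearOver.map_smul]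
    · rw [RingHom.id_apply, CInd.smul_ev]
      simp only [singleFun_ev_of_notMem hone h, smul_zero]

lemma single_ev {g : GL (Fin 2) F} (hg : g ∈ ZK F O) (w : W) :
    (single hone w).ev g = σ ⟨g, hg⟩⁻¹ w := singleFun_ev hone hg w

lemma single_ev_of_notMem {g : GL (Fin 2) F} (hg : g ∉ ZK F O) (w : W) :
    (single hone w).ev g = 0 := singleFun_ev_of_notMem hone hg w

lemma single_ev_one (w : W) : (single hone w).ev 1 = w := by
  rw [single_ev hone (one_mem _)]
  have : (⟨1, one_mem _⟩ : ZK F O)⁻¹ = 1 := inv_one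
  rw [this, map_one, Module.End.one_apply]

lemma single_injective : Function.Injective (single hone) := fun w w' h => by
  rw [← single_ev_one hone w, h, single_ev_one]

variable [FaithfulSMul O F] [Fact (Irreducible ϖ)]

lemma single_rho (x : O) (w : W) :
    single hone ((weightOre hone).rho (ofAdd x) w) =
      (extOre ϖ σ k').rho (ofAdd x) (single hone w) := by
  ext g
  have h0 : ((extOre ϖ σ k').rho (ofAdd x) (single hone w)).ev g =
    (single hone w).ev ((unip F O x)⁻¹ * g) := rfl
  rw [h0]
  by_cases hg : g ∈ ZK F O
  · have hg' := mul_mem (inv_mem (unip_mem (F := F) x)) hg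
    rw [single_ev hone hg, single_ev hone hg', weightOre_rho, resK_upp, ← Module.End.mul_apply,
      ← map_mul]
    have h : (⟨g, hg⟩ : ZK F O)⁻¹ * ⟨unip F O x, unip_mem x⟩ =
        (⟨(unip F O x)⁻¹ * g, hg'⟩ : ZK F O)⁻¹ := Subtype.ext (by
      change g⁻¹ * unip F O x = ((unip F O x)⁻¹ * g)⁻¹
      group)
    rw [h]
  · have hg' : (unip F O x)⁻¹ * g ∉ ZK F O := fun h =>
      hg ((Subgroup.mul_mem_cancel_left _ (inv_mem (unip_mem x))).1 h)
    rw [single_ev_of_notMem hone hg, single_ev_of_notMem hone hg']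

lemma single_act (a : iwasawa k' O ϖ) (w : W) :
    single hone ((weightOre hone).act a w) = (extOre ϖ σ k').act a (single hone w) :=
  OreRep.map_act _ _ (single hone) (fun x v => single_rho hone (toAdd x) v) a w

variable (ϖ σ k') in
/-- The functions in the compact induction with support in the cosets of the matrices
`(ϖ ^ n, x; 0, 1)`. -/
def supp (n : ℕ) : Submodule k' (CInd ϖ σ) where
  carrier := {f | ∀ g, f.ev g ≠ 0 → ∃ x, ∃ κ ∈ ZK F O, g = pt F ϖ x n * κ}
  zero_mem' g hg := absurd rfl hg
  add_mem' {f f'} hf hf' g hg := by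
    by_cases h : f.ev g = 0
    · exact hf' g fun h' => hg (by rw [CInd.add_ev, h, h', add_zero])
    · exact hf g h
  smul_mem' c f hf g hg := hf g fun h => hg (by rw [CInd.smul_ev, h, smul_zero])

lemma eq_zero_of_mem_supp {n : ℕ} {f : CInd ϖ σ} (hf : f ∈ supp ϖ σ k' n)
    (h : ∀ x, f.ev (pt F ϖ x n) = 0) : f = 0 := by
  ext g
  by_contra hg
  obtain ⟨x, κ, hκ, rfl⟩ := hf g hg
  exact hg (by rw [f.ev_mul _ hκ, h, map_zero, CInd.zero_ev])

lemma ev_pt_eq_zero_of_mem_supp (hu : IsUniformizing F ϖ) [IsDomain O] {m n : ℕ} {f : CInd ϖ σ}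
    (hf : f ∈ supp ϖ σ k' n) (hmn : m ≠ n) (x : O) : f.ev (pt F ϖ x m) = 0 := by
  by_contra hg
  obtain ⟨y, κ, hκ, h⟩ := hf _ hg
  exact hmn (hu.eq_and_dvd_of_pt_eq hκ h).1

lemma rho_mem_supp {n : ℕ} (x : Multiplicative O) {f : CInd ϖ σ} (hf : f ∈ supp ϖ σ k' n) :
    (extOre ϖ σ k').rho x f ∈ supp ϖ σ k' n := by
  intro g hg
  obtain ⟨y, κ, hκ, h⟩ := hf ((unip F O (toAdd x))⁻¹ * g) hg
  refine ⟨toAdd x + y, κ, hκ, ?_⟩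
  rw [inv_mul_eq_iff_eq_mul] at h
  rw [h, pt, pt, unip_mul]
  simp only [mul_assoc]

lemma t_mem_supp {n : ℕ} {f : CInd ϖ σ} (hf : f ∈ supp ϖ σ k' n) :
    (extOre ϖ σ k').t f ∈ supp ϖ σ k' (n + 1) := by
  intro g hg
  obtain ⟨y, κ, hκ, h⟩ := hf ((alpha F O ϖ)⁻¹ * g) hg
  refine ⟨ϖ * y, κ, hκ, ?_⟩
  rw [inv_mul_eq_iff_eq_mul] at h
  rw [h, pt, pt, pow_succ', ← mul_assoc (unip F O (ϖ * y)), ← alpha_unip]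
  simp only [mul_assoc]

lemma t_pow_single_mem_supp (n : ℕ) (w : W) :
    ((extOre ϖ σ k').t ^ n) (single hone w) ∈ supp ϖ σ k' n := by
  induction n with
  | zero =>
    intro g hg
    refine ⟨0, g, ?_, ?_⟩
    · by_contra h
      exact hg (single_ev_of_notMem hone h w)
    · rw [pt, pow_zero, unip, AddChar.map_zero_eq_one, map_one, one_mul, one_mul]
  | succ n ih =>
    rw [pow_succ']
    exact t_mem_supp ih

lemma act_mem_supp {n : ℕ} (a : iwasawa k' O ϖ) {f : CInd ϖ σ} (hf : f ∈ supp ϖ σ k' n) :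
    (extOre ϖ σ k').act a f ∈ supp ϖ σ k' n :=
  (extOre ϖ σ k').act_mem (fun x _ hv => rho_mem_supp x hv) a hf

/-- A function with support in the cosets of the matrices `(ϖ ^ n, x; 0, 1)` is the sum of its
restrictions to these cosets. -/
lemma eq_sum_of_mem_supp (hu : IsUniformizing F ϖ) [IsDomain O] {n : ℕ} [Fintype (O ⧸ lev O ϖ n)]
    {f : CInd ϖ σ} (hf : f ∈ supp ϖ σ k' n) :
    f = ∑ x : O ⧸ lev O ϖ n, (extOre ϖ σ k').rho (ofAdd x.out)
      (((extOre ϖ σ k').t ^ n) (single hone (f.ev (pt F ϖ x.out n)))) := by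
  rw [← sub_eq_zero]
  refine eq_zero_of_mem_supp (k' := k') (n := n) (sub_mem hf (sum_mem fun x _ => rho_mem_supp _
    (t_pow_single_mem_supp hone n _))) fun y => ?_
  obtain ⟨c, hc⟩ : ϖ ^ n ∣ y - (Ideal.Quotient.mk (lev O ϖ n) y).out := by
    rw [← Ideal.mem_span_singleton, ← Ideal.Quotient.eq]
    exact (Quotient.out_eq' _).symm
  rw [CInd.sub_ev, CInd.sum_ev, Finset.sum_eq_single (Ideal.Quotient.mk (lev O ϖ n) y)]
  · obtain ⟨z, hz⟩ : ∃ z, z = (Ideal.Quotient.mk (lev O ϖ n) y).out := ⟨_, rfl⟩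
    rw [← hz] at hc ⊢
    obtain rfl : y = z + ϖ ^ n * c := by rw [← hc]; ring
    rw [rho_t_pow_ev, pt_add_mul, inv_mul_cancel_left, f.ev_mul _ (unip_mem c),
      single_ev hone (unip_mem c), sub_self]
  · intro x _ hx
    rw [rho_t_pow_ev]
    refine single_ev_of_notMem hone (fun h => hx ?_) _
    have h1 := (hu.eq_and_dvd_of_pt_eq h (mul_inv_cancel_left _ _).symm).2
    rw [← Ideal.mem_span_singleton, ← Ideal.Quotient.eq] at h1
    exact (Quotient.out_eq' x).symm.trans h1.symm
  · exact fun h => absurd (Finset.mem_univ _) h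

end Support

/-! ### The annihilator of a function with support in `Z GL_2(O)` -/

section Kernel

open Multiplicative

variable {F : Type u} [Field F] {O : Type u} [CommRing O] [Algebra O F] {ϖ : O}
  {k : Type u} [Field k] {W : Type u} [AddCommGroup W] [Module k W]
  {σ : Representation k (ZK F O) W} {k' : Type u} [Field k'] [Module k' W] [IsLinearOver σ k']
  (hone : ∀ g ∈ congr O ϖ 1, resK σ k' g = 1)

/-- The annihilator in `k'[[U]]` of a vector of `σ`. -/
def annIdeal (w : W) : Ideal (iwasawa k' O ϖ) where
  carrier := {a | (weightOre hone).act a w = 0}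
  zero_mem' := (weightOre hone).zero_act w
  add_mem' {a b} ha hb := by
    change (weightOre hone).act (a + b) w = 0
    rw [OreRep.act_add, ha, hb, add_zero]
  smul_mem' a b hb := by
    change (weightOre hone).act (a * b) w = 0
    rw [OreRep.act_mul, hb, OreRep.act_zero]

lemma mem_annIdeal {w : W} {a : iwasawa k' O ϖ} :
    a ∈ annIdeal hone w ↔ (weightOre hone).act a w = 0 := Iff.rfl

variable [FaithfulSMul O F] [Fact (Irreducible ϖ)]

lemma act_single_eq_zero_iff {w : W} {a : iwasawa k' O ϖ} :
    (extOre ϖ σ k').act a (single hone w) = 0 ↔ a ∈ annIdeal hone w := by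
  rw [← single_act, map_eq_zero_iff _ (single_injective hone), mem_annIdeal]

variable (hu : IsUniformizing F ϖ) [IsDomain O] [Finite (O ⧸ Ideal.span {ϖ})]

include hu in
/-- If `a X f = 0`, then `ψ_r(a) f = 0` for all `r`. In fact `a X f` is the sum of the functions
`r X ψ_r(a) f`, and these have disjoint supports for distinct `r` in `U / φ(U)`. -/
lemma act_psi_eq_zero {n : ℕ} {f : CInd ϖ σ} (hf : f ∈ supp ϖ σ k' n) {a : iwasawa k' O ϖ}
    (h : (extOre ϖ σ k').act a ((extOre ϖ σ k').t f) = 0) (r : O ⧸ Ideal.span {ϖ}) :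
    (extOre ϖ σ k').act (psi (Fact.out : Irreducible ϖ).ne_zero r.out a) f = 0 := by
  have := Fintype.ofFinite (O ⧸ Ideal.span {ϖ})
  have hϖ := (Fact.out : Irreducible ϖ).ne_zero
  let b (s : O ⧸ Ideal.span {ϖ}) : CInd ϖ σ := (extOre ϖ σ k').act (psi hϖ s.out a) f
  have hb (s) : b s ∈ supp ϖ σ k' n := act_mem_supp _ hf
  have hsum : ∑ s, (extOre ϖ σ k').rho (ofAdd s.out) ((extOre ϖ σ k').t (b s)) = 0 := by
    rw [sum_dirac_mul_phi_psi hϖ a, OreRep.act_sum] at h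
    rw [← h]
    refine Finset.sum_congr rfl fun s _ => ?_
    rw [OreRep.act_mul, OreRep.act_dirac, OreRep.t_act]
  have hev (s : O ⧸ Ideal.span {ϖ}) (g : GL (Fin 2) F) :
      ((extOre ϖ σ k').rho (ofAdd s.out) ((extOre ϖ σ k').t (b s))).ev g =
        (b s).ev ((pt F ϖ s.out 1)⁻¹ * g) := by
    rw [← rho_t_pow_ev k' (b s) s.out 1 g, pow_one]
  refine eq_zero_of_mem_supp (hb r) fun y => ?_
  have h1 := congrArg (fun f : CInd ϖ σ => f.ev (pt F ϖ r.out 1 * pt F ϖ y n)) hsum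
  simp only [CInd.sum_ev, CInd.zero_ev, hev] at h1
  rw [Finset.sum_eq_single r, inv_mul_cancel_left] at h1
  · exact h1
  · intro s _ hs
    by_contra h0
    obtain ⟨z, κ, hκ, hz⟩ := hb s _ h0
    rw [inv_mul_eq_iff_eq_mul, ← mul_assoc, pt_mul_pt, pt_mul_pt, pow_one] at hz
    have h2 := (hu.eq_and_dvd_of_pt_eq hκ hz).2
    refine hs ?_
    rw [← Quotient.out_eq' s, ← Quotient.out_eq' r]
    refine (Ideal.Quotient.eq.2 (Ideal.mem_span_singleton.2 ?_)).symm
    have h3 : ϖ ∣ r.out + ϖ * y - (s.out + ϖ * z) := (dvd_pow_self ϖ (by omega)).trans h2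
    have h4 : r.out - s.out = (r.out + ϖ * y - (s.out + ϖ * z)) - ϖ * (y - z) := by ring
    rw [h4]
    exact dvd_sub h3 (dvd_mul_right _ _)
  · exact fun h => absurd (Finset.mem_univ _) h

include hu in
lemma monomial_mem_span {w : W} (n : ℕ) {a : iwasawa k' O ϖ}
    (h : (extOre ϖ σ k').act a (((extOre ϖ σ k').t ^ n) (single hone w)) = 0) :
    SkewPolynomial.monomial n a ∈ Submodule.span (Twisted k' O ϖ)
      (SkewPolynomial.C '' (annIdeal hone w : Set (iwasawa k' O ϖ))) := by
  have := Fintype.ofFinite (O ⧸ Ideal.span {ϖ})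
  induction n generalizing a with
  | zero =>
    exact Submodule.subset_span ⟨a, (act_single_eq_zero_iff hone).1 h, rfl⟩
  | succ n ih =>
    rw [pow_succ', Module.End.mul_apply] at h
    have h1 : SkewPolynomial.monomial (n + 1) a = ∑ r : O ⧸ Ideal.span {ϖ},
        (SkewPolynomial.C (dirac k' ϖ r.out) * SkewPolynomial.X : Twisted k' O ϖ) *
          SkewPolynomial.monomial n (psi (Fact.out : Irreducible ϖ).ne_zero r.out a) := by
      conv_lhs => rw [sum_dirac_mul_phi_psi (Fact.out : Irreducible ϖ).ne_zero a]
      rw [map_sum]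
      refine Finset.sum_congr rfl fun r _ => ?_
      rw [mul_assoc, SkewPolynomial.X_mul_monomial, SkewPolynomial.C_mul_monomial, φ_eq_phi]
    rw [h1]
    exact sum_mem fun r _ => Submodule.smul_mem _ _ (ih
      (act_psi_eq_zero hu (t_pow_single_mem_supp hone n w) h r))

include hu in
/-- The annihilator of the function with support in `Z GL_2(O)` and value `w` at `1` is generated
by the annihilator of `w`. -/
lemma toEnd_single_eq_zero_iff {w : W} (Q : Twisted k' O ϖ) :
    (extOre ϖ σ k').toEnd Q (single hone w) = 0 ↔ Q ∈ Submodule.span (Twisted k' O ϖ)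
      (SkewPolynomial.C '' (annIdeal hone w : Set (iwasawa k' O ϖ))) := by
  constructor
  · intro h
    have hQ : Q = ∑ n ∈ Q.support, SkewPolynomial.monomial n (Q.coeff n) := by
      conv_lhs => rw [← SkewPolynomial.sum_monomial Q]
      exact SkewPolynomial.sum_def Q _
    rw [hQ]
    refine sum_mem fun n hn => monomial_mem_span hone hu n ?_
    have hs (m : ℕ) : (extOre ϖ σ k').act (Q.coeff m)
        (((extOre ϖ σ k').t ^ m) (single hone w)) ∈ supp ϖ σ k' m :=
      act_mem_supp _ (t_pow_single_mem_supp hone m w)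
    refine eq_zero_of_mem_supp (hs n) fun x => ?_
    rw [hQ, map_sum, LinearMap.sum_apply] at h
    have h1 := congrArg (fun f : CInd ϖ σ => f.ev (pt F ϖ x n)) h
    simp only [CInd.sum_ev, CInd.zero_ev, OreRep.toEnd_monomial] at h1
    rwa [Finset.sum_eq_single n (fun m _ hm => ev_pt_eq_zero_of_mem_supp hu (hs m) hm.symm x)
      (fun h => absurd hn h)] at h1
  · intro h
    induction h using Submodule.span_induction with
    | mem Q hQ =>
      obtain ⟨a, ha, rfl⟩ := hQ
      have := OreRep.toEnd_monomial (extOre ϖ σ k') 0 a (single hone w)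
      rw [pow_zero, Module.End.one_apply] at this
      exact this.trans ((act_single_eq_zero_iff hone).2 ha)
    | zero => rw [map_zero, LinearMap.zero_apply]
    | add P Q _ _ hP hQ => rw [map_add, LinearMap.add_apply, hP, hQ, add_zero]
    | smul P Q _ hQ => rw [smul_eq_mul, map_mul, Module.End.mul_apply, hQ, map_zero]

include hu in
lemma act_t_single_eq_zero_iff {w : W} (a : iwasawa k' O ϖ) :
    (extOre ϖ σ k').act a ((extOre ϖ σ k').t (single hone w)) = 0 ↔
      a ∈ (annIdeal hone w).map (phi k' O ϖ) := by
  constructor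
  · intro h
    have := Fintype.ofFinite (O ⧸ Ideal.span {ϖ})
    rw [sum_dirac_mul_phi_psi (Fact.out : Irreducible ϖ).ne_zero a]
    refine sum_mem fun r _ => Ideal.mul_mem_left _ _ (Ideal.mem_map_of_mem _ ?_)
    rw [← act_single_eq_zero_iff]
    exact act_psi_eq_zero hu (t_pow_single_mem_supp hone 0 w) h r
  · intro h
    refine Submodule.span_induction (p := fun a _ => (extOre ϖ σ k').act a
      ((extOre ϖ σ k').t (single hone w)) = 0) ?_ ?_ ?_ ?_ h
    · rintro _ ⟨b, hb, rfl⟩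
      refine ((extOre ϖ σ k').t_act b _).symm.trans ?_
      rw [(act_single_eq_zero_iff hone).2 hb, map_zero]
    · exact OreRep.zero_act _ _
    · intro a b _ _ ha hb
      rw [OreRep.act_add, ha, hb, add_zero]
    · intro a b _ hb
      rw [smul_eq_mul, OreRep.act_mul, hb, OreRep.act_zero]

end Kernel

/-! ### The Hecke operator -/

section HeckeValues

open Multiplicative

variable {F : Type u} [Field F] {O : Type u} [CommRing O] [Algebra O F] {ϖ : O}
  [FaithfulSMul O F] [Fact (Irreducible ϖ)]

lemma alpha_val : ((alpha F O ϖ : GL (Fin 2) F) : Matrix (Fin 2) (Fin 2) F) =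
    !![algebraMap O F ϖ, 0; 0, 1] := rfl

omit [FaithfulSMul O F] in
lemma unip_val (x : O) : ((unip F O x : GL (Fin 2) F) : Matrix (Fin 2) (Fin 2) F) =
    !![1, algebraMap O F x; 0, 1] := inc_upp_val x

lemma zUnif_val : ((zUnif F ϖ : GL (Fin 2) F) : Matrix (Fin 2) (Fin 2) F) =
    !![algebraMap O F ϖ, 0; 0, algebraMap O F ϖ] := rfl

omit [FaithfulSMul O F] in
lemma inc_weyl_val : ((inc F O weyl : GL (Fin 2) F) : Matrix (Fin 2) (Fin 2) F) =
    !![0, 1; -1, 0] := by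
  rw [inc_val, weyl_val]
  simp

lemma alpha_mul_weyl_mul_alpha :
    alpha F O ϖ * inc F O weyl * alpha F O ϖ = (zUnif F ϖ : GL (Fin 2) F) * inc F O weyl := by
  apply Units.ext
  simp only [Units.val_mul, alpha_val, zUnif_val, inc_weyl_val, Matrix.mul_fin_two]
  simp

lemma weyl_unip_mul_alpha (x : O) :
    inc F O weyl * unip F O x * (inc F O weyl)⁻¹ * alpha F O ϖ =
      alpha F O ϖ * (inc F O weyl * unip F O (ϖ * x) * (inc F O weyl)⁻¹) := by
  have h : ∀ y : O, inc F O weyl * unip F O y * (inc F O weyl)⁻¹ =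
      inc F O weyl * unip F O y * (inc F O (weyl * dia (-1) (-1))) := fun y => by
    congr 1
    rw [inv_eq_iff_mul_eq_one, ← map_mul, ← mul_assoc, weyl_mul_weyl, dia_mul, neg_mul_neg, one_mul,
      dia_one, map_one]
  rw [h, h]
  apply Units.ext
  simp only [Units.val_mul, alpha_val, inc_weyl_val, unip_val, map_mul, inc_val (dia _ _), dia_val,
    Matrix.mul_fin_two]
  simp [mul_comm]

/-- The double coset of `α` is the union of `α⁻¹ Z GL_2(O)` and of cosets of the matrices
`(ϖ, x; 0, 1)`; both sides are multiplied by `α`. -/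
lemma IsUniformizing.alpha_mul_mul_alpha_inv (hu : IsUniformizing F ϖ) (h : GL (Fin 2) O) :
    alpha F O ϖ * inc F O h * (alpha F O ϖ)⁻¹ ∈ ZK F O ∨
      ∃ x, ∃ κ ∈ ZK F O, alpha F O ϖ * inc F O h * (alpha F O ϖ)⁻¹ = pt F ϖ (ϖ * x) 2 * κ := by
  have hdet := (Matrix.isUnit_iff_isUnit_det _).1 h.isUnit
  rw [Matrix.det_fin_two] at hdet
  rcases hu.isUnit_or_dvd (h 1 0) with hc | ⟨c, hc⟩
  · right
    obtain ⟨x, hx⟩ : ∃ x, h 0 0 = x * h 1 0 := by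
      obtain ⟨c, hc⟩ := hc
      exact ⟨h 0 0 * ↑c⁻¹, by rw [← hc, mul_assoc, c.inv_mul, mul_one]⟩
    have hdet' : (!![0, h 0 1 - x * h 1 1; h 1 0, ϖ * h 1 1] :
        Matrix (Fin 2) (Fin 2) O).det = h 0 0 * h 1 1 - h 0 1 * h 1 0 := by
      rw [Matrix.det_fin_two_of, hx]
      ring
    obtain ⟨κ, hκ⟩ := (Matrix.isUnit_iff_isUnit_det _).2 (hdet' ▸ hdet)
    refine ⟨x, (zUnif F ϖ : GL (Fin 2) F)⁻¹ * inc F O κ,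
      mul_mem (inv_mem (zUnif F ϖ).2) (inc_mem F O κ), ?_⟩
    have hx' : algebraMap O F (h 0 0) = algebraMap O F x * algebraMap O F (h 1 0) := by
      rw [← map_mul, hx]
    have key : (zUnif F ϖ : GL (Fin 2) F) * (alpha F O ϖ * inc F O h) =
        pt F ϖ (ϖ * x) 2 * inc F O κ * alpha F O ϖ := by
      apply Units.ext
      simp only [Units.val_mul, zUnif_val, alpha_val, pt_val, inc_val, hκ, Matrix.mul_fin_two]
      ext i j
      fin_cases i <;> fin_cases j <;> simp [hx'] <;> ring
    have hz : pt F ϖ (ϖ * x) 2 * (zUnif F ϖ : GL (Fin 2) F)⁻¹ =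
        (zUnif F ϖ : GL (Fin 2) F)⁻¹ * pt F ϖ (ϖ * x) 2 :=
      (show Commute _ _ from dia_comm (unifUnit F ϖ) (pt F ϖ (ϖ * x) 2)).inv_right
    rw [← mul_assoc (pt F ϖ _ _), hz, mul_assoc _⁻¹, eq_inv_mul_iff_mul_eq, ← mul_assoc, key,
      mul_inv_cancel_right]
  · left
    have hdet' : (!![h 0 0, ϖ * h 0 1; c, h 1 1] :
        Matrix (Fin 2) (Fin 2) O).det = h 0 0 * h 1 1 - h 0 1 * h 1 0 := by
      rw [Matrix.det_fin_two_of, hc]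
      ring
    obtain ⟨κ, hκ⟩ := (Matrix.isUnit_iff_isUnit_det _).2 (hdet' ▸ hdet)
    have h1 : alpha F O ϖ * inc F O h * (alpha F O ϖ)⁻¹ = inc F O κ := by
      rw [mul_inv_eq_iff_eq_mul]
      apply Units.ext
      simp only [Units.val_mul, alpha_val, inc_val, hκ, Matrix.mul_fin_two]
      simp [hc, mul_comm]
    rw [h1]
    exact inc_mem F O κ

variable {k : Type u} [Field k] {W : Type u} [AddCommGroup W] [Module k W]
  {σ : Representation k (ZK F O) W} {k' : Type u} [Field k'] [Module k' W] [IsLinearOver σ k']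
  (hone : ∀ g ∈ congr O ϖ 1, resK σ k' g = 1) (f : HeckeFun σ)

omit [FaithfulSMul O F] [Fact (Irreducible ϖ)] in
lemma opLin_ev (φ : CInd ϖ σ) (g : GL (Fin 2) F) : (f.opLin φ).ev g = f.conv φ.ev g := rfl

lemma opLin_t_single_ev (w : W) (g : GL (Fin 2) F) :
    (f.opLin ((extOre ϖ σ k').t (single hone w))).ev g = f.toFun (g⁻¹ * alpha F O ϖ) w := by
  obtain ⟨φ, hφ⟩ : ∃ φ, φ = (extOre ϖ σ k').t (single hone w) := ⟨_, rfl⟩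
  have hev (h : GL (Fin 2) F) : φ.ev h = (single hone w).ev ((alpha F O ϖ)⁻¹ * h) := by
    rw [hφ]; rfl
  rw [← hφ, opLin_ev, HeckeFun.conv, finsum_eq_single _ (QuotientGroup.mk (alpha F O ϖ))]
  · rw [f.out_term (fun g κ => φ.ev_mul g κ.2), hev, inv_mul_cancel, single_ev_one]
  · intro c hc
    rw [hev, single_ev_of_notMem hone, map_zero]
    intro h
    refine hc ?_
    rw [← Quotient.out_eq' c]
    exact (QuotientGroup.eq.2 h).symm

omit [FaithfulSMul O F] in
lemma toFun_mul (g : GL (Fin 2) F) {κ : GL (Fin 2) F} (hκ : κ ∈ ZK F O) :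
    f.toFun (g * κ) = f.toFun g * σ ⟨κ, hκ⟩ := by
  have := f.equivariant 1 ⟨κ, hκ⟩ g
  rwa [OneMemClass.coe_one, one_mul, map_one, one_mul] at this

omit [FaithfulSMul O F] in
lemma toFun_mul_left (g : GL (Fin 2) F) {κ : GL (Fin 2) F} (hκ : κ ∈ ZK F O) :
    f.toFun (κ * g) = σ ⟨κ, hκ⟩ * f.toFun g := by
  have := f.equivariant ⟨κ, hκ⟩ 1 g
  rwa [OneMemClass.coe_one, mul_one, map_one, mul_one] at this

/-- The values of `f` commute with the action of the centre, hence are linear over the field that it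
generates. -/
lemma commute_zUnif (g : GL (Fin 2) F) : Commute (f.toFun g) (σ (zUnif F ϖ)) := by
  have h1 := toFun_mul f g (zUnif F ϖ).2
  rw [show g * (zUnif F ϖ : GL (Fin 2) F) = (zUnif F ϖ : GL (Fin 2) F) * g from
    dia_comm (unifUnit F ϖ) g, toFun_mul_left f g (zUnif F ϖ).2] at h1
  exact h1.symm

include hone in
lemma toFun_alpha_upp (x : O) (w : W) :
    f.toFun (alpha F O ϖ) (resK σ k' (upp x) w) = f.toFun (alpha F O ϖ) w := by
  have h1 := toFun_mul f (alpha F O ϖ) (unip_mem x)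
  rw [alpha_unip, toFun_mul_left f _ (unip_mem (ϖ * x))] at h1
  have h2 := LinearMap.congr_fun h1 w
  rw [Module.End.mul_apply, Module.End.mul_apply, ← resK_upp (k' := k') (ϖ * x),
    resK_upp_mul hone] at h2
  exact h2.symm

include hone in
/-- The image of `f(α)` is fixed by the unipotent lower triangular matrices. -/
lemma upp_weyl_inv_toFun_alpha (x : O) (w : W) :
    resK σ k' (upp x) (resK σ k' weyl⁻¹ (f.toFun (alpha F O ϖ) w)) =
      resK σ k' weyl⁻¹ (f.toFun (alpha F O ϖ) w) := by
  have hm (y : O) : inc F O weyl * unip F O y * (inc F O weyl)⁻¹ =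
      inc F O (weyl * upp y * weyl⁻¹) := by
    rw [map_mul, map_mul, map_inv]; rfl
  have h1 := weyl_unip_mul_alpha (F := F) (ϖ := ϖ) x
  rw [hm, hm] at h1
  have h2 := toFun_mul f (alpha F O ϖ) (inc_mem F O (weyl * upp (ϖ * x) * weyl⁻¹))
  rw [← h1, toFun_mul_left f _ (inc_mem F O (weyl * upp x * weyl⁻¹))] at h2
  have h3 := LinearMap.congr_fun h2 w
  have hfix : resK σ k' (weyl * upp (ϖ * x) * weyl⁻¹) = 1 := by
    rw [map_mul, map_mul, resK_upp_mul hone, mul_one, ← map_mul, mul_inv_cancel, map_one]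
  rw [Module.End.mul_apply, Module.End.mul_apply, ← resK_apply (k' := k'),
    ← resK_apply (k' := k') (weyl * upp (ϖ * x) * weyl⁻¹), hfix, Module.End.one_apply, map_mul,
    map_mul, Module.End.mul_apply, Module.End.mul_apply] at h3
  have h4 := congrArg (resK σ k' weyl⁻¹) h3
  rwa [← Module.End.mul_apply (resK σ k' weyl⁻¹) (resK σ k' weyl), ← map_mul, inv_mul_cancel,
    map_one, Module.End.one_apply] at h4

/-- The matrix `α⁻¹` lies in the double coset of `α`, since the Weyl element conjugates `α` to `ϖ α⁻¹`. -/
lemma toFun_alpha_inv (w : W) : f.toFun (alpha F O ϖ)⁻¹ w =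
    σ (zUnif F ϖ)⁻¹ (resK σ k' weyl⁻¹ (f.toFun (alpha F O ϖ) (resK σ k' weyl w))) := by
  have h1 := alpha_mul_weyl_mul_alpha (F := F) (ϖ := ϖ)
  have h2 : (alpha F O ϖ)⁻¹ = (zUnif F ϖ : GL (Fin 2) F)⁻¹ *
      (inc F O weyl⁻¹ * (alpha F O ϖ * inc F O weyl)) := by
    rw [map_inv, eq_inv_mul_iff_mul_eq, eq_inv_mul_iff_mul_eq, ← mul_assoc, mul_inv_eq_iff_eq_mul,
      h1]
    exact dia_comm _ _
  have h3 := toFun_mul_left f (inc F O weyl⁻¹ * (alpha F O ϖ * inc F O weyl))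
    (inv_mem (zUnif F ϖ).2)
  rw [← h2, toFun_mul_left f _ (inc_mem F O weyl⁻¹), toFun_mul f _ (inc_mem F O weyl)] at h3
  exact LinearMap.congr_fun h3 w

end HeckeValues

/-! ### The relation between the generator and the Hecke operator -/

section HeckeRelation

open Multiplicative

variable {F : Type u} [Field F] {O : Type u} [CommRing O] [Algebra O F] {ϖ : O}
  [FaithfulSMul O F] [Fact (Irreducible ϖ)]
  {k : Type u} [Field k] {W : Type u} [AddCommGroup W] [Module k W]
  {σ : Representation k (ZK F O) W} {k' : Type u} [Field k'] [Module k' W] [IsLinearOver σ k']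
  {v : W} (hv : IsLinearWeight σ ϖ k' IsLinearOver.map_smul v) (f : HeckeFun σ)

/-- The generator of the compact induction: the function with support in `Z GL_2(O)` and value
`weyl v` at `1`. -/
def gen : CInd ϖ σ := single hv.congr_one (resK σ k' weyl v)

lemma IsLinearWeight.exists_act_eq (w : W) :
    ∃ a, (weightOre hv.congr_one).act a (resK σ k' weyl v) = w := by
  have hw : w ∈ Submodule.span k' (Set.range fun x => resK σ k' (upp x) (resK σ k' weyl v)) := by
    rw [hv.span]; trivial
  induction hw using Submodule.span_induction with
  | mem w hw =>
    obtain ⟨x, rfl⟩ := hw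
    exact ⟨dirac k' ϖ x, OreRep.act_dirac _ _ _⟩
  | zero => exact ⟨0, OreRep.zero_act _ _⟩
  | add w w' _ _ h h' =>
    obtain ⟨a, rfl⟩ := h
    obtain ⟨b, rfl⟩ := h'
    exact ⟨a + b, OreRep.act_add _ _ _ _⟩
  | smul c w _ h =>
    obtain ⟨a, rfl⟩ := h
    exact ⟨algebraMap k' _ c * a, by rw [OreRep.act_mul, OreRep.act_algebraMap]⟩

include hv in
lemma IsLinearWeight.toFun_smul (g : GL (Fin 2) F) (c : k') (w : W) :
    f.toFun g (c • w) = c • f.toFun g w :=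
  hv.comm _ (commute_zUnif f g) c w

include hv in
lemma IsLinearWeight.weyl_ne_zero : resK σ k' weyl v ≠ 0 := by
  intro h
  have h1 := congrArg (resK σ k' weyl⁻¹) h
  rw [← Module.End.mul_apply, ← map_mul, inv_mul_cancel, map_one, Module.End.one_apply,
    map_zero] at h1
  exact hv.ne_zero h1

/-- The operator `T` as a `k'`-linear endomorphism. -/
def opExt : Module.End k' (CInd ϖ σ) where
  toFun := f.opLin
  map_add' := map_add _
  map_smul' c φ := CInd.ext fun g => by
    rw [RingHom.id_apply, CInd.smul_ev, opLin_ev, opLin_ev, HeckeFun.conv, HeckeFun.conv,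
      smul_finsum]
    exact finsum_congr fun _ => hv.toFun_smul f _ c _

lemma opExt_toEnd (Q : Twisted k' O ϖ) (φ : CInd ϖ σ) :
    opExt hv f ((extOre ϖ σ k').toEnd Q φ) = (extOre ϖ σ k').toEnd Q (opExt hv f φ) :=
  (extOre ϖ σ k').map_toEnd (fun _ φ => Subtype.ext (f.conv_translate φ.2.1 _))
    (fun φ => Subtype.ext (f.conv_translate φ.2.1 _)) Q φ

variable (hf : f.toFun ≠ 0) (hsupp : ∀ g, f.toFun g ≠ 0 → ∃ κ₁ ∈ ZK F O, ∃ κ₂ ∈ ZK F O,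
  g = κ₁ * alpha F O ϖ * κ₂)

include hv hf hsupp in
/-- The generator of `σ` is an eigenvector of `f(α)`. -/
lemma IsLinearWeight.exists_toFun_alpha_eq : ∃ γ : k', γ ≠ 0 ∧
    f.toFun (alpha F O ϖ) (resK σ k' weyl v) = γ • resK σ k' weyl v := by
  obtain ⟨γ, hγ⟩ := hv.line _ fun x =>
    upp_weyl_inv_toFun_alpha hv.congr_one f x (resK σ k' weyl v)
  have h1 : f.toFun (alpha F O ϖ) (resK σ k' weyl v) = γ • resK σ k' weyl v := by
    have := congrArg (resK σ k' weyl) hγ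
    rwa [← Module.End.mul_apply, ← map_mul, mul_inv_cancel, map_one, Module.End.one_apply,
      map_smul] at this
  refine ⟨γ, ?_, h1⟩
  rintro rfl
  rw [zero_smul] at h1
  have h2 : f.toFun (alpha F O ϖ) = 0 := by
    ext w
    have hw : w ∈ Submodule.span k' (Set.range fun x => resK σ k' (upp x) (resK σ k' weyl v)) := by
      rw [hv.span]; trivial
    rw [LinearMap.zero_apply]
    induction hw using Submodule.span_induction with
    | mem w hw =>
      obtain ⟨x, rfl⟩ := hw
      rw [toFun_alpha_upp hv.congr_one, h1]
    | zero => rw [map_zero]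
    | add w w' _ _ h h' => rw [map_add, h, h', add_zero]
    | smul c w _ h => rw [hv.toFun_smul, h, smul_zero]
  refine hf (funext fun g => ?_)
  by_contra hg
  obtain ⟨κ₁, hκ₁, κ₂, hκ₂, rfl⟩ := hsupp g hg
  rw [toFun_mul f _ hκ₂, toFun_mul_left f _ hκ₁, h2, mul_zero, zero_mul] at hg
  exact hg rfl

variable (hu : IsUniformizing F ϖ)

include hsupp hu in
/-- The function `T(α f_w)`, where `f_w` has support in `Z GL_2(O)`, has support in the union of
`Z GL_2(O)` and of cosets of matrices `(ϖ², ϖ x; 0, 1)`. -/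
lemma mem_ZK_or_of_toFun_ne_zero {g : GL (Fin 2) F} (hg : f.toFun (g⁻¹ * alpha F O ϖ) ≠ 0) :
    g ∈ ZK F O ∨ ∃ x, ∃ κ ∈ ZK F O, g = pt F ϖ (ϖ * x) 2 * κ := by
  obtain ⟨κ₁, hκ₁, κ₂, hκ₂, h⟩ := hsupp _ hg
  obtain ⟨n, c, hc⟩ := hu.exists_eq_of_mem_ZK (inv_mem hκ₂)
  have hz : dia (unifUnit F ϖ) (unifUnit F ϖ) ^ n * alpha F O ϖ =
      alpha F O ϖ * dia (unifUnit F ϖ) (unifUnit F ϖ) ^ n := by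
    rw [dia_zpow]
    exact (dia_comm _ _).symm
  have hz' : dia (unifUnit F ϖ) (unifUnit F ϖ) ^ n * κ₁⁻¹ =
      κ₁⁻¹ * dia (unifUnit F ϖ) (unifUnit F ϖ) ^ n := by
    rw [dia_zpow]
    exact (dia_comm _ _).symm
  have h1 : g = alpha F O ϖ * inc F O c * (alpha F O ϖ)⁻¹ *
      (dia (unifUnit F ϖ) (unifUnit F ϖ) ^ n * κ₁⁻¹) := by
    have h2 : g = alpha F O ϖ * (dia (unifUnit F ϖ) (unifUnit F ϖ) ^ n * inc F O c) *
        (alpha F O ϖ)⁻¹ * κ₁⁻¹ := by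
      rw [← hc, eq_mul_inv_iff_mul_eq, eq_mul_inv_iff_mul_eq, eq_mul_inv_iff_mul_eq, mul_assoc g,
        mul_assoc g, ← h, mul_inv_cancel_left]
    rw [h2, ← mul_assoc (alpha F O ϖ), ← hz, hz']
    have h3 (x : GL (Fin 2) F) : dia (unifUnit F ϖ) (unifUnit F ϖ) ^ n * x =
        x * dia (unifUnit F ϖ) (unifUnit F ϖ) ^ n := by
      rw [dia_zpow]
      exact (dia_comm _ _).symm
    rw [mul_assoc, mul_assoc, mul_assoc, h3]
    simp only [mul_assoc]
  have hκ : dia (unifUnit F ϖ) (unifUnit F ϖ) ^ n * κ₁⁻¹ ∈ ZK F O :=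
    mul_mem (zpow_mem (dia_mem_ZK _) n) (inv_mem hκ₁)
  rw [h1]
  rcases hu.alpha_mul_mul_alpha_inv c with h | ⟨x, κ, hκ', h⟩
  · exact Or.inl (mul_mem h hκ)
  · exact Or.inr ⟨x, _, mul_mem hκ' hκ, by rw [h, mul_assoc]⟩

lemma alpha_mul_pt (y : O) : alpha F O ϖ * pt F ϖ y 1 = pt F ϖ (ϖ * y) 2 := by
  rw [pt, pt, ← mul_assoc, alpha_unip, mul_assoc, ← pow_succ']

include hsupp hu in
/-- The relation `T(X e) = γ e + φ(s) X² e` for the generator `e` of the compact induction: the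
part of `T(X e)` outside of `Z GL_2(O)` has support in the cosets of the matrices `(ϖ², ϖ x; 0, 1)`,
hence lies in `X k'[[U]] X e`. -/
lemma exists_opExt_t_gen [IsDomain O] [Finite (O ⧸ lev O ϖ 2)] {γ : k'}
    (hγ : f.toFun (alpha F O ϖ) (resK σ k' weyl v) = γ • resK σ k' weyl v) :
    ∃ s, opExt hv f ((extOre ϖ σ k').t (gen hv)) = γ • gen hv +
      (extOre ϖ σ k').act (phi k' O ϖ s)
        ((extOre ϖ σ k').t ((extOre ϖ σ k').t (gen hv))) := by
  have := Fintype.ofFinite (O ⧸ lev O ϖ 2)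
  obtain ⟨G, hG⟩ : ∃ G, G = opExt hv f ((extOre ϖ σ k').t (gen hv)) - γ • gen hv := ⟨_, rfl⟩
  have hev (g : GL (Fin 2) F) : G.ev g = f.toFun (g⁻¹ * alpha F O ϖ) (resK σ k' weyl v) -
      γ • (gen hv).ev g := by
    rw [hG, CInd.sub_ev, CInd.smul_ev]
    congr 1
    exact opLin_t_single_ev hv.congr_one f _ g
  have hsuppG (g : GL (Fin 2) F) (hg : G.ev g ≠ 0) :
      ∃ x, ∃ κ ∈ ZK F O, g = pt F ϖ (ϖ * x) 2 * κ := by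
    by_cases hgZ : g ∈ ZK F O
    · refine absurd ?_ hg
      rw [hev, toFun_mul_left f _ (inv_mem hgZ), Module.End.mul_apply, hγ, gen,
        single_ev hv.congr_one hgZ, IsLinearOver.map_smul]
      exact sub_self _
    · rw [hev, gen, single_ev_of_notMem hv.congr_one hgZ, smul_zero, sub_zero] at hg
      refine (mem_ZK_or_of_toFun_ne_zero f hsupp hu fun h => hg ?_).resolve_left hgZ
      rw [h, LinearMap.zero_apply]
  have hmem : G ∈ supp ϖ σ k' 2 := fun g hg => by
    obtain ⟨x, κ, hκ, h⟩ := hsuppG g hg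
    exact ⟨ϖ * x, κ, hκ, h⟩
  have hterm (x : O) (w : W) (hw : w = G.ev (pt F ϖ x 2)) :
      ∃ b, (extOre ϖ σ k').rho (ofAdd x)
          (((extOre ϖ σ k').t ^ 2) (single hv.congr_one w)) =
        (extOre ϖ σ k').act (phi k' O ϖ b)
          ((extOre ϖ σ k').t ((extOre ϖ σ k').t (gen hv))) := by
    by_cases hw0 : w = 0
    · exact ⟨0, by rw [hw0, map_zero, map_zero, map_zero, map_zero, OreRep.zero_act]⟩
    · rw [hw] at hw0
      obtain ⟨y, κ, hκ, h⟩ := hsuppG _ hw0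
      obtain ⟨z, hz⟩ := (hu.eq_and_dvd_of_pt_eq hκ h).2
      obtain rfl : x = ϖ * (y + ϖ * z) := by
        rw [← sub_eq_zero, ← sub_eq_zero.2 hz]; ring
      obtain ⟨a, ha⟩ := hv.exists_act_eq w
      refine ⟨dirac k' ϖ (y + ϖ * z) * phi k' O ϖ a, ?_⟩
      rw [map_mul (phi k' O ϖ), phi_dirac, OreRep.act_mul, OreRep.act_dirac, ← OreRep.t_act,
        ← OreRep.t_act,
        gen, ← single_act, ha, pow_two, Module.End.mul_apply]
  choose b hb using hterm
  refine ⟨∑ x : O ⧸ lev O ϖ 2, b x.out _ rfl, ?_⟩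
  rw [add_comm, ← sub_eq_iff_eq_add, ← hG, map_sum, OreRep.act_sum]
  exact (eq_sum_of_mem_supp hv.congr_one hu hmem).trans
    (Finset.sum_congr rfl fun x _ => hb _ _ _)

include hv in
/-- A nonzero `U`-stable subspace contains a nonzero vector fixed by `U`, since `U` acts through a
finite `p`-group. -/
lemma IsLinearWeight.exists_mem_upp_fixed {p : ℕ} [Fact p.Prime] [CharP k' p] (hp : ϖ ∣ (p : O))
    [Finite (O ⧸ Ideal.span {ϖ})] {N : Submodule k' W}
    (hN : ∀ x, ∀ w ∈ N, resK σ k' (upp x) w ∈ N) (hne : N ≠ ⊥) : v ∈ N := by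
  let η : Multiplicative O →* (Module.End k' W)ˣ := MonoidHom.toHomUnits (weightRho σ k')
  have hη (x : Multiplicative O) : ((η x : (Module.End k' W)ˣ) : Module.End k' W) =
    weightRho σ k' x := rfl
  have hker (x y : O) (h : ϖ ∣ y - x) : η (ofAdd x) = η (ofAdd y) := by
    obtain ⟨c, hc⟩ := h
    obtain rfl : y = x + ϖ * c := by rw [← hc]; ring
    apply Units.ext
    rw [hη, hη, weightRho_ofAdd, weightRho_ofAdd, upp_add, map_mul, resK_upp_mul hv.congr_one,
      mul_one]
  have hfin : Finite η.range := finite_range_of_factors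
    (fun x => Ideal.Quotient.mk (Ideal.span {ϖ}) (toAdd x)) η fun x y hxy =>
      hker _ _ (Ideal.mem_span_singleton.1 (Ideal.Quotient.eq.1 hxy.symm))
  have hP : IsPGroup p η.range := by
    rintro ⟨_, x, rfl⟩
    refine ⟨1, Subtype.ext ?_⟩
    rw [pow_one]
    change η x ^ p = 1
    rw [← map_pow, ← map_one η]
    refine (hker 0 (toAdd (x ^ p)) ?_).symm
    rw [toAdd_pow, nsmul_eq_mul, sub_zero]
    exact hp.mul_right _
  obtain ⟨w, hwN, hw0, hw⟩ := exists_fixed_vector hP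
    ((Units.coeHom (Module.End k' W)).comp η.range.subtype : Representation k' η.range W) (N := N)
    (by
      rintro ⟨_, x, rfl⟩ w hw
      exact hN (toAdd x) w hw) hne
  obtain ⟨c, rfl⟩ := hv.line w fun x => hw ⟨η (ofAdd x), ofAdd x, rfl⟩
  have hc : c ≠ 0 := fun h => hw0 (by rw [h, zero_smul])
  exact (Submodule.smul_mem_iff _ hc).1 hwN

include hf hsupp hu in
/-- Multiplication by `s` induces an injective map `A / J → A / φ(J) A`, where `J` is the
annihilator of the generator of `σ`. The reason is that the vectors killed by `f(α⁻¹) u` for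
all `u` in `U` form a `U`-stable subspace, which does not contain the vector fixed by `U`. -/
lemma mem_annIdeal_iff_mul_mem [IsDomain O] {p : ℕ} [Fact p.Prime] [CharP k' p]
    (hp : ϖ ∣ (p : O)) [Finite (O ⧸ Ideal.span {ϖ})] {γ : k'} {s : iwasawa k' O ϖ}
    (hs : opExt hv f ((extOre ϖ σ k').t (gen hv)) = γ • gen hv +
      (extOre ϖ σ k').act (phi k' O ϖ s)
        ((extOre ϖ σ k').t ((extOre ϖ σ k').t (gen hv)))) (a : iwasawa k' O ϖ) :
    a ∈ annIdeal hv.congr_one (resK σ k' weyl v) ↔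
      s * a ∈ (annIdeal hv.congr_one (resK σ k' weyl v)).map (phi k' O ϖ) := by
  obtain ⟨w, hw⟩ : ∃ w, w = (weightOre hv.congr_one).act a (resK σ k' weyl v) := ⟨_, rfl⟩
  obtain ⟨h, hh⟩ : ∃ h, h = (extOre ϖ σ k').act (a * s) ((extOre ϖ σ k').t (gen hv)) := ⟨_, rfl⟩
  have hmem : h ∈ supp ϖ σ k' 1 := by
    rw [hh, gen]
    exact act_mem_supp _ (by simpa using t_pow_single_mem_supp hv.congr_one 1 _)
  have hth : (extOre ϖ σ k').t h = (extOre ϖ σ k').act (phi k' O ϖ a)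
      (opExt hv f ((extOre ϖ σ k').t (gen hv))) -
        γ • (extOre ϖ σ k').act (phi k' O ϖ a) (gen hv) := by
    rw [hs, OreRep.act_add_right, OreRep.act_smul, add_sub_cancel_left, hh, OreRep.t_act,
      map_mul (phi k' O ϖ), OreRep.act_mul]
  have hTa : (extOre ϖ σ k').act (phi k' O ϖ a) (opExt hv f ((extOre ϖ σ k').t (gen hv))) =
      f.opLin ((extOre ϖ σ k').t (single hv.congr_one w)) := by
    have h1 := opExt_toEnd hv f (SkewPolynomial.monomial 0 (phi k' O ϖ a))
      ((extOre ϖ σ k').t (gen hv))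
    simp only [OreRep.toEnd_monomial, pow_zero, Module.End.one_apply] at h1
    rw [← h1, ← OreRep.t_act, gen, ← single_act, ← hw]
    rfl
  have hval (y : O) : h.ev (pt F ϖ y 1) = f.toFun (alpha F O ϖ)⁻¹ (resK σ k' (upp (-y)) w) := by
    have h1 : h.ev (pt F ϖ y 1) = ((extOre ϖ σ k').t h).ev (alpha F O ϖ * pt F ϖ y 1) := by
      change _ = h.ev ((alpha F O ϖ)⁻¹ * (alpha F O ϖ * pt F ϖ y 1))
      rw [inv_mul_cancel_left]
    have h2 : ((extOre ϖ σ k').act (phi k' O ϖ a) (gen hv)).ev (pt F ϖ (ϖ * y) 2) = 0 :=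
      ev_pt_eq_zero_of_mem_supp (k' := k') hu
        (act_mem_supp _ (t_pow_single_mem_supp hv.congr_one 0 _)) two_ne_zero _
    have h3 : (pt F ϖ (ϖ * y) 2)⁻¹ * alpha F O ϖ = (alpha F O ϖ)⁻¹ * unip F O (-y) := by
      have h4 : unip F O y * unip F O (-y) = 1 := by
        rw [← unip_mul, add_neg_cancel, unip, AddChar.map_zero_eq_one, map_one]
      rw [← alpha_mul_pt, inv_mul_eq_iff_eq_mul, pt, pow_one, mul_assoc, mul_assoc,
        mul_inv_cancel_left, h4, mul_one]
    rw [h1, hth, alpha_mul_pt, CInd.sub_ev, CInd.smul_ev, h2, smul_zero, sub_zero, hTa,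
      opLin_t_single_ev, h3, toFun_mul f _ (unip_mem (-y))]
    rfl
  rw [mul_comm, ← act_t_single_eq_zero_iff hv.congr_one hu, mem_annIdeal, ← hw]
  change _ ↔ (extOre ϖ σ k').act (a * s) ((extOre ϖ σ k').t (gen hv)) = 0
  rw [← hh]
  constructor
  · intro h0
    exact eq_zero_of_mem_supp hmem fun y => by rw [hval, h0, map_zero, map_zero]
  · intro h0
    let N : Submodule k' W :=
      { carrier := {w | ∀ y, f.toFun (alpha F O ϖ)⁻¹ (resK σ k' (upp y) w) = 0}
        zero_mem' := fun y => by rw [map_zero, map_zero]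
        add_mem' := fun h h' y => by rw [map_add, map_add, h y, h' y, add_zero]
        smul_mem' := fun c w h y => by rw [map_smul, hv.toFun_smul, h y, smul_zero] }
    have hwN : w ∈ N := fun y => by
      have := hval (-y)
      rwa [h0, CInd.zero_ev, neg_neg, eq_comm] at this
    by_contra hw0
    have hvN : v ∈ N := hv.exists_mem_upp_fixed hp (fun x w hw y => by
      rw [← Module.End.mul_apply, ← map_mul, ← upp_add]
      exact hw _) ((Submodule.ne_bot_iff _).2 ⟨w, hwN, hw0⟩)
    obtain ⟨δ, hδ0, hδ⟩ := hv.exists_toFun_alpha_eq f hf hsupp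
    have h1 := hvN 0
    rw [upp_zero, map_one, Module.End.one_apply, toFun_alpha_inv (k' := k'), hδ, map_smul,
      ← Module.End.mul_apply (resK σ k' weyl⁻¹), ← map_mul, inv_mul_cancel, map_one,
      Module.End.one_apply] at h1
    have h2 := congrArg (σ (zUnif F ϖ)) h1
    rw [← Module.End.mul_apply, ← map_mul, mul_inv_cancel, map_one, Module.End.one_apply,
      map_zero] at h2
    exact smul_ne_zero hδ0 hv.ne_zero h2

end HeckeRelation

/-! ### The modules `I_{≥ i}(σ)` are cyclic -/

section Cokernel

open Multiplicative

/-- Two actions, over `k` and over an extension `k'`, with the same action of `U` and the same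
endomorphism `t` give the same action of `k[[U]][X]_φ`. -/
lemma OreRep.toEnd_skewBaseChange {k k' : Type u} [Field k] [Field k'] [Algebra k k'] {O : Type u}
    [CommRing O] {ϖ : O} {V : Type u} [AddCommGroup V] [Module k V] [Module k' V]
    [IsScalarTower k k' V] (r : OreRep k O ϖ V) (r' : OreRep k' O ϖ V)
    (hrho : ∀ x v, r'.rho x v = r.rho x v) (ht : ∀ v, r'.t v = r.t v) (P : Twisted k O ϖ) (v : V) :
    r'.toEnd (skewBaseChange O ϖ (algebraMap k k') P) v = r.toEnd P v := by
  induction P using skew_induction with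
  | h0 => simp
  | hadd P Q hP hQ => simp only [map_add, LinearMap.add_apply, hP, hQ]
  | hm n a =>
    rw [skewBaseChange_monomial, OreRep.toEnd_monomial, OreRep.toEnd_monomial]
    have hpow : (r'.t ^ n) v = (r.t ^ n) v := by
      induction n with
      | zero => rfl
      | succ n ih => rw [pow_succ', pow_succ', Module.End.mul_apply, Module.End.mul_apply, ih, ht]
    rw [hpow]
    generalize (r.t ^ n) v = w
    obtain ⟨m, hw⟩ := r.smooth w
    have hw' : r'.Fixed m w := fun x => by rw [hrho, hw]
    obtain ⟨b, hb⟩ := proj_surjective k O ϖ m (a.1 m)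
    have hb' : proj k' O ϖ m (b.map (algebraMap k k' : k →+ k')) =
        (baseChange O ϖ (algebraMap k k') a).1 m := by
      change _ = (a.1 m).map (algebraMap k k' : k →+ k')
      rw [← hb]
      clear hb
      induction b using AddMonoidAlgebra.induction_linear with
      | zero => simp
      | add a b ha hb => simp only [AddMonoidAlgebra.map_add, map_add, ha, hb]
      | single z c => simp [proj]
    rw [r.act_eq hw hb, r'.act_eq hw' hb']
    clear hb hb'
    induction b using AddMonoidAlgebra.induction_linear with
    | zero => simp
    | add a b ha hb =>
      simp only [AddMonoidAlgebra.map_add, map_add, LinearMap.add_apply, ha, hb]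
    | single z c => simp [OreRep.grp, hrho]

lemma OreRep.toEnd_C {k : Type u} [Field k] {O : Type u} [CommRing O] {ϖ : O} {V : Type u}
    [AddCommGroup V] [Module k V] (r : OreRep k O ϖ V) (a : iwasawa k O ϖ) (v : V) :
    r.toEnd (SkewPolynomial.C a) v = r.act a v :=
  r.toEnd_monomial 0 a v

lemma OreRep.t_pow_act {k : Type u} [Field k] {O : Type u} [CommRing O] {ϖ : O} {V : Type u}
    [AddCommGroup V] [Module k V] (r : OreRep k O ϖ V) (n : ℕ) (a : iwasawa k O ϖ) (v : V) :
    (r.t ^ n) (r.act a v) = r.act ((phi k O ϖ)^[n] a) ((r.t ^ n) v) := by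
  induction n with
  | zero => rfl
  | succ n ih => rw [pow_succ', Module.End.mul_apply, Module.End.mul_apply, ih, OreRep.t_act,
      Function.iterate_succ_apply']

variable {F : Type u} [Field F] {O : Type u} [CommRing O] [Algebra O F] {ϖ : O}
  [FaithfulSMul O F] [Fact (Irreducible ϖ)]
  {k : Type u} [Field k] {W : Type u} [AddCommGroup W] [Module k W]
  {σ : Representation k (ZK F O) W} {k' : Type u} [Field k'] [Module k' W] [IsLinearOver σ k']

instance [Algebra k k'] [IsScalarTower k k' W] : IsScalarTower k k' (CInd ϖ σ) where
  smul_assoc c d f := CInd.ext fun g => smul_assoc c d (f.ev g)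

section

variable [IsLocalRing O]

/-- The Iwahori subgroup can be replaced by `U` in the definition of the layers. -/
lemma mem_layer_iff {m : ℕ} {f : CInd ϖ σ} : f ∈ layer ϖ σ m ↔ f ∈ supp ϖ σ k' m := by
  constructor
  · intro h g hg
    obtain ⟨i, hi, κ, hκ, rfl⟩ := h g hg
    obtain ⟨x, κ', h'⟩ := iwahori_alpha F O ϖ hi m
    exact ⟨x, inc F O κ' * κ, mul_mem (inc_mem F O κ') hκ, by rw [h', pt, mul_assoc]⟩
  · intro h g hg
    obtain ⟨x, κ, hκ, rfl⟩ := h g hg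
    exact ⟨GeneralLinearGroup.upperRightHom x, by simp [iwahori], κ, hκ, rfl⟩

variable {v : W} (hv : IsLinearWeight σ ϖ k' IsLinearOver.map_smul v)

lemma toEnd_t_pow_gen_mem_geLayer (Q : Twisted k' O ϖ) (i : ℕ) :
    (extOre ϖ σ k').toEnd Q (((extOre ϖ σ k').t ^ i) (gen hv)) ∈ geLayer ϖ σ i := by
  induction Q using skew_induction with
  | h0 => rw [map_zero]; exact zero_mem _
  | hadd P Q hP hQ => rw [map_add]; exact add_mem hP hQ
  | hm n a =>
    rw [OreRep.toEnd_monomial, ← Module.End.mul_apply, ← pow_add]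
    have h : (extOre ϖ σ k').act a (((extOre ϖ σ k').t ^ (n + i)) (gen hv)) ∈
        layer ϖ σ (n + i) :=
      (mem_layer_iff (k' := k')).2 (act_mem_supp _ (t_pow_single_mem_supp hv.congr_one _ _))
    exact Submodule.mem_iSup_of_mem (n + i) (Submodule.mem_iSup_of_mem (Nat.le_add_left i n) h)

variable [IsDomain O] (hu : IsUniformizing F ϖ) (hfin : ∀ n, Finite (O ⧸ lev O ϖ n))
  [Algebra k k'] [IsScalarTower k k' W]

include hu hfin in
/-- The submodule `I_{≥ i}(σ)` is generated by `X ^ i e` over `k'[[U]][X]_φ`, where `e` is the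
generator of the compact induction. -/
lemma exists_toEnd_eq_of_mem_geLayer {i : ℕ} {f : CInd ϖ σ} (hf : f ∈ geLayer ϖ σ i) :
    ∃ Q, (extOre ϖ σ k').toEnd Q (((extOre ϖ σ k').t ^ i) (gen hv)) = f := by
  let N : Submodule k (CInd ϖ σ) :=
    { carrier := {f | ∃ Q, (extOre ϖ σ k').toEnd Q (((extOre ϖ σ k').t ^ i) (gen hv)) = f}
      zero_mem' := ⟨0, by rw [map_zero, LinearMap.zero_apply]⟩
      add_mem' := by
        rintro _ _ ⟨P, rfl⟩ ⟨Q, rfl⟩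
        exact ⟨P + Q, by rw [map_add, LinearMap.add_apply]⟩
      smul_mem' := by
        rintro c _ ⟨P, rfl⟩
        refine ⟨SkewPolynomial.C (algebraMap k' _ (algebraMap k k' c)) * P, ?_⟩
        rw [map_mul, Module.End.mul_apply, OreRep.toEnd_C, OreRep.act_algebraMap,
          algebraMap_smul] }
  have hact (a : iwasawa k' O ϖ) {f : CInd ϖ σ} (hf : f ∈ N) : (extOre ϖ σ k').act a f ∈ N := by
    obtain ⟨Q, rfl⟩ := hf
    exact ⟨SkewPolynomial.C a * Q, by rw [map_mul, Module.End.mul_apply, OreRep.toEnd_C]⟩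
  refine (iSup₂_le fun m hm f hf => ?_ : (⨆ m, ⨆ _ : i ≤ m, layer ϖ σ m) ≤ N) hf
  rw [mem_layer_iff (k' := k')] at hf
  have := hfin m
  have := Fintype.ofFinite (O ⧸ lev O ϖ m)
  rw [eq_sum_of_mem_supp hv.congr_one hu hf]
  refine sum_mem fun x _ => ?_
  obtain ⟨a, ha⟩ := hv.exists_act_eq (f.ev (pt F ϖ x.out m))
  rw [← ha, single_act, ← OreRep.act_dirac]
  refine hact _ ?_
  rw [OreRep.t_pow_act]
  refine hact _ ⟨SkewPolynomial.monomial (m - i) 1, ?_⟩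
  rw [OreRep.toEnd_monomial, OreRep.one_act, ← Module.End.mul_apply, ← pow_add,
    Nat.sub_add_cancel hm]
  rfl

end

end Cokernel

/-! ### The cokernel of the Hecke operator -/

section CokernelTor

open Multiplicative

variable {F : Type u} [Field F] {O : Type u} [CommRing O] [Algebra O F] {ϖ : O}
  [FaithfulSMul O F] [Fact (Irreducible ϖ)] [IsLocalRing O]
  {k : Type u} [Field k] {W : Type u} [AddCommGroup W] [Module k W]
  {σ : Representation k (ZK F O) W} {k' : Type u} [Field k'] [Module k' W] [IsLinearOver σ k']
  [Algebra k k'] [IsScalarTower k k' W]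
  {v : W} (hv : IsLinearWeight σ ϖ k' IsLinearOver.map_smul v) (f : HeckeFun σ)

/-- The surjection of `k'[[U]][X]_φ` onto `I_{≥ 0}(σ) / T(I_{≥ 1}(σ))` that maps `1` to the class
of the generator of the compact induction. -/
def toCokerT : Twisted k' O ϖ →+ cokerT (ϖ := ϖ) f :=
  (Submodule.mkQ (((geLayer ϖ σ 1).map f.op).submoduleOf (geLayer ϖ σ 0))).toAddMonoidHom.comp
    { toFun := fun Q => ⟨(extOre ϖ σ k').toEnd Q (gen hv), toEnd_t_pow_gen_mem_geLayer hv Q 0⟩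
      map_zero' := Subtype.ext (LinearMap.congr_fun (map_zero (extOre ϖ σ k').toEnd) _)
      map_add' := fun P Q => Subtype.ext
        (LinearMap.congr_fun (map_add (extOre ϖ σ k').toEnd P Q) _) }

lemma toCokerT_skewBaseChange_mul (P : Twisted k O ϖ) (Q : Twisted k' O ϖ) :
    toCokerT hv f (skewBaseChange O ϖ (algebraMap k k') P * Q) = P • toCokerT hv f Q := by
  refine Eq.trans (congrArg (Submodule.mkQ _) ?_) (map_smul (Submodule.mkQ
    (((geLayer ϖ σ 1).map f.op).submoduleOf (geLayer ϖ σ 0))) P _)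
  apply Subtype.ext
  change (extOre ϖ σ k').toEnd (skewBaseChange O ϖ (algebraMap k k') P * Q) (gen hv) =
    (cIndOre ϖ σ).toEnd P ((extOre ϖ σ k').toEnd Q (gen hv))
  rw [map_mul, Module.End.mul_apply, (cIndOre ϖ σ).toEnd_skewBaseChange (extOre ϖ σ k')
    (fun _ _ => rfl) (fun _ => rfl)]

variable [IsDomain O] (hu : IsUniformizing F ϖ) (hfin : ∀ n, Finite (O ⧸ lev O ϖ n))

include hu hfin in
lemma toCokerT_surjective : Function.Surjective (toCokerT hv f) := by
  intro y
  obtain ⟨⟨φ, hφ⟩, rfl⟩ := Submodule.mkQ_surjective _ y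
  obtain ⟨Q, rfl⟩ := exists_toEnd_eq_of_mem_geLayer hv hu hfin hφ
  exact ⟨Q, rfl⟩

include hu hfin in
/-- The cokernel of `T` is presented by the annihilator of the generator of `σ` and by the relation
`T(X e) = γ e + φ(s) X² e`, divided by `γ`. -/
lemma toCokerT_eq_zero_iff {γ : k'} (hγ : γ ≠ 0) {s : iwasawa k' O ϖ}
    (hs : opExt hv f ((extOre ϖ σ k').t (gen hv)) = γ • gen hv +
      (extOre ϖ σ k').act (phi k' O ϖ s)
        ((extOre ϖ σ k').t ((extOre ϖ σ k').t (gen hv)))) (Q : Twisted k' O ϖ) :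
    toCokerT hv f Q = 0 ↔
      ∃ R, Q - R * (1 + SkewPolynomial.monomial 2 (phi k' O ϖ (algebraMap k' _ γ⁻¹ * s))) ∈
        Submodule.span (Twisted k' O ϖ)
          (SkewPolynomial.C '' (annIdeal hv.congr_one (resK σ k' weyl v) :
            Set (iwasawa k' O ϖ))) := by
  have h1 (R : Twisted k' O ϖ) : (extOre ϖ σ k').toEnd (R * (1 + SkewPolynomial.monomial 2
      (phi k' O ϖ (algebraMap k' _ γ⁻¹ * s)))) (gen hv) =
      opExt hv f ((extOre ϖ σ k').toEnd (R * SkewPolynomial.C (algebraMap k' _ γ⁻¹))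
        ((extOre ϖ σ k').t (gen hv))) := by
    rw [opExt_toEnd, hs, map_mul (extOre ϖ σ k').toEnd, map_mul (extOre ϖ σ k').toEnd,
      Module.End.mul_apply, Module.End.mul_apply]
    congr 1
    rw [OreRep.toEnd_C, OreRep.act_add_right, OreRep.act_algebraMap,
      inv_smul_smul₀ hγ, map_add, LinearMap.add_apply, map_one, Module.End.one_apply,
      OreRep.toEnd_monomial, map_mul (phi k' O ϖ), AlgHom.commutes, OreRep.act_mul, pow_two]
    rfl
  have h2 : toCokerT hv f Q = 0 ↔ ∃ φ ∈ geLayer ϖ σ 1,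
      opExt hv f φ = (extOre ϖ σ k').toEnd Q (gen hv) :=
    Submodule.Quotient.mk_eq_zero _
  have h3 (R : Twisted k' O ϖ) : Q - R * (1 + SkewPolynomial.monomial 2
      (phi k' O ϖ (algebraMap k' _ γ⁻¹ * s))) ∈ Submodule.span (Twisted k' O ϖ)
        (SkewPolynomial.C '' (annIdeal hv.congr_one (resK σ k' weyl v) :
          Set (iwasawa k' O ϖ))) ↔ (extOre ϖ σ k').toEnd Q (gen hv) =
      opExt hv f ((extOre ϖ σ k').toEnd (R * SkewPolynomial.C (algebraMap k' _ γ⁻¹))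
        ((extOre ϖ σ k').t (gen hv))) := by
    have : Finite (O ⧸ Ideal.span {ϖ}) := pow_one ϖ ▸ hfin 1
    rw [← toEnd_single_eq_zero_iff hv.congr_one hu, map_sub, LinearMap.sub_apply, sub_eq_zero,
      ← h1]
    rfl
  rw [h2]
  constructor
  · rintro ⟨φ, hφ, h⟩
    obtain ⟨R, rfl⟩ := exists_toEnd_eq_of_mem_geLayer hv hu hfin hφ
    refine ⟨R * SkewPolynomial.C (algebraMap k' _ γ), (h3 _).2 ?_⟩
    rw [mul_assoc, ← SkewPolynomial.C_mul, ← map_mul, mul_inv_cancel₀ hγ, map_one,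
      show (SkewPolynomial.C (1 : iwasawa k' O ϖ)) = 1 from rfl, mul_one, ← h, pow_one]
  · rintro ⟨R, hR⟩
    refine ⟨_, ?_, ((h3 R).1 hR).symm⟩
    have := toEnd_t_pow_gen_mem_geLayer hv (R * SkewPolynomial.C (algebraMap k' _ γ⁻¹)) 1
    rwa [pow_one] at this

omit [IsLocalRing O] [IsDomain O] [Algebra k k'] [IsScalarTower k k' W] in
/-- The socle of `k'[[U]] / J`, where `J` is the annihilator of the generator of `σ`, is
the line that corresponds to the vectors of `σ` fixed by `U`. -/
lemma exists_socle_generator : ∃ w : iwasawa k' O ϖ,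
    (∀ a, aug k' O ϖ a = 0 → a * w ∈ annIdeal hv.congr_one (resK σ k' weyl v)) ∧
    ∀ u, (∀ a, aug k' O ϖ a = 0 → a * u ∈ annIdeal hv.congr_one (resK σ k' weyl v)) →
      ∃ c, u - c * w ∈ annIdeal hv.congr_one (resK σ k' weyl v) := by
  obtain ⟨w, hw⟩ := hv.exists_act_eq v
  refine ⟨w, fun a ha => ?_, fun u hu => ?_⟩
  · rw [mem_annIdeal, OreRep.act_mul, hw, OreRep.act_of_fixed _ (fun x => hv.fixed _) a, ha,
      zero_smul]
  · obtain ⟨c, hc⟩ := hv.line ((weightOre hv.congr_one).act u (resK σ k' weyl v)) fun x => by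
      have h1 := hu (dirac k' ϖ x - 1) (by rw [map_sub, map_one, aug_dirac, sub_self])
      rw [mem_annIdeal, OreRep.act_mul, OreRep.act_sub, OreRep.one_act, OreRep.act_dirac,
        sub_eq_zero] at h1
      exact h1
    refine ⟨algebraMap k' _ c, ?_⟩
    rw [mem_annIdeal, OreRep.act_sub, OreRep.act_mul, hw, OreRep.act_algebraMap, hc, sub_self]

omit [FaithfulSMul O F] [Fact (Irreducible ϖ)] [IsLocalRing O] [IsDomain O] [Algebra k k']
  [IsScalarTower k k' W] in
lemma mem_annIdeal_of_val_one_eq_zero (hone : ∀ g ∈ congr O ϖ 1, resK σ k' g = 1) (w : W)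
    {u : iwasawa k' O ϖ} (h : u.1 1 = 0) : u ∈ annIdeal hone w := by
  rw [mem_annIdeal, OreRep.act_eq _ (weightOre_fixed_one hone w) (b := 0) (by rw [map_zero, h]),
    map_zero, LinearMap.zero_apply]

end CokernelTor

/-- The statement on the cokernel of `T` for a ring `O` with the properties of the ring of integers
of a quadratic extension of `ℚ_p` that the argument depends on. -/
theorem not_isTorsion_tor_two_cokerT {p : ℕ} [Fact p.Prime] {F : Type u} [Field F] {O : Type u}
    [CommRing O] [Algebra O F] {ϖ : O} [FaithfulSMul O F] [Fact (Irreducible ϖ)] [IsLocalRing O]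
    [IsDomain O] {e : ℕ} {e₁ e₂ : O} (hb : IsPadicBasis p ϖ e e₁ e₂) (hu : IsUniformizing F ϖ)
    (hp : ϖ ∣ (p : O)) {k : Type u} [Field k] (τ : O ⧸ Ideal.span {ϖ} →+* k) {W : Type u}
    [AddCommGroup W] [Module k W] (σ : Representation k (ZK F O) W) [σ.IsIrreducible]
    (hσ : IsSmooth ϖ σ) (f : HeckeFun σ) (hf : f.toFun ≠ 0)
    (hsupp : ∀ g, f.toFun g ≠ 0 → ∃ κ₁ ∈ ZK F O, ∃ κ₂ ∈ ZK F O, g = κ₁ * alpha F O ϖ * κ₂) :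
    ¬ Module.IsTorsion k[X] (tor k O ϖ (cokerT (ϖ := ϖ) f) 2) ∧
      ¬ Module.Finite k ((ModuleCat.restrictScalars (Polynomial.C : k →+* k[X])).obj
        (tor k O ϖ (cokerT (ϖ := ϖ) f) 2)) := by
  have hchar : CharP k p := by
    refine (CharP.charP_iff_prime_eq_zero Fact.out).2 ?_
    have : (Ideal.Quotient.mk (Ideal.span {ϖ})) (p : O) = 0 := by
      rwa [Ideal.Quotient.eq_zero_iff_mem, Ideal.mem_span_singleton]
    rw [← map_natCast τ p, ← map_natCast (Ideal.Quotient.mk (Ideal.span {ϖ})) p, this, map_zero]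
  have hfin := hb.finite_quotient
  obtain ⟨k', _, _, _, _, _, hlin, v, hv⟩ := exists_isLinearWeight hu hp hfin τ σ hσ
  have : IsLinearOver σ k' := ⟨hlin⟩
  have hchar' : CharP k' p := charP_of_injective_algebraMap (algebraMap k k').injective p
  have hres : Finite (O ⧸ Ideal.span {ϖ}) := hb.finite_residue
  have := hfin 2
  obtain ⟨γ, hγ0, hγ⟩ := hv.exists_toFun_alpha_eq f hf hsupp
  obtain ⟨s, hs⟩ := exists_opExt_t_gen hv f hsupp hu hγ
  obtain ⟨w, hw, hsoc⟩ := exists_socle_generator hv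
  refine tor_two_of_ideal hb (Fact.out : Irreducible ϖ).ne_zero (k' := k')
    (J := annIdeal hv.congr_one (resK σ k' weyl v)) ?_
    (fun u hu => mem_annIdeal_of_val_one_eq_zero hv.congr_one _ hu) hw hsoc
    (s := algebraMap k' _ γ⁻¹ * s) (fun a => ?_) (toCokerT hv f) (toCokerT_skewBaseChange_mul hv f)
    (toCokerT_surjective hv f hu hfin) (toCokerT_eq_zero_iff hv f hu hfin hγ0 hs)
  · rw [Ideal.ne_top_iff_one, mem_annIdeal, OreRep.one_act]
    exact hv.weyl_ne_zero
  · rw [mem_annIdeal_iff_mul_mem hv f hf hsupp hu hp hs, mul_assoc]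
    refine ⟨fun h => Ideal.mul_mem_left _ _ h, fun h => ?_⟩
    have h1 := Ideal.mul_mem_left _ (algebraMap k' _ γ) h
    rwa [← mul_assoc, ← map_mul, mul_inv_cancel₀ hγ0, map_one, one_mul] at h1

/-! ### The ring of integers of a quadratic extension of `ℚ_p` -/

section PadicIntegers

variable (p : ℕ) [Fact p.Prime] (F : Type u) [Field F] [Algebra ℚ_[p] F] [Algebra ℤ_[p] F]
  [IsScalarTower ℤ_[p] ℚ_[p] F] [FiniteDimensional ℚ_[p] F]

instance : IsFractionRing (ringInt p F) F :=
  IsIntegralClosure.isFractionRing_of_finite_extension ℤ_[p] ℚ_[p] F (ringInt p F)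

instance : IsDedekindDomain (ringInt p F) :=
  IsIntegralClosure.isDedekindDomain ℤ_[p] ℚ_[p] F (ringInt p F)

lemma not_isUnit_prime_ringInt : ¬ IsUnit (p : ringInt p F) := by
  rw [isUnit_ringInt_iff]
  have h : (((p : ringInt p F)) : F) = algebraMap ℚ_[p] F p := by simp
  rw [h, spectralNorm_extends, Padic.norm_p]
  exact (inv_lt_one_of_one_lt₀ (by exact_mod_cast (Fact.out : p.Prime).one_lt)).ne

omit [IsScalarTower ℤ_[p] ℚ_[p] F] [FiniteDimensional ℚ_[p] F] in
lemma prime_ne_zero_ringInt : (p : ringInt p F) ≠ 0 := by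
  have := charZero_of_injective_algebraMap (algebraMap ℚ_[p] F).injective
  intro h
  have h1 := congrArg (algebraMap (ringInt p F) F) h
  rw [map_natCast, map_zero] at h1
  exact Nat.cast_ne_zero.2 (Fact.out : p.Prime).ne_zero h1

instance : IsDiscreteValuationRing (ringInt p F) := by
  have : IsPrincipalIdealRing (ringInt p F) := inferInstance
  refine { not_a_field' := fun h => ?_ }
  rw [← IsLocalRing.isField_iff_maximalIdeal_eq] at h
  obtain ⟨b, hb⟩ := h.mul_inv_cancel (prime_ne_zero_ringInt p F)
  exact not_isUnit_prime_ringInt p F (.of_mul_eq_one b hb)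

variable {p F} (ϖ : ringInt p F) [Fact (Irreducible ϖ)]

lemma isUniformizing_ringInt : IsUniformizing F ϖ := by
  intro x hx
  have hϖ : Irreducible ϖ := Fact.out
  obtain ⟨a, b, hb, rfl⟩ := IsFractionRing.div_surjective (A := ringInt p F) x
  have hb0 : b ≠ 0 := nonZeroDivisors.ne_zero hb
  have ha0 : a ≠ 0 := by
    rintro rfl
    simp at hx
  obtain ⟨m, u, rfl⟩ := IsDiscreteValuationRing.eq_unit_mul_pow_irreducible ha0 hϖ
  obtain ⟨n, w, rfl⟩ := IsDiscreteValuationRing.eq_unit_mul_pow_irreducible hb0 hϖ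
  refine ⟨m - n, u * w⁻¹, ?_⟩
  have h0 : algebraMap (ringInt p F) F ϖ ≠ 0 :=
    (map_ne_zero_iff _ (FaithfulSMul.algebraMap_injective (ringInt p F) F)).2 hϖ.ne_zero
  have hw : algebraMap (ringInt p F) F w *
      algebraMap (ringInt p F) F ((w⁻¹ : (ringInt p F)ˣ) : ringInt p F) = 1 := by
    rw [← map_mul, Units.mul_inv, map_one]
  have hw0 := left_ne_zero_of_mul_eq_one hw
  rw [zpow_sub₀ h0, zpow_natCast, zpow_natCast, Units.val_mul, map_mul, map_mul, map_mul, map_pow,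
    map_pow, eq_inv_of_mul_eq_one_right hw]
  field_simp

/-- The ring of integers is free of rank two over `ℤ_p`, and the integers are dense in `ℤ_p`. -/
lemma exists_isPadicBasis (hF : Module.finrank ℚ_[p] F = 2) :
    ∃ e e₁ e₂, IsPadicBasis p ϖ e e₁ e₂ := by
  have hϖ : Irreducible ϖ := Fact.out
  obtain ⟨e, u, he⟩ := IsDiscreteValuationRing.eq_unit_mul_pow_irreducible
    (prime_ne_zero_ringInt p F) hϖ
  have : FaithfulSMul ℤ_[p] F := (faithfulSMul_iff_algebraMap_injective _ _).2 <| by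
    rw [IsScalarTower.algebraMap_eq ℤ_[p] ℚ_[p] F]
    exact (algebraMap ℚ_[p] F).injective.comp Subtype.val_injective
  have : Module.Finite ℤ_[p] (ringInt p F) :=
    IsIntegralClosure.finite ℤ_[p] ℚ_[p] F (ringInt p F)
  have : Module.Free ℤ_[p] (ringInt p F) :=
    IsIntegralClosure.module_free ℤ_[p] ℚ_[p] F (ringInt p F)
  have hrank : Module.finrank ℤ_[p] (ringInt p F) = 2 :=
    (IsIntegralClosure.rank ℤ_[p] ℚ_[p] F (ringInt p F)).trans hF
  let b : Module.Basis (Fin 2) ℤ_[p] (ringInt p F) := Module.finBasisOfFinrankEq _ _ hrank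
  have hdvd (r : ℕ) (x : ℤ_[p]) (y : ringInt p F) (h : x ∈ Ideal.span {(p ^ r : ℤ_[p])}) :
      (p ^ r : ringInt p F) ∣ x • y := by
    obtain ⟨c, rfl⟩ := Ideal.mem_span_singleton.1 h
    exact ⟨c • y, by simp [Algebra.smul_def, mul_assoc]⟩
  refine ⟨e, b 0, b 1, ?_, fun r => ?_, fun r z => ?_, fun r => ?_⟩
  · rcases Nat.eq_zero_or_pos e with rfl | h
    · exact absurd (by rw [he, pow_zero, mul_one]; exact u.isUnit) (not_isUnit_prime_ringInt p F)
    · exact h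
  · rw [lev, he, mul_pow, pow_mul]
    exact (Ideal.span_singleton_mul_left_unit (u.isUnit.pow r) _).symm
  · refine ⟨(b.repr z 0).appr r, (b.repr z 1).appr r, ?_⟩
    have h : z - (((b.repr z 0).appr r : ringInt p F) * b 0 +
        ((b.repr z 1).appr r : ringInt p F) * b 1) =
        (b.repr z 0 - ((b.repr z 0).appr r : ℤ_[p])) • b 0 +
          (b.repr z 1 - ((b.repr z 1).appr r : ℤ_[p])) • b 1 := by
      have hz := b.sum_repr z
      rw [Fin.sum_univ_two] at hz
      simp only [sub_smul, Nat.cast_smul_eq_nsmul, nsmul_eq_mul]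
      linear_combination -hz
    rw [h]
    exact dvd_add (hdvd _ _ _ (PadicInt.appr_spec r _)) (hdvd _ _ _ (PadicInt.appr_spec r _))
  · let g : ringInt p F →+ (Fin 2 → ZMod (p ^ r)) :=
      { toFun := fun z i => PadicInt.toZModPow r (b.repr z i)
        map_zero' := by ext; simp
        map_add' := fun x y => by ext; simp }
    have hg : Function.Surjective g := by
      intro y
      choose x hx using fun i => ZMod.ringHom_surjective (PadicInt.toZModPow (p := p) r) (y i)
      exact ⟨b.equivFun.symm x, funext fun i => by
        change PadicInt.toZModPow r (b.equivFun (b.equivFun.symm x) i) = y i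
        rw [LinearEquiv.apply_symm_apply, hx]⟩
    have hker : (Ideal.span {(p : ringInt p F) ^ r}).toAddSubgroup = g.ker := by
      ext z
      rw [AddMonoidHom.mem_ker, Submodule.mem_toAddSubgroup, Ideal.mem_span_singleton]
      constructor
      · rintro ⟨c, rfl⟩
        funext i
        change PadicInt.toZModPow r (b.repr _ i) = 0
        have : (p : ringInt p F) ^ r * c = (p : ℤ_[p]) ^ r • c := by simp [Algebra.smul_def]
        rw [this, map_smul, Finsupp.smul_apply, smul_eq_mul, ← RingHom.mem_ker,
          PadicInt.ker_toZModPow]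
        exact Ideal.mul_mem_right _ _ (Ideal.mem_span_singleton_self _)
      · intro h
        rw [← b.sum_repr z]
        refine Finset.dvd_sum fun i _ => hdvd _ _ _ ?_
        rw [← PadicInt.ker_toZModPow, RingHom.mem_ker]
        exact congrFun h i
    have h1 := Nat.card_congr ((QuotientAddGroup.quotientAddEquivOfEq hker).trans
      (QuotientAddGroup.quotientKerEquivOfSurjective g hg)).toEquiv
    rw [Nat.card_fun, Nat.card_zmod, Nat.card_fin] at h1
    exact h1

lemma dvd_prime_ringInt : ϖ ∣ (p : ringInt p F) := by
  refine ((isUniformizing_ringInt ϖ).isUnit_or_dvd _).resolve_left (not_isUnit_prime_ringInt p F)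

end PadicIntegers

end ModPGL2

end

theorem mainTheorem7 (p : ℕ) [Fact p.Prime]
    (F : Type u) [Field F] [Algebra ℚ_[p] F] [Algebra ℤ_[p] F] [IsScalarTower ℤ_[p] ℚ_[p] F]
    [FiniteDimensional ℚ_[p] F] (hF : Module.finrank ℚ_[p] F = 2)
    (ϖ : ModPGL2.ringInt p F) [Fact (Irreducible ϖ)]
    (hϖ : Irreducible (p : ModPGL2.ringInt p F) → ϖ = p)
    (k : Type u) [Field k] (τ₀ : (ModPGL2.ringInt p F ⧸ Ideal.span {ϖ}) →+* k)
    (W : Type u) [AddCommGroup W] [Module k W]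
    (σ : Representation k (ModPGL2.ZK F (ModPGL2.ringInt p F)) W)
    [σ.IsIrreducible] (hσ : ModPGL2.IsSmooth ϖ σ)
    (f : ModPGL2.HeckeFun σ) (hf : f.toFun ≠ 0)
    (hsupp : ∀ g, f.toFun g ≠ 0 → ∃ κ₁ ∈ ModPGL2.ZK F (ModPGL2.ringInt p F),
      ∃ κ₂ ∈ ModPGL2.ZK F (ModPGL2.ringInt p F),
        g = κ₁ * ModPGL2.alpha F (ModPGL2.ringInt p F) ϖ * κ₂) :
    ¬ Module.IsTorsion k[X]
        (ModPGL2.tor k (ModPGL2.ringInt p F) ϖ (ModPGL2.cokerT (ϖ := ϖ) f) 2) ∧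
      ¬ Module.Finite k ((ModuleCat.restrictScalars (C : k →+* k[X])).obj
        (ModPGL2.tor k (ModPGL2.ringInt p F) ϖ (ModPGL2.cokerT (ϖ := ϖ) f) 2)) := by
  obtain ⟨e, e₁, e₂, hb⟩ := ModPGL2.exists_isPadicBasis ϖ hF
  exact ModPGL2.not_isTorsion_tor_two_cokerT hb (ModPGL2.isUniformizing_ringInt ϖ)
    (ModPGL2.dvd_prime_ringInt ϖ) τ₀ σ hσ f hf hsupp
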